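/- **Setting.** Let $G$ be a unimodular, second countable, locally compact Hausdorff group, $N\subseteq G$ a closed unimodular subgroup, with Haar measures fixed on both, and let $\phi:G\times G\times G\to\mathbb T$ be a continuous antisymmetric tricharacter (a character in each variable, inverted by transpositions of the variables, and equal to $1$ when two variables agree) with $\phi\equiv 1$ on $N\times N\times N$. **The nonassociative torus.** On $L^2(N)$ let $(\lambda(r)\psi)(s)=\psi(r^{-1}s)$ for $r\in N$ and $(u(x,y)\psi)(s)=\phi(s,x,y)^{-1}\psi(s)$ for $x,y\in G$, and put $\alpha_r[k]=\lambda(r)k\lambda(r)^{-1}$ for $k\in\mathcal K(L^2(N))$. Let $\mathcal B=u\text{-ind}_N^G\,\mathcal K(L^2(N))$ be the $C^*$-algebra of continuous $f:G\to\mathcal K(L^2(N))$ with $f(rx)=u(r,x)^{-1}\alpha_r[f(x)]u(r,x)$ for $r\in N$, $x\in G$, for which $\|f\|$ vanishes at infinity on $N\backslash G$. Put $\beta_y[f](x)=u(x,y)f(xy)u(x,y)^{-1}$ and $v(y,z)(x)=\phi(x,y,z)u(x,y)u(xy,z)u(x,yz)^{-1}$. The space $C_c(G,\mathcal B)$ has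 the product and involution $$(F_1*F_2)(y)=\int_G F_1(z)\,\beta_z[F_2(z^{-1}y)]\,v(z,z^{-1}y)\,dz,\qquad F^*(y)=v(y,y^{-1})^{-1}\beta_y[F(y^{-1})]^*,$$ and the norm of its left regular representation, i.e. the norm of left multiplication by $F$ with respect to $\|F'\|_2=\|(F'^**F')(1)\|_{\mathcal B}^{1/2}$. The completion in this norm, $\mathcal B\rtimes_{\beta,v}G$, is the nonassociative torus describing the T-dual of the bundle $G/N$ over a point. **The algebra $A_\phi$.** Let $HS=L^2(G\times G)$ with $(K_1*K_2)(x,z)=\int_G\phi(x,y,z)K_1(x,y)K_2(y,z)\,dy$ and $K^*(x,y)=\overline{K(y,x)}$, and let $\mathcal K_\phi(L^2(G))$ be its completion in the norm $\|K_1\|=\sup_{K_2\ne 0}\|K_1*K_2\|_{HS}/\|K_2\|_{HS}$, realised as the norm closure of the left multiplications in the bounded operators on $HS$. For $s,t\in N$ put $\gamma_s[K](z,w)=\phi(s,z,w)^{-1}K(s^{-1}z,s^{-1}w)$, and let $u(s,t)$ act on kernels as the multiplication operator by $\phi(\cdot,s,t)$ on $L^2(G)$, so $(u(s,t)K)(z,w)=\phi(z,s,t)K(z,w)$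 and $(K\,u(s,t))(z,w)=K(z,w)\phi(w,s,t)$. For $a\in C_c(N,\mathcal K_\phi(L^2(G)))$ and $g\in C_c(N,HS)$ put $$(a*g)(t)=\int_N a(s)*\gamma_s[g(s^{-1}t)]\;u(s,s^{-1}t)\,ds,\qquad a^*(t)=u(t,t^{-1})^{-1}\gamma_t[a(t^{-1})]^*,$$ where the involution and $\gamma_t$ are extended by continuity to $\mathcal K_\phi(L^2(G))$. Then $A_\phi=\mathcal K_\phi(L^2(G))\rtimes_{\gamma,u}N$ is the completion of $C_c(N,\mathcal K_\phi(L^2(G)))$ in the norm of the left regular representation $g\mapsto a*g$ on $L^2(N,HS)$; its $*$-subalgebra $C_c(N,HS)$ carries the product. **Theorem 8.2.** 1. $C_c(G,\mathcal B)$ is closed under product and involution. The adjoint of left multiplication by $K\in HS$ is left multiplication by $K^*$. The maps $\gamma_s$ ($s\in N$) are $*$-automorphisms of the algebra $HS$ of twisted kernels, and $\gamma_s\gamma_t[K]=u(s,t)\,\gamma_{st}[K]\,u(s,t)^{-1}$ for $s,t\in N$. Sending $g$ to the function of left multiplications by its values embeds $C_c(N,HS)$ in $C_c(N,\mathcal K_\phi(L^2(G)))$,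 its image is closed under the involution, $C_c(N,\mathcal K_\phi(L^2(G)))$ is closed under the involution, and $a*g\in C_c(N,HS)$ for $a\in C_c(N,\mathcal K_\phi(L^2(G)))$ and $g\in C_c(N,HS)$. 2. Both completions exist as Banach spaces with isometric involution. 3. The nonassociative torus $\mathcal B\rtimes_{\beta,v}G$ is isomorphic to $A_\phi=\mathcal K_\phi(L^2(G))\rtimes_{\gamma,u}N$: there is an isometric linear isomorphism $\Phi$ of the completions that respects the involutions, such that the elements $F\in C_c(G,\mathcal B)$ with $\Phi(F)\in C_c(N,HS)$ are dense in the torus, and such that $\Phi(F_1*F_2)=a*g$ whenever $F_1,F_2\in C_c(G,\mathcal B)$, $\Phi(F_1)=a\in C_c(N,\mathcal K_\phi(L^2(G)))$ and $\Phi(F_2)=g\in C_c(N,HS)$. -/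

import Mathlib

open MeasureTheory Filter Topology
open scoped ENNReal NNReal

universe u

set_option linter.unusedSectionVars false

noncomputable section

namespace NAT

/-! ### Antisymmetric tricharacters -/

/-- A continuous antisymmetric tricharacter on `G`: a continuous map `G × G × G → 𝕋` which is a
character in each variable, is inverted by transpositions of its variables, and takes the value
`1` when two of its variables agree (the last condition is stated for the first two variables;
the other cases follow). -/
structure Tricharacter (G : Type u) [Group G] [TopologicalSpace G] where
  toFun : G → G → G → Circle
  continuous' : Continuous fun p : G × G × G => toFun p.1 p.2.1 p.2.2
  map_mul₁ : ∀ x x' y z, toFun (x * x') y z = toFun x y z * toFun x' y z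
  map_mul₂ : ∀ x y y' z, toFun x (y * y') z = toFun x y z * toFun x y' z
  map_mul₃ : ∀ x y z z', toFun x y (z * z') = toFun x y z * toFun x y z'
  swap₁₂ : ∀ x y z, toFun y x z = (toFun x y z)⁻¹
  swap₂₃ : ∀ x y z, toFun x z y = (toFun x y z)⁻¹
  alternating : ∀ x z, toFun x x z = 1

instance (G : Type u) [Group G] [TopologicalSpace G] :
    CoeFun (Tricharacter G) (fun _ => G → G → G → Circle) := ⟨Tricharacter.toFun⟩

theorem Tricharacter.continuous_comp {G : Type u} [Group G] [TopologicalSpace G]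
    (φ : Tricharacter G) {X : Type*} [TopologicalSpace X] {f g h : X → G}
    (hf : Continuous f) (hg : Continuous g) (hh : Continuous h) :
    Continuous fun x => φ (f x) (g x) (h x) :=
  φ.continuous'.comp (hf.prodMk (hg.prodMk hh))

/-! ### Unitary operators on `L²` -/

section L2

theorem continuous_circle_coe : Continuous fun z : Circle => (z : ℂ) := continuous_subtype_val

variable {X : Type*} [TopologicalSpace X] [MeasurableSpace X] [OpensMeasurableSpace X]

/-- The unitary operator on `L²(X)` of multiplication by a continuous function `X → 𝕋`. -/
def mulOp (μ : Measure X) (m : X → Circle) (hm : Continuous m) :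
    Lp ℂ 2 μ →L[ℂ] Lp ℂ 2 μ :=
  have key : ∀ f : Lp ℂ 2 μ, MemLp (fun x => (m x : ℂ) * f x) 2 μ := fun f =>
    (Lp.memLp f).of_le
      ((((continuous_circle_coe.comp hm).stronglyMeasurable).mul
        (Lp.stronglyMeasurable f)).aestronglyMeasurable)
      (ae_of_all _ fun x => by rw [norm_mul, Circle.norm_coe, one_mul])
  LinearMap.mkContinuous
    { toFun := fun f => (key f).toLp _
      map_add' := fun f g => by
        rw [← MemLp.toLp_add]
        apply MemLp.toLp_congr
        filter_upwards [Lp.coeFn_add f g] with x hx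
        rw [hx, Pi.add_apply, Pi.add_apply, mul_add]
      map_smul' := fun c f => by
        rw [RingHom.id_apply, ← MemLp.toLp_const_smul]
        apply MemLp.toLp_congr
        filter_upwards [Lp.coeFn_smul c f] with x hx
        rw [hx, Pi.smul_apply, Pi.smul_apply, mul_smul_comm] }
    1 (fun f => by
      rw [one_mul]
      refine Lp.norm_le_norm_of_ae_le ?_
      filter_upwards [(key f).coeFn_toLp] with x hx
      exact (congrArg norm hx).trans_le (by rw [norm_mul, Circle.norm_coe, one_mul]))

end L2

section Group

variable {G : Type u} [Group G] [TopologicalSpace G] [IsTopologicalGroup G]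
  [MeasurableSpace G] [BorelSpace G]

/-- The left regular representation, `(λ(r) ψ)(s) = ψ(r⁻¹ s)`. -/
def leftReg {Γ : Type u} [Group Γ] [MeasurableSpace Γ] [MeasurableMul Γ] (μ : Measure Γ)
    [μ.IsMulLeftInvariant] (r : Γ) : Lp ℂ 2 μ →L[ℂ] Lp ℂ 2 μ :=
  (Lp.compMeasurePreservingₗᵢ ℂ (fun s => r⁻¹ * s)
    (measurePreserving_mul_left μ r⁻¹)).toContinuousLinearMap

/-! ### The twisted induced algebra and its twisted crossed product

`Op N μN` is the algebra of bounded operators on `L²(N)`. Its product and `star` are composition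
and the Hilbert space adjoint; for the unitary operators below `star` is the inverse. -/

/-- Bounded operators on `L²(N)`. -/
abbrev Op (N : Subgroup G) (μN : Measure N) : Type u := Lp ℂ 2 μN →L[ℂ] Lp ℂ 2 μN

variable (φ : Tricharacter G) (N : Subgroup G) (μG : Measure G) (μN : Measure N)

/-- `(u(x, y) ψ)(r) = φ(r, x, y)⁻¹ ψ(r)` for `x, y ∈ G` and `r ∈ N`. -/
def uOp (x y : G) : Op N μN :=
  mulOp μN (fun r : N => (φ r x y)⁻¹)
    (φ.continuous_comp continuous_subtype_val continuous_const continuous_const).inv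

/-- `α_r[k] = λ(r) k λ(r)⁻¹`; on kernels `α_r[k](s, t) = k(r⁻¹ s, r⁻¹ t)`. -/
def alpha [μN.IsMulLeftInvariant] (r : N) (k : Op N μN) : Op N μN :=
  leftReg μN r * k * star (leftReg μN r)

/-- The twisted induced algebra `B = u-ind_N^G K(L²(N))`: norm continuous functions `f` from `G`
to the compact operators on `L²(N)` with `f(r x) = u(r, x)⁻¹ α_r[f(x)] u(r, x)` for `r ∈ N`,
vanishing at infinity modulo `N` (by equivariance `‖f(x)‖` depends only on the coset `N x`).
Operations are pointwise and the norm is the supremum norm. -/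
def inducedAlgebra [μN.IsMulLeftInvariant] : Submodule ℂ (G → Op N μN) where
  carrier := {f | Continuous f ∧ (∀ x, IsCompactOperator (f x)) ∧
    (∀ (r : N) (x : G),
      f (r * x) = star (uOp φ N μN r x) * alpha N μN r (f x) * uOp φ N μN r x) ∧
    ∀ ε > 0, ∃ K : Set G, IsCompact K ∧ ∀ x, (∀ r : N, (r : G) * x ∉ K) → ‖f x‖ < ε}
  add_mem' := by
    rintro f g ⟨hf, hf1, hf2, hf3⟩ ⟨hg, hg1, hg2, hg3⟩
    refine ⟨hf.add hg, fun x => (hf1 x).add (hg1 x), fun r x => ?_, fun ε hε => ?_⟩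
    · simp only [Pi.add_apply, hf2, hg2, alpha, mul_add, add_mul]
    · obtain ⟨K, hK, hK'⟩ := hf3 (ε / 2) (by positivity)
      obtain ⟨L, hL, hL'⟩ := hg3 (ε / 2) (by positivity)
      refine ⟨K ∪ L, hK.union hL, fun x hx => ?_⟩
      have h1 := hK' x fun r h => hx r (Or.inl h)
      have h2 := hL' x fun r h => hx r (Or.inr h)
      calc ‖f x + g x‖ ≤ ‖f x‖ + ‖g x‖ := norm_add_le _ _
        _ < ε := by linarith
  zero_mem' := by
    refine ⟨continuous_const, fun x => isCompactOperator_zero, fun r x => ?_, fun ε hε => ?_⟩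
    · simp [alpha]
    · exact ⟨∅, isCompact_empty, fun x _ => by simpa using hε⟩
  smul_mem' := by
    rintro c f ⟨hf, hf1, hf2, hf3⟩
    refine ⟨hf.const_smul c, fun x => (hf1 x).smul c, fun r x => ?_, fun ε hε => ?_⟩
    · simp only [Pi.smul_apply, hf2, alpha, mul_smul_comm, smul_mul_assoc]
    · obtain ⟨K, hK, hK'⟩ := hf3 (ε / (‖c‖ + 1)) (by positivity)
      refine ⟨K, hK, fun x hx => ?_⟩
      have h1 := hK' x hx
      rw [lt_div_iff₀ (by positivity)] at h1
      rw [Pi.smul_apply, norm_smul]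
      nlinarith [norm_nonneg (f x)]

/-- `β_y[f](x) = ad(u(x, y))[f(x y)]`. -/
def beta (y : G) (f : G → Op N μN) : G → Op N μN := fun x =>
  uOp φ N μN x y * f (x * y) * star (uOp φ N μN x y)

/-- The multiplier `v(y, z) : x ↦ φ(x, y, z) u(x, y) u(x y, z) u(x, y z)⁻¹`. -/
def vOp (y z : G) : G → Op N μN := fun x =>
  (φ x y z : ℂ) • (uOp φ N μN x y * uOp φ N μN (x * y) z * star (uOp φ N μN x (y * z)))

/-- The space `C_c(G, B)` of continuous compactly supported functions from `G` to the twisted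
induced algebra `B` (with its supremum norm). -/
def torusCore [μN.IsMulLeftInvariant] : Submodule ℂ (G → G → Op N μN) where
  carrier := {F | (∀ y, F y ∈ inducedAlgebra φ N μN) ∧
    (∀ y, TendstoUniformly F (F y) (𝓝 y)) ∧ HasCompactSupport F}
  add_mem' := by
    rintro F H ⟨hF, hF1, hF2⟩ ⟨hH, hH1, hH2⟩
    exact ⟨fun y => Submodule.add_mem _ (hF y) (hH y), fun y => (hF1 y).add (hH1 y),
      hF2.add hH2⟩
  zero_mem' := by
    refine ⟨fun y => Submodule.zero_mem _, fun y => ?_, HasCompactSupport.zero⟩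
    exact fun s hs => Eventually.of_forall fun _ _ => refl_mem_uniformity hs
  smul_mem' := by
    rintro c F ⟨hF, hF1, hF2⟩
    exact ⟨fun y => Submodule.smul_mem _ c (hF y),
      fun y => (uniformContinuous_const_smul c).comp_tendstoUniformly (hF1 y),
      hF2.smul_left (f := fun _ => c)⟩

/-- The twisted convolution `(F₁ * F₂)(y) = ∫_G F₁(z) β_z[F₂(z⁻¹ y)] v(z, z⁻¹ y) dz`. -/
def torusMul (F₁ F₂ : G → G → Op N μN) : G → G → Op N μN := fun y x =>
  ∫ z, F₁ z x * beta φ N μN z (F₂ (z⁻¹ * y)) x * vOp φ N μN z (z⁻¹ * y) x ∂μG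

/-- The involution `F^*(y) = v(y, y⁻¹)⁻¹ β_y[F(y⁻¹)]^*`. -/
def torusStar (F : G → G → Op N μN) : G → G → Op N μN := fun y x =>
  star (vOp φ N μN y y⁻¹ x) * star (beta φ N μN y (F y⁻¹) x)

/-- The norm `‖(F^* * F)(1)‖_B ^ (1/2)` of the `B`-valued inner product on `C_c(G, B)`. -/
def torusL2Norm (F : G → G → Op N μN) : ℝ :=
  Real.sqrt (⨆ x : G, ‖torusMul φ N μG μN (torusStar φ N μN F) F 1 x‖)

/-- The norm of the left regular representation: the norm of left multiplication by `F` on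
`C_c(G, B)` with the norm of its `B`-valued inner product. -/
def torusNorm [μN.IsMulLeftInvariant] (F : G → G → Op N μN) : ℝ :=
  sInf {C : ℝ | 0 ≤ C ∧ ∀ F' ∈ torusCore φ N μN,
    torusL2Norm φ N μG μN (torusMul φ N μG μN F F') ≤ C * torusL2Norm φ N μG μN F'}

/-! ### Twisted compact operators -/

/-- Hilbert-Schmidt operators on `L²(G)`, realised as square integrable kernels on `G × G`. -/
abbrev HS (μG : Measure G) : Type u := Lp ℂ 2 (μG.prod μG)

variable [SecondCountableTopology G] [SFinite μG]

/-- The twisted product `(K₁ * K₂)(x, z) = ∫_G φ(x, y, z) K₁(x, y) K₂(y, z) dy` of kernels. -/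
def hsKernel (K₁ K₂ : G × G → ℂ) : G × G → ℂ := fun p =>
  ∫ y, (φ p.1 y p.2 : ℂ) * K₁ (p.1, y) * K₂ (y, p.2) ∂μG

theorem hsKernel_stronglyMeasurable {K₁ K₂ : G × G → ℂ} (h₁ : StronglyMeasurable K₁)
    (h₂ : StronglyMeasurable K₂) : StronglyMeasurable (hsKernel φ μG K₁ K₂) := by
  have : StronglyMeasurable fun q : (G × G) × G =>
      (φ q.1.1 q.2 q.1.2 : ℂ) * K₁ (q.1.1, q.2) * K₂ (q.2, q.1.2) := by
    refine StronglyMeasurable.mul (StronglyMeasurable.mul ?_ ?_) ?_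
    · exact (continuous_circle_coe.comp (φ.continuous_comp (by fun_prop) (by fun_prop)
        (by fun_prop))).stronglyMeasurable
    · exact h₁.comp_measurable (by fun_prop)
    · exact h₂.comp_measurable (by fun_prop)
  exact this.integral_prod_right'

theorem hsKernel_eLpNorm_le {K₁ K₂ : G × G → ℂ} (h₁ : StronglyMeasurable K₁)
    (h₂ : StronglyMeasurable K₂) :
    eLpNorm (hsKernel φ μG K₁ K₂) 2 (μG.prod μG) ≤
      eLpNorm K₁ 2 (μG.prod μG) * eLpNorm K₂ 2 (μG.prod μG) := by
  have e : ∀ f : G × G → ℂ, eLpNorm f 2 (μG.prod μG) =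
      (∫⁻ p, ‖f p‖ₑ ^ (2 : ℝ) ∂(μG.prod μG)) ^ (1 / 2 : ℝ) := fun f => by
    rw [eLpNorm_eq_lintegral_rpow_enorm_toReal (by norm_num) (by norm_num)]; simp
  have m₁ : Measurable fun p => ‖K₁ p‖ₑ ^ (2 : ℝ) := h₁.enorm.pow_const _
  have m₂ : Measurable fun p => ‖K₂ p‖ₑ ^ (2 : ℝ) := h₂.enorm.pow_const _
  rw [e, e, e, ← ENNReal.mul_rpow_of_nonneg _ _ (by norm_num : (0 : ℝ) ≤ 1 / 2)]
  refine ENNReal.rpow_le_rpow ?_ (by norm_num)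
  rw [lintegral_prod _ m₁.aemeasurable, lintegral_prod_symm _ m₂.aemeasurable,
    ← lintegral_prod_mul m₁.lintegral_prod_right'.aemeasurable
      m₂.lintegral_prod_left'.aemeasurable]
  refine lintegral_mono fun p => ?_
  have c := ENNReal.lintegral_mul_le_Lp_mul_Lq μG Real.HolderConjugate.two_two
    (f := fun y => ‖K₁ (p.1, y)‖ₑ) (g := fun y => ‖K₂ (y, p.2)‖ₑ)
    (h₁.enorm.comp (by fun_prop)).aemeasurable (h₂.enorm.comp (by fun_prop)).aemeasurable
  have d : ‖hsKernel φ μG K₁ K₂ p‖ₑ ≤ ∫⁻ y, ‖K₁ (p.1, y)‖ₑ * ‖K₂ (y, p.2)‖ₑ ∂μG := by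
    refine (enorm_integral_le_lintegral_enorm _).trans (le_of_eq ?_)
    refine lintegral_congr fun y => ?_
    have hc : ‖(φ p.1 y p.2 : ℂ)‖ₑ = 1 := by
      rw [← ofReal_norm, Circle.norm_coe, ENNReal.ofReal_one]
    rw [enorm_mul, enorm_mul, hc, one_mul]
  refine (ENNReal.rpow_le_rpow (d.trans c) (by norm_num : (0 : ℝ) ≤ 2)).trans (le_of_eq ?_)
  rw [ENNReal.mul_rpow_of_nonneg _ _ (by norm_num : (0 : ℝ) ≤ 2), ← ENNReal.rpow_mul,
    ← ENNReal.rpow_mul]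
  norm_num

theorem hsKernel_memLp (K₁ K₂ : HS μG) :
    MemLp (hsKernel φ μG K₁ K₂) 2 (μG.prod μG) :=
  ⟨(hsKernel_stronglyMeasurable φ μG (Lp.stronglyMeasurable K₁)
      (Lp.stronglyMeasurable K₂)).aestronglyMeasurable,
    (hsKernel_eLpNorm_le φ μG (Lp.stronglyMeasurable K₁) (Lp.stronglyMeasurable K₂)).trans_lt
      (ENNReal.mul_lt_top (Lp.memLp K₁).2 (Lp.memLp K₂).2)⟩

theorem memLp_slice_left (K : HS μG) : ∀ᵐ x ∂μG, MemLp (fun y => K (x, y)) 2 μG := by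
  have m : Measurable fun p => ‖K p‖ₑ ^ (2 : ℝ) :=
    (Lp.stronglyMeasurable K).enorm.pow_const _
  have h := (eLpNorm_lt_top_iff_lintegral_rpow_enorm_lt_top (by norm_num) (by norm_num)).1
    (Lp.memLp K).2
  simp only [ENNReal.toReal_ofNat] at h
  rw [lintegral_prod _ m.aemeasurable] at h
  filter_upwards [ae_lt_top m.lintegral_prod_right' h.ne] with x hx
  refine ⟨((Lp.stronglyMeasurable K).comp_measurable (by fun_prop)).aestronglyMeasurable, ?_⟩
  exact (eLpNorm_lt_top_iff_lintegral_rpow_enorm_lt_top (by norm_num) (by norm_num)).2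
    (by simpa using hx)

theorem memLp_slice_right (K : HS μG) : ∀ᵐ z ∂μG, MemLp (fun y => K (y, z)) 2 μG := by
  have m : Measurable fun p => ‖K p‖ₑ ^ (2 : ℝ) :=
    (Lp.stronglyMeasurable K).enorm.pow_const _
  have h := (eLpNorm_lt_top_iff_lintegral_rpow_enorm_lt_top (by norm_num) (by norm_num)).1
    (Lp.memLp K).2
  simp only [ENNReal.toReal_ofNat] at h
  rw [lintegral_prod_symm _ m.aemeasurable] at h
  filter_upwards [ae_lt_top m.lintegral_prod_left' h.ne] with x hx
  refine ⟨((Lp.stronglyMeasurable K).comp_measurable (by fun_prop)).aestronglyMeasurable, ?_⟩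
  exact (eLpNorm_lt_top_iff_lintegral_rpow_enorm_lt_top (by norm_num) (by norm_num)).2
    (by simpa using hx)

theorem hsKernel_integrable (K₁ K₂ : HS μG) : ∀ᵐ p ∂(μG.prod μG),
    Integrable (fun y => (φ p.1 y p.2 : ℂ) * K₁ (p.1, y) * K₂ (y, p.2)) μG := by
  have h₁ := Measure.quasiMeasurePreserving_fst (μ := μG) (ν := μG) |>.ae
    (memLp_slice_left μG K₁)
  have h₂ := Measure.quasiMeasurePreserving_snd (μ := μG) (ν := μG) |>.ae
    (memLp_slice_right μG K₂)
  filter_upwards [h₁, h₂] with p hp₁ hp₂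
  have := hp₁.integrable_mul hp₂
  refine this.mono ?_ (ae_of_all _ fun y => by
    rw [norm_mul, norm_mul, Circle.norm_coe, one_mul, Pi.mul_apply, norm_mul])
  refine StronglyMeasurable.aestronglyMeasurable ?_
  refine StronglyMeasurable.mul (StronglyMeasurable.mul ?_ ?_) ?_
  · exact (continuous_circle_coe.comp (φ.continuous_comp continuous_const continuous_id
      continuous_const)).stronglyMeasurable
  · exact (Lp.stronglyMeasurable K₁).comp_measurable (by fun_prop)
  · exact (Lp.stronglyMeasurable K₂).comp_measurable (by fun_prop)

/-- The twisted product `K₁ * K₂` of Hilbert-Schmidt kernels, as a linear map in `K₂`. -/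
def hsMulLin (K₁ : HS μG) : HS μG →ₗ[ℂ] HS μG where
  toFun := fun K₂ => (hsKernel_memLp φ μG K₁ K₂).toLp _
  map_add' := fun f g => by
    rw [← MemLp.toLp_add]
    apply MemLp.toLp_congr
    have h := Measure.quasiMeasurePreserving_snd (μ := μG) (ν := μG) |>.ae
      (Measure.ae_ae_of_ae_prod ((Measure.measurePreserving_swap (μ := μG)
        (ν := μG)).quasiMeasurePreserving.ae (Lp.coeFn_add f g)))
    filter_upwards [h, hsKernel_integrable φ μG K₁ f, hsKernel_integrable φ μG K₁ g]
      with p hp hf hg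
    simp only [hsKernel, Pi.add_apply]
    rw [← integral_add hf hg]
    refine integral_congr_ae ?_
    filter_upwards [hp] with y hy
    simp only [Prod.swap_prod_mk, Pi.add_apply] at hy
    rw [hy, mul_add]
  map_smul' := fun c f => by
    rw [RingHom.id_apply, ← MemLp.toLp_const_smul]
    apply MemLp.toLp_congr
    have h := Measure.quasiMeasurePreserving_snd (μ := μG) (ν := μG) |>.ae
      (Measure.ae_ae_of_ae_prod ((Measure.measurePreserving_swap (μ := μG)
        (ν := μG)).quasiMeasurePreserving.ae (Lp.coeFn_smul c f)))
    filter_upwards [h] with p hp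
    simp only [hsKernel, Pi.smul_apply, smul_eq_mul]
    rw [← integral_const_mul]
    refine integral_congr_ae ?_
    filter_upwards [hp] with y hy
    simp only [Prod.swap_prod_mk, Pi.smul_apply, smul_eq_mul] at hy
    rw [hy]; ring

theorem hsMulLin_norm_le (K₁ K₂ : HS μG) : ‖hsMulLin φ μG K₁ K₂‖ ≤ ‖K₁‖ * ‖K₂‖ := by
  have h : ‖hsMulLin φ μG K₁ K₂‖ =
      (eLpNorm (hsKernel φ μG K₁ K₂) 2 (μG.prod μG)).toReal :=
    Lp.norm_toLp _ (hsKernel_memLp φ μG K₁ K₂)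
  rw [h, Lp.norm_def, Lp.norm_def, ← ENNReal.toReal_mul]
  exact ENNReal.toReal_mono (ENNReal.mul_lt_top (Lp.memLp K₁).2 (Lp.memLp K₂).2).ne
    (hsKernel_eLpNorm_le φ μG (Lp.stronglyMeasurable K₁) (Lp.stronglyMeasurable K₂))

/-- Left multiplication `L_{K₁} : K₂ ↦ K₁ * K₂` for the twisted product, as a bounded operator on
the Hilbert-Schmidt kernels. -/
def hsMul (K₁ : HS μG) : HS μG →L[ℂ] HS μG :=
  (hsMulLin φ μG K₁).mkContinuous ‖K₁‖ (hsMulLin_norm_le φ μG K₁)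

/-- The involution `K^*(x, y) = conj (K(y, x))` on Hilbert-Schmidt kernels. -/
def hsStar (K : HS μG) : HS μG :=
  star (Lp.compMeasurePreserving Prod.swap Measure.measurePreserving_swap K)

/-- The twisted compact operators `K_φ(L²(G))`: the completion of the Hilbert-Schmidt kernels in
the norm `‖K₁‖ = sup ‖K₁ * K₂‖_HS / ‖K₂‖_HS` of the left regular representation, that is, the norm
closure of the operators `L_K` of left multiplication. (These operators form a linear space.) -/
def twistedCompacts : Submodule ℂ (HS μG →L[ℂ] HS μG) :=
  (Submodule.span ℂ (Set.range (hsMul φ μG))).topologicalClosure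

/-- `γ_s[K](z, w) = φ(s, z, w)⁻¹ K(s⁻¹ z, s⁻¹ w)`, a unitary operator on the Hilbert-Schmidt
kernels. -/
def gamma [μG.IsMulLeftInvariant] (s : G) : HS μG →L[ℂ] HS μG :=
  mulOp (μG.prod μG) (fun p => (φ s p.1 p.2)⁻¹)
      (φ.continuous_comp continuous_const continuous_fst continuous_snd).inv ∘L
    (Lp.compMeasurePreservingₗᵢ ℂ (Prod.map (fun x => s⁻¹ * x) (fun x => s⁻¹ * x))
      ((measurePreserving_mul_left μG s⁻¹).prod
        (measurePreserving_mul_left μG s⁻¹))).toContinuousLinearMap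

/-- Left multiplication `K(z, w) ↦ φ(z, s, t) K(z, w)` by the multiplier `u(s, t)`, which is the
operator of multiplication by `φ(·, s, t)` on `L²(G)`. -/
def uLeft (s t : G) : HS μG →L[ℂ] HS μG :=
  mulOp (μG.prod μG) (fun p => φ p.1 s t)
    (φ.continuous_comp continuous_fst continuous_const continuous_const)

/-- Right multiplication `K(z, w) ↦ K(z, w) φ(w, s, t)` by the multiplier `u(s, t)`. -/
def uRight (s t : G) : HS μG →L[ℂ] HS μG :=
  mulOp (μG.prod μG) (fun p => φ p.2 s t)
    (φ.continuous_comp continuous_snd continuous_const continuous_const)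

/-! ### The twisted crossed product of the twisted compact operators by `N` -/

/-- `C_c(N, HS)`: continuous compactly supported functions from `N` to the Hilbert-Schmidt
kernels. -/
def hsCore : Submodule ℂ (N → HS μG) where
  carrier := {g | Continuous g ∧ HasCompactSupport g}
  add_mem' := fun hf hg => ⟨hf.1.add hg.1, hf.2.add hg.2⟩
  zero_mem' := ⟨continuous_const, HasCompactSupport.zero⟩
  smul_mem' := fun c _ hf => ⟨hf.1.const_smul c, hf.2.smul_left (f := fun _ => c)⟩

/-- `C_c(N, K_φ(L²(G)))`. -/
def aphiCore : Submodule ℂ (N → (HS μG →L[ℂ] HS μG)) where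
  carrier := {a | (∀ t, a t ∈ twistedCompacts φ μG) ∧ Continuous a ∧ HasCompactSupport a}
  add_mem' := fun hf hg => ⟨fun t => Submodule.add_mem _ (hf.1 t) (hg.1 t),
    hf.2.1.add hg.2.1, hf.2.2.add hg.2.2⟩
  zero_mem' := ⟨fun _ => Submodule.zero_mem _, continuous_const, HasCompactSupport.zero⟩
  smul_mem' := fun c _ hf => ⟨fun t => Submodule.smul_mem _ c (hf.1 t), hf.2.1.const_smul c,
    hf.2.2.smul_left (f := fun _ => c)⟩

/-- The twisted convolution `(a * g)(t) = ∫_N a(s) γ_s[g(s⁻¹ t)] u(s, s⁻¹ t) ds`, for `a` with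
values in the twisted compact operators and `g` with values in the Hilbert-Schmidt kernels (which
form a two-sided ideal on which the twisted compact operators act). If `a(s) = L_{f(s)}` with `f`
in `C_c(N, HS)`, this is the product of `f` and `g`. -/
def aphiMul [μG.IsMulLeftInvariant] (a : N → (HS μG →L[ℂ] HS μG)) (g : N → HS μG) :
    N → HS μG := fun t =>
  ∫ s : N, uRight φ μG s ((s⁻¹ * t : N) : G) (a s (gamma φ μG s (g (s⁻¹ * t)))) ∂μN

/-- The involution `a^*(t) = u(t, t⁻¹)⁻¹ γ_t[a(t⁻¹)]^*`. The involution of the twisted compact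
operators is the adjoint of operators on Hilbert-Schmidt kernels (it extends `K ↦ K^*`), and `γ_t`
acts on them by conjugation (this extends `K ↦ γ_t[K]`). -/
def aphiStar [μG.IsMulLeftInvariant] (a : N → (HS μG →L[ℂ] HS μG)) :
    N → (HS μG →L[ℂ] HS μG) := fun t =>
  star (uLeft φ μG t ((t⁻¹ : N) : G)) *
    star (gamma φ μG t * a t⁻¹ * star (gamma φ μG t))

/-- The norm of `L²(N, HS)`. -/
def hsL2Norm (g : N → HS μG) : ℝ := Real.sqrt (∫ t, ‖g t‖ ^ 2 ∂μN)

/-- The norm of the left regular representation on `L²(N, HS)`. -/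
def aphiNorm [μG.IsMulLeftInvariant] (a : N → (HS μG →L[ℂ] HS μG)) : ℝ :=
  sInf {C : ℝ | 0 ≤ C ∧ ∀ g ∈ hsCore N μG,
    hsL2Norm N μG μN (aphiMul φ N μG μN a g) ≤ C * hsL2Norm N μG μN g}

end Group

/-! ### Completions -/

/-- A completion of a complex vector space `core` with a norm `p` and an isometric conjugate
linear involution `st`: a Banach space with an isometric involution, and an isometric linear map
from `core` with dense range that respects the involutions. It is unique up to a unique isometric
isomorphism. -/
structure StarCompletion {E : Type u} [AddCommGroup E] [Module ℂ E] (core : Submodule ℂ E)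
    (p : E → ℝ) (st : E → E) where
  carrier : Type u
  [normed : NormedAddCommGroup carrier]
  [space : NormedSpace ℂ carrier]
  [complete : CompleteSpace carrier]
  [starAdd : StarAddMonoid carrier]
  [starModule : StarModule ℂ carrier]
  [normedStar : NormedStarGroup carrier]
  ι : core →ₗ[ℂ] carrier
  norm_ι : ∀ x : core, ‖ι x‖ = p x
  dense_ι : DenseRange ι
  star_ι : ∀ x y : core, (y : E) = st x → ι y = star (ι x)

attribute [instance] StarCompletion.normed StarCompletion.space StarCompletion.complete
  StarCompletion.starAdd StarCompletion.starModule StarCompletion.normedStar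

section Main

variable {G : Type u} [Group G] [TopologicalSpace G] [IsTopologicalGroup G]
  [MeasurableSpace G] [BorelSpace G] [SecondCountableTopology G]
  (φ : Tricharacter G) (N : Subgroup G) (μG : Measure G) (μN : Measure N)
  [SFinite μG] [μG.IsMulLeftInvariant] [μN.IsMulLeftInvariant]

/-- The nonassociative torus: the twisted crossed product `u-ind_N^G(K(L²(N))) ⋊_{β,v} G`, the
completion of `C_c(G, B)`. -/
abbrev NonassociativeTorus : Type (u + 1) :=
  StarCompletion (torusCore φ N μN) (torusNorm φ N μG μN) (torusStar φ N μN)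

/-- The twisted crossed product `A_φ = K_φ(L²(G)) ⋊_{γ,u} N`, the completion of
`C_c(N, K_φ(L²(G)))`. -/
abbrev TwistedCompactsCrossedProduct : Type (u + 1) :=
  StarCompletion (aphiCore φ N μG) (aphiNorm φ N μG μN) (aphiStar φ N μG)

/-- `Matches Φ F g`: under `Φ`, the element of the torus given by `F` in `C_c(G, B)` goes to the
element of `A_φ` given by `g` in `C_c(N, HS)`. -/
def Matches {T : NonassociativeTorus φ N μG μN} {A : TwistedCompactsCrossedProduct φ N μG μN}
    (Φ : T.carrier ≃ₗᵢ[ℂ] A.carrier) (F : torusCore φ N μN) (g : N → HS μG) : Prop :=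
  g ∈ hsCore N μG ∧ ∃ b : aphiCore φ N μG, (b : N → (HS μG →L[ℂ] HS μG)) = hsMul φ μG ∘ g ∧
    Φ (T.ι F) = A.ι b

/-- An isomorphism of the nonassociative torus with `A_φ`: an isometric linear isomorphism of the
completions which respects the involutions, restricts to a bijection between dense `*`-subalgebras
of the algebras `C_c(G, B)` and `C_c(N, HS)`, and takes products to products, `F₁ * F₂` to `a * g`
whenever `F₁, F₂` in `C_c(G, B)` correspond to `a` in `C_c(N, K_φ)` and `g` in `C_c(N, HS)`. -/
structure IsAlgebraIso {T : NonassociativeTorus φ N μG μN}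
    {A : TwistedCompactsCrossedProduct φ N μG μN}
    (Φ : T.carrier ≃ₗᵢ[ℂ] A.carrier) : Prop where
  map_star : ∀ x, Φ (star x) = star (Φ x)
  dense : Dense {x : T.carrier | ∃ F g, T.ι F = x ∧ Matches φ N μG μN Φ F g}
  map_mul : ∀ (F₁ F₂ F₃ : torusCore φ N μN) (a : aphiCore φ N μG) (g : N → HS μG),
    (F₃ : G → G → Op N μN) = torusMul φ N μG μN F₁ F₂ → Φ (T.ι F₁) = A.ι a →
    Matches φ N μG μN Φ F₂ g → Matches φ N μG μN Φ F₃ (aphiMul φ N μG μN a g)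

end Main

end NAT

end

/-!
# The nonassociative torus as a twisted crossed product by `N`

Both algebras are faithfully represented by operators on the same Hilbert space, and there they have
the same closure.

*The torus.* An element `F` of `C_c(G, B)` is encoded by the operator kernel
`k(x, w) = F(x⁻¹ w)(x) u(x, w)` on `G × G` (`toKernel`). This absorbs `u`, `β` and `v`: the product
becomes `(k * l)(x, w) = ∫ φ(x, v, w) k(x, v) l(v, w) dv` and the involution becomes `k(w, x)^*`
(`torusMul_eq`, `torusStar_eq`). Let `k` act on `L²(G × G, L²(N))` by
`ξ(w, x) ↦ ∫ φ(x, v, w) k(x, v) ξ(w, v) dv` (`kernelRep`). The variable `w` is a parameter, and the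
column `k(·, w)` of a product is the image of the column of the second factor in the fibre over `w`.
As `‖F‖_2` is the supremum of the norms of the columns, and every vector is a column of a kernel of the
same norm, the norm of the torus is the operator norm of `kernelRep` (`norm_kernelRep_toKernel`).

*The crossed product.* Its norm is by definition that of the operators `g ↦ a * g` on `L²(N, HS)`
(`aphiRep`), and these operators respect the involution (`aphiRep_star`).

*The comparison.* A function `ζ` in `C_c(N × G × G)` gives an element `t ↦ L_{ζ(t)}` of the crossed
product, and a kernel `K_ζ` (`coreKernel`) whose values are the integral operators on `L²(N)` with the
kernels `φ(q, r, w)⁻¹ φ(r, x, w)⁻¹ ζ(r⁻¹ q, r⁻¹ x, r⁻¹ w)`. The same formula with `q` fixed gives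
isometries from `L²(N, HS)` to `L²(G × G, L²(N))`, which all intertwine the two actions of `ζ`
(`kernelRep_coreKernel`); for `q = 1` the isometry is a unitary operator (`coreUnitary`). Here `φ = 1`
on `N × N × N` is used. The elements given by such `ζ` are dense on both sides
(`exists_norm_kernelRep_coreKernel_sub_lt`, `aphiRep_mem_closure`). Therefore both completions are the
same closed self-adjoint space of operators, which yields the isometric isomorphism
(`StarCompletion.exists_equiv`).

*The product.* The algebras are not associative, so left multiplication is not multiplicative and the
compatibility with products cannot be read off from a product of operators. Instead, an operator
determines its kernel through the columns: averaging the isometries for all `q` against `ψ(q)` gives an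
operator `columnOperator` from `L²(N, HS)`, which takes `g` to the columns `k(x, w) ψ` of the kernel
with the same operator as `g`. These columns need not be square integrable a priori, and are recovered
by pairing with test functions (`columnPairing_eq_of_kernelRep_eq`). If `k` corresponds to `a` and `l`
to `g`, the columns of `k * l` are the images under `kernelRep k` of those of `l`, hence the columns of
`a * g` (`kernelRep_kernelMul`).
-/

set_option linter.overlappingInstances false

noncomputable section

namespace NAT

/-! ### Continuous compactly supported functions in `L²` -/

section CompactSupport

/-- The space of continuous compactly supported functions `X → E`. -/
def Cc (X E : Type*) [TopologicalSpace X] [NormedAddCommGroup E] [NormedSpace ℂ E] :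
    Submodule ℂ (X → E) where
  carrier := {g | Continuous g ∧ HasCompactSupport g}
  add_mem' := fun hf hg => ⟨hf.1.add hg.1, hf.2.add hg.2⟩
  zero_mem' := ⟨continuous_const, HasCompactSupport.zero⟩
  smul_mem' := fun c _ hf => ⟨hf.1.const_smul c, hf.2.smul_left (f := fun _ => c)⟩

variable {P X Y E F : Type*} [TopologicalSpace P] [TopologicalSpace X] [TopologicalSpace Y]
  [NormedAddCommGroup E] [NormedSpace ℂ E] [NormedAddCommGroup F] [NormedSpace ℂ F]

theorem Cc.exists_isCompact (f : Cc X E) : ∃ K, IsCompact K ∧ ∀ x ∉ K, (f : X → E) x = 0 :=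
  ⟨_, f.2.2, fun _ hx => image_eq_zero_of_notMem_tsupport hx⟩

theorem mem_Cc_of_isCompact [R1Space X] {f : X → E} (hf : Continuous f) {K : Set X}
    (hK : IsCompact K) (h : ∀ x ∉ K, f x = 0) : f ∈ Cc X E :=
  ⟨hf, HasCompactSupport.intro hK h⟩

theorem Cc.curry_mem [T2Space X] [T2Space Y] (f : Cc (X × Y) E) (x : X) :
    (fun y => (f : X × Y → E) (x, y)) ∈ Cc Y E := by
  obtain ⟨K, hK, h⟩ := Cc.exists_isCompact f
  exact mem_Cc_of_isCompact (f.2.1.comp (by fun_prop)) (hK.image continuous_snd)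
    fun y hy => h _ fun hxy => hy ⟨_, hxy, rfl⟩

/-- A slice `f(x, ·)` of a continuous compactly supported function of two variables. -/
def Cc.slice [T2Space X] [T2Space Y] (f : Cc (X × Y) E) (x : X) : Cc Y E := ⟨_, Cc.curry_mem f x⟩

@[simp] theorem Cc.slice_apply [T2Space X] [T2Space Y] (f : Cc (X × Y) E) (x : X) (y : Y) :
    (Cc.slice f x : Y → E) y = (f : X × Y → E) (x, y) := rfl

/-- Functions of `y` depending continuously on a parameter, whose supports lie locally in the
parameter in a fixed compact set. -/
def LocallyCompactlySupported (f : P → Y → E) : Prop :=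
  ∀ p₀, ∃ K, IsCompact K ∧ ∀ᶠ p in 𝓝 p₀, ∀ y ∉ K, f p y = 0

theorem continuous_integral_of_locallyCompactlySupported [MeasurableSpace Y]
    [OpensMeasurableSpace Y] (μ : Measure Y) [IsFiniteMeasureOnCompacts μ] {f : P → Y → E}
    (hf : Continuous fun q : P × Y => f q.1 q.2) (h : LocallyCompactlySupported f) :
    Continuous fun p => ∫ y, f p y ∂μ := by
  refine continuous_iff_continuousAt.2 fun p₀ => ?_
  obtain ⟨K, hK, hp⟩ := h p₀
  obtain ⟨s, hs, hsK⟩ := eventually_iff_exists_mem.1 hp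
  exact (continuousOn_integral_of_compact_support (μ := μ) (s := s) hK hf.continuousOn
    (fun p y hp hy => hsK p hp y hy)).continuousAt hs

variable [MeasurableSpace X] [BorelSpace X] [MeasurableSpace Y] [BorelSpace Y]
  (μ : Measure X) [IsFiniteMeasureOnCompacts μ] (ν : Measure Y) [IsFiniteMeasureOnCompacts ν]

/-- The class in `L²` of a continuous compactly supported function. -/
def toL2 : Cc X E →ₗ[ℂ] Lp E 2 μ where
  toFun f := (f.2.1.memLp_of_hasCompactSupport (p := 2) (μ := μ) f.2.2).toLp _
  map_add' _ _ := rfl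
  map_smul' _ _ := rfl

theorem coeFn_toL2 (f : Cc X E) : toL2 μ f =ᵐ[μ] (f : X → E) :=
  MemLp.coeFn_toLp (f.2.1.memLp_of_hasCompactSupport (p := 2) (μ := μ) f.2.2)

theorem toL2_congr {f g : Cc X E} (h : ∀ x, (f : X → E) x = (g : X → E) x) :
    toL2 μ f = toL2 μ g := by
  congr 1; exact Subtype.ext (funext h)

theorem norm_sq_toL2 (f : Cc X E) : ‖toL2 μ f‖ ^ 2 = ∫ x, ‖(f : X → E) x‖ ^ 2 ∂μ := by
  have h := (f.2.1.memLp_of_hasCompactSupport (p := 2) (μ := μ) f.2.2)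
  have : ‖toL2 μ f‖ = (eLpNorm (f : X → E) 2 μ).toReal := Lp.norm_toLp _ h
  rw [this, h.eLpNorm_eq_integral_rpow_norm (by norm_num) (by norm_num)]
  have h0 : 0 ≤ ∫ x, ‖(f : X → E) x‖ ^ 2 ∂μ := integral_nonneg fun x => by positivity
  simp only [ENNReal.toReal_ofNat, Real.rpow_ofNat]
  rw [ENNReal.toReal_ofReal (by positivity), ← Real.rpow_natCast, ← Real.rpow_mul h0]
  norm_num

theorem norm_toL2_eq_sqrt (f : Cc X E) :
    ‖toL2 μ f‖ = Real.sqrt (∫ x, ‖(f : X → E) x‖ ^ 2 ∂μ) := by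
  rw [← norm_sq_toL2, Real.sqrt_sq (norm_nonneg _)]

theorem inner_toL2 {H : Type*} [NormedAddCommGroup H] [InnerProductSpace ℂ H] (f g : Cc X H) :
    inner ℂ (toL2 μ f) (toL2 μ g) = ∫ x, inner ℂ ((f : X → H) x) ((g : X → H) x) ∂μ := by
  rw [L2.inner_def]
  refine integral_congr_ae ?_
  filter_upwards [coeFn_toL2 μ f, coeFn_toL2 μ g] with x hf hg
  rw [hf, hg]

theorem norm_toL2_le (f : Cc X E) {K : Set X} (hK : IsCompact K)
    (h0 : ∀ x ∉ K, (f : X → E) x = 0) {M : ℝ} (hM : 0 ≤ M) (h : ∀ x, ‖(f : X → E) x‖ ≤ M) :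
    ‖toL2 μ f‖ ≤ M * Real.sqrt (μ.real K) := by
  rw [norm_toL2_eq_sqrt, ← Real.sqrt_sq hM, ← Real.sqrt_mul (sq_nonneg M)]
  refine Real.sqrt_le_sqrt ?_
  rw [← setIntegral_eq_integral_of_forall_compl_eq_zero (s := K)
    (fun x hx => by rw [h0 x hx]; simp)]
  refine (Real.le_norm_self _).trans
    (norm_setIntegral_le_of_norm_le_const hK.measure_lt_top fun x _ => ?_)
  rw [norm_pow, norm_norm]
  exact pow_le_pow_left₀ (norm_nonneg _) (h x) 2

theorem continuous_toL2 {f : P → Cc X E} (hf : Continuous fun q : P × X => (f q.1 : X → E) q.2)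
    (h : LocallyCompactlySupported fun p x => (f p : X → E) x) :
    Continuous fun p => toL2 μ (f p) := by
  refine continuous_iff_continuousAt.2 fun p₀ => ?_
  obtain ⟨K, hK, hp⟩ := h p₀
  rw [Metric.continuousAt_iff']
  intro ε hε
  set δ : ℝ := ε / (Real.sqrt (μ.real K) + 1) with hδ
  have hδ0 : 0 < δ := by positivity
  have h1 : ∀ᶠ p in 𝓝 p₀, ∀ x ∈ K, ‖(f p : X → E) x - (f p₀ : X → E) x‖ < δ := by
    refine hK.eventually_forall_of_forall_eventually fun x _ => ?_
    have hc : Continuous fun q : P × X => ‖(f q.1 : X → E) q.2 - (f p₀ : X → E) q.2‖ :=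
      (hf.sub ((f p₀).2.1.comp continuous_snd)).norm
    refine hc.continuousAt.eventually (Iio_mem_nhds ?_)
    simpa using hδ0
  filter_upwards [h1, hp] with p hp1 hp2
  rw [dist_eq_norm, ← map_sub]
  have hz : ∀ x ∉ K, ((f p - f p₀ : Cc X E) : X → E) x = 0 := fun x hx => by
    change (f p : X → E) x - (f p₀ : X → E) x = 0
    rw [hp2 x hx, show (f p₀ : X → E) x = 0 from hp.self_of_nhds x hx, sub_zero]
  refine (norm_toL2_le μ _ hK hz hδ0.le fun x => ?_).trans_lt ?_
  · by_cases hx : x ∈ K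
    · exact (hp1 x hx).le
    · rw [hz x hx, norm_zero]; exact hδ0.le
  · rw [hδ, div_mul_eq_mul_div, div_lt_iff₀ (by positivity)]
    nlinarith [Real.sqrt_nonneg (μ.real K)]

theorem denseRange_toL2 [NormalSpace X] [LocallyCompactSpace X] [R1Space X] [μ.Regular] :
    DenseRange (toL2 μ : Cc X E →ₗ[ℂ] Lp E 2 μ) := by
  rw [Metric.denseRange_iff]
  intro f ε hε
  obtain ⟨g, hg1, hg2, hg3, hg4⟩ := (Lp.memLp f).exists_hasCompactSupport_eLpNorm_sub_le
    (by norm_num) (ε := ENNReal.ofReal (ε / 2)) (by positivity)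
  refine ⟨⟨g, hg3, hg1⟩, ?_⟩
  have hd : dist f (hg4.toLp g) = (eLpNorm ((f : X → E) - g) 2 μ).toReal := by
    rw [dist_edist, ← Lp.edist_toLp_toLp _ _ (Lp.memLp f) hg4, Lp.toLp_coeFn]
  change dist f (hg4.toLp g) < ε
  rw [hd]
  exact (ENNReal.toReal_le_of_le_ofReal (by positivity) hg2).trans_lt (by linarith)

/-! ### Functions of two variables -/

theorem Cc.continuous_toL2_slice [T2Space X] [T2Space Y] (f : Cc (X × Y) E) :
    Continuous fun x => toL2 ν (Cc.slice f x) := by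
  obtain ⟨K, hK, h⟩ := Cc.exists_isCompact f
  exact continuous_toL2 ν f.2.1 fun x => ⟨_, hK.image continuous_snd,
    Eventually.of_forall fun x y hy => h _ fun hxy => hy ⟨_, hxy, rfl⟩⟩

/-- A continuous compactly supported function of two variables as a continuous compactly supported
function of the first variable with values in `L²` of the second. -/
def curryL2 [T2Space X] [T2Space Y] : Cc (X × Y) E →ₗ[ℂ] Cc X (Lp E 2 ν) where
  toFun f := ⟨fun x => toL2 ν (Cc.slice f x), Cc.continuous_toL2_slice ν f, by
    obtain ⟨K, hK, h⟩ := Cc.exists_isCompact f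
    refine HasCompactSupport.intro (hK.image continuous_fst) fun x hx => ?_
    rw [← map_zero (toL2 ν)]
    exact toL2_congr ν fun y => h _ fun hxy => hx ⟨_, hxy, rfl⟩⟩
  map_add' _ _ := rfl
  map_smul' _ _ := rfl

theorem curryL2_apply [T2Space X] [T2Space Y] (f : Cc (X × Y) E) (x : X) :
    (curryL2 ν f : X → Lp E 2 ν) x = toL2 ν (Cc.slice f x) := rfl

/-- A continuous compactly supported function on `X × Y` as an element of `L²(X, L²(Y))`. -/
def toL2L2 [T2Space X] [T2Space Y] : Cc (X × Y) E →ₗ[ℂ] Lp (Lp E 2 ν) 2 μ :=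
  toL2 μ ∘ₗ curryL2 ν

theorem toL2L2_apply [T2Space X] [T2Space Y] (f : Cc (X × Y) E) :
    toL2L2 μ ν f = toL2 μ (curryL2 ν f) := rfl

theorem norm_sq_toL2L2 [T2Space X] [T2Space Y] (f : Cc (X × Y) E) :
    ‖toL2L2 μ ν f‖ ^ 2 = ∫ x, ∫ y, ‖(f : X × Y → E) (x, y)‖ ^ 2 ∂ν ∂μ := by
  rw [toL2L2_apply, norm_sq_toL2]
  exact integral_congr_ae (ae_of_all _ fun x => norm_sq_toL2 ν _)

/-- The Bochner integral in `L²` of a continuous compactly supported family of continuous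
functions is the pointwise integral. -/
theorem integral_toL2 {H : Type*} [NormedAddCommGroup H] [InnerProductSpace ℂ H] [CompleteSpace H]
    [T2Space X] [T2Space Y] [LocallyCompactSpace Y]
    [NormalSpace Y] [ν.Regular] (f : Cc (X × Y) H) (g : Cc Y H)
    (hg : ∀ y, (g : Y → H) y = ∫ x, (f : X × Y → H) (x, y) ∂μ) :
    ∫ x, toL2 ν (Cc.slice f x) ∂μ = toL2 ν g := by
  have hi : Integrable (fun x => toL2 ν (Cc.slice f x)) μ :=
    (curryL2 ν f).2.1.integrable_of_hasCompactSupport (curryL2 ν f).2.2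
  obtain ⟨K, hK, hK0⟩ := Cc.exists_isCompact f
  have key : ∀ h : Cc Y H, inner ℂ (toL2 ν h) (∫ x, toL2 ν (Cc.slice f x) ∂μ) =
      inner ℂ (toL2 ν h) (toL2 ν g) := fun h => by
    rw [← integral_inner hi, inner_toL2]
    simp only [inner_toL2]
    rw [integral_integral_swap_of_hasCompactSupport]
    · refine integral_congr_ae (ae_of_all _ fun y => ?_)
      simp only [hg, Cc.slice_apply]
      refine integral_inner ?_ _
      refine Continuous.integrable_of_hasCompactSupport (f.2.1.comp (by fun_prop))
        (HasCompactSupport.intro (hK.image continuous_fst) fun x hx => ?_)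
      exact hK0 _ fun hxy => hx ⟨_, hxy, rfl⟩
    · exact (h.2.1.comp continuous_snd).inner f.2.1
    · refine HasCompactSupport.intro hK fun p hp => ?_
      simp only [Function.uncurry, Cc.slice_apply]
      rw [hK0 p hp, inner_zero_right]
  refine ext_inner_left ℂ fun v => ?_
  have hcl : IsClosed {v : Lp H 2 ν | inner ℂ v (∫ x, toL2 ν (Cc.slice f x) ∂μ) =
      inner ℂ v (toL2 ν g)} := isClosed_eq (by fun_prop) (by fun_prop)
  exact (denseRange_toL2 ν).induction_on (p := fun v => inner ℂ v (∫ x, toL2 ν (Cc.slice f x) ∂μ) =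
      inner ℂ v (toL2 ν g)) v hcl key

end CompactSupport

/-! ### Approximation by partitions of unity -/

section Partition

/-- A finite partition of unity on a compact set `L`, subordinate to neighbourhoods `W x` of its
points and indexed by points of `L`. -/
theorem exists_partition {X : Type*} [TopologicalSpace X] [LocallyCompactSpace X] [T2Space X]
    {L : Set X} (hL : IsCompact L) (W : X → Set X) (hW : ∀ x ∈ L, W x ∈ 𝓝 x) :
    ∃ (t : Finset X) (p : X → X → ℝ), (∀ i ∈ t, i ∈ L) ∧
      (∀ i ∈ t, Continuous (p i) ∧ HasCompactSupport (p i) ∧ ∀ x ∉ W i, p i x = 0) ∧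
      (∀ i x, 0 ≤ p i x) ∧ (∀ x, ∑ i ∈ t, p i x ≤ 1) ∧ ∀ x ∈ L, ∑ i ∈ t, p i x = 1 := by
  classical
  obtain ⟨t, ht, htL⟩ := hL.elim_nhds_subcover (fun x => interior (W x))
    fun x hx => interior_mem_nhds.2 (hW x hx)
  obtain ⟨f, hf, hfc⟩ := PartitionOfUnity.exists_isSubordinate_of_locallyFinite_t2space hL
    (fun i : t => interior (W i)) (fun i => isOpen_interior) (locallyFinite_of_finite _)
    (fun x hx => by
      obtain ⟨i, hi, hx'⟩ := Set.mem_iUnion₂.1 (htL hx)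
      exact Set.mem_iUnion.2 ⟨⟨i, hi⟩, hx'⟩)
  have hp : ∀ i (hi : i ∈ t), (fun x => if h : i ∈ t then f ⟨i, h⟩ x else 0) = f ⟨i, hi⟩ :=
    fun i hi => funext fun x => by rw [dif_pos hi]
  have hsum : ∀ x, ∑ i ∈ t, (if h : i ∈ t then f ⟨i, h⟩ x else 0) = ∑ᶠ i, f i x := fun x => by
    rw [finsum_eq_sum_of_fintype, ← Finset.sum_coe_sort]
    exact Finset.sum_congr rfl fun i _ => by rw [dif_pos i.2]
  refine ⟨t, fun i x => if h : i ∈ t then f ⟨i, h⟩ x else 0, ht, fun i hi => ?_, fun i x => ?_,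
    fun x => ?_, fun x hx => ?_⟩
  · dsimp only
    rw [hp i hi]
    refine ⟨(f ⟨i, hi⟩).continuous, hfc _, fun x hx => ?_⟩
    rw [dif_pos hi]
    exact image_eq_zero_of_notMem_tsupport fun h => hx (interior_subset (hf ⟨i, hi⟩ h))
  · dsimp only
    split_ifs with h
    · exact f.nonneg _ _
    · exact le_rfl
  · rw [hsum]; exact f.sum_le_one x
  · rw [hsum]; exact f.sum_eq_one hx

/-- The error made by replacing `a` by the `p i`-weighted average of `s i`. -/
theorem norm_sum_smul_sub_lt {ι E : Type*} [NormedAddCommGroup E] [NormedSpace ℂ E]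
    (t : Finset ι) (p : ι → ℝ) (h0 : ∀ i, 0 ≤ p i) (h1 : ∑ i ∈ t, p i ≤ 1) (s : ι → E) (a : E)
    {ε : ℝ} (hε : 0 < ε) (h : ∀ i ∈ t, p i ≠ 0 → ‖s i - a‖ < ε)
    (ha : ∑ i ∈ t, p i = 1 ∨ ‖a‖ < ε) :
    ‖∑ i ∈ t, (p i : ℂ) • s i - a‖ < 2 * ε := by
  -- the average of the deviations, and the part of `a` missed where the weights do not add up to `1`
  have e1 : ∑ i ∈ t, (p i : ℂ) • s i - a =
      ∑ i ∈ t, (p i : ℂ) • (s i - a) - ((1 - ∑ i ∈ t, p i : ℝ) : ℂ) • a := by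
    simp only [smul_sub, Finset.sum_sub_distrib, ← Finset.sum_smul]
    push_cast
    rw [sub_smul, one_smul]; abel
  have e2 : ‖∑ i ∈ t, (p i : ℂ) • (s i - a)‖ ≤ (∑ i ∈ t, p i) * ε := by
    rw [Finset.sum_mul]
    refine (norm_sum_le _ _).trans (Finset.sum_le_sum fun i hi => ?_)
    rw [norm_smul, Complex.norm_real, Real.norm_of_nonneg (h0 i)]
    by_cases hp : p i = 0
    · rw [hp]; simp
    · exact mul_le_mul_of_nonneg_left (h i hi hp).le (h0 i)
  have hs : 0 ≤ ∑ i ∈ t, p i := Finset.sum_nonneg fun i _ => h0 i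
  have e3 : ‖((1 - ∑ i ∈ t, p i : ℝ) : ℂ) • a‖ < ε := by
    rw [norm_smul, Complex.norm_real, Real.norm_of_nonneg (by linarith)]
    rcases ha with ha | ha
    · rw [ha]; simpa using hε
    · nlinarith [norm_nonneg a]
  rw [e1]
  refine (norm_sub_le _ _).trans_lt ?_
  nlinarith

/-- A module of functions over the continuous compactly supported real functions which is dense in
each fibre approximates every continuous compactly supported function uniformly, with control of
the supports. -/
theorem Cc.exists_approx {X E : Type*} [TopologicalSpace X] [LocallyCompactSpace X] [T2Space X]
    [NormedAddCommGroup E] [NormedSpace ℂ E] (a : Cc X E) (S : Submodule ℂ (X → E))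
    (hmul : ∀ p : X → ℝ, Continuous p → HasCompactSupport p → ∀ s ∈ S,
      (fun x => (p x : ℂ) • s x) ∈ S)
    (hc : ∀ s ∈ S, Continuous s)
    (hfib : ∀ x, ∀ ε > 0, ∃ s ∈ S, ‖s x - (a : X → E) x‖ < ε) :
    ∃ L, IsCompact L ∧ ∀ ε > 0, ∃ s ∈ S, (∀ x ∉ L, s x = 0) ∧
      ∀ x, ‖s x - (a : X → E) x‖ < ε := by
  obtain ⟨K, hK, hK0⟩ := Cc.exists_isCompact a
  obtain ⟨L, hL, hKL⟩ := exists_compact_superset hK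
  refine ⟨L, hL, fun ε hε => ?_⟩
  choose s hsS hs using fun x => hfib x (ε / 2) (by positivity)
  obtain ⟨t, p, ht, hp, hp0, hp1, hpK⟩ := exists_partition hK
    (fun x => {y | ‖s x y - (a : X → E) y‖ < ε / 2} ∩ interior L) fun x hx => by
      refine inter_mem ?_ (isOpen_interior.mem_nhds (hKL hx))
      have : Continuous fun y => ‖s x y - (a : X → E) y‖ := ((hc _ (hsS x)).sub a.2.1).norm
      exact this.continuousAt.eventually (Iio_mem_nhds (hs x))
  refine ⟨∑ i ∈ t, fun x => (p i x : ℂ) • s i x,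
    S.sum_mem fun i hi => hmul _ (hp i hi).1 (hp i hi).2.1 _ (hsS i), fun x hx => ?_, fun x => ?_⟩
  · rw [Finset.sum_apply]
    refine Finset.sum_eq_zero fun i hi => ?_
    rw [(hp i hi).2.2 x fun h => hx (interior_subset h.2)]; simp
  · rw [Finset.sum_apply]
    refine (norm_sum_smul_sub_lt t (fun i => p i x) (fun i => hp0 i x) (hp1 x) (fun i => s i x) _
      (ε := ε / 2) (by positivity) (fun i hi h => ?_) ?_).trans_le (by linarith)
    · by_contra h'
      exact h ((hp i hi).2.2 x fun hx => h' hx.1)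
    · by_cases hx : x ∈ K
      · exact Or.inl (hpK x hx)
      · right; rw [hK0 x hx, norm_zero]; positivity

theorem norm_toL2_sub_le {X E : Type*} [TopologicalSpace X] [NormedAddCommGroup E]
    [NormedSpace ℂ E] [MeasurableSpace X] [BorelSpace X] (μ : Measure X)
    [IsFiniteMeasureOnCompacts μ] (f g : Cc X E) {K : Set X} (hK : IsCompact K)
    (hf : ∀ x ∉ K, (f : X → E) x = 0) (hg : ∀ x ∉ K, (g : X → E) x = 0) {M : ℝ} (hM : 0 ≤ M)
    (h : ∀ x, ‖(f : X → E) x - (g : X → E) x‖ ≤ M) :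
    ‖toL2 μ f - toL2 μ g‖ ≤ M * Real.sqrt (μ.real K) := by
  rw [← map_sub]
  refine norm_toL2_le μ (f - g) hK (fun x hx => ?_) hM h
  change (f : X → E) x - (g : X → E) x = 0
  rw [hf x hx, hg x hx, sub_zero]

variable {X Y : Type*} [TopologicalSpace X] [TopologicalSpace Y]
  [LocallyCompactSpace X] [LocallyCompactSpace Y] [T2Space X] [T2Space Y]

/-- The product of a real function of `x` with a function of `x` and `y`. -/
def Cc.mulFst (p : X → ℝ) (hp : Continuous p) (f : Cc (X × Y) ℂ) : Cc (X × Y) ℂ :=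
  ⟨fun q => (p q.1 : ℂ) * (f : X × Y → ℂ) q, by
    obtain ⟨K, hK, h⟩ := Cc.exists_isCompact f
    have := f.2.1
    exact mem_Cc_of_isCompact (by fun_prop) hK fun q hq => by rw [h q hq, mul_zero]⟩

/-- The function `f(x) g(y)`. -/
def Cc.tensor {E : Type*} [NormedAddCommGroup E] [NormedSpace ℂ E] (f : Cc X ℂ) (g : Cc Y E) :
    Cc (X × Y) E :=
  ⟨fun q => (f : X → ℂ) q.1 • (g : Y → E) q.2, by
    obtain ⟨K, hK, h⟩ := Cc.exists_isCompact f
    obtain ⟨L, hL, h'⟩ := Cc.exists_isCompact g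
    have := f.2.1
    have := g.2.1
    refine mem_Cc_of_isCompact (by fun_prop) (hK.prod hL) fun q hq => ?_
    by_cases h1 : q.1 ∈ K
    · rw [h' q.2 fun h2 => hq ⟨h1, h2⟩, smul_zero]
    · rw [h _ h1, zero_smul]⟩

theorem Cc.exists_eq_one (x : X) : ∃ f : Cc X ℂ, (f : X → ℂ) x = 1 := by
  obtain ⟨f, hf, -, hc, -⟩ := exists_continuous_one_zero_of_isCompact (isCompact_singleton (x := x))
    isClosed_empty (Set.disjoint_empty _)
  refine ⟨⟨fun y => (f y : ℂ), by fun_prop, hc.comp_left Complex.ofReal_zero⟩, ?_⟩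
  change ((f x : ℝ) : ℂ) = 1
  rw [hf (Set.mem_singleton x)]; simp

variable [MeasurableSpace X] [BorelSpace X] [MeasurableSpace Y] [BorelSpace Y]
  (μ : Measure X) [IsFiniteMeasureOnCompacts μ] (ν : Measure Y) [IsFiniteMeasureOnCompacts ν]
  [NormalSpace X] [NormalSpace Y] [μ.Regular] [ν.Regular]

theorem curryL2_exists_approx (a : Cc X (Lp ℂ 2 ν)) :
    ∃ L, IsCompact L ∧ ∀ ε > 0, ∃ f : Cc (X × Y) ℂ,
      (∀ x ∉ L, (curryL2 ν f : X → Lp ℂ 2 ν) x = 0) ∧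
      ∀ x, ‖(curryL2 ν f : X → Lp ℂ 2 ν) x - (a : X → Lp ℂ 2 ν) x‖ < ε := by
  obtain ⟨L, hL, h⟩ := Cc.exists_approx a
    (LinearMap.range ((Cc X (Lp ℂ 2 ν)).subtype ∘ₗ curryL2 ν))
    (by
      rintro p hp - _ ⟨f, rfl⟩
      refine ⟨Cc.mulFst p hp f, funext fun x => ?_⟩
      change toL2 ν _ = (p x : ℂ) • toL2 ν _
      rw [← map_smul]
      exact toL2_congr ν fun y => rfl)
    (by rintro _ ⟨f, rfl⟩; exact (curryL2 ν f).2.1)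
    (fun x ε hε => by
      obtain ⟨g, hg⟩ := Metric.denseRange_iff.1 (denseRange_toL2 ν) ((a : X → Lp ℂ 2 ν) x) ε hε
      obtain ⟨f, hf⟩ := Cc.exists_eq_one x
      refine ⟨_, ⟨Cc.tensor f g, rfl⟩, ?_⟩
      rw [← dist_eq_norm, dist_comm]
      convert hg using 2
      change toL2 ν _ = _
      refine toL2_congr ν fun y => ?_
      change (f : X → ℂ) x * (g : Y → ℂ) y = _
      rw [hf, one_mul])
  refine ⟨L, hL, fun ε hε => ?_⟩
  obtain ⟨_, ⟨f, rfl⟩, h1, h2⟩ := h ε hε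
  exact ⟨f, h1, h2⟩

theorem denseRange_toL2L2 : DenseRange (toL2L2 μ ν : Cc (X × Y) ℂ →ₗ[ℂ] Lp (Lp ℂ 2 ν) 2 μ) := by
  rw [Metric.denseRange_iff]
  intro v ε hε
  obtain ⟨a, ha⟩ := Metric.denseRange_iff.1 (denseRange_toL2 μ) v (ε / 2) (by positivity)
  obtain ⟨L, hL, h⟩ := curryL2_exists_approx ν a
  obtain ⟨K, hK, hK0⟩ := Cc.exists_isCompact a
  set M : ℝ := Real.sqrt (μ.real (K ∪ L)) + 1 with hM
  have hM0 : 0 < M := by positivity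
  obtain ⟨f, hf, hfa⟩ := h (ε / (2 * M)) (by positivity)
  refine ⟨f, (dist_triangle _ (toL2 μ a) _).trans_lt ?_⟩
  have h2 : dist (toL2 μ a) (toL2L2 μ ν f) ≤ ε / (2 * M) * Real.sqrt (μ.real (K ∪ L)) := by
    rw [dist_comm, dist_eq_norm]
    exact norm_toL2_sub_le μ _ _ (hK.union hL) (fun x hx => hf x fun h => hx (Or.inr h))
      (fun x hx => hK0 x fun h => hx (Or.inl h)) (by positivity) fun x => (hfa x).le
  have h3 : ε / (2 * M) * Real.sqrt (μ.real (K ∪ L)) < ε / 2 := by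
    rw [div_mul_eq_mul_div, div_lt_div_iff₀ (by positivity) (by norm_num)]
    nlinarith [Real.sqrt_nonneg (μ.real (K ∪ L))]
  linarith

/-- Continuous compactly supported functions extend from closed subspaces. -/
theorem Cc.exists_extension {A B : Type*} [TopologicalSpace A] [TopologicalSpace B]
    [NormalSpace B] [LocallyCompactSpace B] [T2Space B] {e : A → B} (he : IsClosedEmbedding e)
    (f : Cc A ℂ) : ∃ g : Cc B ℂ, ∀ a, (g : B → ℂ) (e a) = (f : A → ℂ) a := by
  obtain ⟨K, hK, hK0⟩ := Cc.exists_isCompact f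
  obtain ⟨g, hg⟩ := ContinuousMap.exists_extension he (⟨f, f.2.1⟩ : C(A, ℂ))
  -- the Tietze extension is cut off by a function which is `1` on the support of `f`
  obtain ⟨c, hc, -, hcc, -⟩ := exists_continuous_one_zero_of_isCompact (hK.image he.continuous)
    isClosed_empty (Set.disjoint_empty _)
  refine ⟨⟨fun b => (c b : ℂ) * g b, by fun_prop,
    (hcc.comp_left (g := Complex.ofReal) Complex.ofReal_zero).mul_right⟩, fun a => ?_⟩
  have hga : g (e a) = (f : A → ℂ) a := congrArg (fun h : C(A, ℂ) => h a) hg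
  change (c (e a) : ℂ) * g (e a) = _
  rw [hga]
  by_cases ha : a ∈ K
  · rw [hc ⟨a, ha, rfl⟩]; simp
  · rw [hK0 a ha, mul_zero]

end Partition

/-! ### Completions inside an algebra of operators -/

section Completion

variable {E B : Type u} [AddCommGroup E] [Module ℂ E] {core : Submodule ℂ E} {p : E → ℝ}
  {st : E → E} [NormedAddCommGroup B] [NormedSpace ℂ B] [CompleteSpace B] [StarAddMonoid B]
  [StarModule ℂ B] [NormedStarGroup B]

/-- A linear map into a Banach space with isometric involution that realises the norm and the
involution of `core` has a completion of `core` as the closure of its range. -/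
theorem StarCompletion.nonempty_of_rep (ρ : core →ₗ[ℂ] B) (hρ : ∀ x : core, ‖ρ x‖ = p x)
    (hst : ∀ x : core, ∃ y : core, (y : E) = st x ∧ ρ y = star (ρ x)) :
    Nonempty (StarCompletion core p st) := by
  set S : Submodule ℂ B := (LinearMap.range ρ).topologicalClosure with hS
  have hcl : IsClosed (S : Set B) := Submodule.isClosed_topologicalClosure _
  have hstar : ∀ b ∈ S, star b ∈ S := by
    intro b hb
    have h1 : Set.MapsTo star (LinearMap.range ρ : Set B) (LinearMap.range ρ : Set B) := by
      rintro _ ⟨x, rfl⟩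
      obtain ⟨y, -, hy⟩ := hst x
      exact ⟨y, hy⟩
    exact h1.closure continuous_star hb
  let : Star S := ⟨fun b => ⟨star (b : B), hstar b b.2⟩⟩
  let : StarAddMonoid S :=
    { star_involutive := fun b => Subtype.ext (star_star (b : B))
      star_add := fun a b => Subtype.ext (star_add (a : B) b) }
  have : StarModule ℂ S := ⟨fun c b => Subtype.ext (star_smul c (b : B))⟩
  have : NormedStarGroup S := ⟨fun b => (norm_star (b : B)).le⟩
  have : CompleteSpace S := hcl.completeSpace_coe
  let ι : core →ₗ[ℂ] S := ρ.codRestrict S fun x => subset_closure ⟨x, rfl⟩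
  refine ⟨⟨S, ι, hρ, ?_, ?_⟩⟩
  · intro b
    rw [closure_subtype]
    have : Subtype.val '' Set.range ι = (LinearMap.range ρ : Set B) := by
      rw [← Set.range_comp]; rfl
    rw [this]
    exact b.2
  · intro x y hy
    obtain ⟨z, hz, hz'⟩ := hst x
    have : y = z := Subtype.ext (hy.trans hz.symm)
    subst this
    exact Subtype.ext hz'

variable (T : StarCompletion core p st) (ρ : core →ₗ[ℂ] B) (hρ : ∀ x : core, ‖ρ x‖ = p x)

/-- The isometric extension to a completion of a linear map realising the norm of `core`. -/
def StarCompletion.rep : T.carrier →ₗᵢ[ℂ] B where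
  toLinearMap := (ρ.extendOfNorm T.ι).toLinearMap
  norm_map' := by
    refine T.dense_ι.induction ?_ (isClosed_eq (by
      simp only [ContinuousLinearMap.coe_coe]; fun_prop) continuous_norm)
    rintro _ ⟨x, rfl⟩
    have := LinearMap.extendOfNorm_eq (f := ρ) T.dense_ι
      ⟨1, fun x => by rw [one_mul, hρ, T.norm_ι]⟩ x
    simp only [ContinuousLinearMap.coe_coe]
    rw [this, hρ, T.norm_ι]

theorem StarCompletion.rep_ι (x : core) : T.rep ρ hρ (T.ι x) = ρ x :=
  LinearMap.extendOfNorm_eq (f := ρ) T.dense_ι ⟨1, fun x => by rw [one_mul, hρ, T.norm_ι]⟩ x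

theorem StarCompletion.rep_star
    (hst : ∀ x : core, ∃ y : core, (y : E) = st x ∧ ρ y = star (ρ x)) (b : T.carrier) :
    T.rep ρ hρ (star b) = star (T.rep ρ hρ b) := by
  refine T.dense_ι.induction_on (p := fun b => T.rep ρ hρ (star b) = star (T.rep ρ hρ b)) b
    (isClosed_eq ((T.rep ρ hρ).continuous.comp continuous_star)
      (continuous_star.comp (T.rep ρ hρ).continuous)) fun x => ?_
  obtain ⟨y, hy, hy'⟩ := hst x
  rw [← T.star_ι x y hy, T.rep_ι, T.rep_ι, hy']

theorem StarCompletion.range_rep :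
    Set.range (T.rep ρ hρ) = closure (Set.range ρ) := by
  have h1 : Set.range ρ = T.rep ρ hρ '' Set.range T.ι := by
    rw [← Set.range_comp]; congr 1; ext x; exact (T.rep_ι ρ hρ x).symm
  rw [h1]
  refine Set.Subset.antisymm ?_ ?_
  · rintro _ ⟨b, rfl⟩
    exact image_closure_subset_closure_image (T.rep ρ hρ).continuous ⟨b, T.dense_ι b, rfl⟩
  · exact closure_minimal (Set.image_subset_range _ _)
      (T.rep ρ hρ).isometry.isClosedEmbedding.isClosed_range

/-- Two completions realised on the same closed subspace of `B` are isomorphic. -/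
theorem StarCompletion.exists_equiv {E' : Type u} [AddCommGroup E'] [Module ℂ E']
    {core' : Submodule ℂ E'} {p' : E' → ℝ} {st' : E' → E'}
    (T : StarCompletion core p st) (A : StarCompletion core' p' st')
    (ρ : core →ₗ[ℂ] B) (hρ : ∀ x : core, ‖ρ x‖ = p x)
    (hst : ∀ x : core, ∃ y : core, (y : E) = st x ∧ ρ y = star (ρ x))
    (σ : core' →ₗ[ℂ] B) (hσ : ∀ x : core', ‖σ x‖ = p' x)
    (hst' : ∀ x : core', ∃ y : core', (y : E') = st' x ∧ σ y = star (σ x))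
    (D : Set core) (hD : Set.range ρ ⊆ closure (ρ '' D))
    (hDσ : ρ '' D ⊆ Set.range σ) (hσD : Set.range σ ⊆ closure (ρ '' D)) :
    ∃ Φ : T.carrier ≃ₗᵢ[ℂ] A.carrier, (∀ x, Φ (star x) = star (Φ x)) ∧
      (∀ x y, Φ (T.ι x) = A.ι y ↔ ρ x = σ y) ∧ Dense (T.ι '' D) := by
  have hr : Set.range (T.rep ρ hρ) = Set.range (A.rep σ hσ) := by
    rw [T.range_rep, A.range_rep]
    refine Set.Subset.antisymm (closure_minimal (hD.trans (closure_mono hDσ)) isClosed_closure)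
      (closure_minimal (hσD.trans (closure_mono (Set.image_subset_range _ _))) isClosed_closure)
  have hex : ∀ x, ∃ y, A.rep σ hσ y = T.rep ρ hρ x := fun x => by
    have : T.rep ρ hρ x ∈ Set.range (A.rep σ hσ) := hr ▸ ⟨x, rfl⟩
    exact this
  have hsur : ∀ y, ∃ x, T.rep ρ hρ x = A.rep σ hσ y := fun y => by
    have : A.rep σ hσ y ∈ Set.range (T.rep ρ hρ) := hr ▸ ⟨y, rfl⟩
    exact this
  choose f hf using hex
  have hinj := (A.rep σ hσ).injective
  let fl : T.carrier →ₗᵢ[ℂ] A.carrier :=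
    { toFun := f
      map_add' := fun x y => hinj (by rw [map_add, hf, hf, hf, map_add])
      map_smul' := fun c x => hinj (by rw [map_smul, hf, hf, map_smul]; rfl)
      norm_map' := fun x => by
        change ‖f x‖ = ‖x‖
        rw [← (A.rep σ hσ).norm_map, hf, (T.rep ρ hρ).norm_map] }
  have hfs : Function.Surjective fl := fun y => by
    obtain ⟨x, hx⟩ := hsur y
    exact ⟨x, hinj ((hf x).trans hx)⟩
  let Φ := LinearIsometryEquiv.ofSurjective fl hfs
  have hΦ : ∀ x, A.rep σ hσ (Φ x) = T.rep ρ hρ x := hf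
  refine ⟨Φ, fun x => hinj ?_, fun x y => ?_, ?_⟩
  · rw [hΦ, A.rep_star σ hσ hst', T.rep_star ρ hρ hst, hΦ]
  · rw [← hinj.eq_iff, hΦ, T.rep_ι, A.rep_ι]
  · rw [(T.rep ρ hρ).isometry.isEmbedding.isInducing.dense_iff]
    intro x
    have h1 : T.rep ρ hρ '' (T.ι '' D) = ρ '' D := by
      rw [Set.image_image]; exact Set.image_congr fun x _ => T.rep_ι ρ hρ x
    rw [h1]
    refine closure_minimal hD isClosed_closure ?_
    rw [← T.range_rep ρ hρ]
    exact ⟨x, rfl⟩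

end Completion

/-! ### Strongly continuous families and compact operators -/

section Compact

variable {P H H₁ H₂ : Type*} [TopologicalSpace P]
  [NormedAddCommGroup H] [InnerProductSpace ℂ H] [CompleteSpace H]
  [NormedAddCommGroup H₁] [InnerProductSpace ℂ H₁] [CompleteSpace H₁]
  [NormedAddCommGroup H₂] [InnerProductSpace ℂ H₂] [CompleteSpace H₂]

/-- A pointwise continuous family of nonexpansive maps is jointly continuous. -/
theorem continuous_apply_of_nonexpansive {E F : Type*} [SeminormedAddCommGroup E]
    [SeminormedAddCommGroup F] {U : P → E → F} (hb : ∀ p v w, ‖U p v - U p w‖ ≤ ‖v - w‖)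
    {v : P → E} (hU : ∀ p₀, Continuous fun p => U p (v p₀)) (hv : Continuous v) :
    Continuous fun p => U p (v p) := by
  refine continuous_iff_continuousAt.2 fun p₀ => ?_
  rw [ContinuousAt, tendsto_iff_norm_sub_tendsto_zero]
  refine squeeze_zero (fun _ => norm_nonneg _) (g := fun p => ‖v p - v p₀‖ +
    ‖U p (v p₀) - U p₀ (v p₀)‖) (fun p => ?_) ?_
  · have h : U p (v p) - U p₀ (v p₀) = (U p (v p) - U p (v p₀)) +
        (U p (v p₀) - U p₀ (v p₀)) := by abel
    rw [h]
    exact (norm_add_le _ _).trans (add_le_add_left (hb p _ _) _)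
  · have h1 := (tendsto_iff_norm_sub_tendsto_zero.1 (hv.tendsto p₀)).add
      (tendsto_iff_norm_sub_tendsto_zero.1 ((hU p₀).tendsto p₀))
    simpa using h1

/-- Continuity of the orbit maps `p ↦ U p v` passes from a set of vectors to its closure, by an
`ε / 3` argument. -/
theorem continuous_of_mem_closure {E F : Type*} [SeminormedAddCommGroup E]
    [SeminormedAddCommGroup F] {U : P → E → F} (hb : ∀ p v w, ‖U p v - U p w‖ ≤ ‖v - w‖)
    {s : Set E} (hU : ∀ v ∈ s, Continuous fun p => U p v) {v : E} (hv : v ∈ closure s) :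
    Continuous fun p => U p v := by
  refine continuous_iff_continuousAt.2 fun p₀ => ?_
  rw [Metric.continuousAt_iff']
  intro ε hε
  obtain ⟨w, hw, hvw⟩ := Metric.mem_closure_iff.1 hv (ε / 3) (by positivity)
  have h := Metric.continuousAt_iff'.1 ((hU w hw).continuousAt (x := p₀)) (ε / 3) (by positivity)
  filter_upwards [h] with p hp
  have h1 : ∀ p, dist (U p v) (U p w) < ε / 3 := fun p => by
    rw [dist_eq_norm] at hvw ⊢
    exact (hb p v w).trans_lt hvw
  have h2 := h1 p₀
  rw [dist_comm] at h2
  calc dist (U p v) (U p₀ v) ≤ dist (U p v) (U p w) + dist (U p w) (U p₀ w) +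
      dist (U p₀ w) (U p₀ v) := dist_triangle4 _ _ _ _
    _ < ε := by linarith [h1 p]

theorem norm_sub_le_of_norm_le_one {E F : Type*} [SeminormedAddCommGroup E] [NormedSpace ℂ E]
    [SeminormedAddCommGroup F] [NormedSpace ℂ F] {A : E →L[ℂ] F} (hA : ‖A‖ ≤ 1) (v w : E) :
    ‖A v - A w‖ ≤ ‖v - w‖ := by
  rw [← map_sub]
  refine (A.le_opNorm _).trans ?_
  nlinarith [norm_nonneg (v - w)]

theorem StronglyContinuous.apply {U : P → H₁ →L[ℂ] H₂} (hU : ∀ v, Continuous fun p => U p v)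
    (hb : ∀ p, ‖U p‖ ≤ 1) {v : P → H₁} (hv : Continuous v) : Continuous fun p => U p (v p) :=
  continuous_apply_of_nonexpansive (U := fun p v => U p v)
    (fun p => norm_sub_le_of_norm_le_one (hb p)) (fun _ => hU _) hv

theorem continuous_of_dense {U : P → H₁ →L[ℂ] H₂} (hb : ∀ p, ‖U p‖ ≤ 1) {s : Set H₁}
    (hs : Dense s) (hU : ∀ v ∈ s, Continuous fun p => U p v) (v : H₁) :
    Continuous fun p => U p v :=
  continuous_of_mem_closure (U := fun p v => U p v)
    (fun p => norm_sub_le_of_norm_le_one (hb p)) hU (hs v)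

theorem exists_rankOne_approx {f : H₁ →L[ℂ] H₂} (hf : IsCompactOperator f)
    {ε : ℝ} (hε : 0 < ε) : ∃ g ∈ Submodule.span ℂ {g : H₁ →L[ℂ] H₂ | ∃ a b,
      g = InnerProductSpace.rankOne ℂ a b}, ‖f - g‖ < ε := by
  obtain ⟨K, hK, hfK⟩ := hf.image_closedBall_subset_compact (f := (f : H₁ →ₗ[ℂ] H₂)) 1
  obtain ⟨t, -, htf, ht⟩ := hK.finite_cover_balls (show (0 : ℝ) < ε / 2 by positivity)
  set V : Submodule ℂ H₂ := Submodule.span ℂ t with hV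
  have : FiniteDimensional ℂ V := FiniteDimensional.span_of_finite ℂ htf
  -- `V` is spanned by an `ε / 2`-net of the image of the unit ball
  refine ⟨V.starProjection ∘L f, ?_, ?_⟩
  · rw [(stdOrthonormalBasis ℂ V).starProjection_eq_sum_rankOne, ContinuousLinearMap.finsetSum_comp]
    exact Submodule.sum_mem _ fun i _ => Submodule.subset_span
      ⟨_, _, InnerProductSpace.rankOne_comp _ _ _⟩
  · refine lt_of_le_of_lt ?_ (half_lt_self hε)
    refine ContinuousLinearMap.opNorm_le_of_unit_norm (by positivity) fun x hx => ?_
    have hxK : f x ∈ K := hfK ⟨x, by simp [hx], rfl⟩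
    obtain ⟨y, hy, hxy⟩ := Set.mem_iUnion₂.1 (ht hxK)
    rw [Metric.mem_ball, dist_eq_norm] at hxy
    change ‖f x - V.starProjection (f x)‖ ≤ ε / 2
    rw [Submodule.starProjection_minimal]
    refine (ciInf_le ⟨0, ?_⟩ (⟨y, Submodule.subset_span hy⟩ : V)).trans hxy.le
    rintro _ ⟨z, rfl⟩
    exact norm_nonneg _

theorem isCompactOperator_rankOne (a : H₂) (b : H₁) :
    IsCompactOperator (InnerProductSpace.rankOne ℂ a b) := by
  rw [InnerProductSpace.rankOne_def']
  have h : IsCompactOperator (innerSL ℂ b) :=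
    isCompactOperator_of_locallyCompactSpace_dom (innerSL ℂ b)
  exact h.clm_comp (ContinuousLinearMap.toSpanSingleton ℂ a)

/-- Compactness passes to the adjoint, by approximation by operators of finite rank. -/
theorem isCompactOperator_adjoint {f : H₁ →L[ℂ] H₂} (hf : IsCompactOperator f) :
    IsCompactOperator (ContinuousLinearMap.adjoint f) := by
  have h1 : ContinuousLinearMap.adjoint f ∈
      closure {g : H₂ →L[ℂ] H₁ | IsCompactOperator g} := by
    rw [Metric.mem_closure_iff]
    intro ε hε
    obtain ⟨g, hg, hfg⟩ := exists_rankOne_approx hf hε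
    refine ⟨ContinuousLinearMap.adjoint g, ?_, ?_⟩
    · refine Submodule.span_induction (p := fun g _ => IsCompactOperator
        (ContinuousLinearMap.adjoint g)) ?_ ?_ ?_ ?_ hg
      · rintro _ ⟨a, b, rfl⟩
        rw [InnerProductSpace.adjoint_rankOne]
        exact isCompactOperator_rankOne _ _
      · rw [map_zero]; exact isCompactOperator_zero
      · intro x y _ _ hx hy
        rw [map_add]; exact hx.add hy
      · intro c x _ hx
        rw [map_smulₛₗ]; exact hx.smul _
    · rwa [dist_eq_norm, ← map_sub, LinearIsometryEquiv.norm_map]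
  rwa [isClosed_setOfPred_isCompactOperator.closure_eq] at h1

/-- Strong convergence is uniform on compact sets, hence becomes norm convergence after composition
with a compact operator. -/
theorem StronglyContinuous.comp_compact {U : P → H₁ →L[ℂ] H₂}
    (hU : ∀ v, Continuous fun p => U p v) (hb : ∀ p, ‖U p‖ ≤ 1) {f : P → H →L[ℂ] H₁}
    (hf : Continuous f) (hc : ∀ p, IsCompactOperator (f p)) : Continuous fun p => U p ∘L f p := by
  refine continuous_iff_continuousAt.2 fun p₀ => ?_
  rw [Metric.continuousAt_iff']
  intro ε hε
  obtain ⟨K, hK, hfK⟩ := (hc p₀).image_closedBall_subset_compact (f := (f p₀ : H →ₗ[ℂ] H₁)) 1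
  have h1 : ∀ᶠ p in 𝓝 p₀, ∀ y ∈ K, ‖U p y - U p₀ y‖ < ε / 3 := by
    refine hK.eventually_forall_of_forall_eventually fun y _ => ?_
    have hc : Continuous fun q : P × H₁ => ‖U q.1 q.2 - U p₀ q.2‖ := by
      refine ((StronglyContinuous.apply (U := fun q : P × H₁ => U q.1)
        (fun v => (hU v).comp continuous_fst) (fun q => hb q.1) continuous_snd).sub ?_).norm
      fun_prop
    refine hc.continuousAt.eventually (Iio_mem_nhds ?_)
    simp only [sub_self, norm_zero]; positivity
  filter_upwards [h1, Metric.continuousAt_iff'.1 hf.continuousAt (ε / 3) (by positivity)]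
    with p hp hp'
  rw [dist_eq_norm] at hp' ⊢
  have h2 : ‖(U p - U p₀) ∘L f p₀‖ ≤ ε / 3 :=
    ContinuousLinearMap.opNorm_le_of_unit_norm (by positivity) fun x hx =>
      (hp _ (hfK ⟨x, by simp [hx], rfl⟩)).le
  have h3 : U p ∘L f p - U p₀ ∘L f p₀ = U p ∘L (f p - f p₀) + (U p - U p₀) ∘L f p₀ := by
    simp only [ContinuousLinearMap.comp_sub, ContinuousLinearMap.sub_comp]; abel
  rw [h3]
  refine (norm_add_le _ _).trans_lt ?_
  have h4 := ContinuousLinearMap.opNorm_comp_le (U p) (f p - f p₀)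
  nlinarith [hb p, norm_nonneg (f p - f p₀), norm_nonneg (U p)]

theorem StronglyContinuous.compact_comp {U : P → H →L[ℂ] H₁}
    (hU : ∀ v, Continuous fun p => ContinuousLinearMap.adjoint (U p) v) (hb : ∀ p, ‖U p‖ ≤ 1)
    {f : P → H₁ →L[ℂ] H₂}
    (hf : Continuous f) (hc : ∀ p, IsCompactOperator (f p)) : Continuous fun p => f p ∘L U p := by
  have h := StronglyContinuous.comp_compact (U := fun p => ContinuousLinearMap.adjoint (U p))
    (f := fun p => ContinuousLinearMap.adjoint (f p)) hU
    (fun p => by rw [LinearIsometryEquiv.norm_map]; exact hb p)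
    (ContinuousLinearMap.adjoint.continuous.comp hf) fun p => isCompactOperator_adjoint (hc p)
  have h' := ContinuousLinearMap.adjoint.continuous.comp h
  refine h'.congr fun p => ?_
  simp [ContinuousLinearMap.adjoint_comp]

theorem integral_mem_of_isClosed {X E : Type*} [TopologicalSpace X] [MeasurableSpace X]
    [OpensMeasurableSpace X] (μ : Measure X) [IsFiniteMeasureOnCompacts μ] [NormedAddCommGroup E]
    [NormedSpace ℂ E] [CompleteSpace E] {S : Submodule ℂ E} (hS : IsClosed (S : Set E)) {f : X → E}
    (hf : Continuous f) (hs : HasCompactSupport f) (hc : ∀ x, f x ∈ S) : ∫ x, f x ∂μ ∈ S := by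
  have : CompleteSpace S := hS.completeSpace_coe
  let F : X → S := fun x => ⟨f x, hc x⟩
  have hF : Continuous F := hf.subtype_mk _
  have hF' : HasCompactSupport F := by
    refine hs.of_isClosed_subset (isClosed_tsupport _) (closure_mono fun x hx hx' => hx ?_)
    exact Subtype.ext hx'
  have h := S.subtypeL.integral_comp_comm (hF.integrable_of_hasCompactSupport (μ := μ) hF')
  change ∫ x, f x ∂μ = _ at h
  rw [h]
  exact (∫ x, F x ∂μ).2

theorem isCompactOperator_integral {X : Type*} [TopologicalSpace X] [MeasurableSpace X]
    [OpensMeasurableSpace X] (μ : Measure X) [IsFiniteMeasureOnCompacts μ] {f : X → H₁ →L[ℂ] H₂}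
    (hf : Continuous f) (hs : HasCompactSupport f) (hc : ∀ x, IsCompactOperator (f x)) :
    IsCompactOperator (∫ x, f x ∂μ : H₁ →L[ℂ] H₂) :=
  integral_mem_of_isClosed μ (S := compactOperator (RingHom.id ℂ) H₁ H₂)
    isClosed_setOfPred_isCompactOperator hf hs hc

theorem norm_star_clm (A : H →L[ℂ] H) : ‖star A‖ = ‖A‖ := by
  rw [ContinuousLinearMap.star_eq_adjoint, LinearIsometryEquiv.norm_map]

end Compact

/-! ### Multiplication operators and translations -/

section Operators

/-- The product of a continuous compactly supported function with a continuous function to the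
circle. -/
def Cc.circleMul {X : Type*} [TopologicalSpace X] (m : X → Circle) (hm : Continuous m) (f : Cc X ℂ) : Cc X ℂ :=
  ⟨fun x => (m x : ℂ) * (f : X → ℂ) x,
    (continuous_circle_coe.comp hm).mul f.2.1, f.2.2.mul_left⟩

/-- The left translate `s ↦ f(r⁻¹ s)`. -/
def Cc.translate {Γ : Type*} [Group Γ] [TopologicalSpace Γ] [IsTopologicalGroup Γ] {E : Type*} [NormedAddCommGroup E] [NormedSpace ℂ E] (r : Γ) (f : Cc Γ E) :
    Cc Γ E :=
  ⟨fun s => (f : Γ → E) (r⁻¹ * s), f.2.1.comp (continuous_const_mul _),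
    f.2.2.comp_homeomorph (Homeomorph.mulLeft r⁻¹)⟩

variable {X : Type*} [TopologicalSpace X] [MeasurableSpace X] [BorelSpace X]
  (μ : Measure X)

theorem coeFn_mulOp (m : X → Circle) (hm : Continuous m) (f : Lp ℂ 2 μ) :
    mulOp μ m hm f =ᵐ[μ] fun x => (m x : ℂ) * f x := by
  have key : MemLp (fun x => (m x : ℂ) * f x) 2 μ :=
    (Lp.memLp f).of_le
      ((((continuous_circle_coe.comp hm).stronglyMeasurable).mul
        (Lp.stronglyMeasurable f)).aestronglyMeasurable)
      (ae_of_all _ fun x => by rw [norm_mul, Circle.norm_coe, one_mul])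
  exact key.coeFn_toLp

theorem mulOp_mul (m m' : X → Circle) (hm : Continuous m) (hm' : Continuous m') :
    mulOp μ m hm * mulOp μ m' hm' = mulOp μ (fun x => m x * m' x) (hm.mul hm') := by
  ext1 f
  refine Lp.ext ?_
  filter_upwards [coeFn_mulOp μ m hm (mulOp μ m' hm' f), coeFn_mulOp μ m' hm' f,
    coeFn_mulOp μ (fun x => m x * m' x) (hm.mul hm') f] with x h1 h2 h3
  change mulOp μ m hm (mulOp μ m' hm' f) x = _
  rw [h1, h2, h3, Circle.coe_mul, mul_assoc]

theorem mulOp_congr {m m' : X → Circle} {hm : Continuous m} {hm' : Continuous m'}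
    (h : ∀ x, m x = m' x) : mulOp μ m hm = mulOp μ m' hm' := by
  have : m = m' := funext h
  subst this; rfl

theorem mulOp_const (c : Circle) {m : X → Circle} (hm : Continuous m) (h : ∀ x, m x = c) :
    mulOp μ m hm = (c : ℂ) • 1 := by
  ext1 f
  refine Lp.ext ?_
  filter_upwards [coeFn_mulOp μ m hm f, Lp.coeFn_smul (c : ℂ) f] with x h1 h3
  rw [h1, h]
  exact h3.symm

theorem mulOp_one {m : X → Circle} (hm : Continuous m) (h : ∀ x, m x = 1) :
    mulOp μ m hm = 1 := by
  rw [mulOp_const μ 1 hm h]; simp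

theorem norm_mulOp_le (m : X → Circle) (hm : Continuous m) : ‖mulOp μ m hm‖ ≤ 1 := by
  refine ContinuousLinearMap.opNorm_le_bound _ zero_le_one fun f => ?_
  rw [one_mul]
  refine Lp.norm_le_norm_of_ae_le ?_
  filter_upwards [coeFn_mulOp μ m hm f] with x hx
  rw [hx, norm_mul, Circle.norm_coe, one_mul]

theorem star_mulOp (m : X → Circle) (hm : Continuous m) :
    star (mulOp μ m hm) = mulOp μ (fun x => (m x)⁻¹) hm.inv := by
  rw [ContinuousLinearMap.star_eq_adjoint]
  refine Eq.symm ((ContinuousLinearMap.eq_adjoint_iff _ _).2 fun f g => ?_)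
  rw [L2.inner_def, L2.inner_def]
  refine integral_congr_ae ?_
  filter_upwards [coeFn_mulOp μ m hm g, coeFn_mulOp μ (fun x => (m x)⁻¹) hm.inv f] with x h1 h2
  rw [h1, h2, Circle.coe_inv_eq_conj]
  simp only [RCLike.inner_apply, map_mul, Complex.conj_conj]
  ring

theorem mulOp_star_mul (m : X → Circle) (hm : Continuous m) :
    star (mulOp μ m hm) * mulOp μ m hm = 1 := by
  rw [star_mulOp, mulOp_mul]; exact mulOp_one μ _ fun x => inv_mul_cancel _

theorem mulOp_mul_star (m : X → Circle) (hm : Continuous m) :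
    mulOp μ m hm * star (mulOp μ m hm) = 1 := by
  rw [star_mulOp, mulOp_mul]; exact mulOp_one μ _ fun x => mul_inv_cancel _

theorem norm_mulOp_apply (m : X → Circle) (hm : Continuous m) (f : Lp ℂ 2 μ) :
    ‖mulOp μ m hm f‖ = ‖f‖ := by
  refine le_antisymm ?_ ?_
  · exact ((mulOp μ m hm).le_opNorm f).trans
      (by nlinarith [norm_mulOp_le μ m hm, norm_nonneg f])
  · have h : star (mulOp μ m hm) (mulOp μ m hm f) = f := by
      change (star (mulOp μ m hm) * mulOp μ m hm) f = f
      rw [mulOp_star_mul]; rfl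
    have h1 : ‖star (mulOp μ m hm)‖ ≤ 1 := by rw [norm_star_clm]; exact norm_mulOp_le μ m hm
    calc ‖f‖ = ‖star (mulOp μ m hm) (mulOp μ m hm f)‖ := by rw [h]
      _ ≤ ‖star (mulOp μ m hm)‖ * ‖mulOp μ m hm f‖ := ContinuousLinearMap.le_opNorm _ _
      _ ≤ ‖mulOp μ m hm f‖ := by nlinarith [norm_nonneg (mulOp μ m hm f)]

variable [IsFiniteMeasureOnCompacts μ]

theorem mulOp_toL2 (m : X → Circle) (hm : Continuous m) (f : Cc X ℂ) :
    mulOp μ m hm (toL2 μ f) = toL2 μ (Cc.circleMul m hm f) := by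
  refine Lp.ext ?_
  filter_upwards [coeFn_mulOp μ m hm (toL2 μ f), coeFn_toL2 μ f,
    coeFn_toL2 μ (Cc.circleMul m hm f)] with x h1 h2 h3
  rw [h1, h2, h3]; rfl

theorem continuous_mulOp [NormalSpace X] [LocallyCompactSpace X] [R1Space X] [μ.Regular]
    {P : Type*} [TopologicalSpace P] {m : P → X → Circle}
    (hm : Continuous fun q : P × X => m q.1 q.2) (v : Lp ℂ 2 μ) :
    Continuous fun p => mulOp μ (m p) (hm.comp (Continuous.prodMk_right p)) v := by
  refine continuous_of_dense (fun p => norm_mulOp_le μ _ _) (denseRange_toL2 μ) ?_ v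
  rintro _ ⟨f, rfl⟩
  simp only [mulOp_toL2]
  obtain ⟨K, hK, h⟩ := Cc.exists_isCompact f
  refine continuous_toL2 μ ((continuous_circle_coe.comp hm).mul (f.2.1.comp continuous_snd))
    fun p => ⟨K, hK, Eventually.of_forall fun p x hx => ?_⟩
  change _ * (f : X → ℂ) x = 0
  rw [h x hx, mul_zero]

variable {Γ : Type u} [Group Γ] [TopologicalSpace Γ] [IsTopologicalGroup Γ] [MeasurableSpace Γ]
  [BorelSpace Γ] (ν : Measure Γ) [ν.IsMulLeftInvariant]

theorem coeFn_leftReg (r : Γ) (f : Lp ℂ 2 ν) : leftReg ν r f =ᵐ[ν] fun s => f (r⁻¹ * s) :=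
  Lp.coeFn_compMeasurePreserving f (measurePreserving_mul_left ν r⁻¹)

theorem leftReg_mul (r s : Γ) : leftReg ν r * leftReg ν s = leftReg ν (r * s) := by
  ext1 f
  refine Lp.ext ?_
  have h : ∀ᵐ x ∂ν, leftReg ν s f (r⁻¹ * x) = f (s⁻¹ * (r⁻¹ * x)) :=
    (measurePreserving_mul_left ν r⁻¹).quasiMeasurePreserving.ae (coeFn_leftReg ν s f)
  filter_upwards [coeFn_leftReg ν r (leftReg ν s f), h, coeFn_leftReg ν (r * s) f]
    with x h1 h2 h3
  change leftReg ν r (leftReg ν s f) x = _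
  rw [h1, h2, h3, mul_inv_rev, mul_assoc]

theorem leftReg_one : leftReg ν (1 : Γ) = 1 := by
  ext1 f
  refine Lp.ext ?_
  filter_upwards [coeFn_leftReg ν 1 f] with x h1
  rw [h1, inv_one, one_mul]; rfl

theorem norm_leftReg_apply (r : Γ) (f : Lp ℂ 2 ν) : ‖leftReg ν r f‖ = ‖f‖ :=
  LinearIsometry.norm_map _ f

theorem norm_leftReg_le (r : Γ) : ‖leftReg ν r‖ ≤ 1 :=
  ContinuousLinearMap.opNorm_le_bound _ zero_le_one fun f => by rw [norm_leftReg_apply, one_mul]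

theorem star_leftReg (r : Γ) : star (leftReg ν r) = leftReg ν r⁻¹ := by
  rw [ContinuousLinearMap.star_eq_adjoint]
  refine Eq.symm ((ContinuousLinearMap.eq_adjoint_iff _ _).2 fun f g => ?_)
  have h1 : ∀ f g : Lp ℂ 2 ν, inner ℂ (leftReg ν r f) (leftReg ν r g) = inner ℂ f g :=
    fun f g => LinearIsometry.inner_map_map _ f g
  rw [← h1]
  change inner ℂ ((leftReg ν r * leftReg ν r⁻¹) f) _ = _
  rw [leftReg_mul, mul_inv_cancel, leftReg_one]; rfl

theorem leftReg_star_mul (r : Γ) : star (leftReg ν r) * leftReg ν r = 1 := by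
  rw [star_leftReg, leftReg_mul, inv_mul_cancel, leftReg_one]

theorem leftReg_mul_star (r : Γ) : leftReg ν r * star (leftReg ν r) = 1 := by
  rw [star_leftReg, leftReg_mul, mul_inv_cancel, leftReg_one]

theorem leftReg_mulOp (r : Γ) (m : Γ → Circle) (hm : Continuous m) :
    leftReg ν r * mulOp ν m hm = mulOp ν (fun s => m (r⁻¹ * s))
      (hm.comp (continuous_const_mul _)) * leftReg ν r := by
  ext1 f
  refine Lp.ext ?_
  have h : ∀ᵐ x ∂ν, mulOp ν m hm f (r⁻¹ * x) = m (r⁻¹ * x) * f (r⁻¹ * x) :=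
    (measurePreserving_mul_left ν r⁻¹).quasiMeasurePreserving.ae (coeFn_mulOp ν m hm f)
  filter_upwards [coeFn_leftReg ν r (mulOp ν m hm f), h, coeFn_leftReg ν r f,
    coeFn_mulOp ν (fun s => m (r⁻¹ * s)) (hm.comp (continuous_const_mul r⁻¹)) (leftReg ν r f)] with x h1 h2 h3 h4
  exact h1.trans (h2.trans ((congrArg _ h3.symm).trans h4.symm))

theorem leftReg_toL2 [IsFiniteMeasureOnCompacts ν] (r : Γ) (f : Cc Γ ℂ) :
    leftReg ν r (toL2 ν f) = toL2 ν (Cc.translate r f) := by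
  refine Lp.ext ?_
  have h : ∀ᵐ x ∂ν, toL2 ν f (r⁻¹ * x) = (f : Γ → ℂ) (r⁻¹ * x) :=
    (measurePreserving_mul_left ν r⁻¹).quasiMeasurePreserving.ae (coeFn_toL2 ν f)
  filter_upwards [coeFn_leftReg ν r (toL2 ν f), h, coeFn_toL2 ν (Cc.translate r f)]
    with x h1 h2 h3
  rw [h1, h2, h3]; rfl

end Operators

/-! ### Identities for tricharacters -/

section Tricharacter

variable {G : Type u} [Group G] [TopologicalSpace G] (φ : Tricharacter G)

theorem Tricharacter.one₁ (y z : G) : φ 1 y z = 1 := by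
  have := φ.map_mul₁ 1 1 y z
  rw [mul_one] at this
  exact left_eq_mul.1 this

theorem Tricharacter.inv₁ (x y z : G) : φ x⁻¹ y z = (φ x y z)⁻¹ := by
  rw [eq_inv_iff_mul_eq_one, ← φ.map_mul₁, inv_mul_cancel, φ.one₁]

theorem Tricharacter.one₂ (y z : G) : φ y 1 z = 1 := by rw [φ.swap₁₂, φ.one₁, inv_one]

theorem Tricharacter.inv₂ (x y z : G) : φ x y⁻¹ z = (φ x y z)⁻¹ := by
  rw [φ.swap₁₂, φ.inv₁, φ.swap₁₂ x y, inv_inv]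

theorem Tricharacter.one₃ (y z : G) : φ y z 1 = 1 := by rw [φ.swap₂₃, φ.one₂, inv_one]

theorem Tricharacter.inv₃ (x y z : G) : φ x y z⁻¹ = (φ x y z)⁻¹ := by
  rw [φ.swap₂₃, φ.inv₂, φ.swap₂₃ x y, inv_inv]

theorem Tricharacter.alt₁₃ (x y : G) : φ x y x = 1 := by
  rw [φ.swap₂₃, φ.alternating, inv_one]

theorem Tricharacter.alt₂₃ (x y : G) : φ x y y = 1 := by
  rw [φ.swap₁₂, φ.alt₁₃, inv_one]

theorem Tricharacter.cycle (x y z : G) : φ y z x = φ x y z := by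
  rw [φ.swap₂₃, φ.swap₁₂, inv_inv]

end Tricharacter

theorem LocallyCompactlySupported.of_image {P Y Z E : Type*} [TopologicalSpace P]
    [TopologicalSpace Y] [TopologicalSpace Z] [WeaklyLocallyCompactSpace P] [NormedAddCommGroup E]
    {f : P → Y → E} {K : Set Z} (hK : IsCompact K) {h : P × Z → Y} (hh : Continuous h)
    (hf : ∀ p y, f p y ≠ 0 → ∃ z ∈ K, h (p, z) = y) : LocallyCompactlySupported f := by
  intro p₀
  obtain ⟨V, hV, hp₀⟩ := exists_compact_mem_nhds p₀
  refine ⟨h '' (V ×ˢ K), (hV.prod hK).image hh, ?_⟩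
  filter_upwards [hp₀] with p hp y hy
  by_contra hne
  obtain ⟨z, hz, rfl⟩ := hf p y hne
  exact hy ⟨_, ⟨hp, hz⟩, rfl⟩

/-! ### Fubini for continuous compactly supported functions -/

section Fubini

variable {X Y Z E : Type*} [TopologicalSpace X] [TopologicalSpace Y] [TopologicalSpace Z]
  [T2Space X] [T2Space Y] [T2Space Z] [NormedAddCommGroup E] [NormedSpace ℂ E]
  [MeasurableSpace X] [BorelSpace X] [MeasurableSpace Y] [BorelSpace Y] [MeasurableSpace Z]
  [BorelSpace Z]
  (μ : Measure X) [IsFiniteMeasureOnCompacts μ] (ν : Measure Y) [IsFiniteMeasureOnCompacts ν]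
  (ρ : Measure Z) [IsFiniteMeasureOnCompacts ρ]

theorem Cc.integrable (f : Cc X E) : Integrable (f : X → E) μ :=
  f.2.1.integrable_of_hasCompactSupport f.2.2

/-- The integral over the second variable. -/
def Cc.integralSnd (f : Cc (X × Y) E) : Cc X E :=
  ⟨fun x => ∫ y, (f : X × Y → E) (x, y) ∂ν, by
    obtain ⟨K, hK, h⟩ := Cc.exists_isCompact f
    refine mem_Cc_of_isCompact (continuous_integral_of_locallyCompactlySupported ν f.2.1
      fun x => ⟨_, hK.image continuous_snd, Eventually.of_forall fun x y hy =>
        h _ fun hxy => hy ⟨_, hxy, rfl⟩⟩) (hK.image continuous_fst) fun x hx => ?_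
    refine integral_eq_zero_of_ae (ae_of_all _ fun y => ?_)
    exact h _ fun hxy => hx ⟨_, hxy, rfl⟩⟩

theorem Cc.integral_swap (f : Cc (X × Y) E) :
    ∫ x, ∫ y, (f : X × Y → E) (x, y) ∂ν ∂μ = ∫ y, ∫ x, (f : X × Y → E) (x, y) ∂μ ∂ν :=
  integral_integral_swap_of_hasCompactSupport (f := fun x y => (f : X × Y → E) (x, y)) f.2.1 f.2.2

theorem Cc.integral_swap₁₂ (f : Cc ((X × Y) × Z) E) :
    ∫ x, ∫ y, ∫ z, (f : (X × Y) × Z → E) ((x, y), z) ∂ρ ∂ν ∂μ =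
      ∫ y, ∫ x, ∫ z, (f : (X × Y) × Z → E) ((x, y), z) ∂ρ ∂μ ∂ν :=
  Cc.integral_swap μ ν (Cc.integralSnd ρ f)

theorem Cc.integral_swap₂₃ (f : Cc (X × Y × Z) E) :
    ∫ x, ∫ y, ∫ z, (f : X × Y × Z → E) (x, y, z) ∂ρ ∂ν ∂μ =
      ∫ x, ∫ z, ∫ y, (f : X × Y × Z → E) (x, y, z) ∂ν ∂ρ ∂μ := by
  congr 1; funext x
  exact Cc.integral_swap ν ρ (Cc.slice f x)

theorem Cc.integral_prod [SFinite ν] [SFinite μ] [OpensMeasurableSpace (X × Y)]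
    [IsFiniteMeasureOnCompacts (μ.prod ν)] (f : Cc (X × Y) E) :
    ∫ p, (f : X × Y → E) p ∂(μ.prod ν) = ∫ x, ∫ y, (f : X × Y → E) (x, y) ∂ν ∂μ :=
  MeasureTheory.integral_prod _ (f.2.1.integrable_of_hasCompactSupport f.2.2)

end Fubini

/-! ### Twisted kernels -/

section HilbertSchmidt

variable {G : Type u} [Group G] [TopologicalSpace G] [IsTopologicalGroup G]
  [MeasurableSpace G] [BorelSpace G] [SecondCountableTopology G] [LocallyCompactSpace G] [T2Space G]
  (φ : Tricharacter G) (μG : Measure G) [μG.IsHaarMeasure]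

theorem coeFn_hsMul (K₁ K₂ : HS μG) :
    hsMul φ μG K₁ K₂ =ᵐ[μG.prod μG] hsKernel φ μG K₁ K₂ :=
  (hsKernel_memLp φ μG K₁ K₂).coeFn_toLp

theorem ae_slice_left {p : G × G → Prop} (h : ∀ᵐ q ∂(μG.prod μG), p q) :
    ∀ᵐ q : G × G ∂(μG.prod μG), ∀ᵐ y ∂μG, p (q.1, y) :=
  Measure.quasiMeasurePreserving_fst.ae (Measure.ae_ae_of_ae_prod h)

theorem ae_slice_right {p : G × G → Prop} (h : ∀ᵐ q ∂(μG.prod μG), p q) :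
    ∀ᵐ q : G × G ∂(μG.prod μG), ∀ᵐ y ∂μG, p (y, q.2) :=
  Measure.quasiMeasurePreserving_snd.ae (p := fun z => ∀ᵐ y ∂μG, p (y, z))
    (Measure.ae_ae_of_ae_prod
      (Measure.measurePreserving_swap.quasiMeasurePreserving.ae (p := fun q => p q) h))

theorem hsKernel_congr {K₁ K₂ k₁ k₂ : G × G → ℂ} (h₁ : K₁ =ᵐ[μG.prod μG] k₁)
    (h₂ : K₂ =ᵐ[μG.prod μG] k₂) :
    hsKernel φ μG K₁ K₂ =ᵐ[μG.prod μG] hsKernel φ μG k₁ k₂ := by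
  filter_upwards [ae_slice_left μG h₁, ae_slice_right μG h₂] with q hq₁ hq₂
  refine integral_congr_ae ?_
  filter_upwards [hq₁, hq₂] with y hy₁ hy₂
  rw [hy₁, hy₂]

theorem hsMul_add_left (K K' : HS μG) : hsMul φ μG (K + K') = hsMul φ μG K + hsMul φ μG K' := by
  ext1 f
  refine Lp.ext ?_
  filter_upwards [coeFn_hsMul φ μG (K + K') f, coeFn_hsMul φ μG K f, coeFn_hsMul φ μG K' f,
    Lp.coeFn_add (hsMul φ μG K f) (hsMul φ μG K' f), hsKernel_integrable φ μG K f,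
    hsKernel_integrable φ μG K' f, ae_slice_left μG (Lp.coeFn_add K K')] with q h1 h2 h3 h4 h5 h6 h7
  rw [h1]
  refine Eq.trans ?_ h4.symm
  rw [Pi.add_apply, h2, h3]
  simp only [hsKernel]
  rw [← integral_add h5 h6]
  refine integral_congr_ae ?_
  filter_upwards [h7] with y hy
  rw [hy, Pi.add_apply]; ring

theorem hsMul_smul_left (c : ℂ) (K : HS μG) : hsMul φ μG (c • K) = c • hsMul φ μG K := by
  ext1 f
  refine Lp.ext ?_
  filter_upwards [coeFn_hsMul φ μG (c • K) f, coeFn_hsMul φ μG K f,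
    Lp.coeFn_smul c (hsMul φ μG K f), ae_slice_left μG (Lp.coeFn_smul c K)] with q h1 h2 h4 h7
  rw [h1]
  refine Eq.trans ?_ h4.symm
  rw [Pi.smul_apply, h2]
  simp only [hsKernel, smul_eq_mul]
  rw [← integral_const_mul]
  refine integral_congr_ae ?_
  filter_upwards [h7] with y hy
  rw [hy, Pi.smul_apply, smul_eq_mul]; ring

theorem norm_hsMul_le (K : HS μG) : ‖hsMul φ μG K‖ ≤ ‖K‖ :=
  LinearMap.mkContinuous_norm_le _ (norm_nonneg _) (hsMulLin_norm_le φ μG K)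

/-- The twisted left multiplication `K ↦ L_K` as a bounded linear map. -/
def hsMulL : HS μG →L[ℂ] HS μG →L[ℂ] HS μG :=
  LinearMap.mkContinuous
    { toFun := hsMul φ μG
      map_add' := hsMul_add_left φ μG
      map_smul' := hsMul_smul_left φ μG } 1 fun K => by
    rw [one_mul]; exact norm_hsMul_le φ μG K

theorem hsMulL_apply (K : HS μG) : hsMulL φ μG K = hsMul φ μG K := rfl

theorem continuous_hsMul : Continuous (hsMul φ μG) := (hsMulL φ μG).continuous

/-- The twisted product of continuous compactly supported kernels. -/
def ccMul (κ₁ κ₂ : Cc (G × G) ℂ) : Cc (G × G) ℂ :=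
  ⟨hsKernel φ μG κ₁ κ₂, by
    obtain ⟨K₁, hK₁, h₁⟩ := Cc.exists_isCompact κ₁
    obtain ⟨K₂, hK₂, h₂⟩ := Cc.exists_isCompact κ₂
    refine mem_Cc_of_isCompact ?_
      ((hK₁.image continuous_fst).prod (hK₂.image continuous_snd)) fun q hq => ?_
    · refine continuous_integral_of_locallyCompactlySupported μG ?_ fun q =>
        ⟨_, hK₁.image continuous_snd, Eventually.of_forall fun q y hy => ?_⟩
      · exact ((continuous_circle_coe.comp (φ.continuous_comp (by fun_prop) (by fun_prop)
          (by fun_prop))).mul (κ₁.2.1.comp (by fun_prop))).mul (κ₂.2.1.comp (by fun_prop))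
      · rw [h₁ _ fun h => hy ⟨_, h, rfl⟩, mul_zero, zero_mul]
    · refine integral_eq_zero_of_ae (ae_of_all _ fun y => ?_)
      by_cases h : q.1 ∈ Prod.fst '' K₁
      · have : (κ₂ : G × G → ℂ) (y, q.2) = 0 := h₂ _ fun h' => hq ⟨h, ⟨_, h', rfl⟩⟩
        simp [this]
      · have : (κ₁ : G × G → ℂ) (q.1, y) = 0 := h₁ _ fun h' => h ⟨_, h', rfl⟩
        simp [this]⟩

theorem ccMul_apply (κ₁ κ₂ : Cc (G × G) ℂ) (x z : G) : (ccMul φ μG κ₁ κ₂ : G × G → ℂ) (x, z) =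
    ∫ y, (φ x y z : ℂ) * (κ₁ : G × G → ℂ) (x, y) * (κ₂ : G × G → ℂ) (y, z) ∂μG := rfl

theorem hsMul_toL2 (κ₁ κ₂ : Cc (G × G) ℂ) :
    hsMul φ μG (toL2 (μG.prod μG) κ₁) (toL2 (μG.prod μG) κ₂) =
      toL2 (μG.prod μG) (ccMul φ μG κ₁ κ₂) := by
  refine Lp.ext ?_
  exact ((coeFn_hsMul φ μG _ _).trans (hsKernel_congr φ μG (coeFn_toL2 _ κ₁)
    (coeFn_toL2 _ κ₂))).trans (coeFn_toL2 _ (ccMul φ μG κ₁ κ₂)).symm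

theorem HS_induction {p : HS μG → Prop} (hp : IsClosed {K | p K})
    (h : ∀ κ : Cc (G × G) ℂ, p (toL2 (μG.prod μG) κ)) (K : HS μG) : p K :=
  (denseRange_toL2 (μG.prod μG)).induction_on K hp h

/-- The involution of continuous compactly supported kernels. -/
def ccStar (κ : Cc (G × G) ℂ) : Cc (G × G) ℂ :=
  ⟨fun q => star ((κ : G × G → ℂ) q.swap), by
    obtain ⟨K, hK, h⟩ := Cc.exists_isCompact κ
    have := κ.2.1
    refine mem_Cc_of_isCompact (by fun_prop) (hK.image continuous_swap) fun q hq => ?_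
    rw [h _ fun hq' => hq ⟨_, hq', Prod.swap_swap q⟩, star_zero]⟩

theorem coeFn_hsStar (K : HS μG) : hsStar μG K =ᵐ[μG.prod μG] fun q => star (K q.swap) := by
  have h1 := Lp.coeFn_star (Lp.compMeasurePreserving Prod.swap
    (Measure.measurePreserving_swap (μ := μG) (ν := μG)) K)
  have h2 := Lp.coeFn_compMeasurePreserving K
    (Measure.measurePreserving_swap (μ := μG) (ν := μG))
  filter_upwards [h1, h2] with q h1 h2
  refine h1.trans ?_
  rw [Pi.star_apply, h2]; rfl

theorem hsStar_toL2 (κ : Cc (G × G) ℂ) :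
    hsStar μG (toL2 (μG.prod μG) κ) = toL2 (μG.prod μG) (ccStar κ) := by
  refine Lp.ext ?_
  filter_upwards [coeFn_hsStar μG (toL2 (μG.prod μG) κ),
    (Measure.measurePreserving_swap (μ := μG) (ν := μG)).quasiMeasurePreserving.ae
      (coeFn_toL2 (μG.prod μG) κ), coeFn_toL2 (μG.prod μG) (ccStar κ)] with q h1 h2 h3
  rw [h1, h2, h3]; rfl

theorem norm_hsStar_sub (K K' : HS μG) : ‖hsStar μG K - hsStar μG K'‖ = ‖K - K'‖ := by
  have h1 : ‖hsStar μG K - hsStar μG K'‖ = ‖Lp.compMeasurePreserving Prod.swap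
      (Measure.measurePreserving_swap (μ := μG) (ν := μG)) (K - K')‖ := by
    have h : ∀ᵐ q ∂(μG.prod μG), ‖(hsStar μG K - hsStar μG K') q‖ =
        ‖Lp.compMeasurePreserving Prod.swap
      (Measure.measurePreserving_swap (μ := μG) (ν := μG)) (K - K') q‖ := by
      filter_upwards [Lp.coeFn_sub (hsStar μG K) (hsStar μG K'), coeFn_hsStar μG K,
        coeFn_hsStar μG K', Lp.coeFn_compMeasurePreserving (K - K')
          (Measure.measurePreserving_swap (μ := μG) (ν := μG)),
        (Measure.measurePreserving_swap (μ := μG) (ν := μG)).quasiMeasurePreserving.ae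
          (Lp.coeFn_sub K K')] with q h1 h2 h3 h4 h5
      rw [h1, h4, Pi.sub_apply, h2, h3, Function.comp_apply, h5, Pi.sub_apply, ← star_sub,
        norm_star]
    exact le_antisymm (Lp.norm_le_norm_of_ae_le (h.mono fun q h => h.le))
      (Lp.norm_le_norm_of_ae_le (h.mono fun q h => h.ge))
  rw [h1, Lp.norm_compMeasurePreserving]

theorem continuous_hsStar : Continuous (hsStar μG) :=
  (LipschitzWith.of_dist_le_mul (K := 1) fun K K' => by
    rw [dist_eq_norm, dist_eq_norm, norm_hsStar_sub]; simp).continuous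

/-- The adjoint of the twisted left multiplication by `K` is that by `K^*`. Both sides are the same
triple integral up to the order of integration, since `φ(y, x, z)` is the conjugate of `φ(x, y, z)`. -/
theorem hsMul_hsStar (K : HS μG) : hsMul φ μG (hsStar μG K) = star (hsMul φ μG K) := by
  rw [ContinuousLinearMap.star_eq_adjoint, ContinuousLinearMap.eq_adjoint_iff]
  have c1 := continuous_hsStar μG
  have c2 := continuous_hsMul φ μG
  intro K₁ K₂
  refine HS_induction μG (p := fun K => inner ℂ (hsMul φ μG (hsStar μG K) K₁) K₂ =
    inner ℂ K₁ (hsMul φ μG K K₂)) (isClosed_eq (by fun_prop) (by fun_prop)) (fun κ => ?_) K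
  refine HS_induction μG (p := fun K₁ => inner ℂ (hsMul φ μG (hsStar μG _) K₁) K₂ =
    inner ℂ K₁ (hsMul φ μG _ K₂)) (isClosed_eq (by fun_prop) (by fun_prop)) (fun κ₁ => ?_) K₁
  refine HS_induction μG (p := fun K₂ => inner ℂ (hsMul φ μG (hsStar μG _) _) K₂ =
    inner ℂ (toL2 _ κ₁) (hsMul φ μG _ K₂)) (isClosed_eq (by fun_prop) (by fun_prop))
    (fun κ₂ => ?_) K₂
  rw [hsStar_toL2, hsMul_toL2, hsMul_toL2, inner_toL2, inner_toL2]
  -- both sides are the integral of this function of three variables, with `x` and `y` exchanged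
  let f : Cc (G × G × G) ℂ := ⟨fun q => (φ q.2.2 q.1 q.2.1 : ℂ) *
      (κ : G × G → ℂ) (q.2.2, q.1) * star ((κ₁ : G × G → ℂ) (q.2.2, q.2.1)) *
      (κ₂ : G × G → ℂ) (q.1, q.2.1), by
    obtain ⟨K₁, hK₁, h₁⟩ := Cc.exists_isCompact κ
    obtain ⟨K₂, hK₂, h₂⟩ := Cc.exists_isCompact κ₂
    have c1 := κ₁.2.1
    have c2 := κ₂.2.1
    have c3 := κ.2.1
    have c4 : Continuous fun q : G × G × G => (φ q.2.2 q.1 q.2.1 : ℂ) :=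
      continuous_circle_coe.comp (φ.continuous_comp (by fun_prop) (by fun_prop) (by fun_prop))
    refine mem_Cc_of_isCompact (by fun_prop) ((hK₁.image continuous_snd).prod
      ((hK₂.image continuous_snd).prod (hK₁.image continuous_fst))) fun q hq => ?_
    by_cases h : (q.2.2, q.1) ∈ K₁
    · have : (κ₂ : G × G → ℂ) (q.1, q.2.1) = 0 :=
        h₂ _ fun h' => hq ⟨⟨_, h, rfl⟩, ⟨_, h', rfl⟩, ⟨_, h, rfl⟩⟩
      simp [this]
    · have : (κ : G × G → ℂ) (q.2.2, q.1) = 0 := h₁ _ h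
      simp [this]⟩
  have e1 : ∫ p, inner ℂ ((ccMul φ μG (ccStar κ) κ₁ : G × G → ℂ) p) ((κ₂ : G × G → ℂ) p)
      ∂(μG.prod μG) = ∫ x, ∫ z, ∫ y, (f : G × G × G → ℂ) (x, z, y) ∂μG ∂μG ∂μG := by
    refine (Cc.integral_prod μG μG ⟨fun p => inner ℂ ((ccMul φ μG (ccStar κ) κ₁ : G × G → ℂ) p)
      ((κ₂ : G × G → ℂ) p), (ccMul φ μG (ccStar κ) κ₁).2.1.inner κ₂.2.1, ?_⟩).trans ?_
    · obtain ⟨K₂, hK₂, h₂⟩ := Cc.exists_isCompact κ₂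
      exact HasCompactSupport.intro hK₂ fun x hx => by rw [h₂ x hx, inner_zero_right]
    · refine integral_congr_ae (ae_of_all _ fun x => integral_congr_ae (ae_of_all _ fun z => ?_))
      simp only [RCLike.inner_apply, ccMul_apply, f]
      rw [← integral_conj, ← integral_const_mul]
      refine integral_congr_ae (ae_of_all _ fun y => ?_)
      simp only [ccStar, map_mul, Prod.swap_prod_mk, RCLike.star_def, Complex.conj_conj]
      rw [φ.swap₁₂ y x z, Circle.coe_inv_eq_conj, Complex.conj_conj]
      ring
  have e2 : ∫ p, inner ℂ ((κ₁ : G × G → ℂ) p) ((ccMul φ μG κ κ₂ : G × G → ℂ) p)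
      ∂(μG.prod μG) = ∫ y, ∫ z, ∫ x, (f : G × G × G → ℂ) (x, z, y) ∂μG ∂μG ∂μG := by
    refine (Cc.integral_prod μG μG ⟨fun p => inner ℂ ((κ₁ : G × G → ℂ) p)
      ((ccMul φ μG κ κ₂ : G × G → ℂ) p), κ₁.2.1.inner (ccMul φ μG κ κ₂).2.1, ?_⟩).trans ?_
    · obtain ⟨K₂, hK₂, h₂⟩ := Cc.exists_isCompact κ₁
      exact HasCompactSupport.intro hK₂ fun x hx => by rw [h₂ x hx, inner_zero_left]
    · refine integral_congr_ae (ae_of_all _ fun x => integral_congr_ae (ae_of_all _ fun z => ?_))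
      simp only [RCLike.inner_apply, ccMul_apply, f]
      rw [← integral_mul_const]
      refine integral_congr_ae (ae_of_all _ fun y => ?_)
      simp only [RCLike.star_def]
      ring
  rw [e1, e2]
  let g : Cc ((G × G) × G) ℂ := ⟨_, f.2.1.comp (Homeomorph.prodAssoc G G G).continuous,
    f.2.2.comp_homeomorph (Homeomorph.prodAssoc G G G)⟩
  calc ∫ x, ∫ z, ∫ y, (f : G × G × G → ℂ) (x, z, y) ∂μG ∂μG ∂μG
      = ∫ z, ∫ x, ∫ y, (f : G × G × G → ℂ) (x, z, y) ∂μG ∂μG ∂μG :=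
        Cc.integral_swap₁₂ μG μG μG g
    _ = ∫ z, ∫ y, ∫ x, (f : G × G × G → ℂ) (x, z, y) ∂μG ∂μG ∂μG := by
        let e : G × G × G ≃ₜ G × G × G :=
          (Homeomorph.prodAssoc G G G).symm.trans
            (((Homeomorph.prodComm G G).prodCongr (Homeomorph.refl G)).trans
              (Homeomorph.prodAssoc G G G))
        exact Cc.integral_swap₂₃ μG μG μG (⟨_, f.2.1.comp e.continuous,
          f.2.2.comp_homeomorph e⟩ : Cc (G × G × G) ℂ)
    _ = ∫ y, ∫ z, ∫ x, (f : G × G × G → ℂ) (x, z, y) ∂μG ∂μG ∂μG := by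
        let e : (G × G) × G ≃ₜ G × G × G :=
          (((Homeomorph.prodComm G G).prodCongr (Homeomorph.refl G))).trans
            ((Homeomorph.prodComm (G × G) G).trans
            ((Homeomorph.refl G).prodCongr (Homeomorph.prodComm G G)))
        exact Cc.integral_swap₁₂ μG μG μG (⟨_, f.2.1.comp e.continuous,
          f.2.2.comp_homeomorph e⟩ : Cc ((G × G) × G) ℂ)

/-! ### The action `γ` on twisted kernels -/

theorem coeFn_gamma (s : G) (K : HS μG) : gamma φ μG s K =ᵐ[μG.prod μG]
    fun q => (((φ s q.1 q.2)⁻¹ : Circle) : ℂ) * K (s⁻¹ * q.1, s⁻¹ * q.2) := by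
  have h1 := Lp.coeFn_compMeasurePreserving K ((measurePreserving_mul_left μG s⁻¹).prod
        (measurePreserving_mul_left μG s⁻¹))
  have h2 := coeFn_mulOp (μG.prod μG) (fun p => (φ s p.1 p.2)⁻¹)
      (φ.continuous_comp continuous_const continuous_fst continuous_snd).inv
      (Lp.compMeasurePreserving _ ((measurePreserving_mul_left μG s⁻¹).prod
        (measurePreserving_mul_left μG s⁻¹)) K)
  filter_upwards [h1, h2] with q h1 h2
  refine h2.trans ?_
  rw [h1]; rfl

/-- `γ_s` on continuous compactly supported kernels. -/
def ccGamma (s : G) (κ : Cc (G × G) ℂ) : Cc (G × G) ℂ :=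
  ⟨fun q => (((φ s q.1 q.2)⁻¹ : Circle) : ℂ) * (κ : G × G → ℂ) (s⁻¹ * q.1, s⁻¹ * q.2), by
    have c := κ.2.1
    have c4 : Continuous fun q : G × G => (((φ s q.1 q.2)⁻¹ : Circle) : ℂ) :=
      continuous_circle_coe.comp
        (φ.continuous_comp (by fun_prop) (by fun_prop) (by fun_prop)).inv
    refine ⟨by fun_prop, HasCompactSupport.mul_left ?_⟩
    exact κ.2.2.comp_homeomorph ((Homeomorph.mulLeft s⁻¹).prodCongr (Homeomorph.mulLeft s⁻¹))⟩

theorem gamma_toL2 (s : G) (κ : Cc (G × G) ℂ) :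
    gamma φ μG s (toL2 (μG.prod μG) κ) = toL2 (μG.prod μG) (ccGamma φ s κ) := by
  refine Lp.ext ?_
  filter_upwards [coeFn_gamma φ μG s (toL2 (μG.prod μG) κ),
    ((measurePreserving_mul_left μG s⁻¹).prod
      (measurePreserving_mul_left μG s⁻¹)).quasiMeasurePreserving.ae
      (coeFn_toL2 (μG.prod μG) κ), coeFn_toL2 (μG.prod μG) (ccGamma φ s κ)] with q h1 h2 h3
  rw [h1, h3]
  exact congrArg _ h2

theorem norm_gamma_apply (s : G) (K : HS μG) : ‖gamma φ μG s K‖ = ‖K‖ :=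
  (norm_mulOp_apply (μG.prod μG) (fun p => (φ s p.1 p.2)⁻¹)
    (φ.continuous_comp continuous_const continuous_fst continuous_snd).inv
    (Lp.compMeasurePreserving _ ((measurePreserving_mul_left μG s⁻¹).prod
        (measurePreserving_mul_left μG s⁻¹)) K)).trans
    (Lp.norm_compMeasurePreserving K ((measurePreserving_mul_left μG s⁻¹).prod
        (measurePreserving_mul_left μG s⁻¹)))

theorem norm_gamma_le (s : G) : ‖gamma φ μG s‖ ≤ 1 :=
  ContinuousLinearMap.opNorm_le_bound _ zero_le_one fun f => by rw [norm_gamma_apply, one_mul]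

/-- The action `γ` of `G` is an action up to the inner automorphisms given by `u`. -/
theorem gamma_gamma (s t : G) (K : HS μG) : gamma φ μG s (gamma φ μG t K) =
    uLeft φ μG s t (star (uRight φ μG s t) (gamma φ μG (s * t) K)) := by
  refine HS_induction μG (p := fun K => gamma φ μG s (gamma φ μG t K) =
    uLeft φ μG s t (star (uRight φ μG s t) (gamma φ μG (s * t) K)))
    (isClosed_eq (by fun_prop) (by fun_prop)) (fun κ => ?_) K
  rw [uLeft, uRight, star_mulOp, gamma_toL2, gamma_toL2, gamma_toL2, mulOp_toL2, mulOp_toL2]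
  refine toL2_congr _ fun q => ?_
  have h : (φ s q.1 q.2)⁻¹ * (φ t (s⁻¹ * q.1) (s⁻¹ * q.2))⁻¹ =
      φ q.1 s t * (φ q.2 s t)⁻¹ * (φ (s * t) q.1 q.2)⁻¹ := by
    simp only [φ.map_mul₁, φ.map_mul₂, φ.map_mul₃, φ.inv₂, φ.inv₃, φ.alt₂₃]
    rw [← φ.cycle q.1 s t, ← φ.cycle q.2 s t, φ.swap₁₂ s t q.2, φ.cycle s t q.1]
    apply Additive.ofMul.injective
    simp only [ofMul_mul, ofMul_inv, ofMul_one]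
    abel
  simp only [ccGamma, Cc.circleMul, ← mul_assoc, mul_inv_rev, ← Circle.coe_mul, h]

theorem gamma_one (K : HS μG) : gamma φ μG 1 K = K := by
  refine HS_induction μG (p := fun K => gamma φ μG 1 K = K)
    (isClosed_eq (by fun_prop) (by fun_prop)) (fun κ => ?_) K
  rw [gamma_toL2]
  refine toL2_congr _ fun q => ?_
  simp [ccGamma, φ.one₁]

theorem gamma_gamma_inv (s : G) (K : HS μG) : gamma φ μG s (gamma φ μG s⁻¹ K) = K := by
  rw [gamma_gamma, mul_inv_cancel, gamma_one, uLeft, uRight, star_mulOp]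
  have h : ∀ x : G, φ x s s⁻¹ = 1 := fun x => by rw [φ.inv₃, φ.alt₂₃, inv_one]
  rw [mulOp_one _ _ fun p => by simp only [h],
    mulOp_one _ _ fun p => by simp only [h, inv_one]]
  rfl

theorem gamma_inv_gamma (s : G) (K : HS μG) : gamma φ μG s⁻¹ (gamma φ μG s K) = K := by
  simpa using gamma_gamma_inv φ μG s⁻¹ K

theorem bijective_gamma (s : G) : Function.Bijective (gamma φ μG s) :=
  Function.bijective_iff_has_inverse.2 ⟨gamma φ μG s⁻¹, gamma_inv_gamma φ μG s,
    gamma_gamma_inv φ μG s⟩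

theorem inner_gamma (s : G) (K K' : HS μG) :
    inner ℂ (gamma φ μG s K) (gamma φ μG s K') = inner ℂ K K' :=
  LinearIsometry.inner_map_map (⟨gamma φ μG s, norm_gamma_apply φ μG s⟩ : HS μG →ₗᵢ[ℂ] HS μG) K K'

theorem star_gamma (s : G) : star (gamma φ μG s) = gamma φ μG s⁻¹ := by
  rw [ContinuousLinearMap.star_eq_adjoint, eq_comm, ContinuousLinearMap.eq_adjoint_iff]
  intro K K'
  rw [← inner_gamma φ μG s, gamma_gamma_inv]

theorem gamma_hsMul (s : G) (K₁ K₂ : HS μG) : gamma φ μG s (hsMul φ μG K₁ K₂) =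
    hsMul φ μG (gamma φ μG s K₁) (gamma φ μG s K₂) := by
  have c2 := continuous_hsMul φ μG
  refine HS_induction μG (p := fun K₁ => gamma φ μG s (hsMul φ μG K₁ K₂) =
    hsMul φ μG (gamma φ μG s K₁) (gamma φ μG s K₂))
    (isClosed_eq (by fun_prop) (by fun_prop)) (fun κ₁ => ?_) K₁
  refine HS_induction μG (p := fun K₂ => gamma φ μG s (hsMul φ μG (toL2 _ κ₁) K₂) =
    hsMul φ μG (gamma φ μG s (toL2 _ κ₁)) (gamma φ μG s K₂))
    (isClosed_eq (by fun_prop) (by fun_prop)) (fun κ₂ => ?_) K₂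
  rw [hsMul_toL2, gamma_toL2, gamma_toL2, gamma_toL2, hsMul_toL2]
  refine toL2_congr _ fun q => ?_
  obtain ⟨x, z⟩ := q
  -- the variables are replaced by their translates, the integration variable included
  obtain ⟨x, rfl⟩ : ∃ x', x = s * x' := ⟨s⁻¹ * x, by simp⟩
  obtain ⟨z, rfl⟩ : ∃ z', z = s * z' := ⟨s⁻¹ * z, by simp⟩
  rw [ccMul_apply]
  conv_rhs => rw [← integral_mul_left_eq_self _ s]
  simp only [ccGamma, ccMul_apply, inv_mul_cancel_left]
  rw [← integral_const_mul]
  refine integral_congr_ae (ae_of_all _ fun y => ?_)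
  -- the defect of invariance of `φ` under simultaneous translation is a coboundary
  have h : φ (s * x) (s * y) (s * z) * ((φ s (s * x) (s * y))⁻¹ * (φ s (s * y) (s * z))⁻¹) =
      (φ s (s * x) (s * z))⁻¹ * φ x y z := by
    simp only [φ.map_mul₁, φ.map_mul₂, φ.map_mul₃, φ.alternating, φ.alt₁₃, φ.alt₂₃]
    rw [φ.swap₁₂ s x z, ← φ.cycle x y s, ← φ.cycle y s x]
    apply Additive.ofMul.injective
    simp only [ofMul_mul, ofMul_inv, ofMul_one]
    abel
  have h' := congrArg (fun z : Circle => (z : ℂ)) h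
  simp only [Circle.coe_mul] at h'
  linear_combination (-(κ₁ : G × G → ℂ) (x, y) * (κ₂ : G × G → ℂ) (y, z)) * h'

theorem gamma_hsStar (s : G) (K : HS μG) :
    gamma φ μG s (hsStar μG K) = hsStar μG (gamma φ μG s K) := by
  have c1 := continuous_hsStar μG
  refine HS_induction μG (p := fun K => gamma φ μG s (hsStar μG K) = hsStar μG (gamma φ μG s K))
    (isClosed_eq (by fun_prop) (by fun_prop)) (fun κ => ?_) K
  rw [hsStar_toL2, gamma_toL2, gamma_toL2, hsStar_toL2]
  refine toL2_congr _ fun q => ?_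
  simp only [ccGamma, ccStar, Prod.fst_swap, Prod.snd_swap, star_mul', Prod.swap_prod_mk]
  rw [φ.swap₂₃ s q.1 q.2, inv_inv, Circle.coe_inv_eq_conj]
  rfl

theorem continuous_gamma (K : HS μG) : Continuous fun s => gamma φ μG s K := by
  refine continuous_of_dense (U := fun s => gamma φ μG s) (norm_gamma_le φ μG)
    (denseRange_toL2 (μG.prod μG)) (fun v hv => ?_) K
  obtain ⟨κ, rfl⟩ := hv
  simp only [gamma_toL2]
  obtain ⟨L, hL, h⟩ := Cc.exists_isCompact κ
  have c := κ.2.1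
  refine continuous_toL2 (f := fun s => ccGamma φ s κ) _ (Continuous.mul (continuous_circle_coe.comp
    (φ.continuous_comp (by fun_prop) (by fun_prop) (by fun_prop)).inv)
    (c.comp (by fun_prop))) (.of_image hL
    (h := fun p : G × G × G => (p.1 * p.2.1, p.1 * p.2.2)) (by fun_prop) fun s q hq => ?_)
  refine ⟨(s⁻¹ * q.1, s⁻¹ * q.2), ?_, by simp⟩
  by_contra hne
  exact hq (by simp [ccGamma, h _ hne])

/-! ### Twisted compact operators -/

theorem hsMul_mem_twistedCompacts (K : HS μG) : hsMul φ μG K ∈ twistedCompacts φ μG :=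
  Submodule.le_topologicalClosure _ (Submodule.subset_span ⟨K, rfl⟩)

theorem twistedCompacts_eq : twistedCompacts φ μG =
    (LinearMap.range (hsMulL φ μG).toLinearMap).topologicalClosure := by
  rw [twistedCompacts]
  congr 1
  refine le_antisymm (Submodule.span_le.2 ?_) ?_
  · rintro _ ⟨K, rfl⟩; exact ⟨K, rfl⟩
  · rintro _ ⟨K, rfl⟩; exact Submodule.subset_span ⟨K, rfl⟩

theorem mem_closure_range_hsMul {A : HS μG →L[ℂ] HS μG} (hA : A ∈ twistedCompacts φ μG) :
    A ∈ closure (Set.range (hsMul φ μG)) := by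
  rw [twistedCompacts_eq] at hA
  exact hA

theorem twistedCompacts_induction {p : (HS μG →L[ℂ] HS μG) → Prop} (hp : IsClosed {A | p A})
    (h : ∀ K, p (hsMul φ μG K)) {A : HS μG →L[ℂ] HS μG} (hA : A ∈ twistedCompacts φ μG) : p A :=
  closure_minimal (Set.range_subset_iff.2 h) hp (mem_closure_range_hsMul φ μG hA)

theorem isClosed_twistedCompacts :
    IsClosed (twistedCompacts φ μG : Set (HS μG →L[ℂ] HS μG)) :=
  Submodule.isClosed_topologicalClosure _

theorem star_mem_twistedCompacts {A : HS μG →L[ℂ] HS μG} (hA : A ∈ twistedCompacts φ μG) :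
    star A ∈ twistedCompacts φ μG := by
  refine twistedCompacts_induction φ μG (p := fun A => star A ∈ twistedCompacts φ μG)
    ((isClosed_twistedCompacts φ μG).preimage continuous_star) (fun K => ?_) hA
  rw [← hsMul_hsStar]
  exact hsMul_mem_twistedCompacts φ μG _

theorem gamma_conj_hsMul (s : G) (K : HS μG) :
    gamma φ μG s * hsMul φ μG K * star (gamma φ μG s) = hsMul φ μG (gamma φ μG s K) := by
  ext1 K'
  rw [star_gamma]
  change gamma φ μG s (hsMul φ μG K (gamma φ μG s⁻¹ K')) = _
  rw [gamma_hsMul, gamma_gamma_inv]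

theorem gamma_conj_mem_twistedCompacts (s : G) {A : HS μG →L[ℂ] HS μG}
    (hA : A ∈ twistedCompacts φ μG) :
    gamma φ μG s * A * star (gamma φ μG s) ∈ twistedCompacts φ μG := by
  refine twistedCompacts_induction φ μG
    (p := fun A => gamma φ μG s * A * star (gamma φ μG s) ∈ twistedCompacts φ μG)
    ((isClosed_twistedCompacts φ μG).preimage (by fun_prop)) (fun K => ?_) hA
  rw [gamma_conj_hsMul]
  exact hsMul_mem_twistedCompacts φ μG _

theorem uRight_hsMul (s t : G) (K : HS μG) :
    uRight φ μG s t * hsMul φ μG K = hsMul φ μG K * uRight φ μG s t := by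
  ext1 K'
  have c2 := continuous_hsMul φ μG
  refine HS_induction μG (p := fun K => (uRight φ μG s t * hsMul φ μG K) K' =
    (hsMul φ μG K * uRight φ μG s t) K')
    (isClosed_eq (by simp only [mul_apply_eq_comp]; fun_prop)
      (by simp only [mul_apply_eq_comp]; fun_prop)) (fun κ => ?_) K
  refine HS_induction μG (p := fun K' => (uRight φ μG s t * hsMul φ μG (toL2 _ κ)) K' =
    (hsMul φ μG (toL2 _ κ) * uRight φ μG s t) K')
    (isClosed_eq (by fun_prop) (by fun_prop)) (fun κ' => ?_) K'
  simp only [mul_apply_eq_comp, uRight]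
  rw [hsMul_toL2, mulOp_toL2, mulOp_toL2, hsMul_toL2]
  refine toL2_congr _ fun q => ?_
  obtain ⟨x, z⟩ := q
  simp only [ccMul_apply, Cc.circleMul]
  rw [← integral_const_mul]
  refine integral_congr_ae (ae_of_all _ fun y => ?_)
  ring

/-- Right multiplications commute with left multiplications, although the product is not associative:
the function `φ(·, s, t)` of the last variable is not involved in the integration. -/
theorem uRight_comm (s t : G) {A : HS μG →L[ℂ] HS μG} (hA : A ∈ twistedCompacts φ μG) :
    uRight φ μG s t * A = A * uRight φ μG s t :=
  twistedCompacts_induction φ μG (p := fun A => uRight φ μG s t * A = A * uRight φ μG s t)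
    (isClosed_eq (by fun_prop) (by fun_prop)) (uRight_hsMul φ μG s t) hA

theorem uLeft_inv (t : G) : uLeft φ μG t t⁻¹ = 1 := by
  have h : ∀ x : G, φ x t t⁻¹ = 1 := fun x => by rw [φ.inv₃, φ.alt₂₃, inv_one]
  exact mulOp_one _ _ fun p => h p.1

theorem norm_gamma_conj_sub (s : G) (A B : HS μG →L[ℂ] HS μG) :
    ‖gamma φ μG s * A * star (gamma φ μG s) - gamma φ μG s * B * star (gamma φ μG s)‖ ≤
      ‖A - B‖ := by
  rw [← sub_mul, ← mul_sub]
  refine (norm_mul_le _ _).trans ?_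
  rw [star_gamma]
  calc _ ≤ ‖gamma φ μG s * (A - B)‖ * 1 := by gcongr; exact norm_gamma_le φ μG _
    _ ≤ ‖gamma φ μG s‖ * ‖A - B‖ := by rw [mul_one]; exact norm_mul_le _ _
    _ ≤ 1 * ‖A - B‖ := by gcongr; exact norm_gamma_le φ μG _
    _ = _ := one_mul _

theorem continuous_gamma_conj {A : HS μG →L[ℂ] HS μG} (hA : A ∈ twistedCompacts φ μG) :
    Continuous fun s => gamma φ μG s * A * star (gamma φ μG s) := by
  refine continuous_of_mem_closure (s := Set.range (hsMul φ μG))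
    (U := fun s A => gamma φ μG s * A * star (gamma φ μG s)) (norm_gamma_conj_sub φ μG) ?_
    (mem_closure_range_hsMul φ μG hA)
  rintro _ ⟨K, rfl⟩
  simp only [gamma_conj_hsMul]
  exact (continuous_hsMul φ μG).comp (continuous_gamma φ μG K)

end HilbertSchmidt

/-! ### Bounded operators on `L²` from integral operators on continuous functions -/

section Extension

theorem norm_eq_sInf_of_denseRange {V H : Type*} [AddCommGroup V] [Module ℂ V]
    [NormedAddCommGroup H] [NormedSpace ℂ H] {e : V →ₗ[ℂ] H} (he : DenseRange e) (A : H →L[ℂ] H) :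
    ‖A‖ = sInf {C : ℝ | 0 ≤ C ∧ ∀ f, ‖A (e f)‖ ≤ C * ‖e f‖} := by
  rw [ContinuousLinearMap.norm_def]
  congr 1
  ext C
  refine and_congr_right fun _ => ⟨fun h f => h _, fun h x => ?_⟩
  exact he.induction_on (p := fun x => ‖A x‖ ≤ C * ‖x‖) x
    (isClosed_le (by fun_prop) (by fun_prop)) h

theorem eq_star_of_denseRange {V H : Type*} [AddCommGroup V] [Module ℂ V]
    [NormedAddCommGroup H] [InnerProductSpace ℂ H] [CompleteSpace H] {e : V →ₗ[ℂ] H}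
    (he : DenseRange e) {A B : H →L[ℂ] H}
    (h : ∀ f g, inner ℂ (A (e f)) (e g) = inner ℂ (e f) (B (e g))) : A = star B := by
  rw [ContinuousLinearMap.star_eq_adjoint, ContinuousLinearMap.eq_adjoint_iff]
  intro x y
  refine he.induction_on₂ (p := fun x y => inner ℂ (A x) y = inner ℂ x (B y))
    (isClosed_eq (by fun_prop) (by fun_prop)) h x y

theorem clm_ext_of_denseRange {V H F : Type*} [AddCommGroup V] [Module ℂ V]
    [NormedAddCommGroup H] [NormedSpace ℂ H] [NormedAddCommGroup F] [NormedSpace ℂ F]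
    {e : V →ₗ[ℂ] H} (he : DenseRange e) {A B : H →L[ℂ] F} (h : ∀ f, A (e f) = B (e f)) : A = B :=
  ContinuousLinearMap.ext fun x => he.induction_on (p := fun x => A x = B x) x
    (isClosed_eq (by fun_prop) (by fun_prop)) h

variable {X Y : Type*} [TopologicalSpace X] [TopologicalSpace Y] [T2Space X] [T2Space Y]
  [MeasurableSpace X] [BorelSpace X] [MeasurableSpace Y] [BorelSpace Y]
  (μ : Measure X) [IsFiniteMeasureOnCompacts μ] (ν : Measure Y) [IsFiniteMeasureOnCompacts ν]

/-- Minkowski's integral inequality. -/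
theorem norm_toL2_integral_le {H : Type*} [NormedAddCommGroup H] [InnerProductSpace ℂ H]
    [CompleteSpace H] [LocallyCompactSpace Y]
    [NormalSpace Y] [ν.Regular] (f : Cc (X × Y) H) (g : Cc Y H)
    (hg : ∀ y, (g : Y → H) y = ∫ x, (f : X × Y → H) (x, y) ∂μ) {c : X → ℝ} (hc : Integrable c μ)
    (h : ∀ x, ‖toL2 ν (Cc.slice f x)‖ ≤ c x) : ‖toL2 ν g‖ ≤ ∫ x, c x ∂μ := by
  rw [← integral_toL2 μ ν f g hg]
  exact norm_integral_le_of_norm_le hc (ae_of_all _ h)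

theorem Cc.integrable_norm_sq {E : Type*} [NormedAddCommGroup E] [NormedSpace ℂ E] (f : Cc X E) :
    Integrable (fun x => ‖(f : X → E) x‖ ^ 2) μ := by
  have h1 : Continuous fun x => ‖(f : X → E) x‖ ^ 2 := f.2.1.norm.pow 2
  have h2 : HasCompactSupport fun x => ‖(f : X → E) x‖ ^ 2 :=
    HasCompactSupport.comp_left (g := fun v : E => ‖v‖ ^ 2) f.2.2 (by simp)
  exact h1.integrable_of_hasCompactSupport h2

/-- A continuous compactly supported function of two variables with the variables exchanged. -/
def Cc.swap {E : Type*} [NormedAddCommGroup E] [NormedSpace ℂ E] (f : Cc (X × Y) E) :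
    Cc (Y × X) E :=
  ⟨fun q => (f : X × Y → E) q.swap, f.2.1.comp continuous_swap,
    f.2.2.comp_homeomorph (Homeomorph.prodComm Y X)⟩

/-- The integral over the first variable. -/
def Cc.integralFst {E : Type*} [NormedAddCommGroup E] [NormedSpace ℂ E] (f : Cc (X × Y) E) :
    Cc Y E :=
  ⟨fun y => ∫ x, (f : X × Y → E) (x, y) ∂μ, (Cc.integralSnd μ (Cc.swap f)).2⟩

theorem Cc.integrable_fst {E : Type*} [NormedAddCommGroup E] [NormedSpace ℂ E]
    (f : Cc (X × Y) E) (y : Y) : Integrable (fun x => (f : X × Y → E) (x, y)) μ :=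
  Cc.integrable μ (Cc.slice (Cc.swap f) y)

theorem norm_toL2_le_of_integral_le {E F : Type*} [NormedAddCommGroup E] [NormedSpace ℂ E]
    [NormedAddCommGroup F] [NormedSpace ℂ F] (f : Cc X E) (g : Cc Y F) {c : ℝ} (hc : 0 ≤ c)
    (h : ∫ x, ‖(f : X → E) x‖ ^ 2 ∂μ ≤ c ^ 2 * ∫ y, ‖(g : Y → F) y‖ ^ 2 ∂ν) :
    ‖toL2 μ f‖ ≤ c * ‖toL2 ν g‖ := by
  rw [← norm_sq_toL2, ← norm_sq_toL2, ← mul_pow] at h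
  exact (pow_le_pow_iff_left₀ (norm_nonneg _) (by positivity) two_ne_zero).1 h

end Extension

/-- A Haar measure of a unimodular group is invariant under inversion. -/
theorem isInvInvariant_of_isMulRightInvariant {Γ : Type*} [Group Γ] [TopologicalSpace Γ]
    [IsTopologicalGroup Γ] [MeasurableSpace Γ] [BorelSpace Γ] [LocallyCompactSpace Γ]
    (μ : Measure Γ) [μ.IsHaarMeasure] [μ.Regular] [μ.IsMulRightInvariant] : μ.IsInvInvariant := by
  constructor
  -- `μ.inv` is left invariant, so it is `c μ`; inverting twice gives `c ^ 2 = 1`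
  let c : ℝ≥0∞ := Measure.haarScalarFactor μ.inv μ
  have hc : μ.inv = c • μ := Measure.isMulLeftInvariant_eq_smul_of_regular μ.inv μ
  have h2 : μ = c ^ 2 • μ := by
    have h := congrArg Measure.inv hc
    rwa [Measure.inv_inv, Measure.inv_def (c • μ), Measure.map_smul, ← Measure.inv_def, hc,
      smul_smul, ← pow_two] at h
  obtain ⟨K⟩ : Nonempty (TopologicalSpace.PositiveCompacts Γ) := inferInstance
  have hK : c ^ 2 * μ K = 1 ^ 2 * μ K := by
    conv_rhs => rw [h2]
    simp
  have hc2 : c ^ 2 = 1 ^ 2 :=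
    (ENNReal.mul_left_inj (Measure.measure_pos_of_nonempty_interior _ K.interior_nonempty).ne'
      K.isCompact.measure_lt_top.ne).1 hK
  rw [hc, (ENNReal.pow_right_strictMono two_ne_zero).injective hc2, one_smul]

theorem integral_inner_const {Z H : Type*} [MeasurableSpace Z] {μ : Measure Z}
    [NormedAddCommGroup H] [InnerProductSpace ℂ H] [CompleteSpace H] {f : Z → H}
    (hf : Integrable f μ) (c : H) : ∫ z, inner ℂ (f z) c ∂μ = inner ℂ (∫ z, f z ∂μ) c := by
  rw [← inner_conj_symm, ← integral_inner hf, ← integral_conj]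
  exact integral_congr_ae (ae_of_all _ fun z => (inner_conj_symm _ _).symm)

/-! ### The crossed product of the twisted compact operators -/

instance Subgroup.secondCountableTopology {G : Type u} [Group G] [TopologicalSpace G]
    [SecondCountableTopology G] (N : Subgroup G) : SecondCountableTopology N :=
  inferInstanceAs (SecondCountableTopology (N : Set G))

section CrossedProduct

variable {G : Type u} [Group G] [TopologicalSpace G] [IsTopologicalGroup G]
  [MeasurableSpace G] [BorelSpace G] [SecondCountableTopology G] [LocallyCompactSpace G] [T2Space G]
  (φ : Tricharacter G) (N : Subgroup G) [LocallyCompactSpace N]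
  (μG : Measure G) [μG.IsHaarMeasure]
  (μN : Measure N) [μN.IsHaarMeasure] [μN.IsMulRightInvariant]

theorem continuous_uRight (K : HS μG) :
    Continuous fun q : G × G => uRight φ μG q.1 q.2 K := by
  refine continuous_mulOp (μG.prod μG) (m := fun (q : G × G) (p : G × G) => φ p.2 q.1 q.2) ?_ K
  exact φ.continuous_comp (by fun_prop) (by fun_prop) (by fun_prop)

theorem norm_uRight_apply (s t : G) (K : HS μG) : ‖uRight φ μG s t K‖ = ‖K‖ :=
  norm_mulOp_apply _ _ _ _

theorem norm_uRight_le (s t : G) : ‖uRight φ μG s t‖ ≤ 1 := norm_mulOp_le _ _ _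

/-- The integrand of `(a * g)(t)` as a function of `(s, t)`. -/
def aphiIntegrand (a : aphiCore φ N μG) (g : Cc N (HS μG)) : Cc (N × N) (HS μG) :=
  ⟨fun q => uRight φ μG q.1 ((q.1⁻¹ * q.2 : N) : G) ((a : N → (HS μG →L[ℂ] HS μG)) q.1
    (gamma φ μG q.1 ((g : N → HS μG) (q.1⁻¹ * q.2)))), by
    obtain ⟨-, ha, hac⟩ := a.2
    obtain ⟨K, hK, h⟩ := Cc.exists_isCompact g
    refine mem_Cc_of_isCompact ?_ ((hac.isCompact.prod (hac.isCompact.mul hK)))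
      fun q hq => ?_
    · refine StronglyContinuous.apply (U := fun q : N × N =>
        uRight φ μG q.1 ((q.1⁻¹ * q.2 : N) : G)) (fun v => ?_) (fun q => norm_uRight_le φ μG _ _) ?_
      · exact (continuous_uRight φ μG v).comp
          (f := fun q : N × N => ((q.1 : G), ((q.1⁻¹ * q.2 : N) : G))) (by fun_prop)
      · refine (ha.comp continuous_fst).clm_apply ?_
        refine StronglyContinuous.apply (U := fun q : N × N => gamma φ μG q.1)
          (fun v => ?_) (fun q => norm_gamma_le φ μG _) (g.2.1.comp (by fun_prop))
        exact (continuous_gamma φ μG v).comp (by fun_prop)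
    · by_cases h1 : q.1 ∈ tsupport (a : N → (HS μG →L[ℂ] HS μG))
      · rw [h (q.1⁻¹ * q.2) fun h2 => hq ⟨h1, ⟨_, h1, _, h2, by simp⟩⟩]
        simp
      · rw [image_eq_zero_of_notMem_tsupport h1]
        simp⟩

theorem aphiIntegrand_apply (a : aphiCore φ N μG) (g : Cc N (HS μG)) (s t : N) :
    (aphiIntegrand φ N μG a g : N × N → HS μG) (s, t) = uRight φ μG s ((s⁻¹ * t : N) : G)
      ((a : N → (HS μG →L[ℂ] HS μG)) s (gamma φ μG s ((g : N → HS μG) (s⁻¹ * t)))) := rfl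

/-- The twisted convolution `a * g` as a continuous compactly supported function. -/
def aphiConv (a : aphiCore φ N μG) : Cc N (HS μG) →ₗ[ℂ] Cc N (HS μG) where
  toFun g := ⟨aphiMul φ N μG μN a g, (Cc.integralFst μN (aphiIntegrand φ N μG a g)).2⟩
  map_add' g g' := by
    ext1; funext t
    refine Eq.trans ?_ (integral_add (Cc.integrable_fst μN (aphiIntegrand φ N μG a g) t)
      (Cc.integrable_fst μN (aphiIntegrand φ N μG a g') t))
    refine integral_congr_ae (ae_of_all _ fun s => ?_)
    simp
  map_smul' c g := by
    ext1; funext t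
    refine Eq.trans ?_ (integral_smul c _)
    refine integral_congr_ae (ae_of_all _ fun s => ?_)
    simp

theorem coe_aphiConv (a : aphiCore φ N μG) (g : Cc N (HS μG)) :
    (aphiConv φ N μG μN a g : N → HS μG) = aphiMul φ N μG μN a g := rfl

theorem aphiConv_apply (a : aphiCore φ N μG) (g : Cc N (HS μG)) (t : N) :
    (aphiConv φ N μG μN a g : N → HS μG) t =
      ∫ s, (aphiIntegrand φ N μG a g : N × N → HS μG) (s, t) ∂μN := rfl

theorem aphiMul_mem_hsCore {a : N → (HS μG →L[ℂ] HS μG)} (ha : a ∈ aphiCore φ N μG)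
    {g : N → HS μG} (hg : g ∈ hsCore N μG) : aphiMul φ N μG μN a g ∈ hsCore N μG :=
  (aphiConv φ N μG μN ⟨a, ha⟩ ⟨g, hg⟩).2

/-- For fixed `s`, the integrand of `a * g` is `a(s)` applied to a function with the norm of `g`: `γ_s`,
`u(s, s⁻¹ t)` and translation by `s` are isometric. -/
theorem norm_toL2_slice_aphiIntegrand_le (a : aphiCore φ N μG) (g : Cc N (HS μG)) (s : N) :
    ‖toL2 μN (Cc.slice (aphiIntegrand φ N μG a g) s)‖ ≤
      ‖(a : N → (HS μG →L[ℂ] HS μG)) s‖ * ‖toL2 μN g‖ := by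
  let g' : Cc N (HS μG) := ⟨fun t => (g : N → HS μG) (s⁻¹ * t), g.2.1.comp (by fun_prop),
    g.2.2.comp_homeomorph (Homeomorph.mulLeft s⁻¹)⟩
  have h1 : ‖toL2 μN g'‖ = ‖toL2 μN g‖ := by
    rw [norm_toL2_eq_sqrt, norm_toL2_eq_sqrt]
    congr 1
    exact integral_mul_left_eq_self (fun t => ‖(g : N → HS μG) t‖ ^ 2) s⁻¹
  rw [← h1]
  refine norm_toL2_le_of_integral_le μN μN _ g' (norm_nonneg _) ?_
  rw [← integral_const_mul]
  refine integral_mono_of_nonneg (ae_of_all _ fun t => by positivity) ?_ (ae_of_all _ fun t => ?_)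
  · exact (Cc.integrable_norm_sq μN g').const_mul _
  · simp only [Cc.slice_apply, aphiIntegrand_apply, norm_uRight_apply]
    rw [← mul_pow]
    refine pow_le_pow_left₀ (norm_nonneg _) ((ContinuousLinearMap.le_opNorm _ _).trans ?_) 2
    rw [norm_gamma_apply]

theorem norm_toL2_aphiConv_le (a : aphiCore φ N μG) (g : Cc N (HS μG)) :
    ‖toL2 μN (aphiConv φ N μG μN a g)‖ ≤
      (∫ s, ‖(a : N → (HS μG →L[ℂ] HS μG)) s‖ ∂μN) * ‖toL2 μN g‖ := by
  rw [← integral_mul_const]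
  refine norm_toL2_integral_le μN μN (aphiIntegrand φ N μG a g) _ (fun _ => rfl)
    (Integrable.mul_const ?_ _) (norm_toL2_slice_aphiIntegrand_le φ N μG μN a g)
  exact (a.2.2.1.integrable_of_hasCompactSupport a.2.2.2).norm

/-- The operator `g ↦ a * g` on `L²(N, HS)`. -/
def aphiOp (a : aphiCore φ N μG) : Lp (HS μG) 2 μN →L[ℂ] Lp (HS μG) 2 μN :=
  (toL2 μN ∘ₗ aphiConv φ N μG μN a).extendOfNorm (toL2 μN)

theorem aphiOp_toL2 (a : aphiCore φ N μG) (g : Cc N (HS μG)) :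
    aphiOp φ N μG μN a (toL2 μN g) = toL2 μN (aphiConv φ N μG μN a g) :=
  LinearMap.extendOfNorm_eq (f := toL2 μN ∘ₗ aphiConv φ N μG μN a) (denseRange_toL2 μN)
    ⟨_, norm_toL2_aphiConv_le φ N μG μN a⟩ g

theorem aphiConv_add (a b : aphiCore φ N μG) (g : Cc N (HS μG)) :
    aphiConv φ N μG μN (a + b) g = aphiConv φ N μG μN a g + aphiConv φ N μG μN b g := by
  ext1; funext t
  refine Eq.trans ?_ (integral_add (Cc.integrable_fst μN (aphiIntegrand φ N μG a g) t)
    (Cc.integrable_fst μN (aphiIntegrand φ N μG b g) t))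
  refine integral_congr_ae (ae_of_all _ fun s => ?_)
  simp

theorem aphiConv_smul (c : ℂ) (a : aphiCore φ N μG) (g : Cc N (HS μG)) :
    aphiConv φ N μG μN (c • a) g = c • aphiConv φ N μG μN a g := by
  ext1; funext t
  refine Eq.trans ?_ (integral_smul c _)
  refine integral_congr_ae (ae_of_all _ fun s => ?_)
  simp

theorem aphiOp_add (a b : aphiCore φ N μG) :
    aphiOp φ N μG μN (a + b) = aphiOp φ N μG μN a + aphiOp φ N μG μN b := by
  refine clm_ext_of_denseRange (e := toL2 μN (E := HS μG)) (denseRange_toL2 μN) fun g => ?_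
  rw [add_apply, aphiOp_toL2, aphiOp_toL2, aphiOp_toL2, aphiConv_add, map_add]

theorem aphiOp_smul (c : ℂ) (a : aphiCore φ N μG) :
    aphiOp φ N μG μN (c • a) = c • aphiOp φ N μG μN a := by
  refine clm_ext_of_denseRange (e := toL2 μN (E := HS μG)) (denseRange_toL2 μN) fun g => ?_
  rw [smul_apply, aphiOp_toL2, aphiOp_toL2, aphiConv_smul, map_smul]

/-- The left regular representation of `C_c(N, K_φ)` on `L²(N, HS)`. -/
def aphiRep : aphiCore φ N μG →ₗ[ℂ] (Lp (HS μG) 2 μN →L[ℂ] Lp (HS μG) 2 μN) where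
  toFun := aphiOp φ N μG μN
  map_add' := aphiOp_add φ N μG μN
  map_smul' := aphiOp_smul φ N μG μN

theorem aphiRep_toL2 (a : aphiCore φ N μG) (g : Cc N (HS μG)) :
    aphiRep φ N μG μN a (toL2 μN g) = toL2 μN (aphiConv φ N μG μN a g) :=
  aphiOp_toL2 φ N μG μN a g

theorem hsL2Norm_eq (g : Cc N (HS μG)) : hsL2Norm N μG μN g = ‖toL2 μN g‖ :=
  (norm_toL2_eq_sqrt μN g).symm

theorem hsL2Norm_aphiMul (a : aphiCore φ N μG) (g : Cc N (HS μG)) :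
    hsL2Norm N μG μN (aphiMul φ N μG μN a g) = ‖aphiRep φ N μG μN a (toL2 μN g)‖ := by
  rw [aphiRep_toL2, ← coe_aphiConv, hsL2Norm_eq]

/-- The operator norm of `aphiRep` is the norm of the crossed product: the norm is defined by the
action on `C_c(N, HS)`, which is dense in `L²(N, HS)`. -/
theorem norm_aphiRep (a : aphiCore φ N μG) :
    ‖aphiRep φ N μG μN a‖ = aphiNorm φ N μG μN a := by
  have h : ∀ C : ℝ, (∀ g : Cc N (HS μG), ‖aphiRep φ N μG μN a (toL2 μN g)‖ ≤ C * ‖toL2 μN g‖) ↔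
      ∀ g ∈ hsCore N μG, hsL2Norm N μG μN (aphiMul φ N μG μN a g) ≤ C * hsL2Norm N μG μN g := by
    intro C
    simp only [← hsL2Norm_aphiMul, ← hsL2Norm_eq]
    exact ⟨fun h g hg => h ⟨g, hg⟩, fun h g => h g g.2⟩
  rw [norm_eq_sInf_of_denseRange (e := toL2 μN (E := HS μG)) (denseRange_toL2 μN), aphiNorm]
  simp only [h]

/-! ### The involution of the crossed product -/

theorem hsMul_comp_mem_aphiCore {g : N → HS μG} (hg : g ∈ hsCore N μG) :
    hsMul φ μG ∘ g ∈ aphiCore φ N μG :=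
  ⟨fun _ => hsMul_mem_twistedCompacts φ μG _, (continuous_hsMul φ μG).comp hg.1,
    hg.2.comp_left (map_zero (hsMulL φ μG))⟩

/-- In the involution of the crossed product the factor `u(t, t⁻¹)` is `1`, as `φ` is alternating. -/
theorem aphiStar_apply (a : N → (HS μG →L[ℂ] HS μG)) (t : N) : aphiStar φ N μG a t =
    gamma φ μG t * star (a t⁻¹) * star (gamma φ μG t) := by
  rw [aphiStar, Subgroup.coe_inv, uLeft_inv, star_one, one_mul, star_mul, star_mul, star_star,
    mul_assoc]

theorem aphiStar_mem_aphiCore {a : N → (HS μG →L[ℂ] HS μG)} (ha : a ∈ aphiCore φ N μG) :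
    aphiStar φ N μG a ∈ aphiCore φ N μG := by
  have h : aphiStar φ N μG a =
      fun t : N => gamma φ μG t * star (a t⁻¹) * star (gamma φ μG t) :=
    funext (aphiStar_apply φ N μG a)
  rw [h]
  refine ⟨fun t => gamma_conj_mem_twistedCompacts φ μG _ (star_mem_twistedCompacts φ μG (ha.1 _)),
    ?_, ?_⟩
  · refine continuous_apply_of_nonexpansive (v := fun t : N => star (a t⁻¹))
      (U := fun (t : N) A => gamma φ μG t * A * star (gamma φ μG t))
      (fun t => norm_gamma_conj_sub φ μG t) (fun t₀ => ?_) ?_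
    · exact (continuous_gamma_conj φ μG (star_mem_twistedCompacts φ μG (ha.1 _))).comp
        continuous_subtype_val
    · exact continuous_star.comp (ha.2.1.comp continuous_inv)
  · refine HasCompactSupport.intro ha.2.2.isCompact.inv fun t ht => ?_
    rw [image_eq_zero_of_notMem_tsupport (f := a) fun h => ht (by simpa using h)]
    simp

theorem hsStar_zero : hsStar μG (0 : HS μG) = 0 := by
  rw [← map_zero (toL2 (μG.prod μG)), hsStar_toL2]
  exact toL2_congr _ fun q => star_zero ℂ

/-- The involution preserves `C_c(N, HS)`, where it is `g^*(t) = γ_t[g(t⁻¹)^*]`. -/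
theorem exists_hsMul_comp_eq_aphiStar {g : N → HS μG} (hg : g ∈ hsCore N μG) :
    ∃ g' ∈ hsCore N μG, hsMul φ μG ∘ g' = aphiStar φ N μG (hsMul φ μG ∘ g) := by
  refine ⟨fun t => gamma φ μG t (hsStar μG (g t⁻¹)), ⟨?_, ?_⟩, funext fun t => ?_⟩
  · exact StronglyContinuous.apply (U := fun t : N => gamma φ μG t)
      (fun v => (continuous_gamma φ μG v).comp continuous_subtype_val)
      (fun _ => norm_gamma_le φ μG _) ((continuous_hsStar μG).comp (hg.1.comp continuous_inv))
  · refine HasCompactSupport.intro (hg.2.isCompact.inv) fun t ht => ?_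
    rw [image_eq_zero_of_notMem_tsupport (f := g) fun h => ht (by simpa using h)]
    rw [hsStar_zero, map_zero]
  · rw [aphiStar_apply, Function.comp_apply, Function.comp_apply, ← hsMul_hsStar,
      gamma_conj_hsMul]

theorem gamma_star_uRight (s t : G) (K : HS μG) :
    gamma φ μG s (star (uRight φ μG s⁻¹ t) K) = uRight φ μG s (s⁻¹ * t) (gamma φ μG s K) := by
  refine HS_induction μG (p := fun K => gamma φ μG s (star (uRight φ μG s⁻¹ t) K) =
    uRight φ μG s (s⁻¹ * t) (gamma φ μG s K))
    (isClosed_eq (by fun_prop) (by fun_prop)) (fun κ => ?_) K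
  rw [uRight, uRight, star_mulOp, gamma_toL2, mulOp_toL2, mulOp_toL2, gamma_toL2]
  refine toL2_congr _ fun q => ?_
  have h : (φ (s⁻¹ * q.2) s⁻¹ t)⁻¹ = φ q.2 s (s⁻¹ * t) := by
    simp only [φ.map_mul₁, φ.map_mul₃, φ.inv₁, φ.inv₂, φ.inv₃, φ.alternating, φ.alt₂₃, inv_one,
      one_mul, inv_inv]
  simp only [ccGamma, Cc.circleMul, h]
  ring

theorem star_apply_inner {H : Type*} [NormedAddCommGroup H] [InnerProductSpace ℂ H]
    [CompleteSpace H] (A : H →L[ℂ] H) (x y : H) : inner ℂ (star A x) y = inner ℂ x (A y) :=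
  ContinuousLinearMap.adjoint_inner_left A y x

theorem inner_star_apply {H : Type*} [NormedAddCommGroup H] [InnerProductSpace ℂ H]
    [CompleteSpace H] (A : H →L[ℂ] H) (x y : H) : inner ℂ x (star A y) = inner ℂ (A x) y :=
  ContinuousLinearMap.adjoint_inner_right A x y

/-- The pointwise form of the adjointness of `a` and `a^*`, before integration over `s` and `t`; the
point `(s⁻¹, s⁻¹ t)` corresponds to the substitutions `s ↦ s⁻¹` and `t ↦ s t`. -/
theorem inner_aphiIntegrand_star (a b : aphiCore φ N μG)
    (h : (b : N → (HS μG →L[ℂ] HS μG)) = aphiStar φ N μG a) (g g' : Cc N (HS μG)) (s t : N) :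
    inner ℂ ((aphiIntegrand φ N μG b g : N × N → HS μG) (s⁻¹, s⁻¹ * t))
      ((g' : N → HS μG) (s⁻¹ * t)) =
    inner ℂ ((g : N → HS μG) t) ((aphiIntegrand φ N μG a g' : N × N → HS μG) (s, t)) := by
  rw [aphiIntegrand_apply, aphiIntegrand_apply, h, aphiStar_apply, inv_inv, mul_inv_cancel_left,
    Subgroup.coe_inv, star_gamma, inv_inv, mul_apply_eq_comp, mul_apply_eq_comp, gamma_gamma_inv]
  have hs : gamma φ μG s = star (gamma φ μG (s : G)⁻¹) := by rw [star_gamma, inv_inv]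
  have h1 := congrArg (fun A : HS μG →L[ℂ] HS μG =>
    A (gamma φ μG s ((g' : N → HS μG) (s⁻¹ * t))))
    (uRight_comm φ μG s ((s⁻¹ * t : N) : G) (a.2.1 s))
  simp only [mul_apply_eq_comp] at h1
  rw [h1, Subgroup.coe_mul, Subgroup.coe_inv, ← gamma_star_uRight, ← star_apply_inner,
    hs, inner_star_apply, inner_star_apply]

/-- The left regular representation of the crossed product respects the involutions. -/
theorem aphiRep_star (a b : aphiCore φ N μG)
    (h : (b : N → (HS μG →L[ℂ] HS μG)) = aphiStar φ N μG a) :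
    aphiRep φ N μG μN b = star (aphiRep φ N μG μN a) := by
  refine eq_star_of_denseRange (e := toL2 μN (E := HS μG)) (denseRange_toL2 μN) fun g g' => ?_
  rw [aphiRep_toL2, aphiRep_toL2, inner_toL2, inner_toL2]
  let F : Cc (N × N) ℂ := ⟨fun q => inner ℂ ((aphiIntegrand φ N μG b g : N × N → HS μG) q)
    ((g' : N → HS μG) q.2), (aphiIntegrand φ N μG b g).2.1.inner (g'.2.1.comp continuous_snd), by
    obtain ⟨K, hK, hK0⟩ := Cc.exists_isCompact (aphiIntegrand φ N μG b g)
    exact HasCompactSupport.intro hK fun q hq => by rw [hK0 q hq, inner_zero_left]⟩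
  let F' : Cc (N × N) ℂ := ⟨fun q => inner ℂ ((g : N → HS μG) q.2)
    ((aphiIntegrand φ N μG a g' : N × N → HS μG) q),
    (g.2.1.comp continuous_snd).inner (aphiIntegrand φ N μG a g').2.1, by
    obtain ⟨K, hK, hK0⟩ := Cc.exists_isCompact (aphiIntegrand φ N μG a g')
    exact HasCompactSupport.intro hK fun q hq => by rw [hK0 q hq, inner_zero_right]⟩
  have e1 : ∀ t, inner ℂ ((aphiConv φ N μG μN b g : N → HS μG) t) ((g' : N → HS μG) t) =
      ∫ s, (F : N × N → ℂ) (s, t) ∂μN := fun t => by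
    rw [aphiConv_apply]
    exact (integral_inner_const (Cc.integrable_fst μN (aphiIntegrand φ N μG b g) t) _).symm
  have e2 : ∀ t, inner ℂ ((g : N → HS μG) t) ((aphiConv φ N μG μN a g' : N → HS μG) t) =
      ∫ s, (F' : N × N → ℂ) (s, t) ∂μN := fun t => by
    rw [aphiConv_apply]
    exact (integral_inner (Cc.integrable_fst μN (aphiIntegrand φ N μG a g') t) _).symm
  have := isInvInvariant_of_isMulRightInvariant μN
  simp only [e1, e2]
  -- inversion of `s`, then translation of `t` by `s`; unimodularity of `N` enters in the former
  rw [← Cc.integral_swap, ← Cc.integral_swap, ← integral_inv_eq_self]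
  refine integral_congr_ae (ae_of_all _ fun s => ?_)
  dsimp only
  rw [← integral_mul_left_eq_self _ s⁻¹]
  exact integral_congr_ae (ae_of_all _ fun t => inner_aphiIntegrand_star φ N μG a b h g g' s t)

end CrossedProduct

/-! ### Equivariant operator kernels on `G × G` -/

section Kernels

variable {G : Type u} [Group G] [TopologicalSpace G] [IsTopologicalGroup G]
  [MeasurableSpace G] [BorelSpace G] [SecondCountableTopology G] [LocallyCompactSpace G] [T2Space G]
  (φ : Tricharacter G) (N : Subgroup G) [LocallyCompactSpace N]
  (μG : Measure G) [μG.IsHaarMeasure]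
  (μN : Measure N) [μN.IsHaarMeasure] [μN.IsMulRightInvariant]

theorem star_uOp_mul (x y : G) : star (uOp φ N μN x y) * uOp φ N μN x y = 1 :=
  mulOp_star_mul _ _ _

theorem uOp_mul_star (x y : G) : uOp φ N μN x y * star (uOp φ N μN x y) = 1 :=
  mulOp_mul_star _ _ _

theorem norm_uOp_le (x y : G) : ‖uOp φ N μN x y‖ ≤ 1 := norm_mulOp_le _ _ _

theorem norm_star_uOp_le (x y : G) : ‖star (uOp φ N μN x y)‖ ≤ 1 := by
  rw [norm_star_clm]; exact norm_uOp_le φ N μN x y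

theorem continuous_uOp (v : Lp ℂ 2 μN) : Continuous fun q : G × G => uOp φ N μN q.1 q.2 v := by
  refine continuous_mulOp μN (m := fun (q : G × G) (p : N) => (φ p q.1 q.2)⁻¹) ?_ v
  exact (φ.continuous_comp (by fun_prop) (by fun_prop) (by fun_prop)).inv

theorem star_uOp (x y : G) : star (uOp φ N μN x y) = uOp φ N μN y x := by
  rw [uOp, star_mulOp]
  exact mulOp_congr _ fun r => by rw [φ.swap₂₃ r x y]

theorem continuous_star_uOp (v : Lp ℂ 2 μN) :
    Continuous fun q : G × G => star (uOp φ N μN q.1 q.2) v := by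
  simp only [star_uOp]
  exact (continuous_uOp φ N μN v).comp (f := fun q : G × G => (q.2, q.1)) (by fun_prop)

theorem uOp_mul_right (x y : G) : uOp φ N μN x (x * y) = uOp φ N μN x y :=
  mulOp_congr _ fun r => by rw [φ.map_mul₃, φ.alt₂₃, one_mul]

theorem uOp_inv_mul_right (x y : G) : uOp φ N μN x (x⁻¹ * y) = uOp φ N μN x y := by
  rw [← uOp_mul_right, mul_inv_cancel_left]

theorem smul_mulOp {X : Type*} [TopologicalSpace X] [MeasurableSpace X] [BorelSpace X]
    (μ : Measure X) (c : Circle) (m : X → Circle) (hm : Continuous m) :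
    (c : ℂ) • mulOp μ m hm = mulOp μ (fun x => c * m x) (continuous_const.mul hm) := by
  rw [← mulOp_mul μ (fun _ => c) m continuous_const hm, mulOp_const μ c continuous_const
    (fun _ => rfl), smul_mul_assoc, one_mul]

theorem alpha_mul (n : N) (A B : Op N μN) :
    alpha N μN n (A * B) = alpha N μN n A * alpha N μN n B := by
  have h := leftReg_star_mul μN n
  simp only [alpha]
  calc _ = leftReg μN n * A * (1 * B) * star (leftReg μN n) := by rw [one_mul]; simp only [mul_assoc]
    _ = _ := by rw [← h]; simp only [mul_assoc]

theorem alpha_star (n : N) (A : Op N μN) : alpha N μN n (star A) = star (alpha N μN n A) := by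
  simp only [alpha, star_mul, star_star, mul_assoc]

theorem alpha_smul (n : N) (c : ℂ) (A : Op N μN) :
    alpha N μN n (c • A) = c • alpha N μN n A := by
  simp only [alpha, mul_smul_comm, smul_mul_assoc]

theorem alpha_mulOp (n : N) (m : N → Circle) (hm : Continuous m) :
    alpha N μN n (mulOp μN m hm) = mulOp μN (fun s => m (n⁻¹ * s))
      (hm.comp (continuous_const_mul _)) := by
  rw [alpha, leftReg_mulOp, mul_assoc, leftReg_mul_star, mul_one]

theorem norm_alpha_le (n : N) (A : Op N μN) : ‖alpha N μN n A‖ ≤ ‖A‖ := by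
  calc ‖leftReg μN n * A * star (leftReg μN n)‖
      ≤ ‖leftReg μN n * A‖ * ‖star (leftReg μN n)‖ := norm_mul_le _ _
    _ ≤ ‖leftReg μN n * A‖ * 1 := by
        gcongr; rw [norm_star_clm]; exact norm_leftReg_le μN n
    _ ≤ ‖leftReg μN n‖ * ‖A‖ := by rw [mul_one]; exact norm_mul_le _ _
    _ ≤ 1 * ‖A‖ := by gcongr; exact norm_leftReg_le μN n
    _ = _ := one_mul _

theorem norm_star_uOp_mul_mul_uOp_le (x y z w : G) (A : Op N μN) :
    ‖star (uOp φ N μN x y) * A * uOp φ N μN z w‖ ≤ ‖A‖ := by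
  calc _ ≤ ‖star (uOp φ N μN x y) * A‖ * ‖uOp φ N μN z w‖ := norm_mul_le _ _
    _ ≤ ‖star (uOp φ N μN x y) * A‖ * 1 := by gcongr; exact norm_uOp_le φ N μN z w
    _ ≤ ‖star (uOp φ N μN x y)‖ * ‖A‖ := by rw [mul_one]; exact norm_mul_le _ _
    _ ≤ 1 * ‖A‖ := by gcongr; exact norm_star_uOp_le φ N μN x y
    _ = _ := one_mul _

/-- The projective cocycle identity behind the equivariance of kernels. -/
theorem uOp_mul_uOp_translate (n : N) (x w : G) :
    uOp φ N μN n x * uOp φ N μN (n * x) (n * w) =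
      (((φ n x w)⁻¹ : Circle) : ℂ) • (alpha N μN n (uOp φ N μN x w) * uOp φ N μN n w) := by
  simp only [uOp]
  rw [alpha_mulOp, mulOp_mul, mulOp_mul, smul_mulOp]
  refine mulOp_congr _ fun s => ?_
  simp only [Subgroup.coe_mul, Subgroup.coe_inv, φ.map_mul₁, φ.map_mul₂, φ.map_mul₃, φ.inv₁,
    φ.alt₂₃]
  rw [φ.swap₂₃ s n x]
  apply Additive.ofMul.injective
  simp only [ofMul_mul, ofMul_inv, ofMul_one]
  abel

/-- The action of `n ∈ N` on the value of an equivariant kernel at `(x, w)`. -/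
def kernelAct (n : N) (x w : G) (A : Op N μN) : Op N μN :=
  (((φ n x w)⁻¹ : Circle) : ℂ) • (star (uOp φ N μN n x) * alpha N μN n A * uOp φ N μN n w)

theorem kernelAct_add (n : N) (x w : G) (A B : Op N μN) :
    kernelAct φ N μN n x w (A + B) = kernelAct φ N μN n x w A + kernelAct φ N μN n x w B := by
  simp only [kernelAct, alpha, mul_add, add_mul, smul_add]

theorem kernelAct_smul (n : N) (x w : G) (c : ℂ) (A : Op N μN) :
    kernelAct φ N μN n x w (c • A) = c • kernelAct φ N μN n x w A := by
  simp only [kernelAct, alpha_smul, mul_smul_comm, smul_mul_assoc]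
  rw [smul_comm]

theorem norm_kernelAct_le (n : N) (x w : G) (A : Op N μN) :
    ‖kernelAct φ N μN n x w A‖ ≤ ‖A‖ := by
  rw [kernelAct, norm_smul, Circle.norm_coe, one_mul]
  exact (norm_star_uOp_mul_mul_uOp_le φ N μN _ _ _ _ _).trans (norm_alpha_le N μN n A)

/-- The space of operator kernels `k(x, w)` on `G × G` which encode the elements of
`C_c(G, B)` through `k(x, w) = F(x⁻¹ w)(x) u(x, w)`. In these terms the twisted convolution is
`∫ φ(x, v, w) k₁(x, v) k₂(v, w) dv` and the involution is `k(w, x)^*`. -/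
def kernels : Submodule ℂ (G → G → Op N μN) where
  carrier := {k | Continuous (fun p : G × G => k p.1 p.2) ∧ (∀ x w, IsCompactOperator (k x w)) ∧
    (∀ (n : N) (x w : G), k (n * x) (n * w) = kernelAct φ N μN n x w (k x w)) ∧
    (∃ C : Set G, IsCompact C ∧ ∀ x w, x⁻¹ * w ∉ C → k x w = 0) ∧
    ∀ ε > 0, ∃ K : Set G, IsCompact K ∧ ∀ x w, (∀ r : N, (r : G) * x ∉ K) → ‖k x w‖ < ε}
  add_mem' := by
    rintro k l ⟨h1, h2, h3, ⟨C, hC, h4⟩, h5⟩ ⟨h1', h2', h3', ⟨C', hC', h4'⟩, h5'⟩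
    refine ⟨h1.add h1', fun x w => (h2 x w).add (h2' x w), fun n x w => ?_,
      ⟨C ∪ C', hC.union hC', fun x w h => ?_⟩, fun ε hε => ?_⟩
    · simp only [Pi.add_apply, h3, h3', kernelAct_add]
    · simp only [Pi.add_apply, h4 x w fun h' => h (Or.inl h'), h4' x w fun h' => h (Or.inr h'),
        add_zero]
    · obtain ⟨K, hK, hK'⟩ := h5 (ε / 2) (by positivity)
      obtain ⟨L, hL, hL'⟩ := h5' (ε / 2) (by positivity)
      refine ⟨K ∪ L, hK.union hL, fun x w hx => ?_⟩
      have e1 := hK' x w fun r h => hx r (Or.inl h)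
      have e2 := hL' x w fun r h => hx r (Or.inr h)
      exact (norm_add_le _ _).trans_lt (by linarith)
  zero_mem' := by
    refine ⟨continuous_const, fun x w => isCompactOperator_zero, fun n x w => ?_,
      ⟨∅, isCompact_empty, fun x w _ => rfl⟩,
      fun ε hε => ⟨∅, isCompact_empty, fun x w _ => by simpa using hε⟩⟩
    simp [kernelAct, alpha]
  smul_mem' := by
    rintro c k ⟨h1, h2, h3, ⟨C, hC, h4⟩, h5⟩
    refine ⟨h1.const_smul c, fun x w => (h2 x w).smul c, fun n x w => ?_,
      ⟨C, hC, fun x w h => ?_⟩, fun ε hε => ?_⟩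
    · simp only [Pi.smul_apply, h3, kernelAct_smul]
    · simp only [Pi.smul_apply, h4 x w h, smul_zero]
    · obtain ⟨K, hK, hK'⟩ := h5 (ε / (‖c‖ + 1)) (by positivity)
      refine ⟨K, hK, fun x w hx => ?_⟩
      have e1 := hK' x w hx
      rw [lt_div_iff₀ (by positivity)] at e1
      rw [Pi.smul_apply, Pi.smul_apply, norm_smul]
      nlinarith [norm_nonneg (k x w)]

variable {φ N μN}

/-- The kernel as a function. -/
abbrev kernels.fn (k : kernels φ N μN) : G → G → Op N μN := k

theorem kernels.continuous (k : kernels φ N μN) : Continuous fun p : G × G => kernels.fn k p.1 p.2 :=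
  k.2.1

theorem kernels.isCompactOperator (k : kernels φ N μN) (x w : G) :
    IsCompactOperator (kernels.fn k x w) := k.2.2.1 x w

theorem kernels.equivariant (k : kernels φ N μN) (n : N) (x w : G) :
    kernels.fn k (n * x) (n * w) = kernelAct φ N μN n x w (kernels.fn k x w) := k.2.2.2.1 n x w

theorem kernels.exists_support (k : kernels φ N μN) : ∃ C : Set G, IsCompact C ∧
    ∀ x w, x⁻¹ * w ∉ C → kernels.fn k x w = 0 := k.2.2.2.2.1

theorem kernels.vanishing (k : kernels φ N μN) {ε : ℝ} (hε : 0 < ε) : ∃ K : Set G, IsCompact K ∧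
    ∀ x w, (∀ r : N, (r : G) * x ∉ K) → ‖kernels.fn k x w‖ < ε := k.2.2.2.2.2 ε hε

theorem kernels.norm_translate_le (k : kernels φ N μN) (n : N) (x w : G) :
    ‖kernels.fn k (n * x) (n * w)‖ ≤ ‖kernels.fn k x w‖ := by
  rw [kernels.equivariant]; exact norm_kernelAct_le φ N μN n x w _

theorem kernels.norm_translate (k : kernels φ N μN) (n : N) (x w : G) :
    ‖kernels.fn k (n * x) (n * w)‖ = ‖kernels.fn k x w‖ := by
  refine le_antisymm (kernels.norm_translate_le k n x w) ?_
  have h := kernels.norm_translate_le k n⁻¹ (n * x) (n * w)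
  simpa using h

/-- Kernels are bounded: they vanish at infinity modulo the diagonal action of `N`, under which their
norm is invariant, and `x⁻¹ w` stays in a compact set on their support. -/
theorem kernels.exists_bound (k : kernels φ N μN) :
    ∃ M : ℝ, 0 ≤ M ∧ ∀ x w, ‖kernels.fn k x w‖ ≤ M := by
  obtain ⟨K, hK, h⟩ := kernels.vanishing k one_pos
  obtain ⟨C, hC, h0⟩ := kernels.exists_support k
  have hc : Continuous fun p : G × G => kernels.fn k p.1 (p.1 * p.2) :=
    (kernels.continuous k).comp (f := fun p : G × G => (p.1, p.1 * p.2)) (by fun_prop)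
  obtain ⟨M, hM⟩ := (hK.prod hC).exists_bound_of_continuousOn hc.continuousOn
  refine ⟨max M 1, by positivity, fun x w => ?_⟩
  by_cases hx : ∀ r : N, (r : G) * x ∉ K
  · exact (h x w hx).le.trans (le_max_right _ _)
  · push Not at hx
    obtain ⟨r, hr⟩ := hx
    by_cases hw : x⁻¹ * w ∈ C
    · rw [← kernels.norm_translate k r]
      have := hM (r * x, x⁻¹ * w) ⟨hr, hw⟩
      dsimp only at this
      rw [mul_assoc, mul_inv_cancel_left] at this
      exact this.trans (le_max_left _ _)
    · rw [h0 x w hw, norm_zero]; positivity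

variable (φ N μN)

theorem continuous_torusCore {F : G → G → Op N μN} (hF : F ∈ torusCore φ N μN) :
    Continuous fun p : G × G => F p.1 p.2 := by
  obtain ⟨hF, hc, -⟩ := hF
  refine continuous_iff_continuousAt.2 fun p => Metric.continuousAt_iff'.2 fun ε hε => ?_
  have h1 := continuous_fst.tendsto p |>.eventually
    (Metric.tendstoUniformly_iff.1 (hc p.1) (ε / 2) (by positivity))
  have h2 := continuous_snd.tendsto p |>.eventually
    (Metric.continuousAt_iff'.1 ((hF p.1).1.continuousAt (x := p.2)) (ε / 2) (by positivity))
  filter_upwards [h1, h2] with q h1 h2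
  have h3 := h1 q.2
  rw [dist_comm] at h3
  exact (dist_triangle _ (F p.1 q.2) _).trans_lt (by linarith)

/-- Multiplication by `u(x, w)` is only strongly continuous, but the values are compact operators, so
the kernel is norm continuous. -/
theorem toKernel_mem {F : G → G → Op N μN} (hF : F ∈ torusCore φ N μN) :
    (fun x w => F (x⁻¹ * w) x * uOp φ N μN x w) ∈ kernels φ N μN := by
  have hjc := continuous_torusCore φ N μN hF
  obtain ⟨hF, hc, hs⟩ := hF
  have hle : ∀ x w, ‖F (x⁻¹ * w) x * uOp φ N μN x w‖ ≤ ‖F (x⁻¹ * w) x‖ := fun x w =>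
    (norm_mul_le _ _).trans (mul_le_of_le_one_right (norm_nonneg _) (norm_uOp_le φ N μN x w))
  refine ⟨?_, fun x w => ?_, fun n x w => ?_, ⟨_, hs.isCompact, fun x w h => ?_⟩, fun ε hε => ?_⟩
  · refine StronglyContinuous.compact_comp (U := fun p : G × G => uOp φ N μN p.1 p.2)
      (continuous_star_uOp φ N μN) (fun p => norm_uOp_le φ N μN _ _)
      (hjc.comp (f := fun p : G × G => (p.1⁻¹ * p.2, p.1)) (by fun_prop)) fun p => ?_
    exact (hF _).2.1 _
  · exact ((hF (x⁻¹ * w)).2.1 x).comp_clm _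
  · have h1 : (n * x : G)⁻¹ * (n * w) = x⁻¹ * w := by group
    dsimp only
    rw [h1, (hF _).2.2.1 n x, kernelAct, mul_assoc, uOp_mul_uOp_translate, alpha_mul]
    simp only [mul_smul_comm, mul_assoc]
  · dsimp only
    rw [image_eq_zero_of_notMem_tsupport h]; simp
  · choose K hK hK' using fun y => (hF y).2.2.2 (ε / 2) (by positivity)
    -- `F` is covered up to `ε / 2` by its values at finitely many `y`, so one `K` serves all `y`
    obtain ⟨t, -, ht⟩ := hs.isCompact.elim_nhds_subcover
      (fun y => {y' | ∀ x, dist (F y x) (F y' x) < ε / 2})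
      fun y _ => Metric.tendstoUniformly_iff.1 (hc y) (ε / 2) (by positivity)
    refine ⟨⋃ y ∈ t, K y, t.isCompact_biUnion fun y _ => hK y, fun x w hx => ?_⟩
    refine (hle x w).trans_lt ?_
    by_cases h : x⁻¹ * w ∈ tsupport F
    · obtain ⟨y, hy, hy'⟩ := Set.mem_iUnion₂.1 (ht h)
      have h1 := hK' y x fun r hr => hx r (Set.mem_iUnion₂.2 ⟨y, hy, hr⟩)
      have h2 := hy' x
      rw [dist_comm, dist_eq_norm] at h2
      have h3 := norm_sub_norm_le (F (x⁻¹ * w) x) (F y x)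
      linarith
    · rw [image_eq_zero_of_notMem_tsupport h]; simpa using hε

/-- The kernel of an element of `C_c(G, B)`. -/
def toKernel : torusCore φ N μN →ₗ[ℂ] kernels φ N μN where
  toFun F := ⟨fun x w => (F : G → G → Op N μN) (x⁻¹ * w) x * uOp φ N μN x w,
    toKernel_mem φ N μN F.2⟩
  map_add' F H := by ext1; funext x w; exact add_mul _ _ _
  map_smul' c F := by
    ext1; funext x w
    exact smul_mul_assoc c ((F : G → G → Op N μN) (x⁻¹ * w) x) _

theorem toKernel_apply (F : torusCore φ N μN) (x w : G) : kernels.fn (toKernel φ N μN F) x w =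
    (F : G → G → Op N μN) (x⁻¹ * w) x * uOp φ N μN x w := rfl

/-- The equivariance of kernels corresponds to that of the elements of `B`. -/
theorem kernelAct_mul_star_uOp (n : N) (x y : G) (A : Op N μN) :
    kernelAct φ N μN n x (x * y) A * star (uOp φ N μN (n * x) y) =
      star (uOp φ N μN n x) * alpha N μN n (A * star (uOp φ N μN x y)) * uOp φ N μN n x := by
  have h : (((φ n x (x * y))⁻¹ : Circle) : ℂ) • (uOp φ N μN n (x * y) *
      star (uOp φ N μN (n * x) y)) = alpha N μN n (star (uOp φ N μN x y)) * uOp φ N μN n x := by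
    rw [star_uOp, star_uOp]
    simp only [uOp]
    rw [alpha_mulOp, mulOp_mul, mulOp_mul, smul_mulOp]
    refine mulOp_congr _ fun s => ?_
    simp only [Subgroup.coe_mul, Subgroup.coe_inv, φ.map_mul₁, φ.map_mul₃, φ.inv₁,
      φ.alt₂₃]
    rw [φ.swap₂₃ s n y, φ.swap₂₃ n x y]
    apply Additive.ofMul.injective
    simp only [ofMul_mul, ofMul_inv, ofMul_one]
    abel
  rw [alpha_mul, mul_assoc, mul_assoc, ← h, kernelAct, smul_mul_assoc]
  simp only [mul_smul_comm, mul_assoc]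

theorem continuous_kernel_mul_star_uOp (k : kernels φ N μN) : Continuous fun p : G × G =>
    kernels.fn k p.2 (p.2 * p.1) * star (uOp φ N μN p.2 p.1) := by
  refine StronglyContinuous.compact_comp (U := fun p : G × G => star (uOp φ N μN p.2 p.1))
    (fun v => ?_) (fun p => norm_star_uOp_le φ N μN _ _)
    ((kernels.continuous k).comp (f := fun p : G × G => (p.2, p.2 * p.1)) (by fun_prop))
    fun p => kernels.isCompactOperator k _ _
  have h : ∀ p : G × G, ContinuousLinearMap.adjoint (star (uOp φ N μN p.2 p.1)) v =
      uOp φ N μN p.2 p.1 v := fun p => by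
    rw [← ContinuousLinearMap.star_eq_adjoint, star_star]
  simp only [h]
  exact (continuous_uOp φ N μN v).comp (f := fun q : G × G => (q.2, q.1)) (by fun_prop)

theorem ofKernel_mem (k : kernels φ N μN) :
    (fun y x => kernels.fn k x (x * y) * star (uOp φ N μN x y)) ∈ torusCore φ N μN := by
  have hc := continuous_kernel_mul_star_uOp φ N μN k
  have hle : ∀ x y, ‖kernels.fn k x (x * y) * star (uOp φ N μN x y)‖ ≤
      ‖kernels.fn k x (x * y)‖ := fun x w =>
    (norm_mul_le _ _).trans
      (mul_le_of_le_one_right (norm_nonneg _) (norm_star_uOp_le φ N μN x w))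
  have heq : ∀ (n : N) (x y : G), kernels.fn k (n * x) (n * x * y) *
      star (uOp φ N μN (n * x) y) = star (uOp φ N μN n x) *
        alpha N μN n (kernels.fn k x (x * y) * star (uOp φ N μN x y)) * uOp φ N μN n x := by
    intro n x y
    rw [mul_assoc (n : G), kernels.equivariant, kernelAct_mul_star_uOp]
  refine ⟨fun y => ⟨?_, fun x => ?_, fun n x => heq n x y, fun ε hε => ?_⟩, fun y => ?_, ?_⟩
  · exact hc.comp (Continuous.prodMk_right y)
  · exact (kernels.isCompactOperator k x (x * y)).comp_clm _
  · obtain ⟨K, hK, h⟩ := kernels.vanishing k hε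
    exact ⟨K, hK, fun x hx => (hle x y).trans_lt (h _ _ hx)⟩
  · refine Metric.tendstoUniformly_iff.2 fun ε hε => ?_
    obtain ⟨K, hK, h⟩ := kernels.vanishing k (half_pos hε)
    have h1 : ∀ᶠ y' in 𝓝 y, ∀ x ∈ K, dist (kernels.fn k x (x * y) * star (uOp φ N μN x y))
        (kernels.fn k x (x * y') * star (uOp φ N μN x y')) < ε := by
      refine hK.eventually_forall_of_forall_eventually fun x _ => ?_
      have hd : Continuous fun q : G × G =>
          dist (kernels.fn k q.2 (q.2 * y) * star (uOp φ N μN q.2 y))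
            (kernels.fn k q.2 (q.2 * q.1) * star (uOp φ N μN q.2 q.1)) :=
        (hc.comp (f := fun q : G × G => (y, q.2)) (by fun_prop)).dist hc
      refine hd.continuousAt.eventually (Iio_mem_nhds ?_)
      simpa using hε
    filter_upwards [h1] with y' hy' x
    -- outside the translates of `K` both terms are small; elsewhere equivariance moves `x` into `K`
    by_cases hx : ∀ r : N, (r : G) * x ∉ K
    · rw [dist_eq_norm]
      refine (norm_sub_le _ _).trans_lt ?_
      have e1 := (hle x y).trans_lt (h _ _ hx)
      have e2 := (hle x y').trans_lt (h _ _ hx)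
      linarith
    · push Not at hx
      obtain ⟨r, hr⟩ := hx
      have e1 := hy' _ hr
      have e2 : ∀ y, kernels.fn k x (x * y) * star (uOp φ N μN x y) =
          star (uOp φ N μN (r⁻¹ : N) (r * x)) * alpha N μN r⁻¹
            (kernels.fn k (r * x) (r * x * y) * star (uOp φ N μN (r * x) y)) *
              uOp φ N μN (r⁻¹ : N) (r * x) := fun y => by
        rw [← heq, Subgroup.coe_inv, inv_mul_cancel_left]
      rw [e2 y, e2 y', dist_eq_norm, ← sub_mul, ← mul_sub]
      rw [dist_eq_norm] at e1
      refine lt_of_le_of_lt ?_ e1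
      refine (norm_star_uOp_mul_mul_uOp_le φ N μN _ _ _ _ _).trans ?_
      simp only [alpha, ← sub_mul, ← mul_sub]
      exact norm_alpha_le N μN r⁻¹ _
  · obtain ⟨C, hC, h⟩ := kernels.exists_support k
    refine HasCompactSupport.intro hC fun y hy => funext fun x => ?_
    rw [h x (x * y) (by rwa [inv_mul_cancel_left])]
    exact zero_mul _

/-- The element of `C_c(G, B)` with a given kernel. -/
def ofKernel (k : kernels φ N μN) : torusCore φ N μN := ⟨_, ofKernel_mem φ N μN k⟩

theorem toKernel_ofKernel (k : kernels φ N μN) : toKernel φ N μN (ofKernel φ N μN k) = k := by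
  ext1; funext x w
  change kernels.fn k x (x * (x⁻¹ * w)) * star (uOp φ N μN x (x⁻¹ * w)) * uOp φ N μN x w = _
  rw [mul_inv_cancel_left, uOp_inv_mul_right, mul_assoc, star_uOp_mul, mul_one]

theorem eq_of_toKernel_eq {F H : G → G → Op N μN}
    (h : ∀ x w, F (x⁻¹ * w) x * uOp φ N μN x w = H (x⁻¹ * w) x * uOp φ N μN x w) : F = H := by
  funext y x
  have h1 := congrArg (fun A => A * star (uOp φ N μN x (x * y))) (h x (x * y))
  simpa only [mul_assoc, uOp_mul_star, mul_one, inv_mul_cancel_left] using h1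

end Kernels

/-! ### Product and involution of kernels -/

section KernelAlgebra

open scoped Pointwise

variable {G : Type u} [Group G] [TopologicalSpace G] [IsTopologicalGroup G]
  [MeasurableSpace G] [BorelSpace G] [SecondCountableTopology G] [LocallyCompactSpace G] [T2Space G]
  (φ : Tricharacter G) (N : Subgroup G) [LocallyCompactSpace N]
  (μG : Measure G) [μG.IsHaarMeasure]
  (μN : Measure N) [μN.IsHaarMeasure] [μN.IsMulRightInvariant]

theorem star_kernelAct (n : N) (x w : G) (A : Op N μN) :
    star (kernelAct φ N μN n w x A) = kernelAct φ N μN n x w (star A) := by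
  rw [kernelAct, kernelAct, star_smul, star_mul, star_mul, star_star, alpha_star, mul_assoc]
  congr 1
  rw [φ.swap₂₃ n x w, inv_inv, Circle.coe_inv_eq_conj]
  rfl

/-- The action of `N` on the values of kernels is multiplicative for the product twisted by `φ`. -/
theorem smul_kernelAct_mul_kernelAct (n : N) (x v w : G) (A B : Op N μN) :
    (φ (n * x) (n * v) (n * w) : ℂ) • (kernelAct φ N μN n x v A * kernelAct φ N μN n v w B) =
      kernelAct φ N μN n x w ((φ x v w : ℂ) • (A * B)) := by
  have h1 : star (uOp φ N μN n x) * alpha N μN n A * uOp φ N μN n v *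
      (star (uOp φ N μN n v) * alpha N μN n B * uOp φ N μN n w) =
      star (uOp φ N μN n x) * alpha N μN n (A * B) * uOp φ N μN n w := by
    have h := uOp_mul_star φ N μN n v
    rw [alpha_mul]
    calc _ = star (uOp φ N μN n x) * alpha N μN n A * (uOp φ N μN n v * star (uOp φ N μN n v)) *
          alpha N μN n B * uOp φ N μN n w := by simp only [mul_assoc]
      _ = _ := by rw [h]; simp only [mul_assoc, one_mul]
  have h2 : φ (n * x) (n * v) (n * w) * ((φ n x v)⁻¹ * (φ n v w)⁻¹) =
      (φ n x w)⁻¹ * φ x v w := by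
    simp only [φ.map_mul₁, φ.map_mul₂, φ.map_mul₃, φ.alternating, φ.alt₁₃, φ.alt₂₃]
    rw [← φ.cycle x v n, ← φ.cycle v n x, φ.swap₁₂ n x w]
    apply Additive.ofMul.injective
    simp only [ofMul_mul, ofMul_inv, ofMul_one]
    abel
  rw [kernelAct_smul]
  simp only [kernelAct]
  rw [smul_mul_smul_comm, h1, smul_smul, smul_smul, ← Circle.coe_mul, ← Circle.coe_mul, h2,
    ← Circle.coe_mul, mul_comm]

/-- `kernelAct` as a bounded operator. -/
def kernelActL (n : N) (x w : G) : Op N μN →L[ℂ] Op N μN :=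
  LinearMap.mkContinuous
    { toFun := kernelAct φ N μN n x w
      map_add' := kernelAct_add φ N μN n x w
      map_smul' := kernelAct_smul φ N μN n x w } 1 fun A => by
    rw [one_mul]; exact norm_kernelAct_le φ N μN n x w A

variable {φ N μN}

/-- The involution `k^*(x, w) = k(w, x)^*` of kernels. -/
def kernelStar (k : kernels φ N μN) : kernels φ N μN :=
  ⟨fun x w => star (kernels.fn k w x), by
    obtain ⟨C, hC, h⟩ := kernels.exists_support k
    refine ⟨?_, fun x w => isCompactOperator_adjoint (kernels.isCompactOperator k w x),
      fun n x w => ?_, ⟨C⁻¹, hC.inv, fun x w hx => ?_⟩, fun ε hε => ?_⟩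
    · exact continuous_star.comp
        ((kernels.continuous k).comp (f := fun p : G × G => (p.2, p.1)) (by fun_prop))
    · dsimp only
      rw [kernels.equivariant, star_kernelAct]
    · dsimp only
      rw [h w x fun h' => hx (by simpa using h'), star_zero]
    · obtain ⟨K, hK, hK'⟩ := kernels.vanishing k hε
      refine ⟨K * C, hK.mul hC, fun x w hx => ?_⟩
      rw [norm_star_clm]
      by_cases hw : w⁻¹ * x ∈ C
      · exact hK' w x fun r hr => hx r ⟨_, hr, _, hw, by simp [mul_assoc]⟩
      · rw [h w x hw, norm_zero]; exact hε⟩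

theorem kernelStar_apply (k : kernels φ N μN) (x w : G) :
    kernels.fn (kernelStar k) x w = star (kernels.fn k w x) := rfl

theorem kernels.continuous_mul (k l : kernels φ N μN) : Continuous fun q : (G × G) × G =>
    (φ q.1.1 q.2 q.1.2 : ℂ) • (kernels.fn k q.1.1 q.2 * kernels.fn l q.2 q.1.2) := by
  refine (continuous_circle_coe.comp (φ.continuous_comp (by fun_prop) (by fun_prop)
    (by fun_prop))).smul ?_
  exact ((kernels.continuous k).comp (f := fun q : (G × G) × G => (q.1.1, q.2))
    (by fun_prop)).mul ((kernels.continuous l).comp (f := fun q : (G × G) × G => (q.2, q.1.2))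
    (by fun_prop))

theorem kernels.locallyCompactlySupported_mul (k l : kernels φ N μN) :
    LocallyCompactlySupported fun (p : G × G) (v : G) =>
      (φ p.1 v p.2 : ℂ) • (kernels.fn k p.1 v * kernels.fn l v p.2) := by
  obtain ⟨C, hC, h⟩ := kernels.exists_support k
  refine .of_image hC (h := fun q : (G × G) × G => q.1.1 * q.2) (by fun_prop)
    fun p v hv => ⟨p.1⁻¹ * v, ?_, by simp⟩
  by_contra hne
  exact hv (by rw [h _ _ hne, zero_mul, smul_zero])

theorem kernels.mul_slice_mem (k l : kernels φ N μN) (x w : G) :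
    (fun v => (φ x v w : ℂ) • (kernels.fn k x v * kernels.fn l v w)) ∈ Cc G (Op N μN) := by
  obtain ⟨K, hK, h⟩ := kernels.locallyCompactlySupported_mul k l (x, w)
  exact mem_Cc_of_isCompact ((kernels.continuous_mul k l).comp (Continuous.prodMk_right (x, w)))
    hK h.self_of_nhds

theorem kernels.integrable_mul (k l : kernels φ N μN) (x w : G) :
    Integrable (fun v => (φ x v w : ℂ) • (kernels.fn k x v * kernels.fn l v w)) μG :=
  Cc.integrable μG ⟨_, kernels.mul_slice_mem k l x w⟩

/-- The product `(k * l)(x, w) = ∫ φ(x, v, w) k(x, v) l(v, w) dv` of kernels. -/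
def kernelMul (k l : kernels φ N μN) : kernels φ N μN :=
  ⟨fun x w => ∫ v, (φ x v w : ℂ) • (kernels.fn k x v * kernels.fn l v w) ∂μG, by
    obtain ⟨C, hC, h⟩ := kernels.exists_support k
    obtain ⟨C', hC', h'⟩ := kernels.exists_support l
    refine ⟨?_, fun x w => ?_, fun n x w => ?_, ⟨C * C', hC.mul hC', fun x w hx => ?_⟩,
      fun ε hε => ?_⟩
    · exact continuous_integral_of_locallyCompactlySupported μG (kernels.continuous_mul k l)
        (kernels.locallyCompactlySupported_mul k l)
    · have hm := kernels.mul_slice_mem k l x w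
      refine isCompactOperator_integral μG hm.1 hm.2 fun v => ?_
      have hv : IsCompactOperator (kernels.fn k x v * kernels.fn l v w) :=
        (kernels.isCompactOperator k x v).comp_clm _
      exact hv.smul (φ x v w : ℂ)
    · dsimp only
      rw [← integral_mul_left_eq_self _ (n : G)]
      simp only [kernels.equivariant, smul_kernelAct_mul_kernelAct]
      exact (kernelActL φ N μN n x w).integral_comp_comm (kernels.integrable_mul μG k l x w)
    · refine integral_eq_zero_of_ae (ae_of_all _ fun v => ?_)
      by_cases h1 : x⁻¹ * v ∈ C
      · have : kernels.fn l v w = 0 := h' v w fun h2 => hx ⟨_, h1, _, h2, by simp [mul_assoc]⟩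
        simp [this]
      · simp [h x v h1]
    · obtain ⟨M, hM, hl⟩ := kernels.exists_bound l
      set δ := ε / (M * μG.real C + 1) with hδ
      have hδ0 : 0 < δ := by positivity
      obtain ⟨K, hK, hK'⟩ := kernels.vanishing k hδ0
      refine ⟨K, hK, fun x w hx => ?_⟩
      dsimp only
      rw [← integral_mul_left_eq_self _ x, ← setIntegral_eq_integral_of_forall_compl_eq_zero
        (s := C) fun y hy => by rw [h x (x * y) (by simpa using hy), zero_mul, smul_zero]]
      refine (norm_setIntegral_le_of_norm_le_const (C := δ * M) hC.measure_lt_top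
        fun y _ => ?_).trans_lt ?_
      · rw [norm_smul, Circle.norm_coe, one_mul]
        refine (norm_mul_le _ _).trans ?_
        gcongr
        · exact (hK' x _ hx).le
        · exact hl _ _
      · rw [hδ, div_mul_eq_mul_div, div_mul_eq_mul_div, div_lt_iff₀ (by positivity)]
        nlinarith⟩

theorem kernelMul_apply (k l : kernels φ N μN) (x w : G) : kernels.fn (kernelMul μG k l) x w =
    ∫ v, (φ x v w : ℂ) • (kernels.fn k x v * kernels.fn l v w) ∂μG := rfl

variable (φ N μN)

/-- In terms of kernels the cocycle `v` and the automorphisms `β` reduce to the scalar `φ(x, v, w)`,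
where `v = x z` for the integration variable `z` of the torus. -/
theorem vOp_mul_integrand (F H : torusCore φ N μN) (x w z : G) :
    (F : G → G → Op N μN) z x * beta φ N μN z ((H : G → G → Op N μN) (z⁻¹ * (x⁻¹ * w))) x *
      vOp φ N μN z (z⁻¹ * (x⁻¹ * w)) x =
    ((φ x (x * z) w : ℂ) • (kernels.fn (toKernel φ N μN F) x (x * z) *
      kernels.fn (toKernel φ N μN H) (x * z) w)) * star (uOp φ N μN x w) := by
  have h1 : z⁻¹ * (x⁻¹ * w) = (x * z)⁻¹ * w := by rw [mul_inv_rev, mul_assoc]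
  have h2 : z * ((x * z)⁻¹ * w) = x⁻¹ * w := by group
  have h3 : φ x z ((x * z)⁻¹ * w) = φ x (x * z) w := by
    simp only [mul_inv_rev, φ.map_mul₂, φ.map_mul₃, φ.inv₃, φ.alternating, φ.alt₁₃, φ.alt₂₃,
      inv_one, one_mul]
  have h4 := star_uOp_mul φ N μN x z
  rw [toKernel_apply, toKernel_apply, inv_mul_cancel_left, uOp_mul_right, beta, vOp, h1, h2, h3,
    uOp_inv_mul_right, uOp_inv_mul_right]
  simp only [mul_smul_comm, smul_mul_assoc]
  congr 1
  calc _ = (F : G → G → Op N μN) z x * uOp φ N μN x z *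
        (H : G → G → Op N μN) ((x * z)⁻¹ * w) (x * z) * (star (uOp φ N μN x z) * uOp φ N μN x z) *
        uOp φ N μN (x * z) w * star (uOp φ N μN x w) := by simp only [mul_assoc]
    _ = _ := by rw [h4, mul_one]; simp only [mul_assoc]

theorem toKernel_torusMul (F H : torusCore φ N μN) (x w : G) :
    torusMul φ N μG μN F H (x⁻¹ * w) x * uOp φ N μN x w =
      kernels.fn (kernelMul μG (toKernel φ N μN F) (toKernel φ N μN H)) x w := by
  have hi := (kernels.integrable_mul μG (toKernel φ N μN F) (toKernel φ N μN H) x w).comp_mul_left x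
  have h1 : torusMul φ N μG μN F H (x⁻¹ * w) x =
      kernels.fn (kernelMul μG (toKernel φ N μN F) (toKernel φ N μN H)) x w *
        star (uOp φ N μN x w) := by
    rw [kernelMul_apply, ← integral_mul_left_eq_self _ x, torusMul]
    simp only [vOp_mul_integrand]
    exact integral_mul_const_of_integrable hi
  rw [h1, mul_assoc, star_uOp_mul, mul_one]

/-- The product of `C_c(G, B)` is the product of kernels. -/
theorem torusMul_eq (F H : torusCore φ N μN) : torusMul φ N μG μN F H =
    ofKernel φ N μN (kernelMul μG (toKernel φ N μN F) (toKernel φ N μN H)) :=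
  eq_of_toKernel_eq φ N μN fun x w => by
    rw [toKernel_torusMul, ← toKernel_apply, toKernel_ofKernel]

theorem torusMul_mem {F H : G → G → Op N μN} (hF : F ∈ torusCore φ N μN)
    (hH : H ∈ torusCore φ N μN) : torusMul φ N μG μN F H ∈ torusCore φ N μN := by
  have h := torusMul_eq φ N μG μN ⟨F, hF⟩ ⟨H, hH⟩
  dsimp only at h
  rw [h]
  exact Subtype.property _

theorem toKernel_torusStar (F : torusCore φ N μN) (x w : G) :
    torusStar φ N μN F (x⁻¹ * w) x * uOp φ N μN x w =
      kernels.fn (kernelStar (toKernel φ N μN F)) x w := by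
  have h1 : vOp φ N μN (x⁻¹ * w) (x⁻¹ * w)⁻¹ x = 1 := by
    have h2 : uOp φ N μN w (w⁻¹ * x) = star (uOp φ N μN x w) := by
      rw [uOp_inv_mul_right, star_uOp]
    have h3 : uOp φ N μN x (1 : G) = 1 := mulOp_one _ _ fun r => by rw [φ.one₃, inv_one]
    rw [vOp, φ.inv₃, φ.alt₂₃, uOp_inv_mul_right, mul_inv_cancel_left, mul_inv_rev, inv_inv, h2,
      uOp_mul_star, show x⁻¹ * w * (w⁻¹ * x) = 1 by group, h3]
    simp
  rw [torusStar, h1, star_one, one_mul, beta, uOp_inv_mul_right, mul_inv_cancel_left, mul_inv_rev,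
    inv_inv, kernelStar_apply, toKernel_apply, star_mul, star_mul, star_mul, star_star, star_uOp,
    star_uOp, ← star_uOp φ N μN x w]
  simp only [mul_assoc, star_uOp_mul, mul_one]

/-- The involution of `C_c(G, B)` is the involution of kernels; the factor `v(y, y⁻¹)` is `1`. -/
theorem torusStar_eq (F : torusCore φ N μN) : torusStar φ N μN F =
    ofKernel φ N μN (kernelStar (toKernel φ N μN F)) :=
  eq_of_toKernel_eq φ N μN fun x w => by
    rw [toKernel_torusStar, ← toKernel_apply, toKernel_ofKernel]

theorem torusStar_mem {F : G → G → Op N μN} (hF : F ∈ torusCore φ N μN) :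
    torusStar φ N μN F ∈ torusCore φ N μN := by
  have h := torusStar_eq φ N μN ⟨F, hF⟩
  dsimp only at h
  rw [h]
  exact Subtype.property _

end KernelAlgebra

/-! ### The representation of kernels on `L²(G × G, L²(N))` -/

section KernelRepresentation

open scoped Pointwise

variable {G : Type u} [Group G] [TopologicalSpace G] [IsTopologicalGroup G]
  [MeasurableSpace G] [BorelSpace G] [SecondCountableTopology G] [LocallyCompactSpace G] [T2Space G]
  {φ : Tricharacter G} {N : Subgroup G} [LocallyCompactSpace N]
  (μG : Measure G) [μG.IsHaarMeasure] [μG.IsMulRightInvariant]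
  {μN : Measure N} [μN.IsHaarMeasure] [μN.IsMulRightInvariant]

/-- The integrand `φ(x, x y, w) k(x, x y) ξ(w, x y)` as a function of `(y, (w, x))`. -/
def kernelIntegrand (k : kernels φ N μN) (ξ : Cc (G × G) (Lp ℂ 2 μN)) :
    Cc (G × G × G) (Lp ℂ 2 μN) :=
  ⟨fun q => (φ q.2.2 (q.2.2 * q.1) q.2.1 : ℂ) • kernels.fn k q.2.2 (q.2.2 * q.1)
    ((ξ : G × G → Lp ℂ 2 μN) (q.2.1, q.2.2 * q.1)), by
    obtain ⟨C, hC, h⟩ := kernels.exists_support k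
    obtain ⟨K, hK, h'⟩ := Cc.exists_isCompact ξ
    refine mem_Cc_of_isCompact ?_ (hC.prod ((hK.image continuous_fst).prod
      ((hK.image continuous_snd).mul hC.inv))) fun q hq => ?_
    · refine (continuous_circle_coe.comp (φ.continuous_comp (by fun_prop) (by fun_prop)
        (by fun_prop))).smul (((kernels.continuous k).comp
          (f := fun q : G × G × G => (q.2.2, q.2.2 * q.1)) (by fun_prop)).clm_apply
          (ξ.2.1.comp (by fun_prop)))
    · by_cases h1 : q.1 ∈ C
      · rw [h' (q.2.1, q.2.2 * q.1) fun h2 => hq ⟨h1, ⟨_, h2, rfl⟩,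
          ⟨_, ⟨_, h2, rfl⟩, q.1⁻¹, Set.inv_mem_inv.2 h1, by simp⟩⟩, map_zero, smul_zero]
      · rw [h _ _ (by simpa using h1)]; simp⟩

theorem kernelIntegrand_apply (k : kernels φ N μN) (ξ : Cc (G × G) (Lp ℂ 2 μN)) (y w x : G) :
    (kernelIntegrand k ξ : G × G × G → Lp ℂ 2 μN) (y, w, x) =
      (φ x (x * y) w : ℂ) • kernels.fn k x (x * y) ((ξ : G × G → Lp ℂ 2 μN) (w, x * y)) := rfl

/-- The action `ξ ↦ ∫ φ(x, v, w) k(x, v) ξ(w, v) dv` of a kernel on continuous functions. -/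
def kernelConv (k : kernels φ N μN) : Cc (G × G) (Lp ℂ 2 μN) →ₗ[ℂ] Cc (G × G) (Lp ℂ 2 μN) where
  toFun ξ := Cc.integralFst μG (kernelIntegrand k ξ)
  map_add' ξ η := by
    ext1; funext p
    refine Eq.trans ?_ (integral_add (Cc.integrable_fst μG (kernelIntegrand k ξ) p)
      (Cc.integrable_fst μG (kernelIntegrand k η) p))
    refine integral_congr_ae (ae_of_all _ fun y => ?_)
    obtain ⟨w, x⟩ := p
    simp only [kernelIntegrand_apply]
    rw [← smul_add, ← map_add]; rfl
  map_smul' c ξ := by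
    ext1; funext p
    refine Eq.trans ?_ (integral_smul c _)
    refine integral_congr_ae (ae_of_all _ fun y => ?_)
    obtain ⟨w, x⟩ := p
    simp only [kernelIntegrand_apply]
    exact (congrArg _ (map_smul (kernels.fn k x (x * y)) c _)).trans (smul_comm _ _ _)

theorem kernelConv_apply (k : kernels φ N μN) (ξ : Cc (G × G) (Lp ℂ 2 μN)) (w x : G) :
    (kernelConv μG k ξ : G × G → Lp ℂ 2 μN) (w, x) =
      ∫ v, (φ x v w : ℂ) • kernels.fn k x v ((ξ : G × G → Lp ℂ 2 μN) (w, v)) ∂μG := by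
  rw [← integral_mul_left_eq_self _ x]; rfl

theorem norm_toL2_mul_right {E : Type*} [NormedAddCommGroup E] [NormedSpace ℂ E] (y : G)
    (ξ ξ' : Cc (G × G) E)
    (h : ∀ w x, (ξ' : G × G → E) (w, x) = (ξ : G × G → E) (w, x * y)) :
    ‖toL2 (μG.prod μG) ξ'‖ = ‖toL2 (μG.prod μG) ξ‖ := by
  rw [norm_toL2_eq_sqrt, norm_toL2_eq_sqrt, MeasureTheory.integral_prod _
    (Cc.integrable_norm_sq _ ξ'), MeasureTheory.integral_prod _ (Cc.integrable_norm_sq _ ξ)]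
  simp only [h]
  congr 1
  refine integral_congr_ae (ae_of_all _ fun w => ?_)
  exact integral_mul_right_eq_self (fun x => ‖(ξ : G × G → E) (w, x)‖ ^ 2) y

/-- For fixed `y` the integrand has norm at most `M ‖ξ‖`, since right translation is isometric on the
unimodular group `G`. -/
theorem norm_toL2_slice_kernelIntegrand_le (k : kernels φ N μN) (ξ : Cc (G × G) (Lp ℂ 2 μN))
    {M : ℝ} (hM : 0 ≤ M) (h : ∀ x w, ‖kernels.fn k x w‖ ≤ M) (y : G) :
    ‖toL2 (μG.prod μG) (Cc.slice (kernelIntegrand k ξ) y)‖ ≤ M * ‖toL2 (μG.prod μG) ξ‖ := by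
  let e : G × G ≃ₜ G × G := (Homeomorph.refl G).prodCongr (Homeomorph.mulRight y)
  let ξ' : Cc (G × G) (Lp ℂ 2 μN) := ⟨fun p => (ξ : G × G → Lp ℂ 2 μN) (e p),
    ξ.2.1.comp e.continuous, ξ.2.2.comp_homeomorph e⟩
  rw [← norm_toL2_mul_right μG y ξ ξ' fun _ _ => rfl]
  refine norm_toL2_le_of_integral_le _ _ _ ξ' hM ?_
  rw [← integral_const_mul]
  refine integral_mono_of_nonneg (ae_of_all _ fun t => by positivity)
    ((Cc.integrable_norm_sq _ ξ').const_mul _) (ae_of_all _ fun p => ?_)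
  obtain ⟨w, x⟩ := p
  simp only [Cc.slice_apply, kernelIntegrand_apply, norm_smul, Circle.norm_coe, one_mul]
  rw [← mul_pow]
  exact pow_le_pow_left₀ (norm_nonneg _) ((ContinuousLinearMap.le_opNorm _ _).trans
    (mul_le_mul_of_nonneg_right (h _ _) (norm_nonneg _))) 2

theorem norm_toL2_kernelConv_le (k : kernels φ N μN)
    {M : ℝ} (hM : 0 ≤ M) (h : ∀ x w, ‖kernels.fn k x w‖ ≤ M) {C : Set G} (hC : IsCompact C)
    (h0 : ∀ x w, x⁻¹ * w ∉ C → kernels.fn k x w = 0) (ξ : Cc (G × G) (Lp ℂ 2 μN)) :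
    ‖toL2 (μG.prod μG) (kernelConv μG k ξ)‖ ≤ M * μG.real C * ‖toL2 (μG.prod μG) ξ‖ := by
  have hm := hC.measurableSet
  have h1 : ∫ y, C.indicator (fun _ => M * ‖toL2 (μG.prod μG) ξ‖) y ∂μG =
      M * μG.real C * ‖toL2 (μG.prod μG) ξ‖ := by
    rw [integral_indicator_const _ hm, smul_eq_mul]; ring
  rw [← h1]
  refine norm_toL2_integral_le μG (μG.prod μG) (kernelIntegrand k ξ) _ (fun _ => rfl)
    ((integrable_indicator_iff hm).2 (integrableOn_const hC.measure_lt_top.ne)) fun y => ?_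
  by_cases hy : y ∈ C
  · rw [Set.indicator_of_mem hy]
    exact norm_toL2_slice_kernelIntegrand_le μG k ξ hM h y
  · rw [Set.indicator_of_notMem hy]
    have : toL2 (μG.prod μG) (Cc.slice (kernelIntegrand k ξ) y) = 0 := by
      rw [← map_zero (toL2 (μG.prod μG))]
      refine toL2_congr _ fun p => ?_
      obtain ⟨w, x⟩ := p
      rw [Cc.slice_apply, kernelIntegrand_apply, h0 _ _ (by simpa using hy)]
      simp
    rw [this, norm_zero]

/-- The operator on `L²(G × G, L²(N))` given by a kernel. -/
def kernelOp (k : kernels φ N μN) :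
    Lp (Lp ℂ 2 μN) 2 (μG.prod μG) →L[ℂ] Lp (Lp ℂ 2 μN) 2 (μG.prod μG) :=
  (toL2 (μG.prod μG) ∘ₗ kernelConv μG k).extendOfNorm (toL2 (μG.prod μG))

theorem kernelOp_toL2 (k : kernels φ N μN) (ξ : Cc (G × G) (Lp ℂ 2 μN)) :
    kernelOp μG k (toL2 (μG.prod μG) ξ) = toL2 (μG.prod μG) (kernelConv μG k ξ) := by
  obtain ⟨M, hM, h⟩ := kernels.exists_bound k
  obtain ⟨C, hC, h0⟩ := kernels.exists_support k
  exact LinearMap.extendOfNorm_eq (f := toL2 (μG.prod μG) ∘ₗ kernelConv μG k)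
    (denseRange_toL2 (μG.prod μG)) ⟨_, norm_toL2_kernelConv_le μG k hM h hC h0⟩ ξ

theorem kernelConv_add (k l : kernels φ N μN) (ξ : Cc (G × G) (Lp ℂ 2 μN)) :
    kernelConv μG (k + l) ξ = kernelConv μG k ξ + kernelConv μG l ξ := by
  ext1; funext p
  refine Eq.trans ?_ (integral_add (Cc.integrable_fst μG (kernelIntegrand k ξ) p)
    (Cc.integrable_fst μG (kernelIntegrand l ξ) p))
  refine integral_congr_ae (ae_of_all _ fun y => ?_)
  obtain ⟨w, x⟩ := p
  simp only [kernelIntegrand_apply]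
  rw [← smul_add]; rfl

theorem kernelConv_smul (c : ℂ) (k : kernels φ N μN) (ξ : Cc (G × G) (Lp ℂ 2 μN)) :
    kernelConv μG (c • k) ξ = c • kernelConv μG k ξ := by
  ext1; funext p
  refine Eq.trans ?_ (integral_smul c _)
  refine integral_congr_ae (ae_of_all _ fun y => ?_)
  obtain ⟨w, x⟩ := p
  simp only [kernelIntegrand_apply]
  rw [smul_comm]; rfl

theorem kernelOp_add (k l : kernels φ N μN) :
    kernelOp μG (k + l) = kernelOp μG k + kernelOp μG l := by
  refine clm_ext_of_denseRange (e := toL2 (μG.prod μG) (E := Lp ℂ 2 μN))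
    (denseRange_toL2 (μG.prod μG)) fun g => ?_
  rw [add_apply, kernelOp_toL2, kernelOp_toL2, kernelOp_toL2, kernelConv_add, map_add]

theorem kernelOp_smul (c : ℂ) (k : kernels φ N μN) :
    kernelOp μG (c • k) = c • kernelOp μG k := by
  refine clm_ext_of_denseRange (e := toL2 (μG.prod μG) (E := Lp ℂ 2 μN))
    (denseRange_toL2 (μG.prod μG)) fun g => ?_
  rw [smul_apply, kernelOp_toL2, kernelOp_toL2, kernelConv_smul, map_smul]

/-- The representation of kernels on `L²(G × G, L²(N))`. -/
def kernelRep : kernels φ N μN →ₗ[ℂ]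
    (Lp (Lp ℂ 2 μN) 2 (μG.prod μG) →L[ℂ] Lp (Lp ℂ 2 μN) 2 (μG.prod μG)) where
  toFun := kernelOp μG
  map_add' := kernelOp_add μG
  map_smul' := kernelOp_smul μG

theorem kernelRep_toL2 (k : kernels φ N μN) (ξ : Cc (G × G) (Lp ℂ 2 μN)) :
    kernelRep μG k (toL2 (μG.prod μG) ξ) = toL2 (μG.prod μG) (kernelConv μG k ξ) :=
  kernelOp_toL2 μG k ξ

/-- Minkowski's inequality in the variable `y = x⁻¹ v`, which ranges over the compact set `C`. -/
theorem norm_kernelRep_le (k : kernels φ N μN)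
    {M : ℝ} (hM : 0 ≤ M) (h : ∀ x w, ‖kernels.fn k x w‖ ≤ M) {C : Set G} (hC : IsCompact C)
    (h0 : ∀ x w, x⁻¹ * w ∉ C → kernels.fn k x w = 0) :
    ‖kernelRep μG k‖ ≤ M * μG.real C := by
  refine ContinuousLinearMap.opNorm_le_bound _ (by positivity) fun f => ?_
  refine (denseRange_toL2 (μG.prod μG)).induction_on (p := fun f =>
    ‖kernelRep μG k f‖ ≤ M * μG.real C * ‖f‖) f
    (isClosed_le (by fun_prop) (by fun_prop)) fun ξ => ?_
  rw [kernelRep_toL2]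
  exact norm_toL2_kernelConv_le μG k hM h hC h0 ξ

theorem inner_toL2_prod {H : Type*} [NormedAddCommGroup H] [InnerProductSpace ℂ H]
    (ξ η : Cc (G × G) H) : inner ℂ (toL2 (μG.prod μG) ξ) (toL2 (μG.prod μG) η) =
      ∫ w, ∫ x, inner ℂ ((ξ : G × G → H) (w, x)) ((η : G × G → H) (w, x)) ∂μG ∂μG := by
  rw [inner_toL2]
  refine Cc.integral_prod μG μG ⟨_, ξ.2.1.inner η.2.1, ?_⟩
  obtain ⟨K, hK, h⟩ := Cc.exists_isCompact ξ
  exact HasCompactSupport.intro hK fun x hx => by rw [h x hx, inner_zero_left]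

theorem kernelConv_slice_mem (k : kernels φ N μN) (ξ : Cc (G × G) (Lp ℂ 2 μN)) (w x : G) :
    (fun v => (φ x v w : ℂ) • kernels.fn k x v ((ξ : G × G → Lp ℂ 2 μN) (w, v))) ∈
      Cc G (Lp ℂ 2 μN) := by
  obtain ⟨K, hK, h⟩ := Cc.exists_isCompact (Cc.slice ξ w)
  refine mem_Cc_of_isCompact ?_ hK fun v hv => ?_
  · exact (continuous_circle_coe.comp (φ.continuous_comp (by fun_prop) (by fun_prop)
      (by fun_prop))).smul (((kernels.continuous k).comp (Continuous.prodMk_right x)).clm_apply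
        (ξ.2.1.comp (by fun_prop)))
  · have := h v hv
    rw [Cc.slice_apply] at this
    rw [this, map_zero, smul_zero]

/-- `kernelRep` respects the involutions, although it is not multiplicative: this only uses
`φ(v, x, w) = φ(x, v, w)⁻¹`. -/
theorem kernelRep_star (k : kernels φ N μN) :
    kernelRep μG (kernelStar k) = star (kernelRep μG k) := by
  refine eq_star_of_denseRange (e := toL2 (μG.prod μG) (E := Lp ℂ 2 μN))
    (denseRange_toL2 (μG.prod μG)) fun ξ η => ?_
  rw [kernelRep_toL2, kernelRep_toL2, inner_toL2_prod, inner_toL2_prod]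
  refine integral_congr_ae (ae_of_all _ fun w => ?_)
  dsimp only
  let f : Cc (G × G) ℂ := ⟨fun q => inner ℂ ((ξ : G × G → Lp ℂ 2 μN) (w, q.2))
      ((φ q.2 q.1 w : ℂ) • kernels.fn k q.2 q.1 ((η : G × G → Lp ℂ 2 μN) (w, q.1))), by
    obtain ⟨K, hK, h⟩ := Cc.exists_isCompact (Cc.slice ξ w)
    obtain ⟨K', hK', h'⟩ := Cc.exists_isCompact (Cc.slice η w)
    simp only [Cc.slice_apply] at h h'
    refine mem_Cc_of_isCompact ?_ (hK'.prod hK) fun q hq => ?_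
    · have hξ : Continuous fun q : G × G => (ξ : G × G → Lp ℂ 2 μN) (w, q.2) :=
        ξ.2.1.comp (by fun_prop)
      have hη : Continuous fun q : G × G => (φ q.2 q.1 w : ℂ) • kernels.fn k q.2 q.1
          ((η : G × G → Lp ℂ 2 μN) (w, q.1)) :=
        (continuous_circle_coe.comp (φ.continuous_comp (by fun_prop) (by fun_prop)
          (by fun_prop))).smul (((kernels.continuous k).comp
          (f := fun q : G × G => (q.2, q.1)) (by fun_prop)).clm_apply
          (η.2.1.comp (f := fun q : G × G => (w, q.1)) (by fun_prop)))
      exact hξ.inner hη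
    · by_cases h1 : q.1 ∈ K'
      · rw [h q.2 fun h2 => hq ⟨h1, h2⟩, inner_zero_left]
      · rw [h' q.1 h1, map_zero, smul_zero, inner_zero_right]⟩
  calc ∫ x, inner ℂ ((kernelConv μG (kernelStar k) ξ : G × G → Lp ℂ 2 μN) (w, x))
        ((η : G × G → Lp ℂ 2 μN) (w, x)) ∂μG
      = ∫ x, ∫ v, (f : G × G → ℂ) (x, v) ∂μG ∂μG := by
        refine integral_congr_ae (ae_of_all _ fun x => ?_)
        dsimp only
        rw [kernelConv_apply]
        refine (integral_inner_const (Cc.integrable μG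
          ⟨_, kernelConv_slice_mem (kernelStar k) ξ w x⟩) _).symm.trans ?_
        refine integral_congr_ae (ae_of_all _ fun v => ?_)
        simp only [f]
        rw [inner_smul_left, inner_smul_right, kernelStar_apply, star_apply_inner,
          ← Circle.coe_inv_eq_conj, φ.swap₁₂ v x w, inv_inv]
    _ = ∫ v, ∫ x, (f : G × G → ℂ) (x, v) ∂μG ∂μG := Cc.integral_swap μG μG f
    _ = _ := by
        refine integral_congr_ae (ae_of_all _ fun x => ?_)
        dsimp only
        rw [kernelConv_apply]
        exact integral_inner (𝕜 := ℂ) (Cc.integrable μG ⟨_, kernelConv_slice_mem k η w x⟩)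
          ((ξ : G × G → Lp ℂ 2 μN) (w, x))

end KernelRepresentation

/-! ### Columns of kernels and the `L²` norm of the torus -/

section Columns

open scoped Pointwise

variable {G : Type u} [Group G] [TopologicalSpace G] [IsTopologicalGroup G]
  [MeasurableSpace G] [BorelSpace G] [SecondCountableTopology G] [LocallyCompactSpace G] [T2Space G]
  {φ : Tricharacter G} {N : Subgroup G} [LocallyCompactSpace N]
  (μG : Measure G) [μG.IsHaarMeasure] [μG.IsMulRightInvariant]
  {μN : Measure N} [μN.IsHaarMeasure] [μN.IsMulRightInvariant]

/-- The function `x ↦ k(x, w) ψ`. -/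
def kernels.column (k : kernels φ N μN) (w : G) : Lp ℂ 2 μN →ₗ[ℂ] Cc G (Lp ℂ 2 μN) where
  toFun ψ := ⟨fun x => kernels.fn k x w ψ, by
    obtain ⟨C, hC, h⟩ := kernels.exists_support k
    refine mem_Cc_of_isCompact (((kernels.continuous k).comp
      (Continuous.prodMk_left w)).clm_apply continuous_const)
      ((isCompact_singleton (x := w)).mul hC.inv) fun x hx => ?_
    rw [h x w fun h1 => hx ⟨w, rfl, _, Set.inv_mem_inv.2 h1, by simp⟩]; rfl⟩
  map_add' ψ ψ' := by ext1; funext x; exact map_add (kernels.fn k x w) ψ ψ'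
  map_smul' c ψ := by ext1; funext x; exact map_smul (kernels.fn k x w) c ψ

theorem kernels.column_apply (k : kernels φ N μN) (w : G) (ψ : Lp ℂ 2 μN) (x : G) :
    (kernels.column k w ψ : G → Lp ℂ 2 μN) x = kernels.fn k x w ψ := rfl

/-- The operator `ψ ↦ k(·, w) ψ` from `L²(N)` to `L²(G, L²(N))`. -/
def columnOp (k : kernels φ N μN) (w : G) : Lp ℂ 2 μN →L[ℂ] Lp (Lp ℂ 2 μN) 2 μG where
  toLinearMap := toL2 μG ∘ₗ kernels.column k w
  cont := by
    obtain ⟨M, hM, h⟩ := kernels.exists_bound k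
    obtain ⟨C, hC, h0⟩ := kernels.exists_support k
    refine AddMonoidHomClass.continuous_of_bound (toL2 μG ∘ₗ kernels.column k w)
      (M * Real.sqrt (μG.real (({w} : Set G) * C⁻¹))) fun ψ => ?_
    refine (norm_toL2_le μG (kernels.column k w ψ) (isCompact_singleton.mul hC.inv)
      (fun x hx => ?_) (M := M * ‖ψ‖) (by positivity) fun x => ?_).trans (le_of_eq (by ring))
    · rw [kernels.column_apply, h0 x w fun h1 => hx ⟨w, rfl, _, Set.inv_mem_inv.2 h1, by simp⟩]
      rfl
    · exact (ContinuousLinearMap.le_opNorm _ _).trans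
        (mul_le_mul_of_nonneg_right (h _ _) (norm_nonneg _))

theorem columnOp_apply (k : kernels φ N μN) (w : G) (ψ : Lp ℂ 2 μN) :
    columnOp μG k w ψ = toL2 μG (kernels.column k w ψ) := rfl

theorem star_columnOp_comp (k : kernels φ N μN) (w : G) :
    ContinuousLinearMap.adjoint (columnOp μG k w) ∘L columnOp μG k w =
      kernels.fn (kernelMul μG (kernelStar k) k) w w := by
  ext1 ψ
  refine ext_inner_right ℂ fun ψ' => ?_
  rw [ContinuousLinearMap.comp_apply, ContinuousLinearMap.adjoint_inner_left, columnOp_apply,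
    columnOp_apply, inner_toL2, kernelMul_apply]
  have hi := kernels.integrable_mul μG (kernelStar k) k w w
  rw [ContinuousLinearMap.integral_apply hi]
  refine Eq.trans ?_ (integral_inner_const (hi.apply_continuousLinearMap ψ) ψ')
  refine integral_congr_ae (ae_of_all _ fun v => ?_)
  dsimp only
  rw [kernels.column_apply, kernels.column_apply, φ.alt₁₃, Circle.coe_one, one_smul,
    mul_apply_eq_comp, kernelStar_apply, star_apply_inner]

/-- The `C^*`-identity for the operator of a column: `φ(w, v, w) = 1`, so that no twist is left in
`(k^* * k)(w, w)`. -/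
theorem norm_columnOp_sq (k : kernels φ N μN) (w : G) :
    ‖columnOp μG k w‖ ^ 2 = ‖kernels.fn (kernelMul μG (kernelStar k) k) w w‖ := by
  have h := ContinuousLinearMap.norm_adjoint_comp_self (columnOp μG k w)
  rw [star_columnOp_comp, ← sq] at h
  exact h.symm

theorem ofKernel_one (k : kernels φ N μN) (x : G) :
    (ofKernel φ N μN k : G → G → Op N μN) 1 x = kernels.fn k x x := by
  have h3 : uOp φ N μN x (1 : G) = 1 := mulOp_one _ _ fun r => by rw [φ.one₃, inv_one]
  have h4 : star (uOp φ N μN x (1 : G)) = 1 := by rw [h3, star_one]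
  have h5 : kernels.fn k x (x * 1) = kernels.fn k x x := congrArg _ (mul_one x)
  exact (congrArg₂ (fun A B : Op N μN => A * B) h5 h4).trans (mul_one _)

/-- The norm `‖F‖_2` of the torus is the supremum of the norms of the columns of the kernel, because
`(F^* * F)(1)` consists of the diagonal values `(k^* * k)(w, w)`. -/
theorem torusL2Norm_eq (F : torusCore φ N μN) : torusL2Norm φ N μG μN F =
    Real.sqrt (⨆ w, ‖columnOp μG (toKernel φ N μN F) w‖ ^ 2) := by
  rw [torusL2Norm]
  congr 1
  refine iSup_congr fun w => ?_
  rw [norm_columnOp_sq, torusStar_eq, torusMul_eq, toKernel_ofKernel]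
  exact congrArg norm (ofKernel_one (kernelMul μG (kernelStar (toKernel φ N μN F))
    (toKernel φ N μN F)) w)

theorem bddAbove_norm_columnOp_sq (k : kernels φ N μN) :
    BddAbove (Set.range fun w => ‖columnOp μG k w‖ ^ 2) := by
  obtain ⟨M, hM, h⟩ := kernels.exists_bound (kernelMul μG (kernelStar k) k)
  refine ⟨M, ?_⟩
  rintro _ ⟨w, rfl⟩
  dsimp only
  rw [norm_columnOp_sq]
  exact h w w

theorem norm_columnOp_le_torusL2Norm (F : torusCore φ N μN) (w : G) :
    ‖columnOp μG (toKernel φ N μN F) w‖ ≤ torusL2Norm φ N μG μN F := by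
  rw [torusL2Norm_eq]
  exact Real.le_sqrt_of_sq_le (le_ciSup (bddAbove_norm_columnOp_sq μG _) w)

theorem torusL2Norm_le (F : torusCore φ N μN) {M : ℝ} (hM : 0 ≤ M)
    (h : ∀ w, ‖columnOp μG (toKernel φ N μN F) w‖ ≤ M) : torusL2Norm φ N μG μN F ≤ M := by
  rw [torusL2Norm_eq, Real.sqrt_le_left hM]
  exact ciSup_le fun w => pow_le_pow_left₀ (norm_nonneg _) (h w) 2


/-- The action of a kernel on functions of one variable, for a fixed value of the parameter `w`:
`ξ ↦ ∫ φ(x, v, w) k(x, v) ξ(v) dv`. It is a slice of `kernelConv`, which is independent of the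
function of `w` chosen to obtain a function of two variables. -/
def fibreConv (k : kernels φ N μN) (w : G) (ξ : Cc G (Lp ℂ 2 μN)) : Cc G (Lp ℂ 2 μN) :=
  Cc.slice (kernelConv μG k (Cc.tensor (Cc.exists_eq_one w).choose ξ)) w

theorem fibreConv_apply (k : kernels φ N μN) (w : G) (ξ : Cc G (Lp ℂ 2 μN)) (x : G) :
    (fibreConv μG k w ξ : G → Lp ℂ 2 μN) x =
      ∫ v, (φ x v w : ℂ) • kernels.fn k x v ((ξ : G → Lp ℂ 2 μN) v) ∂μG := by
  rw [fibreConv, Cc.slice_apply, kernelConv_apply]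
  refine integral_congr_ae (ae_of_all _ fun v => ?_)
  have h : (Cc.tensor (Cc.exists_eq_one w).choose ξ : G × G → Lp ℂ 2 μN) (w, v) =
      (ξ : G → Lp ℂ 2 μN) v := by
    change ((Cc.exists_eq_one w).choose : G → ℂ) w • _ = _
    rw [(Cc.exists_eq_one w).choose_spec, one_smul]
  dsimp only
  rw [h]

theorem slice_kernelConv (k : kernels φ N μN) (ξ : Cc (G × G) (Lp ℂ 2 μN)) (w : G) :
    Cc.slice (kernelConv μG k ξ) w = fibreConv μG k w (Cc.slice ξ w) := by
  ext1; funext x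
  rw [fibreConv_apply, Cc.slice_apply, kernelConv_apply]; rfl

theorem fibreConv_smul (k : kernels φ N μN) (w : G) (c : ℂ) (ξ : Cc G (Lp ℂ 2 μN)) :
    fibreConv μG k w (c • ξ) = c • fibreConv μG k w ξ := by
  have h : Cc.tensor (Cc.exists_eq_one w).choose (c • ξ) =
      c • Cc.tensor (Cc.exists_eq_one w).choose ξ := by
    ext1; funext q; exact smul_comm _ c _
  rw [fibreConv, h, map_smul]; rfl

theorem norm_sq_toL2_prod {E : Type*} [NormedAddCommGroup E] [NormedSpace ℂ E]
    (ξ : Cc (G × G) E) : ‖toL2 (μG.prod μG) ξ‖ ^ 2 = ∫ w, ‖toL2 μG (Cc.slice ξ w)‖ ^ 2 ∂μG := by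
  rw [norm_sq_toL2, MeasureTheory.integral_prod _ (Cc.integrable_norm_sq _ ξ)]
  exact integral_congr_ae (ae_of_all _ fun w => (norm_sq_toL2 μG (Cc.slice ξ w)).symm)

theorem integrable_norm_sq_slice {E : Type*} [NormedAddCommGroup E] [NormedSpace ℂ E]
    (ξ : Cc (G × G) E) : Integrable (fun w => ‖toL2 μG (Cc.slice ξ w)‖ ^ 2) μG :=
  Cc.integrable_norm_sq μG (curryL2 μG ξ)

/-- `kernelRep k` is decomposable over the parameter `w`, so its norm is bounded by those of its
fibres. -/
theorem norm_kernelRep_le_of_fibreConv (k : kernels φ N μN) {C : ℝ} (hC : 0 ≤ C)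
    (h : ∀ w (f : Cc (G × N) ℂ), ‖toL2 μG (fibreConv μG k w (curryL2 μN f))‖ ≤
      C * ‖toL2 μG (curryL2 μN f)‖) : ‖kernelRep μG k‖ ≤ C := by
  refine ContinuousLinearMap.opNorm_le_bound _ hC fun f => ?_
  refine (denseRange_toL2L2 (μG.prod μG) μN).induction_on (p := fun f =>
    ‖kernelRep μG k f‖ ≤ C * ‖f‖) f
    (isClosed_le (by fun_prop) (by fun_prop)) fun f => ?_
  rw [toL2L2_apply, kernelRep_toL2]
  refine le_of_sq_le_sq ?_ (by positivity)
  rw [mul_pow, norm_sq_toL2_prod, norm_sq_toL2_prod, ← integral_const_mul]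
  refine integral_mono (integrable_norm_sq_slice μG _)
    ((integrable_norm_sq_slice μG _).const_mul _) fun w => ?_
  dsimp only
  obtain ⟨K, hK, h0⟩ := Cc.exists_isCompact f
  have hs : Cc.slice (curryL2 μN f) w =
      curryL2 μN (⟨fun q => (f : (G × G) × N → ℂ) ((w, q.1), q.2),
        mem_Cc_of_isCompact (f.2.1.comp (by fun_prop))
          (hK.image (f := fun q : (G × G) × N => (q.1.2, q.2)) (by fun_prop))
          fun q hq => h0 _ fun hm => hq ⟨_, hm, rfl⟩⟩ : Cc (G × N) ℂ) := rfl
  rw [slice_kernelConv, ← mul_pow, hs]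
  exact pow_le_pow_left₀ (norm_nonneg _) (h w _) 2

theorem nonpos_of_integral_sq_mul_nonpos {g : G → ℝ} (hg : Continuous g)
    (h : ∀ f : Cc G ℂ, ∫ w, ‖(f : G → ℂ) w‖ ^ 2 * g w ∂μG ≤ 0) (w : G) : g w ≤ 0 := by
  by_contra! hw
  have hU : IsOpen {w | 0 < g w} := isOpen_lt continuous_const hg
  obtain ⟨f, hf1, hf0, hfc, hf⟩ := exists_continuous_one_zero_of_isCompact
    (isCompact_singleton (x := w)) hU.isClosed_compl (by simpa using hw)
  let f' : Cc G ℂ := ⟨fun w => ((f w : ℝ) : ℂ), by fun_prop,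
    hfc.comp_left (g := fun r : ℝ => (r : ℂ)) Complex.ofReal_zero⟩
  refine absurd (h f') (not_le.2 ?_)
  have hc : Continuous fun w => ‖(f' : G → ℂ) w‖ ^ 2 * g w := (f'.2.1.norm.pow 2).mul hg
  refine hc.integral_pos_of_hasCompactSupport_nonneg_nonzero (x := w) ?_ (fun v => ?_) ?_
  · obtain ⟨K, hK, hK0⟩ := Cc.exists_isCompact f'
    exact HasCompactSupport.intro hK fun x hx => by simp [hK0 x hx]
  · by_cases hv : 0 < g v
    · exact mul_nonneg (by positivity) hv.le
    · have : (f' : G → ℂ) v = 0 := by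
        change ((f v : ℝ) : ℂ) = 0
        rw [hf0 hv]; rfl
      simp [this]
  · have : (f' : G → ℂ) w = 1 := by
      change ((f w : ℝ) : ℂ) = 1
      rw [hf1 rfl]; simp
    rw [this]; simpa using hw.ne'

theorem continuous_norm_fibreConv (k : kernels φ N μN) (ξ : Cc G (Lp ℂ 2 μN)) :
    Continuous fun w => ‖toL2 μG (fibreConv μG k w ξ)‖ := by
  refine continuous_iff_continuousAt.2 fun w₀ => ?_
  obtain ⟨f, hf⟩ := Cc.exists_eq_one w₀
  have h0 : (f : G → ℂ) w₀ ≠ 0 := by rw [hf]; exact one_ne_zero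
  have h1 : ∀ᶠ w in 𝓝 w₀, (f : G → ℂ) w ≠ 0 := f.2.1.continuousAt.eventually_ne h0
  have h2 : ContinuousAt (fun w => ‖toL2 μG (Cc.slice (kernelConv μG k (Cc.tensor f ξ)) w)‖ /
      ‖(f : G → ℂ) w‖) w₀ :=
    (Cc.continuous_toL2_slice μG _).norm.continuousAt.div f.2.1.norm.continuousAt
      (norm_ne_zero_iff.2 h0)
  refine h2.congr ?_
  filter_upwards [h1] with w hw
  have hs : toL2 μG (Cc.slice (kernelConv μG k (Cc.tensor f ξ)) w) =
      (f : G → ℂ) w • toL2 μG (fibreConv μG k w ξ) := by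
    rw [slice_kernelConv, ← map_smul, ← fibreConv_smul]; rfl
  rw [hs, norm_smul, mul_div_cancel_left₀ _ (norm_ne_zero_iff.2 hw)]

theorem norm_sq_slice_tensor (f : Cc G ℂ) (ξ : Cc G (Lp ℂ 2 μN)) (w : G) :
    ‖toL2 μG (Cc.slice (Cc.tensor f ξ) w)‖ ^ 2 =
      ‖(f : G → ℂ) w‖ ^ 2 * ‖toL2 μG ξ‖ ^ 2 := by
  have hs : toL2 μG (Cc.slice (Cc.tensor f ξ) w) = (f : G → ℂ) w • toL2 μG ξ := by
    rw [← map_smul]; rfl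
  rw [hs, norm_smul, mul_pow]

theorem norm_sq_slice_kernelConv_tensor (k : kernels φ N μN) (f : Cc G ℂ)
    (ξ : Cc G (Lp ℂ 2 μN)) (w : G) :
    ‖toL2 μG (Cc.slice (kernelConv μG k (Cc.tensor f ξ)) w)‖ ^ 2 =
      ‖(f : G → ℂ) w‖ ^ 2 * ‖toL2 μG (fibreConv μG k w ξ)‖ ^ 2 := by
  have hs : toL2 μG (Cc.slice (kernelConv μG k (Cc.tensor f ξ)) w) =
      (f : G → ℂ) w • toL2 μG (fibreConv μG k w ξ) := by
    rw [slice_kernelConv, ← map_smul, ← fibreConv_smul]; rfl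
  rw [hs, norm_smul, mul_pow]

/-- Each fibre of `kernelRep k` is bounded by `‖kernelRep k‖`: the bound holds after integration against
every `|f(w)|²`, and the fibres depend continuously on `w`. -/
theorem norm_fibreConv_le (k : kernels φ N μN) (w : G) (ξ : Cc G (Lp ℂ 2 μN)) :
    ‖toL2 μG (fibreConv μG k w ξ)‖ ≤ ‖kernelRep μG k‖ * ‖toL2 μG ξ‖ := by
  have h0 := norm_nonneg (kernelRep μG k)
  have hle : ∀ f, ‖kernelRep μG k f‖ ≤ ‖kernelRep μG k‖ * ‖f‖ := (kernelRep μG k).le_opNorm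
  generalize ‖kernelRep μG k‖ = r at h0 hle ⊢
  have hg : ∀ w, ‖toL2 μG (fibreConv μG k w ξ)‖ ^ 2 - (r * ‖toL2 μG ξ‖) ^ 2 ≤ 0 := by
    refine nonpos_of_integral_sq_mul_nonpos μG
      (((continuous_norm_fibreConv μG k ξ).pow 2).sub continuous_const) fun f => ?_
    have h1 : ‖toL2 (μG.prod μG) (kernelConv μG k (Cc.tensor f ξ))‖ ^ 2 ≤
        r ^ 2 * ‖toL2 (μG.prod μG) (Cc.tensor f ξ)‖ ^ 2 := by
      have h2 := hle (toL2 (μG.prod μG) (Cc.tensor f ξ))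
      rw [kernelRep_toL2] at h2
      exact (pow_le_pow_left₀ (norm_nonneg _) h2 2).trans_eq (mul_pow _ _ _)
    have i1 := integrable_norm_sq_slice μG (kernelConv μG k (Cc.tensor f ξ))
    have i2 := (integrable_norm_sq_slice μG (Cc.tensor f ξ)).const_mul (r ^ 2)
    rw [norm_sq_toL2_prod μG (kernelConv μG k (Cc.tensor f ξ)),
      norm_sq_toL2_prod μG (Cc.tensor f ξ), ← integral_const_mul] at h1
    refine le_of_eq_of_le ?_ (sub_nonpos.2 h1)
    refine Eq.trans ?_ (integral_sub i1 i2)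
    refine integral_congr_ae (ae_of_all _ fun w => ?_)
    dsimp only
    rw [norm_sq_slice_tensor, norm_sq_slice_kernelConv_tensor]
    ring
  exact le_of_sq_le_sq (sub_nonpos.1 (hg w)) (mul_nonneg h0 (norm_nonneg _))

/-- The columns of `k * l` are the images of the columns of `l` under the fibres of `k`; this is the
link between the product of kernels and `kernelRep`. -/
theorem column_kernelMul (k l : kernels φ N μN) (w : G) (ψ : Lp ℂ 2 μN) :
    kernels.column (kernelMul μG k l) w ψ = fibreConv μG k w (kernels.column l w ψ) := by
  ext1; funext x
  rw [kernels.column_apply, kernelMul_apply, fibreConv_apply,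
    ContinuousLinearMap.integral_apply (kernels.integrable_mul μG k l x w)]
  rfl

theorem norm_columnOp_kernelMul_le (k l : kernels φ N μN) (w : G) :
    ‖columnOp μG (kernelMul μG k l) w‖ ≤ ‖kernelRep μG k‖ * ‖columnOp μG l w‖ := by
  refine ContinuousLinearMap.opNorm_le_bound _ (by positivity) fun ψ => ?_
  rw [columnOp_apply, column_kernelMul, mul_assoc]
  exact (norm_fibreConv_le μG k w _).trans
    (mul_le_mul_of_nonneg_left ((columnOp μG l w).le_opNorm ψ) (norm_nonneg _))

end Columns

/-! ### Integral operators -/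

section IntegralOperators

variable {X H : Type*} [TopologicalSpace X] [MeasurableSpace X] [BorelSpace X]
  (μ : Measure X) [IsFiniteMeasureOnCompacts μ]
  [NormedAddCommGroup H] [InnerProductSpace ℂ H] [CompleteSpace H]

/-- The function `q ↦ ⟪c(q), η⟫`. -/
def Cc.innerConst (c : Cc X H) (η : H) : Cc X ℂ :=
  ⟨fun q => inner ℂ ((c : X → H) q) η, c.2.1.inner continuous_const, by
    exact c.2.2.comp_left (g := fun v : H => inner ℂ v η) (inner_zero_left η)⟩

theorem Cc.innerConst_apply (c : Cc X H) (η : H) (q : X) :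
    (Cc.innerConst c η : X → ℂ) q = inner ℂ ((c : X → H) q) η := rfl

theorem norm_toL2_innerConst_le (c : Cc X H) (η : H) :
    ‖toL2 μ (Cc.innerConst c η)‖ ≤ ‖toL2 μ c‖ * ‖η‖ := by
  refine le_of_sq_le_sq ?_ (by positivity)
  rw [mul_pow, norm_sq_toL2, norm_sq_toL2, ← integral_mul_const]
  refine integral_mono_of_nonneg (ae_of_all _ fun t => by positivity)
    (Integrable.mul_const ?_ _) (ae_of_all _ fun q => ?_)
  · have hc : Continuous fun x => ‖(c : X → H) x‖ ^ 2 := c.2.1.norm.pow 2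
    exact hc.integrable_of_hasCompactSupport
      (c.2.2.comp_left (g := fun v : H => ‖v‖ ^ 2) (by simp))
  · dsimp only
    rw [← mul_pow]
    exact pow_le_pow_left₀ (norm_nonneg _) (norm_inner_le_norm _ _) 2

/-- The operator `ψ ↦ ∫ ψ(q) c(q) dq` from `L²(X)` to `H`, for a continuous compactly supported
function `c : X → H`; it is defined as the adjoint of `η ↦ ⟪c(·), η⟫`. -/
def integralOp (c : Cc X H) : Lp ℂ 2 μ →L[ℂ] H :=
  ContinuousLinearMap.adjoint (LinearMap.mkContinuous
    { toFun := fun η => toL2 μ (Cc.innerConst c η)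
      map_add' := fun η η' => by
        rw [← map_add]; exact toL2_congr μ fun q => inner_add_right _ _ _
      map_smul' := fun a η => by
        rw [RingHom.id_apply, ← map_smul]; exact toL2_congr μ fun q => inner_smul_right _ _ _ }
    ‖toL2 μ c‖ (norm_toL2_innerConst_le μ c))

theorem inner_integralOp (c : Cc X H) (η : H) (ψ : Lp ℂ 2 μ) :
    inner ℂ η (integralOp μ c ψ) = inner ℂ (toL2 μ (Cc.innerConst c η)) ψ :=
  ContinuousLinearMap.adjoint_inner_right _ _ _

theorem norm_integralOp_le (c : Cc X H) : ‖integralOp μ c‖ ≤ ‖toL2 μ c‖ := by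
  rw [integralOp, LinearIsometryEquiv.norm_map]
  exact LinearMap.mkContinuous_norm_le _ (norm_nonneg _) _

theorem Cc.integrable_smul (ψ : Cc X ℂ) {c : X → H} (hc : Continuous c) :
    Integrable (fun q => (ψ : X → ℂ) q • c q) μ :=
  (ψ.2.1.smul hc).integrable_of_hasCompactSupport (ψ.2.2.smul_right)

theorem integralOp_toL2 (c : Cc X H) (ψ : Cc X ℂ) :
    integralOp μ c (toL2 μ ψ) = ∫ q, (ψ : X → ℂ) q • (c : X → H) q ∂μ := by
  refine ext_inner_left ℂ fun η => ?_
  rw [inner_integralOp, inner_toL2]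
  refine Eq.trans ?_ (integral_inner (𝕜 := ℂ) (Cc.integrable_smul μ ψ c.2.1) η)
  refine integral_congr_ae (ae_of_all _ fun q => ?_)
  dsimp only
  rw [Cc.innerConst_apply, inner_smul_right, RCLike.inner_apply, inner_conj_symm]

theorem integralOp_add (c c' : Cc X H) :
    integralOp μ (c + c') = integralOp μ c + integralOp μ c' := by
  ext1 ψ
  refine ext_inner_left ℂ fun η => ?_
  rw [add_apply, inner_add_right, inner_integralOp, inner_integralOp, inner_integralOp,
    ← inner_add_left, ← map_add]
  congr 1
  exact toL2_congr μ fun q => inner_add_left _ _ _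

theorem integralOp_smul (a : ℂ) (c : Cc X H) : integralOp μ (a • c) = a • integralOp μ c := by
  ext1 ψ
  refine ext_inner_left ℂ fun η => ?_
  rw [smul_apply, inner_smul_right, inner_integralOp, inner_integralOp]
  have h : toL2 μ (Cc.innerConst (a • c) η) = (starRingEnd ℂ a) • toL2 μ (Cc.innerConst c η) := by
    rw [← map_smul]
    exact toL2_congr μ fun q => inner_smul_left _ _ _
  rw [h, inner_smul_left, Complex.conj_conj]

theorem integralOp_smul_const (f : Cc X ℂ) (v : H) (c : Cc X H)
    (h : ∀ q, (c : X → H) q = (f : X → ℂ) q • v) (g : Cc X ℂ)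
    (hg : ∀ q, (g : X → ℂ) q = star ((f : X → ℂ) q)) :
    integralOp μ c = InnerProductSpace.rankOne ℂ v (toL2 μ g) := by
  ext1 ψ
  refine ext_inner_left ℂ fun η => ?_
  rw [inner_integralOp, InnerProductSpace.rankOne_apply, inner_smul_right]
  have h : toL2 μ (Cc.innerConst c η) = (inner ℂ v η) • toL2 μ g := by
    rw [← map_smul]
    refine toL2_congr μ fun q => ?_
    change inner ℂ ((c : X → H) q) η = inner ℂ v η * (g : X → ℂ) q
    rw [h, inner_smul_left, hg, mul_comm]; rfl
  rw [h, inner_smul_left, inner_conj_symm, mul_comm]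

/-- Finite sums of elementary tensors `q ↦ f(q) v` in the continuous compactly supported
functions. -/
def elementaryTensors (X H : Type*) [TopologicalSpace X] [NormedAddCommGroup H]
    [NormedSpace ℂ H] : Submodule ℂ (X → H) :=
  Submodule.span ℂ {s | ∃ (f : Cc X ℂ) (v : H), s = fun q => (f : X → ℂ) q • v}

theorem mem_Cc_of_mem_elementaryTensors {s : X → H} (hs : s ∈ elementaryTensors X H) :
    s ∈ Cc X H := by
  refine Submodule.span_le.2 ?_ hs
  rintro _ ⟨f, v, rfl⟩
  exact ⟨f.2.1.smul continuous_const, f.2.2.smul_right⟩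

theorem mul_mem_elementaryTensors {p : X → ℝ} (hp : Continuous p) {s : X → H}
    (hs : s ∈ elementaryTensors X H) : (fun x => (p x : ℂ) • s x) ∈ elementaryTensors X H := by
  induction hs using Submodule.span_induction with
  | mem s h =>
    obtain ⟨f, v, rfl⟩ := h
    have hf := f.2.1
    refine Submodule.subset_span ⟨⟨fun x => (p x : ℂ) * (f : X → ℂ) x, by fun_prop,
      f.2.2.mul_left⟩, v, ?_⟩
    funext x
    exact smul_smul _ _ _
  | zero =>
    have : (fun x => (p x : ℂ) • (0 : X → H) x) = 0 := by funext x; exact smul_zero _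
    rw [this]
    exact Submodule.zero_mem _
  | add s t _ _ h1 h2 =>
    have : (fun x => (p x : ℂ) • (s + t) x) =
        (fun x => (p x : ℂ) • s x) + fun x => (p x : ℂ) • t x := by funext x; exact smul_add _ _ _
    rw [this]
    exact Submodule.add_mem _ h1 h2
  | smul a s _ h =>
    have : (fun x => (p x : ℂ) • (a • s) x) = a • fun x => (p x : ℂ) • s x := by
      funext x; exact smul_comm _ _ _
    rw [this]
    exact Submodule.smul_mem _ a h

theorem isCompactOperator_integralOp_of_mem_elementaryTensors {s : X → H}
    (hs : s ∈ elementaryTensors X H) :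
    ∀ c : Cc X H, (c : X → H) = s → IsCompactOperator (integralOp μ c) := by
  induction hs using Submodule.span_induction with
  | mem s h =>
    obtain ⟨f, v, rfl⟩ := h
    intro c hc
    rw [integralOp_smul_const μ f v c (fun q => congrFun hc q)
      ⟨fun q => star ((f : X → ℂ) q), f.2.1.star, f.2.2.comp_left (star_zero ℂ)⟩ fun _ => rfl]
    exact isCompactOperator_rankOne _ _
  | zero =>
    intro c hc
    obtain rfl : c = 0 := Subtype.ext hc
    rw [← zero_smul ℂ (0 : Cc X H), integralOp_smul, zero_smul]
    exact isCompactOperator_zero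
  | add s t hs ht h1 h2 =>
    intro c hc
    obtain rfl : c = ⟨s, mem_Cc_of_mem_elementaryTensors hs⟩ +
      ⟨t, mem_Cc_of_mem_elementaryTensors ht⟩ := Subtype.ext hc
    rw [integralOp_add]
    exact (h1 _ rfl).add (h2 _ rfl)
  | smul a s hs h =>
    intro c hc
    obtain rfl : c = a • ⟨s, mem_Cc_of_mem_elementaryTensors hs⟩ := Subtype.ext hc
    rw [integralOp_smul]
    exact (h _ rfl).smul a

theorem norm_integralOp_sub_le (c c' : Cc X H) :
    ‖integralOp μ c - integralOp μ c'‖ ≤ ‖toL2 μ c - toL2 μ c'‖ := by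
  have h : integralOp μ c - integralOp μ c' = integralOp μ (c - c') := by
    rw [sub_eq_add_neg c c', integralOp_add, ← neg_one_smul ℂ c', integralOp_smul, neg_one_smul,
      sub_eq_add_neg]
  rw [h, ← map_sub]
  exact norm_integralOp_le μ _

/-- Integral operators are compact: those given by elementary tensors have rank one, and finite sums of
them are dense. -/
theorem isCompactOperator_integralOp [LocallyCompactSpace X] [T2Space X] (c : Cc X H) :
    IsCompactOperator (integralOp μ c) := by
  obtain ⟨L, hL, hap⟩ := Cc.exists_approx c (elementaryTensors X H)
    (fun p hp _ s hs => mul_mem_elementaryTensors hp hs)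
    (fun s hs => (mem_Cc_of_mem_elementaryTensors hs).1) fun x ε hε => by
      obtain ⟨f, hf⟩ := Cc.exists_eq_one x
      exact ⟨_, Submodule.subset_span ⟨f, (c : X → H) x, rfl⟩, by
        rw [hf, one_smul, sub_self, norm_zero]; exact hε⟩
  obtain ⟨K, hK, h0⟩ := Cc.exists_isCompact c
  refine isClosed_setOfPred_isCompactOperator.closure_subset_iff.2 (fun _ h => h)
    (Metric.mem_closure_iff.2 fun ε hε => ?_ :
      integralOp μ c ∈ closure {A : Lp ℂ 2 μ →L[ℂ] H | IsCompactOperator A})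
  set r := Real.sqrt (μ.real (K ∪ L)) with hr
  obtain ⟨s, hs, hsL, hsc⟩ := hap (ε / (r + 1)) (by positivity)
  refine ⟨integralOp μ ⟨s, mem_Cc_of_mem_elementaryTensors hs⟩,
    isCompactOperator_integralOp_of_mem_elementaryTensors μ hs _ rfl, ?_⟩
  rw [dist_eq_norm]
  refine ((norm_integralOp_sub_le μ _ _).trans (norm_toL2_sub_le μ _ _ (hK.union hL)
    (fun x hx => h0 x fun h => hx (Or.inl h)) (fun x hx => hsL x fun h => hx (Or.inr h))
    (M := ε / (r + 1)) (by positivity) fun x => ?_)).trans_lt ?_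
  · rw [norm_sub_rev]; exact (hsc x).le
  · rw [← hr, div_mul_eq_mul_div, div_lt_iff₀ (by positivity)]
    nlinarith [Real.sqrt_nonneg (μ.real (K ∪ L))]

variable [LocallyCompactSpace X] [T2Space X] [SecondCountableTopology X]

/-- The integral operator on `L²(X)` with kernel `κ`, `(T ψ)(r) = ∫ κ(q, r) ψ(q) dq`. -/
def kernelOperator (κ : Cc (X × X) ℂ) : Lp ℂ 2 μ →L[ℂ] Lp ℂ 2 μ :=
  integralOp μ (curryL2 μ κ)

theorem kernelOperator_toL2 (κ : Cc (X × X) ℂ) (ψ : Cc X ℂ) :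
    kernelOperator μ κ (toL2 μ ψ) = ∫ q, (ψ : X → ℂ) q • toL2 μ (Cc.slice κ q) ∂μ :=
  integralOp_toL2 μ _ ψ

theorem kernelOperator_add (κ κ' : Cc (X × X) ℂ) :
    kernelOperator μ (κ + κ') = kernelOperator μ κ + kernelOperator μ κ' := by
  rw [kernelOperator, map_add, integralOp_add]; rfl

theorem kernelOperator_smul (a : ℂ) (κ : Cc (X × X) ℂ) :
    kernelOperator μ (a • κ) = a • kernelOperator μ κ := by
  rw [kernelOperator, map_smul, integralOp_smul]; rfl

theorem kernelOperator_congr {κ κ' : Cc (X × X) ℂ}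
    (h : ∀ q r, (κ : X × X → ℂ) (q, r) = (κ' : X × X → ℂ) (q, r)) :
    kernelOperator μ κ = kernelOperator μ κ' := by
  congr 1; exact Subtype.ext (funext fun p => h p.1 p.2)

theorem isCompactOperator_kernelOperator (κ : Cc (X × X) ℂ) :
    IsCompactOperator (kernelOperator μ κ) := isCompactOperator_integralOp μ _

theorem continuous_kernelOperator {P : Type*} [TopologicalSpace P] {κ : P → Cc (X × X) ℂ}
    (hκ : Continuous fun q : P × X × X => (κ q.1 : X × X → ℂ) q.2)
    (h : LocallyCompactlySupported fun p x => (κ p : X × X → ℂ) x) :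
    Continuous fun p => kernelOperator μ (κ p) := by
  have h1 := continuous_toL2 (μ.prod μ) hκ h
  refine continuous_iff_continuousAt.2 fun p₀ => Metric.continuousAt_iff'.2 fun ε hε => ?_
  filter_upwards [Metric.continuousAt_iff'.1 h1.continuousAt ε hε] with p hp
  refine lt_of_le_of_lt ?_ hp
  rw [dist_eq_norm, dist_eq_norm]
  refine (norm_integralOp_sub_le μ _ _).trans (le_of_eq ?_)
  rw [← map_sub, ← map_sub, ← map_sub, ← sq_eq_sq₀ (norm_nonneg _) (norm_nonneg _),
    ← toL2L2_apply, norm_sq_toL2L2, norm_sq_toL2]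
  exact (MeasureTheory.integral_prod _ (Cc.integrable_norm_sq _ (κ p - κ p₀))).symm

/-- Integral operators with continuous compactly supported kernels are dense in the compact operators. -/
theorem kernelOperator_mem_closure {A : Lp ℂ 2 μ →L[ℂ] Lp ℂ 2 μ} (hA : IsCompactOperator A)
    {ε : ℝ} (hε : 0 < ε) : ∃ κ : Cc (X × X) ℂ, ‖A - kernelOperator μ κ‖ < ε := by
  let R : Submodule ℂ (Lp ℂ 2 μ →L[ℂ] Lp ℂ 2 μ) := LinearMap.range
    ({ toFun := kernelOperator μ, map_add' := kernelOperator_add μ,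
       map_smul' := kernelOperator_smul μ } : Cc (X × X) ℂ →ₗ[ℂ] Lp ℂ 2 μ →L[ℂ] Lp ℂ 2 μ)
  have h1 : Submodule.span ℂ {g : Lp ℂ 2 μ →L[ℂ] Lp ℂ 2 μ | ∃ a b,
      g = InnerProductSpace.rankOne ℂ a b} ≤ R.topologicalClosure := by
    refine Submodule.span_le.2 ?_
    rintro _ ⟨a, b, rfl⟩
    have hcl := R.isClosed_topologicalClosure
    refine (denseRange_toL2 μ).induction_on₂ (p := fun a b =>
      InnerProductSpace.rankOne ℂ a b ∈ R.topologicalClosure) ?_ (fun f g => ?_) a b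
    · exact hcl.preimage (f := fun q : Lp ℂ 2 μ × Lp ℂ 2 μ =>
        InnerProductSpace.rankOne ℂ q.1 q.2)
        (((ContinuousLinearMap.smulRightL ℂ (Lp ℂ 2 μ) (Lp ℂ 2 μ)).continuous.comp
          ((innerSL ℂ).continuous.comp continuous_snd)).clm_apply continuous_fst)
    · refine Submodule.le_topologicalClosure _ ⟨Cc.tensor
        ⟨fun q => star ((g : X → ℂ) q), g.2.1.star, g.2.2.comp_left (star_zero ℂ)⟩ f, ?_⟩
      refine integralOp_smul_const μ
        ⟨fun q => star ((g : X → ℂ) q), g.2.1.star, g.2.2.comp_left (star_zero ℂ)⟩ _ _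
        (fun q => ?_) g fun q => (star_star _).symm
      rw [curryL2_apply, ← map_smul]; rfl
  obtain ⟨g, hg, hgA⟩ := exists_rankOne_approx hA (half_pos hε)
  obtain ⟨_, ⟨κ, rfl⟩, h⟩ := Metric.mem_closure_iff.1 (h1 hg) (ε / 2) (half_pos hε)
  refine ⟨κ, ?_⟩
  rw [dist_eq_norm] at h
  calc _ = ‖(A - g) + (g - kernelOperator μ κ)‖ := by rw [sub_add_sub_cancel]
    _ ≤ ‖A - g‖ + ‖g - kernelOperator μ κ‖ := norm_add_le _ _
    _ < ε := by
      have : ‖g - kernelOperator μ κ‖ < ε / 2 := h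
      linarith

end IntegralOperators

/-! ### Kernels of smooth elements -/

section CoreKernel

open scoped Pointwise

variable {G : Type u} [Group G] [TopologicalSpace G] [IsTopologicalGroup G]
  [MeasurableSpace G] [BorelSpace G] [SecondCountableTopology G] [LocallyCompactSpace G] [T2Space G]
  (φ : Tricharacter G) {N : Subgroup G} [LocallyCompactSpace N]
  (μG : Measure G) [μG.IsHaarMeasure] [μG.IsMulRightInvariant]
  (μN : Measure N) [μN.IsHaarMeasure] [μN.IsMulRightInvariant]

theorem uOp_toL2 (x y : G) (ψ : Cc N ℂ) : uOp φ N μN x y (toL2 μN ψ) =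
    toL2 μN (Cc.circleMul (fun r : N => (φ r x y)⁻¹)
      (φ.continuous_comp continuous_subtype_val continuous_const continuous_const).inv ψ) :=
  mulOp_toL2 _ _ _ _

theorem star_uOp_leftReg_toL2 (n : N) (x y : G) (ψ ψ' : Cc N ℂ)
    (h : ∀ r, (ψ' : N → ℂ) r = (φ r x y : ℂ) * (ψ : N → ℂ) (n⁻¹ * r)) :
    star (uOp φ N μN x y) (leftReg μN n (toL2 μN ψ)) = toL2 μN ψ' := by
  rw [star_uOp, leftReg_toL2, uOp_toL2]
  refine toL2_congr μN fun r => ?_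
  rw [h, φ.swap₂₃ r y x]; rfl

/-- The action of `N` on integral operators in terms of their kernels. -/
theorem kernelAct_kernelOperator (n : N) (x w : G) (κ κ' : Cc (N × N) ℂ)
    (h : ∀ q r : N, (κ' : N × N → ℂ) (q, r) =
      (((φ n x w)⁻¹ * φ r n x * (φ q n w)⁻¹ : Circle) : ℂ) *
        (κ : N × N → ℂ) (n⁻¹ * q, n⁻¹ * r)) :
    kernelAct φ N μN n x w (kernelOperator μN κ) = kernelOperator μN κ' := by
  refine clm_ext_of_denseRange (e := toL2 μN (E := ℂ)) (denseRange_toL2 μN) fun ψ => ?_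
  set A : Op N μN := star (uOp φ N μN n x) * leftReg μN n with hA
  set c : ℂ := (((φ n x w)⁻¹ : Circle) : ℂ) with hc
  have h1 : kernelAct φ N μN n x w (kernelOperator μN κ) (toL2 μN ψ) =
      c • A (kernelOperator μN κ (leftReg μN n⁻¹ (uOp φ N μN n w (toL2 μN ψ)))) := by
    rw [kernelAct, alpha, star_leftReg]; rfl
  rw [h1, uOp_toL2, leftReg_toL2]
  set χ := Cc.translate n⁻¹ (Cc.circleMul (fun r : N => (φ r n w)⁻¹)
    (φ.continuous_comp continuous_subtype_val continuous_const continuous_const).inv ψ) with hχ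
  have hi : Integrable (fun q => (χ : N → ℂ) q • toL2 μN (Cc.slice κ q)) μN :=
    Cc.integrable_smul μN _ (curryL2 μN κ).2.1
  rw [kernelOperator_toL2, kernelOperator_toL2, ← ContinuousLinearMap.integral_comp_comm A hi,
    ← integral_smul, ← integral_mul_left_eq_self _ n⁻¹]
  refine integral_congr_ae (ae_of_all _ fun q => ?_)
  dsimp only
  have h2 : (((φ n x w)⁻¹ : Circle) : ℂ) • A (toL2 μN (Cc.slice κ (n⁻¹ * q))) =
      ((φ q n w : Circle) : ℂ) • toL2 μN (Cc.slice κ' q) := by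
    have h3 := star_uOp_leftReg_toL2 φ μN n n x (Cc.slice κ (n⁻¹ * q))
      (((φ n x w : Circle) : ℂ) • ((φ q n w : Circle) : ℂ) • Cc.slice κ' q) fun r => by
        change _ * (_ * (κ' : N × N → ℂ) (q, r)) = _ * (κ : N × N → ℂ) (n⁻¹ * q, n⁻¹ * r)
        rw [h]
        simp only [Circle.coe_mul, Circle.coe_inv]
        have e1 : ((φ n x w : Circle) : ℂ) ≠ 0 := Circle.coe_ne_zero _
        have e2 : ((φ q n w : Circle) : ℂ) ≠ 0 := Circle.coe_ne_zero _
        field_simp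
    have h4 : A (toL2 μN (Cc.slice κ (n⁻¹ * q))) = _ := h3
    rw [h4, map_smul, map_smul, smul_smul, ← Circle.coe_mul, inv_mul_cancel, Circle.coe_one,
      one_smul]
  have h5 : (χ : N → ℂ) (n⁻¹ * q) = (((φ q n w)⁻¹ : Circle) : ℂ) * (ψ : N → ℂ) q := by
    change (((φ ((n⁻¹⁻¹ * (n⁻¹ * q) : N) : G) n w)⁻¹ : Circle) : ℂ) *
      (ψ : N → ℂ) (n⁻¹⁻¹ * (n⁻¹ * q)) = _
    rw [inv_inv, mul_inv_cancel_left]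
  rw [map_smul, h5, smul_comm, h2, smul_smul, mul_right_comm, ← Circle.coe_mul,
    inv_mul_cancel, Circle.coe_one, one_mul]

/-! ### The kernel of an element of `C_c(N × G × G)` -/

theorem circle_coe_mul_eq {a b c : Circle} (h : a = b * c) {u v : ℂ} (huv : u = v) :
    (a : ℂ) * u = b * (c * v) := by
  rw [h, huv, Circle.coe_mul, mul_assoc]

/-- The function `(q, r) ↦ φ(q, r, w)⁻¹ φ(r, x, w)⁻¹ ζ(r⁻¹ q, r⁻¹ x, r⁻¹ w)` on `N × N`. -/
def coreFun (ζ : Cc (N × G × G) ℂ) (x w : G) (p : N × N) : ℂ :=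
  (((φ p.1 p.2 w)⁻¹ * (φ p.2 x w)⁻¹ : Circle) : ℂ) *
    (ζ : N × G × G → ℂ) (p.2⁻¹ * p.1, (p.2 : G)⁻¹ * x, (p.2 : G)⁻¹ * w)

theorem continuous_coreFun (ζ : Cc (N × G × G) ℂ) :
    Continuous fun p : (G × G) × N × N => coreFun φ ζ p.1.1 p.1.2 p.2 := by
  unfold coreFun
  refine (continuous_circle_coe.comp ((φ.continuous_comp (by fun_prop) (by fun_prop)
    (by fun_prop)).inv.mul (φ.continuous_comp (by fun_prop) (by fun_prop) (by fun_prop)).inv)).mul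
    (ζ.2.1.comp (by fun_prop))

theorem exists_isCompact_coreFun (hN : IsClosed (N : Set G)) (ζ : Cc (N × G × G) ℂ) {U : Set G}
    (hU : IsCompact U) : ∃ K : Set (N × N), IsCompact K ∧ ∀ x w, w ∈ U → ∀ p ∉ K,
      coreFun φ ζ x w p = 0 := by
  obtain ⟨K, hK, h⟩ := Cc.exists_isCompact ζ
  set B : Set G := (fun p : N × G × G => p.2.2) '' K with hB
  have hBc : IsCompact B := hK.image (by fun_prop)
  have hR : IsCompact ((↑) ⁻¹' (U * B⁻¹) : Set N) :=
    hN.isClosedEmbedding_subtypeVal.isCompact_preimage (hU.mul hBc.inv)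
  refine ⟨(fun p : N × N => (p.2 * p.1, p.2)) '' ((Prod.fst '' K) ×ˢ ((↑) ⁻¹' (U * B⁻¹) : Set N)),
    ((hK.image continuous_fst).prod hR).image (by fun_prop), fun x w hw p hp => ?_⟩
  rw [coreFun, h _ fun hm => hp ⟨(p.2⁻¹ * p.1, p.2), ⟨⟨_, hm, rfl⟩, w, hw,
    ((p.2 : G)⁻¹ * w)⁻¹, Set.inv_mem_inv.2 ⟨_, hm, rfl⟩, by simp⟩, by simp⟩, mul_zero]

/-- The integral kernel on `N × N` given by `coreFun`. -/
def coreCc (hN : IsClosed (N : Set G)) (ζ : Cc (N × G × G) ℂ) (x w : G) : Cc (N × N) ℂ :=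
  ⟨coreFun φ ζ x w, by
    obtain ⟨K, hK, h⟩ := exists_isCompact_coreFun φ hN ζ (isCompact_singleton (x := w))
    have hc : Continuous (coreFun φ ζ x w) :=
      (continuous_coreFun φ ζ).comp (f := fun p : N × N => ((x, w), p)) (by fun_prop)
    exact mem_Cc_of_isCompact hc hK (h x w rfl)⟩

theorem coreCc_apply (hN : IsClosed (N : Set G)) (ζ : Cc (N × G × G) ℂ) (x w : G) (q r : N) :
    (coreCc φ hN ζ x w : N × N → ℂ) (q, r) = (((φ q r w)⁻¹ * (φ r x w)⁻¹ : Circle) : ℂ) *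
      (ζ : N × G × G → ℂ) (r⁻¹ * q, (r : G)⁻¹ * x, (r : G)⁻¹ * w) := rfl

theorem continuous_kernelOperator_coreCc (hN : IsClosed (N : Set G)) (ζ : Cc (N × G × G) ℂ) :
    Continuous fun p : G × G => kernelOperator μN (coreCc φ hN ζ p.1 p.2) := by
  refine continuous_kernelOperator μN (continuous_coreFun φ ζ) fun p => ?_
  obtain ⟨U, hU, hUp⟩ := exists_compact_mem_nhds p.2
  obtain ⟨K, hK, h⟩ := exists_isCompact_coreFun φ hN ζ hU
  refine ⟨K, hK, ?_⟩
  filter_upwards [continuous_snd.continuousAt.eventually hUp] with q hq y hy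
  exact h q.1 q.2 hq y hy

theorem coreCc_eq_zero (hN : IsClosed (N : Set G)) {ζ : Cc (N × G × G) ℂ} {K : Set (N × G × G)}
    (h : ∀ p ∉ K, (ζ : N × G × G → ℂ) p = 0) {x w : G}
    (hx : ∀ r : N, ∀ s, (s, (r : G) * x, (r : G) * w) ∉ K) : coreCc φ hN ζ x w = 0 := by
  ext1; funext p
  obtain ⟨q, r⟩ := p
  rw [coreCc_apply, h _ (by simpa using hx r⁻¹ (r⁻¹ * q)), mul_zero]; rfl

theorem kernelOperator_zero : kernelOperator μN (0 : Cc (N × N) ℂ) = 0 := by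
  rw [← zero_smul ℂ (0 : Cc (N × N) ℂ), kernelOperator_smul, zero_smul]

/-- The kernels `K_ζ` are equivariant. This is where `φ = 1` on `N × N × N` is needed: the factor
`φ(q, r, n)` would remain otherwise. -/
theorem kernelOperator_coreCc_mem (hN : IsClosed (N : Set G)) (hφ : ∀ r s t : N, φ r s t = 1)
    (ζ : Cc (N × G × G) ℂ) :
    (fun x w => kernelOperator μN (coreCc φ hN ζ x w)) ∈ kernels φ N μN := by
  obtain ⟨K, hK, h⟩ := Cc.exists_isCompact ζ
  have h0 : ∀ x w, (∀ r : N, ∀ s, (s, (r : G) * x, (r : G) * w) ∉ K) →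
      kernelOperator μN (coreCc φ hN ζ x w) = 0 := fun x w hx => by
    rw [coreCc_eq_zero φ hN h hx, kernelOperator_zero]
  refine ⟨continuous_kernelOperator_coreCc φ μN hN ζ,
    fun x w => isCompactOperator_kernelOperator μN _, fun n x w => ?_,
    ⟨(fun p : N × G × G => p.2.1⁻¹ * p.2.2) '' K, hK.image (by fun_prop), fun x w hx => ?_⟩,
    fun ε hε => ⟨(fun p : N × G × G => p.2.1) '' K, hK.image (by fun_prop), fun x w hx => ?_⟩⟩
  · refine (kernelAct_kernelOperator φ μN n x w _ _ fun q r => ?_).symm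
    have e : (φ q r (n * w))⁻¹ * (φ r (n * x) (n * w))⁻¹ =
        (φ n x w)⁻¹ * φ r n x * (φ q n w)⁻¹ *
          ((φ (n⁻¹ * q : N) (n⁻¹ * r : N) w)⁻¹ * (φ (n⁻¹ * r : N) x w)⁻¹) := by
      have h1 := hφ q r n
      simp only [Subgroup.coe_mul, Subgroup.coe_inv, φ.map_mul₁, φ.map_mul₂, φ.map_mul₃, φ.inv₁,
        φ.inv₂, φ.alternating, φ.alt₂₃, h1]
      rw [φ.swap₂₃ r n x, φ.swap₁₂ r n w]
      apply Additive.ofMul.injective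
      simp only [ofMul_mul, ofMul_inv, ofMul_one]
      abel
    exact circle_coe_mul_eq e (by simp [mul_assoc])
  · exact h0 x w fun r s hm => hx ⟨_, hm, by simp [mul_assoc]⟩
  · dsimp only
    rw [h0 x w fun r s hm => hx r ⟨_, hm, rfl⟩, norm_zero]; exact hε

/-- The operator kernel `K_ζ` of an element `ζ` of `C_c(N × G × G)`. -/
def coreKernel (hN : IsClosed (N : Set G)) (hφ : ∀ r s t : N, φ r s t = 1) :
    Cc (N × G × G) ℂ →ₗ[ℂ] kernels φ N μN where
  toFun ζ := ⟨_, kernelOperator_coreCc_mem φ μN hN hφ ζ⟩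
  map_add' ζ ζ' := by
    ext1; funext x w
    change _ = kernelOperator μN (coreCc φ hN ζ x w) + kernelOperator μN (coreCc φ hN ζ' x w)
    rw [← kernelOperator_add]
    exact kernelOperator_congr μN fun q r => mul_add _ _ _
  map_smul' a ζ := by
    ext1; funext x w
    change _ = a • kernelOperator μN (coreCc φ hN ζ x w)
    rw [← kernelOperator_smul]
    exact kernelOperator_congr μN fun q r => mul_left_comm _ _ _

theorem coreKernel_apply (hN : IsClosed (N : Set G)) (hφ : ∀ r s t : N, φ r s t = 1)
    (ζ : Cc (N × G × G) ℂ) (x w : G) : kernels.fn (coreKernel φ μN hN hφ ζ) x w =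
      kernelOperator μN (coreCc φ hN ζ x w) := rfl

/-- For a fixed value of `w`, the kernels `K_ζ(·, w)` take arbitrary values among the continuous
compactly supported families of integral operators. -/
theorem exists_coreKernel_eq (hN : IsClosed (N : Set G)) (hφ : ∀ r s t : N, φ r s t = 1) (w : G)
    (f : Cc (G × N × N) ℂ) : ∃ ζ : Cc (N × G × G) ℂ, ∀ x,
      kernels.fn (coreKernel φ μN hN hφ ζ) x w = kernelOperator μN (Cc.slice f x) := by
  -- for fixed `w` the arguments of `ζ` in `coreFun` form a closed subspace, from which the required
  -- function extends
  let e : G × N × N → N × G × G := fun p => (p.2.2⁻¹ * p.2.1, (p.2.2 : G)⁻¹ * p.1, (p.2.2 : G)⁻¹ * w)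
  have he : IsClosedEmbedding e := by
    let e₁ : G × N × N ≃ₜ N × G × N :=
      { toFun := fun p => (p.2.2⁻¹ * p.2.1, (p.2.2 : G)⁻¹ * p.1, p.2.2⁻¹)
        invFun := fun p => ((p.2.2 : G)⁻¹ * p.2.1, p.2.2⁻¹ * p.1, p.2.2⁻¹)
        left_inv := fun p => by simp
        right_inv := fun p => by simp
        continuous_toFun := by fun_prop
        continuous_invFun := by fun_prop }
    have e₂ : IsClosedEmbedding fun r : N => (r : G) * w :=
      (Homeomorph.mulRight w).isClosedEmbedding.comp hN.isClosedEmbedding_subtypeVal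
    have e₃ : IsClosedEmbedding (Prod.map id (Prod.map id fun r : N => (r : G) * w) :
        N × G × N → N × G × G) := IsClosedEmbedding.id.prodMap (IsClosedEmbedding.id.prodMap e₂)
    exact e₃.comp e₁.isClosedEmbedding
  let f' : Cc (G × N × N) ℂ := Cc.circleMul
    (fun p => φ p.2.1 p.2.2 w * φ p.2.2 p.1 w)
    ((φ.continuous_comp (by fun_prop) (by fun_prop) (by fun_prop)).mul
      (φ.continuous_comp (by fun_prop) (by fun_prop) (by fun_prop))) f
  obtain ⟨ζ, hζ⟩ := Cc.exists_extension he f'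
  refine ⟨ζ, fun x => ?_⟩
  rw [coreKernel_apply]
  refine kernelOperator_congr μN fun q r => ?_
  have h1 : (ζ : N × G × G → ℂ) (r⁻¹ * q, (r : G)⁻¹ * x, (r : G)⁻¹ * w) =
      ((φ q r w * φ r x w : Circle) : ℂ) * (f : G × N × N → ℂ) (x, q, r) := hζ (x, q, r)
  rw [coreCc_apply, h1, ← mul_assoc, ← Circle.coe_mul, ← mul_inv, inv_mul_cancel, Circle.coe_one,
    one_mul]
  rfl

end CoreKernel

/-! ### The norm of the torus -/

section TorusNorm

open scoped Pointwise

variable {G : Type u} [Group G] [TopologicalSpace G] [IsTopologicalGroup G]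
  [MeasurableSpace G] [BorelSpace G] [SecondCountableTopology G] [LocallyCompactSpace G] [T2Space G]
  {φ : Tricharacter G} {N : Subgroup G} [LocallyCompactSpace N]
  (μG : Measure G) [μG.IsHaarMeasure] [μG.IsMulRightInvariant]
  {μN : Measure N} [μN.IsHaarMeasure] [μN.IsMulRightInvariant]

theorem continuous_norm_columnOp (k : kernels φ N μN) : Continuous fun w => ‖columnOp μG k w‖ := by
  have h : ∀ w, ‖columnOp μG k w‖ =
      Real.sqrt ‖kernels.fn (kernelMul μG (kernelStar k) k) w w‖ := fun w => by
    rw [← norm_columnOp_sq, Real.sqrt_sq (norm_nonneg _)]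
  simp only [h]
  exact Real.continuous_sqrt.comp ((kernels.continuous (kernelMul μG (kernelStar k) k)).comp
    (f := fun w : G => (w, w)) (by fun_prop)).norm

theorem norm_columnOp_translate (k : kernels φ N μN) (n : N) (w : G) :
    ‖columnOp μG k (n * w)‖ = ‖columnOp μG k w‖ := by
  rw [← sq_eq_sq₀ (norm_nonneg _) (norm_nonneg _), norm_columnOp_sq, norm_columnOp_sq,
    kernels.norm_translate]

/-- The kernel `p(w) k(x, w)`, for a continuous `N`-invariant function `p : G → [0, 1]`. -/
def kernels.rescale (k : kernels φ N μN) (p : G → ℝ) (hp : Continuous p) (h0 : ∀ w, 0 ≤ p w)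
    (h1 : ∀ w, p w ≤ 1) (hN : ∀ (n : N) w, p (n * w) = p w) : kernels φ N μN :=
  ⟨fun x w => (p w : ℂ) • kernels.fn k x w, by
    have hc := kernels.continuous k
    obtain ⟨C, hC, h⟩ := kernels.exists_support k
    refine ⟨by fun_prop, fun x w => (kernels.isCompactOperator k x w).smul (p w : ℂ), fun n x w => ?_,
      ⟨C, hC, fun x w hx => by dsimp only; rw [h x w hx, smul_zero]⟩, fun ε hε => ?_⟩
    · dsimp only
      rw [hN, kernels.equivariant, kernelAct_smul]
    · obtain ⟨K, hK, h'⟩ := kernels.vanishing k hε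
      refine ⟨K, hK, fun x w hx => lt_of_le_of_lt ?_ (h' x w hx)⟩
      rw [norm_smul, Complex.norm_real, Real.norm_of_nonneg (h0 w)]
      exact mul_le_of_le_one_left (norm_nonneg _) (h1 w)⟩

theorem columnOp_rescale (k : kernels φ N μN) {p : G → ℝ} (hp : Continuous p) (h0 : ∀ w, 0 ≤ p w)
    (h1 : ∀ w, p w ≤ 1) (hN : ∀ (n : N) w, p (n * w) = p w) (w : G) :
    columnOp μG (kernels.rescale k p hp h0 h1 hN) w = (p w : ℂ) • columnOp μG k w := by
  ext1 ψ
  rw [smul_apply, columnOp_apply, columnOp_apply, ← map_smul]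
  rfl

theorem exists_norm_toL2_eq_one {X : Type*} [TopologicalSpace X] [MeasurableSpace X] [BorelSpace X]
    [LocallyCompactSpace X] [T2Space X] [Nonempty X] (μ : Measure X) [IsFiniteMeasureOnCompacts μ]
    [μ.IsOpenPosMeasure] : ∃ ψ : Cc X ℂ, ‖toL2 μ ψ‖ = 1 := by
  obtain ⟨x⟩ := ‹Nonempty X›
  obtain ⟨f, hf⟩ := Cc.exists_eq_one x
  have hpos : 0 < ‖toL2 μ f‖ ^ 2 := by
    rw [norm_sq_toL2]
    refine (f.2.1.norm.pow 2).integral_pos_of_hasCompactSupport_nonneg_nonzero (x := x)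
      (f.2.2.comp_left (g := fun z : ℂ => ‖z‖ ^ 2) (by simp)) (fun y => by positivity) ?_
    rw [hf]; simp
  have h0 : ‖toL2 μ f‖ ≠ 0 := fun h => by rw [h] at hpos; norm_num at hpos
  refine ⟨((‖toL2 μ f‖⁻¹ : ℝ) : ℂ) • f, ?_⟩
  rw [map_smul, norm_smul, Complex.norm_real, norm_inv, norm_norm, inv_mul_cancel₀ h0]

/-- A given function in `C_c(G × N)` is a column of some kernel of the same norm. -/
theorem exists_kernel_column_eq (hN : IsClosed (N : Set G)) (hφ : ∀ r s t : N, φ r s t = 1)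
    (w₀ : G) (f : Cc (G × N) ℂ) (hf : toL2 μG (curryL2 μN f) ≠ 0) :
    ∃ (k : kernels φ N μN) (ψ : Lp ℂ 2 μN), ‖ψ‖ = 1 ∧
      kernels.column k w₀ ψ = curryL2 μN f ∧ ∀ w, ‖columnOp μG k w‖ ≤ ‖toL2 μG (curryL2 μN f)‖ := by
  obtain ⟨ψ, hψ⟩ := exists_norm_toL2_eq_one μN
  let ψ' : Cc N ℂ := ⟨fun q => star ((ψ : N → ℂ) q), ψ.2.1.star, ψ.2.2.comp_left (star_zero ℂ)⟩
  -- the integral kernels of the operators `v ↦ ⟨ψ, v⟩ f(x)` of rank one, prescribed as `l(x, w₀)`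
  let f' : Cc (G × N × N) ℂ := ⟨fun p => (ψ' : N → ℂ) p.2.1 * (f : G × N → ℂ) (p.1, p.2.2), by
    obtain ⟨K, hK, h⟩ := Cc.exists_isCompact f
    obtain ⟨L, hL, h'⟩ := Cc.exists_isCompact ψ'
    refine mem_Cc_of_isCompact ?_ ((hK.image continuous_fst).prod
      (hL.prod (hK.image continuous_snd))) fun p hp => ?_
    · exact (ψ'.2.1.comp (by fun_prop)).mul (f.2.1.comp (by fun_prop))
    · by_cases h1 : p.2.1 ∈ L
      · rw [h _ fun h2 => hp ⟨⟨_, h2, rfl⟩, h1, ⟨_, h2, rfl⟩⟩, mul_zero]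
      · rw [h' _ h1, zero_mul]⟩
  obtain ⟨ζ, hζ⟩ := exists_coreKernel_eq φ μN hN hφ w₀ f'
  set l := coreKernel φ μN hN hφ ζ
  have hl : ∀ x, kernels.fn l x w₀ = InnerProductSpace.rankOne ℂ
      ((curryL2 μN f : G → Lp ℂ 2 μN) x) (toL2 μN ψ) := fun x => by
    rw [hζ]
    refine integralOp_smul_const μN ψ' _ _ (fun q => ?_) ψ fun q => (star_star _).symm
    rw [curryL2_apply, curryL2_apply, ← map_smul]; rfl
  set m := ‖toL2 μG (curryL2 μN f)‖ with hm
  have hm0 : 0 < m := norm_pos_iff.2 hf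
  have hl0 : ‖columnOp μG l w₀‖ ≤ m := by
    refine ContinuousLinearMap.opNorm_le_bound _ hm0.le fun v => ?_
    have : columnOp μG l w₀ v = (inner ℂ (toL2 μN ψ) v : ℂ) • toL2 μG (curryL2 μN f) := by
      rw [columnOp_apply, ← map_smul]
      refine toL2_congr μG fun x => ?_
      rw [kernels.column_apply, hl]; rfl
    rw [this, norm_smul, mul_comm]
    exact mul_le_mul_of_nonneg_left ((norm_inner_le_norm _ _).trans_eq (by rw [hψ, one_mul]))
      hm0.le
  have hpos : ∀ w, 0 < max ‖columnOp μG l w‖ m := fun w => lt_max_of_lt_right hm0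
  -- the other columns are scaled down to norm at most `m`, by an invariant function which is `1` at `w₀`
  let p : G → ℝ := fun w => m / max ‖columnOp μG l w‖ m
  have hp : Continuous p := continuous_const.div
    ((continuous_norm_columnOp μG l).max continuous_const) fun w => (hpos w).ne'
  have hp0 : ∀ w, 0 ≤ p w := fun w => div_nonneg hm0.le (hpos w).le
  have hp1 : ∀ w, p w ≤ 1 := fun w => (div_le_one (hpos w)).2 (le_max_right _ _)
  have hpN : ∀ (n : N) w, p (n * w) = p w := fun n w => by
    simp only [p, norm_columnOp_translate]
  have hp2 : p w₀ = 1 := by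
    simp only [p, max_eq_right hl0, div_self hm0.ne']
  refine ⟨kernels.rescale l p hp hp0 hp1 hpN, toL2 μN ψ, hψ, ?_, fun w => ?_⟩
  · ext1; funext x
    change (p w₀ : ℂ) • kernels.fn l x w₀ (toL2 μN ψ) = _
    rw [hp2, Complex.ofReal_one, one_smul, hl, InnerProductSpace.rankOne_apply,
      inner_self_eq_norm_sq_to_K, hψ]
    simp
  · rw [columnOp_rescale, norm_smul, Complex.norm_real, Real.norm_of_nonneg (hp0 w)]
    change m / max ‖columnOp μG l w‖ m * _ ≤ m
    rw [div_mul_eq_mul_div, div_le_iff₀ (hpos w)]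
    exact mul_le_mul_of_nonneg_left (le_max_left _ _) hm0.le

theorem norm_columnOp_le_torusL2Norm_ofKernel (k : kernels φ N μN) (w : G) :
    ‖columnOp μG k w‖ ≤ torusL2Norm φ N μG μN (ofKernel φ N μN k) := by
  have h := norm_columnOp_le_torusL2Norm μG (ofKernel φ N μN k) w
  rwa [toKernel_ofKernel] at h

theorem torusL2Norm_ofKernel_le (k : kernels φ N μN) {M : ℝ} (hM : 0 ≤ M)
    (h : ∀ w, ‖columnOp μG k w‖ ≤ M) : torusL2Norm φ N μG μN (ofKernel φ N μN k) ≤ M :=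
  torusL2Norm_le μG _ hM fun w => by rw [toKernel_ofKernel]; exact h w

theorem torusL2Norm_torusMul_le (F F' : torusCore φ N μN) :
    torusL2Norm φ N μG μN (torusMul φ N μG μN F F') ≤
      ‖kernelRep μG (toKernel φ N μN F)‖ * torusL2Norm φ N μG μN F' := by
  rw [torusMul_eq]
  refine torusL2Norm_ofKernel_le μG _ (mul_nonneg (norm_nonneg _) (Real.sqrt_nonneg _)) fun w => ?_
  exact (norm_columnOp_kernelMul_le μG _ _ w).trans
    (mul_le_mul_of_nonneg_left (norm_columnOp_le_torusL2Norm μG F' w) (norm_nonneg _))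

/-- A bound for left multiplication in the norm `‖·‖_2` bounds each fibre of `kernelRep k`: every
vector is a column of a kernel of no larger norm. -/
theorem norm_kernelRep_le_of_torusL2Norm (hN : IsClosed (N : Set G))
    (hφ : ∀ r s t : N, φ r s t = 1) (k : kernels φ N μN) {C : ℝ} (hC : 0 ≤ C)
    (h : ∀ l : kernels φ N μN, torusL2Norm φ N μG μN (ofKernel φ N μN (kernelMul μG k l)) ≤
      C * torusL2Norm φ N μG μN (ofKernel φ N μN l)) : ‖kernelRep μG k‖ ≤ C := by
  refine norm_kernelRep_le_of_fibreConv μG k hC fun w₀ f => ?_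
  -- the zero vector is no column of a kernel scaled to its norm, but the claim is trivial for it
  by_cases hf : toL2 μG (curryL2 μN f) = 0
  · have h1 := norm_fibreConv_le μG k w₀ (curryL2 μN f)
    rw [hf, norm_zero, mul_zero] at h1 ⊢
    exact h1
  obtain ⟨l, ψ, hψ, hl, hln⟩ := exists_kernel_column_eq μG hN hφ w₀ f hf
  have h2 := norm_columnOp_le_torusL2Norm_ofKernel μG (kernelMul μG k l) w₀
  have h3 := torusL2Norm_ofKernel_le μG l (norm_nonneg _) hln
  have h4 := (columnOp μG (kernelMul μG k l) w₀).le_opNorm ψ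
  rw [hψ, mul_one, columnOp_apply, column_kernelMul, hl] at h4
  exact h4.trans (h2.trans ((h l).trans (mul_le_mul_of_nonneg_left h3 hC)))

/-- The norm of the left regular representation of the torus is the operator norm of
`kernelRep`. -/
theorem norm_kernelRep_toKernel (hN : IsClosed (N : Set G)) (hφ : ∀ r s t : N, φ r s t = 1)
    (F : torusCore φ N μN) :
    ‖kernelRep μG (toKernel φ N μN F)‖ = torusNorm φ N μG μN F := by
  have hmem : ‖kernelRep μG (toKernel φ N μN F)‖ ∈ {C : ℝ | 0 ≤ C ∧ ∀ F' ∈ torusCore φ N μN,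
      torusL2Norm φ N μG μN (torusMul φ N μG μN F F') ≤ C * torusL2Norm φ N μG μN F'} :=
    ⟨norm_nonneg _, fun F' hF' => torusL2Norm_torusMul_le μG F ⟨F', hF'⟩⟩
  refine le_antisymm (le_csInf ⟨_, hmem⟩ fun C hC => ?_) (csInf_le ⟨0, fun C hC => hC.1⟩ hmem)
  refine norm_kernelRep_le_of_torusL2Norm μG hN hφ _ hC.1 fun l => ?_
  have h := hC.2 _ (ofKernel φ N μN l).2
  rwa [torusMul_eq, toKernel_ofKernel] at h

end TorusNorm

/-! ### Density of the kernels `K_ζ` -/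

section Density

open scoped Pointwise

variable {G : Type u} [Group G] [TopologicalSpace G] [IsTopologicalGroup G]
  [MeasurableSpace G] [BorelSpace G] [SecondCountableTopology G] [LocallyCompactSpace G] [T2Space G]
  {φ : Tricharacter G} {N : Subgroup G} [LocallyCompactSpace N]
  (μG : Measure G) [μG.IsHaarMeasure] [μG.IsMulRightInvariant]
  {μN : Measure N} [μN.IsHaarMeasure] [μN.IsMulRightInvariant]

/-- The quotient map from `G × G` to its quotient by the diagonal action of `N` from the left,
`(x, w) ↦ (x⁻¹ w, x⁻¹ N)`. -/
def diagQuotient (N : Subgroup G) (p : G × G) : G × (G ⧸ N) :=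
  (p.1⁻¹ * p.2, QuotientGroup.mk p.1⁻¹)

theorem isOpenQuotientMap_diagQuotient : IsOpenQuotientMap (diagQuotient N) := by
  let e : G × G ≃ₜ G × G :=
    { toFun := fun p => (p.1⁻¹ * p.2, p.1⁻¹)
      invFun := fun p => (p.2⁻¹, p.2⁻¹ * p.1)
      left_inv := fun p => by simp
      right_inv := fun p => by simp
      continuous_toFun := by fun_prop
      continuous_invFun := by fun_prop }
  exact (IsOpenQuotientMap.id.prodMap QuotientGroup.isOpenQuotientMap_mk).comp e.isOpenQuotientMap

theorem diagQuotient_translate (n : N) (x w : G) :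
    diagQuotient N (n * x, n * w) = diagQuotient N (x, w) := by
  refine Prod.ext ?_ ?_
  · simp [diagQuotient, mul_assoc]
  · refine QuotientGroup.eq.2 ?_
    simp

theorem exists_eq_of_diagQuotient_eq {p q : G × G} (h : diagQuotient N p = diagQuotient N q) :
    ∃ n : N, q = (n * p.1, n * p.2) := by
  have h1 : p.1⁻¹ * p.2 = q.1⁻¹ * q.2 := congrArg Prod.fst h
  have h2 : p.1⁻¹⁻¹ * q.1⁻¹ ∈ N := QuotientGroup.eq.1 (congrArg Prod.snd h)
  refine ⟨⟨_, h2⟩⁻¹, Prod.ext ?_ ?_⟩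
  · simp
  · simp [mul_assoc, h1]

variable (φ μN) in
/-- The kernels `K_ζ` form a module over the functions on the quotient of `G × G` by `N`. -/
theorem coreKernel_mul (hN : IsClosed (N : Set G)) (hφ : ∀ r s t : N, φ r s t = 1)
    {p : G × (G ⧸ N) → ℝ} (hp : Continuous p) (ζ : Cc (N × G × G) ℂ) :
    ∃ ζ' : Cc (N × G × G) ℂ, ∀ x w, kernels.fn (coreKernel φ μN hN hφ ζ') x w =
      (p (diagQuotient N (x, w)) : ℂ) • kernels.fn (coreKernel φ μN hN hφ ζ) x w := by
  have hq := (isOpenQuotientMap_diagQuotient (N := N)).continuous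
  refine ⟨⟨fun s => (p (diagQuotient N s.2) : ℂ) * (ζ : N × G × G → ℂ) s,
    (Complex.continuous_ofReal.comp (hp.comp (hq.comp continuous_snd))).mul ζ.2.1,
    ζ.2.2.mul_left⟩, fun x w => ?_⟩
  rw [coreKernel_apply, coreKernel_apply, ← kernelOperator_smul]
  refine kernelOperator_congr μN fun q r => ?_
  have h : diagQuotient N ((r : G)⁻¹ * x, (r : G)⁻¹ * w) = diagQuotient N (x, w) :=
    diagQuotient_translate r⁻¹ x w
  rw [coreCc_apply]
  change _ * ((p (diagQuotient N ((r : G)⁻¹ * x, (r : G)⁻¹ * w)) : ℂ) * _) = _ * (_ * _)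
  rw [h]
  exact mul_left_comm _ _ _

theorem exists_coreKernel_sub_lt (hN : IsClosed (N : Set G)) (hφ : ∀ r s t : N, φ r s t = 1)
    (k : kernels φ N μN) (x w : G) {ε : ℝ} (hε : 0 < ε) : ∃ ζ : Cc (N × G × G) ℂ,
      ‖kernels.fn (coreKernel φ μN hN hφ ζ - k) x w‖ < ε := by
  obtain ⟨κ, hκ⟩ := kernelOperator_mem_closure μN (kernels.isCompactOperator k x w) hε
  obtain ⟨f, hf⟩ := Cc.exists_eq_one x
  obtain ⟨ζ, hζ⟩ := exists_coreKernel_eq φ μN hN hφ w (Cc.tensor f κ)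
  refine ⟨ζ, ?_⟩
  have h : kernels.fn (coreKernel φ μN hN hφ ζ) x w = kernelOperator μN κ := by
    rw [hζ]
    refine kernelOperator_congr μN fun q r => ?_
    change (f : G → ℂ) x • _ = _
    rw [hf, one_smul]
  change ‖kernels.fn (coreKernel φ μN hN hφ ζ) x w - kernels.fn k x w‖ < ε
  rw [h, norm_sub_rev]
  exact hκ

theorem fn_coreKernel_sum (hN : IsClosed (N : Set G)) (hφ : ∀ r s t : N, φ r s t = 1) {ι : Type*}
    (t : Finset ι) (ζ : ι → Cc (N × G × G) ℂ) (x w : G) :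
    kernels.fn (coreKernel φ μN hN hφ (∑ y ∈ t, ζ y)) x w =
      ∑ y ∈ t, kernels.fn (coreKernel φ μN hN hφ (ζ y)) x w := by
  have h1 : ((coreKernel φ μN hN hφ (∑ y ∈ t, ζ y) : kernels φ N μN) : G → G → Op N μN) =
      ∑ y ∈ t, (coreKernel φ μN hN hφ (ζ y) : G → G → Op N μN) :=
    map_sum ((kernels φ N μN).subtype ∘ₗ coreKernel φ μN hN hφ) _ _
  refine (congrFun (congrFun h1 x) w).trans ?_
  rw [Finset.sum_apply, Finset.sum_apply]

/-- Kernels are approximated by the kernels `K_ζ`, uniformly and with control of the supports: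
this is a partition of unity argument on the quotient of `G × G` by the diagonal action of `N`. -/
theorem exists_coreKernel_approx (hN : IsClosed (N : Set G))
    (hφ : ∀ r s t : N, φ r s t = 1) (k : kernels φ N μN) : ∃ C' : Set G, IsCompact C' ∧
    ∀ δ > 0, ∃ ζ : Cc (N × G × G) ℂ,
      (∀ x w, ‖kernels.fn (coreKernel φ μN hN hφ ζ - k) x w‖ ≤ 2 * δ) ∧
      ∀ x w, x⁻¹ * w ∉ C' → kernels.fn (coreKernel φ μN hN hφ ζ - k) x w = 0 := by
  have := hN
  obtain ⟨C, hC, hC0⟩ := kernels.exists_support k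
  obtain ⟨C', hC', hCC'⟩ := exists_compact_superset hC
  refine ⟨C', hC', fun δ hδ0 => ?_⟩
  obtain ⟨K, hK, hK0⟩ := kernels.vanishing k hδ0
  have hq := isOpenQuotientMap_diagQuotient (N := N)
  let L : Set (G × (G ⧸ N)) := C ×ˢ ((QuotientGroup.mk : G → G ⧸ N) '' K⁻¹)
  have hLc : IsCompact L := hC.prod (hK.inv.image QuotientGroup.continuous_mk)
  have hex : ∀ y : G × (G ⧸ N), ∃ ζ : Cc (N × G × G) ℂ, ∃ p : G × G, diagQuotient N p = y ∧
      ‖kernels.fn (coreKernel φ μN hN hφ ζ - k) p.1 p.2‖ < δ := fun y => by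
    obtain ⟨p, hp⟩ := hq.surjective y
    obtain ⟨ζ, hζ⟩ := exists_coreKernel_sub_lt hN hφ k p.1 p.2 hδ0
    exact ⟨ζ, p, hp, hζ⟩
  choose ζ p hp hζ using hex
  -- the neighbourhoods where the approximation at a point is good are invariant, hence descend
  let V : G × (G ⧸ N) → Set (G × G) := fun y =>
    {q | ‖kernels.fn (coreKernel φ μN hN hφ (ζ y) - k) q.1 q.2‖ < δ}
  have hV : ∀ y, IsOpen (V y) := fun y =>
    isOpen_lt (kernels.continuous (coreKernel φ μN hN hφ (ζ y) - k)).norm continuous_const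
  let W : G × (G ⧸ N) → Set (G × (G ⧸ N)) := fun y =>
    diagQuotient N '' V y ∩ (interior C' ×ˢ Set.univ)
  have hWlt : ∀ y x w, diagQuotient N (x, w) ∈ W y →
      ‖kernels.fn (coreKernel φ μN hN hφ (ζ y) - k) x w‖ < δ := fun y x w h => by
    obtain ⟨⟨q, hqV, hqe⟩, -⟩ := h
    obtain ⟨n, hn⟩ := exists_eq_of_diagQuotient_eq hqe
    obtain ⟨rfl, rfl⟩ : x = n * q.1 ∧ w = n * q.2 := Prod.mk.inj hn
    rw [kernels.norm_translate]
    exact hqV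
  obtain ⟨t, P, -, hP, hP0, hP1, hPL⟩ := exists_partition hLc W fun y hy =>
    Filter.inter_mem ((hq.isOpenMap _ (hV y)).mem_nhds ⟨p y, hζ y, hp y⟩)
      ((isOpen_interior.prod isOpen_univ).mem_nhds ⟨hCC' hy.1, trivial⟩)
  have hex' : ∀ y, ∃ ζ' : Cc (N × G × G) ℂ, y ∈ t → ∀ x w,
      kernels.fn (coreKernel φ μN hN hφ ζ') x w = (P y (diagQuotient N (x, w)) : ℂ) •
        kernels.fn (coreKernel φ μN hN hφ (ζ y)) x w := fun y => by
    by_cases hy : y ∈ t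
    · obtain ⟨ζ', h⟩ := coreKernel_mul φ μN hN hφ (hP y hy).1 (ζ y)
      exact ⟨ζ', fun _ => h⟩
    · exact ⟨0, fun h => absurd h hy⟩
  choose ζ' hζ' using hex'
  have hsum : ∀ x w, kernels.fn (coreKernel φ μN hN hφ (∑ y ∈ t, ζ' y)) x w =
      ∑ y ∈ t, (P y (diagQuotient N (x, w)) : ℂ) •
        kernels.fn (coreKernel φ μN hN hφ (ζ y)) x w := fun x w => by
    rw [fn_coreKernel_sum]
    exact Finset.sum_congr rfl fun y hy => hζ' y hy x w
  refine ⟨∑ y ∈ t, ζ' y, fun x w => ?_, fun x w hx => ?_⟩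
  · change ‖kernels.fn (coreKernel φ μN hN hφ (∑ y ∈ t, ζ' y)) x w - kernels.fn k x w‖ ≤ 2 * δ
    rw [hsum]
    refine (norm_sum_smul_sub_lt t (fun y => P y (diagQuotient N (x, w))) (fun y => hP0 y _)
      (hP1 _) (fun y => kernels.fn (coreKernel φ μN hN hφ (ζ y)) x w) (kernels.fn k x w) hδ0
      (fun y hy h => ?_) ?_).le
    · refine hWlt y x w ?_
      by_contra hne
      exact h ((hP y hy).2.2 _ hne)
    · by_cases hm : diagQuotient N (x, w) ∈ L
      · exact Or.inl (hPL _ hm)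
      · refine Or.inr ?_
        by_cases h1 : x⁻¹ * w ∈ C
        · refine hK0 x w fun r hr => hm ⟨h1, ((r : G) * x)⁻¹, Set.inv_mem_inv.2 hr, ?_⟩
          refine QuotientGroup.eq.2 ?_
          simp
        · rw [hC0 x w h1, norm_zero]; exact hδ0
  · change kernels.fn (coreKernel φ μN hN hφ (∑ y ∈ t, ζ' y)) x w - kernels.fn k x w = 0
    rw [hsum, hC0 x w fun h => hx (interior_subset (hCC' h)), sub_zero]
    refine Finset.sum_eq_zero fun y hy => ?_
    rw [(hP y hy).2.2 _ fun h => hx (interior_subset h.2.1), Complex.ofReal_zero, zero_smul]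

/-- The operators of the kernels `K_ζ` are dense among those of all kernels. -/
theorem exists_norm_kernelRep_coreKernel_sub_lt (hN : IsClosed (N : Set G))
    (hφ : ∀ r s t : N, φ r s t = 1) (k : kernels φ N μN) {ε : ℝ} (hε : 0 < ε) :
    ∃ ζ : Cc (N × G × G) ℂ, ‖kernelRep μG (coreKernel φ μN hN hφ ζ - k)‖ < ε := by
  obtain ⟨C', hC', h⟩ := exists_coreKernel_approx hN hφ k
  obtain ⟨δ, hδ0, hδ⟩ := exists_pos_mul_lt hε (2 * μG.real C')
  have h3 : 2 * δ * μG.real C' < ε := by rwa [mul_right_comm] at hδ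
  exact (h δ hδ0).imp fun ζ hζ =>
    (norm_kernelRep_le μG _ (mul_nonneg zero_le_two hδ0.le) hζ.1 hC' hζ.2).trans_lt h3

end Density

/-! ### The unitary operator between the two Hilbert spaces -/

section Unitary

open scoped Pointwise

variable {G : Type u} [Group G] [TopologicalSpace G] [IsTopologicalGroup G]
  [MeasurableSpace G] [BorelSpace G] [SecondCountableTopology G] [LocallyCompactSpace G] [T2Space G]
  (φ : Tricharacter G) {N : Subgroup G} [LocallyCompactSpace N]
  (μG : Measure G) [μG.IsHaarMeasure] [μG.IsMulRightInvariant]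
  (μN : Measure N) [μN.IsHaarMeasure] [μN.IsMulRightInvariant]

/-- For `ζ` in `C_c(N × G × G)` and `q ∈ N`, the function
`((w, x), r) ↦ φ(q, r, w)⁻¹ φ(r, x, w)⁻¹ ζ(r⁻¹ q, r⁻¹ x, r⁻¹ w)`. The operator `K_ζ(x, w)` takes
`ψ` to the integral of `ψ(q)` times this function over `q`. -/
def coreVec (q : N) : Cc (N × G × G) ℂ →ₗ[ℂ] Cc ((G × G) × N) ℂ where
  toFun ζ := ⟨fun p => coreFun φ ζ p.1.2 p.1.1 (q, p.2), by
    obtain ⟨K, hK, h⟩ := Cc.exists_isCompact ζ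
    refine mem_Cc_of_isCompact ((continuous_coreFun φ ζ).comp
      (f := fun p : (G × G) × N => ((p.1.2, p.1.1), (q, p.2))) (by fun_prop))
      (hK.image (f := fun p : N × G × G => ((((q * p.1⁻¹ : N) : G) * p.2.2,
        ((q * p.1⁻¹ : N) : G) * p.2.1), q * p.1⁻¹)) (by fun_prop)) fun p hp => ?_
    obtain ⟨⟨w, x⟩, r⟩ := p
    refine mul_eq_zero_of_right _ (h _ fun hm => hp ⟨_, hm, ?_⟩)
    simp⟩
  map_add' _ _ := by ext1; funext p; exact mul_add _ _ _
  map_smul' _ _ := by ext1; funext p; exact mul_left_comm _ _ _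

theorem coreVec_apply (q : N) (ζ : Cc (N × G × G) ℂ) (w x : G) (r : N) :
    (coreVec φ q ζ : (G × G) × N → ℂ) ((w, x), r) = coreFun φ ζ x w (q, r) := rfl

theorem norm_coreFun (ζ : Cc (N × G × G) ℂ) (x w : G) (q r : N) : ‖coreFun φ ζ x w (q, r)‖ =
    ‖(ζ : N × G × G → ℂ) (r⁻¹ * q, (r : G)⁻¹ * x, (r : G)⁻¹ * w)‖ := by
  rw [coreFun, norm_mul, Circle.norm_coe, one_mul]

/-- For every `q` the map `coreVec φ q` is isometric: its substitutions preserve the Haar measures of the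
unimodular group `N` and of `G`, and the factors from `φ` have modulus `1`. -/
theorem norm_toL2L2_coreVec (q : N) (ζ : Cc (N × G × G) ℂ) :
    ‖toL2L2 (μG.prod μG) μN (coreVec φ q ζ)‖ = ‖toL2L2 μN (μG.prod μG) ζ‖ := by
  have := isInvInvariant_of_isMulRightInvariant μN
  rw [← sq_eq_sq₀ (norm_nonneg _) (norm_nonneg _), norm_sq_toL2L2, norm_sq_toL2L2]
  have hc : Continuous (Function.uncurry fun (p : G × G) (r : N) =>
      ‖(coreVec φ q ζ : (G × G) × N → ℂ) (p, r)‖ ^ 2) := (coreVec φ q ζ).2.1.norm.pow 2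
  have hs : HasCompactSupport (Function.uncurry fun (p : G × G) (r : N) =>
      ‖(coreVec φ q ζ : (G × G) × N → ℂ) (p, r)‖ ^ 2) :=
    (coreVec φ q ζ).2.2.comp_left (g := fun z : ℂ => ‖z‖ ^ 2) (by simp)
  rw [integral_integral_swap_of_hasCompactSupport hc hs]
  let H : N → ℝ := fun s => ∫ p, ‖(ζ : N × G × G → ℂ) (s, p)‖ ^ 2 ∂(μG.prod μG)
  have h1 : ∀ r : N, ∫ p, ‖(coreVec φ q ζ : (G × G) × N → ℂ) (p, r)‖ ^ 2 ∂(μG.prod μG) =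
      H (r⁻¹ * q) := fun r => by
    rw [← integral_prod_swap]
    refine Eq.trans ?_ (integral_mul_left_eq_self
      (fun p => ‖(ζ : N × G × G → ℂ) (r⁻¹ * q, p)‖ ^ 2) (((r : G)⁻¹, (r : G)⁻¹) : G × G))
    refine integral_congr_ae (ae_of_all _ fun p => ?_)
    exact congrArg (· ^ 2) (norm_coreFun φ ζ p.1 p.2 q r)
  simp only [h1]
  rw [integral_inv_eq_self (fun r => H (r * q)) μN, integral_mul_right_eq_self H q]

/-- The linear isomorphism of `C_c(N × G × G)` with `C_c(G × G × N)` which takes `ζ` to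
`((w, x), r) ↦ φ(r, x, w)⁻¹ ζ(r⁻¹, r⁻¹ x, r⁻¹ w)`. -/
def coreEquiv : Cc (N × G × G) ℂ ≃ₗ[ℂ] Cc ((G × G) × N) ℂ :=
  LinearEquiv.ofBijective (coreVec φ 1) (by
    refine ⟨fun ζ ζ' h => ?_, fun ξ => ?_⟩
    · ext1; funext p
      obtain ⟨s, z, v⟩ := p
      have h1 := congrFun (congrArg (fun f : Cc ((G × G) × N) ℂ => (f : (G × G) × N → ℂ)) h)
        (((s⁻¹ : N) * v, (s⁻¹ : N) * z), s⁻¹)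
      rw [coreVec_apply, coreVec_apply, coreFun, coreFun] at h1
      simpa using h1
    · let e : N × G × G ≃ₜ (G × G) × N :=
        { toFun := fun p => ((((p.1⁻¹ : N) : G) * p.2.2, ((p.1⁻¹ : N) : G) * p.2.1), p.1⁻¹)
          invFun := fun p => (p.2⁻¹, ((p.2⁻¹ : N) : G) * p.1.2, ((p.2⁻¹ : N) : G) * p.1.1)
          left_inv := fun p => by simp
          right_inv := fun p => by simp
          continuous_toFun := by fun_prop
          continuous_invFun := by fun_prop }
      refine ⟨Cc.circleMul (fun p => φ (e p).2 (e p).1.2 (e p).1.1)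
        (φ.continuous_comp (by fun_prop) (by fun_prop) (by fun_prop))
        ⟨fun p => (ξ : (G × G) × N → ℂ) (e p), ξ.2.1.comp e.continuous,
          ξ.2.2.comp_homeomorph e⟩, ?_⟩
      ext1; funext p
      obtain ⟨⟨w, x⟩, r⟩ := p
      have h1 : e (r⁻¹ * 1, (r : G)⁻¹ * x, (r : G)⁻¹ * w) = ((w, x), r) := by simp [e]
      have h2 : (((φ ((1 : N) : G) r w)⁻¹ * (φ r x w)⁻¹ : Circle) : ℂ) * ((φ r x w : Circle) : ℂ) = 1 := by
        rw [← Circle.coe_mul, Subgroup.coe_one, φ.one₁, inv_one, one_mul, inv_mul_cancel,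
          Circle.coe_one]
      change (((φ ((1 : N) : G) r w)⁻¹ * (φ r x w)⁻¹ : Circle) : ℂ) *
        ((φ (e (r⁻¹ * 1, (r : G)⁻¹ * x, (r : G)⁻¹ * w)).2
          (e (r⁻¹ * 1, (r : G)⁻¹ * x, (r : G)⁻¹ * w)).1.2
          (e (r⁻¹ * 1, (r : G)⁻¹ * x, (r : G)⁻¹ * w)).1.1 : ℂ) *
        (ξ : (G × G) × N → ℂ) (e (r⁻¹ * 1, (r : G)⁻¹ * x, (r : G)⁻¹ * w))) = _
      rw [h1, ← mul_assoc, h2, one_mul])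

/-- The unitary operator `L²(N, L²(G × G)) → L²(G × G, L²(N))` given by `coreEquiv`. -/
def coreUnitary : Lp (HS μG) 2 μN ≃ₗᵢ[ℂ] Lp (Lp ℂ 2 μN) 2 (μG.prod μG) :=
  (coreEquiv φ).extendOfIsometry (toL2L2 μN (μG.prod μG)) (toL2L2 (μG.prod μG) μN)
    (denseRange_toL2L2 μN (μG.prod μG)) (denseRange_toL2L2 (μG.prod μG) μN)
    (norm_toL2L2_coreVec φ μG μN 1)

theorem coreUnitary_toL2L2 (ζ : Cc (N × G × G) ℂ) :
    coreUnitary φ μG μN (toL2L2 μN (μG.prod μG) ζ) =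
      toL2L2 (μG.prod μG) μN (coreVec φ 1 ζ) :=
  LinearEquiv.extendOfIsometry_eq _ _ (f := coreEquiv φ) (denseRange_toL2L2 μN (μG.prod μG))
    (denseRange_toL2L2 (μG.prod μG) μN) (norm_toL2L2_coreVec φ μG μN 1) ζ

end Unitary

/-! ### The product of smooth elements -/

section CoreMul

variable {G : Type u} [Group G] [TopologicalSpace G] [IsTopologicalGroup G]
  [MeasurableSpace G] [BorelSpace G] [SecondCountableTopology G] [LocallyCompactSpace G] [T2Space G]
  (φ : Tricharacter G) {N : Subgroup G} [LocallyCompactSpace N]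
  (μG : Measure G) [μG.IsHaarMeasure] [μG.IsMulRightInvariant]
  (μN : Measure N) [μN.IsHaarMeasure] [μN.IsMulRightInvariant]

/-- The integrand of the product of `ζ₁` and `ζ₂`, as a function of `(y, s, t, z, v)`. -/
def coreMulIntegrand (ζ₁ ζ₂ : Cc (N × G × G) ℂ) : Cc (G × N × N × G × G) ℂ :=
  ⟨fun p => ((φ p.2.2.2.1 p.1 p.2.2.2.2 * (φ p.2.1 p.1 p.2.2.2.2)⁻¹ *
      φ p.2.2.2.2 p.2.1 ((p.2.1⁻¹ * p.2.2.1 : N) : G) : Circle) : ℂ) *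
      ((ζ₁ : N × G × G → ℂ) (p.2.1, p.2.2.2.1, p.1) *
        (ζ₂ : N × G × G → ℂ) (p.2.1⁻¹ * p.2.2.1, (p.2.1 : G)⁻¹ * p.1,
          (p.2.1 : G)⁻¹ * p.2.2.2.2)), by
    obtain ⟨K₁, hK₁, h₁⟩ := Cc.exists_isCompact ζ₁
    obtain ⟨K₂, hK₂, h₂⟩ := Cc.exists_isCompact ζ₂
    refine mem_Cc_of_isCompact ?_ ((hK₁.prod hK₂).image
      (f := fun q : (N × G × G) × N × G × G =>
        (q.1.2.2, q.1.1, q.1.1 * q.2.1, q.1.2.1, (q.1.1 : G) * q.2.2.2)) (by fun_prop))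
      fun p hp => ?_
    · refine (continuous_circle_coe.comp (((φ.continuous_comp ?_ ?_ ?_).mul
        (φ.continuous_comp ?_ ?_ ?_).inv).mul (φ.continuous_comp ?_ ?_ ?_))).mul
        ((ζ₁.2.1.comp ?_).mul (ζ₂.2.1.comp ?_)) <;> fun_prop
    · obtain ⟨y, s, t, z, v⟩ := p
      by_cases h : (s, z, y) ∈ K₁
      · rw [h₂ _ fun h' => hp ⟨(_, _), ⟨h, h'⟩, by simp⟩, mul_zero, mul_zero]
      · rw [h₁ _ h, zero_mul, mul_zero]⟩

/-- The product of elements of `C_c(N × G × G)`, regarded as elements of `C_c(N, HS)`. -/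
def coreMul (ζ₁ ζ₂ : Cc (N × G × G) ℂ) : Cc (N × G × G) ℂ :=
  Cc.integralFst μN (Cc.integralFst μG (coreMulIntegrand φ ζ₁ ζ₂))

/-- The element `t ↦ L_{g(t)}` of `C_c(N, K_φ)` given by an element `g` of `C_c(N, HS)`. -/
def hsElement : Cc N (HS μG) →ₗ[ℂ] aphiCore φ N μG where
  toFun g := ⟨hsMul φ μG ∘ (g : N → HS μG), hsMul_comp_mem_aphiCore φ N μG g.2⟩
  map_add' _ _ := by ext1; funext t; exact hsMul_add_left φ μG _ _
  map_smul' _ _ := by ext1; funext t; exact hsMul_smul_left φ μG _ _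

theorem hsElement_apply (g : Cc N (HS μG)) (t : N) :
    (hsElement φ μG g : N → (HS μG →L[ℂ] HS μG)) t = hsMul φ μG ((g : N → HS μG) t) := rfl

theorem aphiIntegrand_hsElement (ζ₁ ζ₂ : Cc (N × G × G) ℂ) (s t : N) (κ : Cc (G × G) ℂ)
    (hκ : ∀ p, (κ : G × G → ℂ) p =
      ∫ y, (coreMulIntegrand φ ζ₁ ζ₂ : G × N × N × G × G → ℂ) (y, s, t, p) ∂μG) :
    (aphiIntegrand φ N μG (hsElement φ μG (curryL2 (μG.prod μG) ζ₁))
      (curryL2 (μG.prod μG) ζ₂) : N × N → HS μG) (s, t) = toL2 (μG.prod μG) κ := by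
  rw [aphiIntegrand_apply, hsElement_apply, curryL2_apply, curryL2_apply, gamma_toL2, hsMul_toL2,
    uRight, mulOp_toL2]
  refine toL2_congr _ fun p => ?_
  obtain ⟨z, v⟩ := p
  rw [hκ]
  refine (integral_const_mul _ _).symm.trans (integral_congr_ae (ae_of_all _ fun y => ?_))
  change ((φ v s ((s⁻¹ * t : N) : G) : Circle) : ℂ) * ((φ z y v : ℂ) *
    (ζ₁ : N × G × G → ℂ) (s, z, y) * ((((φ s y v)⁻¹ : Circle) : ℂ) *
      (ζ₂ : N × G × G → ℂ) (s⁻¹ * t, (s : G)⁻¹ * y, (s : G)⁻¹ * v))) =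
    ((φ z y v * (φ s y v)⁻¹ * φ v s ((s⁻¹ * t : N) : G) : Circle) : ℂ) *
      ((ζ₁ : N × G × G → ℂ) (s, z, y) *
        (ζ₂ : N × G × G → ℂ) (s⁻¹ * t, (s : G)⁻¹ * y, (s : G)⁻¹ * v))
  rw [Circle.coe_mul, Circle.coe_mul]
  ring

/-- On elements of `C_c(N × G × G)` the product of the crossed product is `coreMul`. -/
theorem aphiConv_hsElement (ζ₁ ζ₂ : Cc (N × G × G) ℂ) :
    aphiConv φ N μG μN (hsElement φ μG (curryL2 (μG.prod μG) ζ₁)) (curryL2 (μG.prod μG) ζ₂) =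
      curryL2 (μG.prod μG) (coreMul φ μG μN ζ₁ ζ₂) := by
  ext1; funext t
  rw [aphiConv_apply, curryL2_apply]
  let P := Cc.integralFst μG (coreMulIntegrand φ ζ₁ ζ₂)
  let f : Cc (N × G × G) ℂ := ⟨fun q => (P : N × N × G × G → ℂ) (q.1, t, q.2), by
    obtain ⟨K, hK, h⟩ := Cc.exists_isCompact P
    exact mem_Cc_of_isCompact (P.2.1.comp (f := fun q : N × G × G => (q.1, t, q.2)) (by fun_prop))
      (hK.image (f := fun p : N × N × G × G => (p.1, p.2.2)) (by fun_prop))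
      fun q hq => h _ fun h' => hq ⟨_, h', rfl⟩⟩
  rw [← integral_toL2 μN (μG.prod μG) f _ fun _ => rfl]
  exact integral_congr_ae (ae_of_all _ fun s =>
    aphiIntegrand_hsElement φ μG ζ₁ ζ₂ s t _ fun _ => rfl)

theorem aphiRep_hsElement (ζ₁ ζ₂ : Cc (N × G × G) ℂ) :
    aphiRep φ N μG μN (hsElement φ μG (curryL2 (μG.prod μG) ζ₁))
      (toL2L2 μN (μG.prod μG) ζ₂) = toL2L2 μN (μG.prod μG) (coreMul φ μG μN ζ₁ ζ₂) := by
  rw [toL2L2_apply, aphiRep_toL2, aphiConv_hsElement, toL2L2_apply]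

/-- The integrand of the action of `K_{ζ₁}` on the vectors `coreVec φ q ζ₂`, as a function of
`(p, (v, r))`. -/
def kernelCoreIntegrand (ζ₁ ζ₂ : Cc (N × G × G) ℂ) (q : N) (w x : G) : Cc (N × G × N) ℂ :=
  ⟨fun a => (φ x a.2.1 w : ℂ) * (coreFun φ ζ₂ a.2.1 w (q, a.1) *
      coreFun φ ζ₁ x a.2.1 (a.1, a.2.2)), by
    obtain ⟨K₁, hK₁, h₁⟩ := Cc.exists_isCompact ζ₁
    obtain ⟨K₂, hK₂, h₂⟩ := Cc.exists_isCompact ζ₂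
    refine mem_Cc_of_isCompact ?_ ((hK₁.prod hK₂).image
      (f := fun b : (N × G × G) × N × G × G =>
        (q * b.2.1⁻¹, ((q * b.2.1⁻¹ : N) : G) * b.2.2.1, q * b.2.1⁻¹ * b.1.1⁻¹)) (by fun_prop))
      fun a ha => ?_
    · refine (continuous_circle_coe.comp (φ.continuous_comp ?_ ?_ ?_)).mul
        (((continuous_coreFun φ ζ₂).comp
          (f := fun a : N × G × N => ((a.2.1, w), (q, a.1))) ?_).mul
        ((continuous_coreFun φ ζ₁).comp
          (f := fun a : N × G × N => ((x, a.2.1), (a.1, a.2.2))) ?_)) <;> fun_prop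
    · obtain ⟨p, v, r⟩ := a
      by_cases h : (p⁻¹ * q, (p : G)⁻¹ * v, (p : G)⁻¹ * w) ∈ K₂
      · have h1 : coreFun φ ζ₁ x v (p, r) = 0 :=
          mul_eq_zero_of_right _ (h₁ _ fun h' => ha ⟨(_, _), ⟨h', h⟩, by simp⟩)
        rw [h1, mul_zero, mul_zero]
      · have h1 : coreFun φ ζ₂ v w (q, p) = 0 := mul_eq_zero_of_right _ (h₂ _ h)
        rw [h1, zero_mul, mul_zero]⟩

/-- The substitution `p = r s`, `v = r y` turns the integrand of the action of `K_{ζ₁}` into that of the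
product. The identity of the phases again uses `φ = 1` on `N × N × N`. -/
theorem kernelCoreIntegrand_substitution (hφ : ∀ r s t : N, φ r s t = 1)
    (ζ₁ ζ₂ : Cc (N × G × G) ℂ) (q r s : N) (w x y : G) :
    (kernelCoreIntegrand φ ζ₁ ζ₂ q w x : N × G × N → ℂ) (r * s, (r : G) * y, r) =
      (((φ q r w)⁻¹ * (φ r x w)⁻¹ : Circle) : ℂ) *
        (coreMulIntegrand φ ζ₁ ζ₂ : G × N × N × G × G → ℂ)
          (y, s, r⁻¹ * q, (r : G)⁻¹ * x, (r : G)⁻¹ * w) := by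
  -- both sides are expanded into characters of the variables and compared additively
  have e : φ x (r * y) w * ((φ q (r * s : N) w)⁻¹ * (φ (r * s : N) (r * y) w)⁻¹) *
      ((φ (r * s : N) r (r * y))⁻¹ * (φ r x (r * y))⁻¹) =
      ((φ q r w)⁻¹ * (φ r x w)⁻¹) * (φ ((r : G)⁻¹ * x) y ((r : G)⁻¹ * w) *
        (φ s y ((r : G)⁻¹ * w))⁻¹ * φ ((r : G)⁻¹ * w) s ((s⁻¹ * (r⁻¹ * q) : N) : G)) := by
    have h1 := hφ r s q
    simp only [Subgroup.coe_mul, Subgroup.coe_inv, φ.map_mul₁, φ.map_mul₂, φ.map_mul₃, φ.inv₁,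
      φ.inv₃, φ.alternating, φ.alt₁₃, φ.alt₂₃, h1]
    rw [φ.swap₁₂ r x w, φ.cycle r x y, φ.swap₂₃ s r y, φ.cycle w s r, φ.swap₁₂ s q w, φ.cycle w s q]
    apply Additive.ofMul.injective
    simp only [ofMul_mul, ofMul_inv, ofMul_one]
    abel
  have e1 : (ζ₁ : N × G × G → ℂ) (r⁻¹ * (r * s), (r : G)⁻¹ * x, (r : G)⁻¹ * (r * y)) =
      (ζ₁ : N × G × G → ℂ) (s, (r : G)⁻¹ * x, y) := by simp
  have e2 : (ζ₂ : N × G × G → ℂ) ((r * s)⁻¹ * q, ((r * s : N) : G)⁻¹ * (r * y),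
      ((r * s : N) : G)⁻¹ * w) = (ζ₂ : N × G × G → ℂ) (s⁻¹ * (r⁻¹ * q), (s : G)⁻¹ * y,
        (s : G)⁻¹ * ((r : G)⁻¹ * w)) := by simp [mul_assoc]
  change (φ x (r * y) w : ℂ) * ((((φ q (r * s : N) w)⁻¹ * (φ (r * s : N) (r * y) w)⁻¹ : Circle) : ℂ) *
    (ζ₂ : N × G × G → ℂ) ((r * s)⁻¹ * q, ((r * s : N) : G)⁻¹ * (r * y),
      ((r * s : N) : G)⁻¹ * w) * ((((φ (r * s : N) r (r * y))⁻¹ * (φ r x (r * y))⁻¹ : Circle) : ℂ) *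
    (ζ₁ : N × G × G → ℂ) (r⁻¹ * (r * s), (r : G)⁻¹ * x, (r : G)⁻¹ * (r * y)))) =
    (((φ q r w)⁻¹ * (φ r x w)⁻¹ : Circle) : ℂ) *
    (((φ ((r : G)⁻¹ * x) y ((r : G)⁻¹ * w) * (φ s y ((r : G)⁻¹ * w))⁻¹ *
      φ ((r : G)⁻¹ * w) s ((s⁻¹ * (r⁻¹ * q) : N) : G) : Circle) : ℂ) *
    ((ζ₁ : N × G × G → ℂ) (s, (r : G)⁻¹ * x, y) * (ζ₂ : N × G × G → ℂ) (s⁻¹ * (r⁻¹ * q), (s : G)⁻¹ * y,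
        (s : G)⁻¹ * ((r : G)⁻¹ * w))))
  rw [e1, e2]
  generalize (ζ₁ : N × G × G → ℂ) (s, (r : G)⁻¹ * x, y) = u
  generalize (ζ₂ : N × G × G → ℂ) (s⁻¹ * (r⁻¹ * q), (s : G)⁻¹ * y,
        (s : G)⁻¹ * ((r : G)⁻¹ * w)) = v
  generalize φ x (r * y) w = a at *
  generalize (φ q (r * s : N) w)⁻¹ * (φ (r * s : N) (r * y) w)⁻¹ = b at *
  generalize (φ (r * s : N) r (r * y))⁻¹ * (φ r x (r * y))⁻¹ = c at *
  generalize (φ q r w)⁻¹ * (φ r x w)⁻¹ = d at *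
  generalize φ ((r : G)⁻¹ * x) y ((r : G)⁻¹ * w) * (φ s y ((r : G)⁻¹ * w))⁻¹ *
      φ ((r : G)⁻¹ * w) s ((s⁻¹ * (r⁻¹ * q) : N) : G) = f at *
  have e3 : (a : ℂ) * b * c = d * f := by
    rw [← Circle.coe_mul, ← Circle.coe_mul, e, Circle.coe_mul]
  linear_combination (u * v) * e3

/-- The kernel `K_{ζ₁}` acts on the vectors `coreVec φ q ζ₂` by the product: up to the unitary
operator this is the left regular representation, for every `q`. -/
theorem kernelConv_coreKernel (hN : IsClosed (N : Set G)) (hφ : ∀ r s t : N, φ r s t = 1)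
    (ζ₁ ζ₂ : Cc (N × G × G) ℂ) (q : N) :
    kernelConv μG (coreKernel φ μN hN hφ ζ₁) (curryL2 μN (coreVec φ q ζ₂)) =
      curryL2 μN (coreVec φ q (coreMul φ μG μN ζ₁ ζ₂)) := by
  ext1; funext a
  obtain ⟨w, x⟩ := a
  rw [kernelConv_apply, curryL2_apply]
  let D := kernelCoreIntegrand φ ζ₁ ζ₂ q w x
  let D' : Cc (G × N) ℂ := Cc.integralFst μN D
  have h1 : ∀ v, (φ x v w : ℂ) • kernels.fn (coreKernel φ μN hN hφ ζ₁) x v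
      ((curryL2 μN (coreVec φ q ζ₂) : G × G → Lp ℂ 2 μN) (w, v)) = toL2 μN (Cc.slice D' v) := by
    intro v
    rw [curryL2_apply, coreKernel_apply, kernelOperator_toL2, ← integral_smul]
    let f : Cc (N × N) ℂ := ⟨fun b => (D : N × G × N → ℂ) (b.1, v, b.2), by
      obtain ⟨K, hK, h⟩ := Cc.exists_isCompact D
      exact mem_Cc_of_isCompact (D.2.1.comp (f := fun b : N × N => (b.1, v, b.2)) (by fun_prop))
        (hK.image (f := fun p : N × G × N => (p.1, p.2.2)) (by fun_prop))
        fun q hq => h _ fun h' => hq ⟨_, h', rfl⟩⟩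
    rw [← integral_toL2 μN μN f _ fun _ => rfl]
    refine integral_congr_ae (ae_of_all _ fun p => ?_)
    dsimp only
    rw [← map_smul, ← map_smul]
    exact toL2_congr μN fun r => rfl
  simp only [h1]
  rw [integral_toL2 μG μN D' (Cc.integralFst μG D') fun _ => rfl]
  refine toL2_congr μN fun r => ?_
  change ∫ v, ∫ p, (D : N × G × N → ℂ) (p, v, r) ∂μN ∂μG =
    (((φ q r w)⁻¹ * (φ r x w)⁻¹ : Circle) : ℂ) *
      ∫ s, ∫ y, (coreMulIntegrand φ ζ₁ ζ₂ : G × N × N × G × G → ℂ)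
          (y, s, r⁻¹ * q, (r : G)⁻¹ * x, (r : G)⁻¹ * w) ∂μG ∂μN
  let I : Cc (G × N) ℂ := ⟨fun b => (coreMulIntegrand φ ζ₁ ζ₂ : G × N × N × G × G → ℂ)
          (b.1, b.2, r⁻¹ * q, (r : G)⁻¹ * x, (r : G)⁻¹ * w), by
      obtain ⟨K, hK, h⟩ := Cc.exists_isCompact (coreMulIntegrand φ ζ₁ ζ₂)
      exact mem_Cc_of_isCompact ((coreMulIntegrand φ ζ₁ ζ₂).2.1.comp
        (f := fun b : G × N => (b.1, b.2, r⁻¹ * q, (r : G)⁻¹ * x, (r : G)⁻¹ * w)) (by fun_prop))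
        (hK.image (f := fun p : G × N × N × G × G => (p.1, p.2.1)) (by fun_prop))
        fun q hq => h _ fun h' => hq ⟨_, h', rfl⟩⟩
  rw [← Cc.integral_swap μG μN I, ← integral_const_mul, ← integral_mul_left_eq_self _ (r : G)]
  refine integral_congr_ae (ae_of_all _ fun y => ?_)
  dsimp only
  rw [← integral_const_mul, ← integral_mul_left_eq_self _ r]
  exact integral_congr_ae (ae_of_all _ fun s =>
    kernelCoreIntegrand_substitution φ hφ ζ₁ ζ₂ q r s w x y)

theorem kernelRep_coreKernel (hN : IsClosed (N : Set G)) (hφ : ∀ r s t : N, φ r s t = 1)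
    (ζ₁ ζ₂ : Cc (N × G × G) ℂ) (q : N) :
    kernelRep μG (coreKernel φ μN hN hφ ζ₁) (toL2L2 (μG.prod μG) μN (coreVec φ q ζ₂)) =
      toL2L2 (μG.prod μG) μN (coreVec φ q (coreMul φ μG μN ζ₁ ζ₂)) := by
  rw [toL2L2_apply, kernelRep_toL2, kernelConv_coreKernel, toL2L2_apply]

end CoreMul

/-! ### Columns of the kernels of smooth elements -/

section ColumnOperators

variable {G : Type u} [Group G] [TopologicalSpace G] [IsTopologicalGroup G]
  [MeasurableSpace G] [BorelSpace G] [SecondCountableTopology G] [LocallyCompactSpace G] [T2Space G]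
  (φ : Tricharacter G) {N : Subgroup G} [LocallyCompactSpace N]
  (μG : Measure G) [μG.IsHaarMeasure] [μG.IsMulRightInvariant]
  (μN : Measure N) [μN.IsHaarMeasure] [μN.IsMulRightInvariant]

/-- The function `((q, p), r) ↦ ψ(q) (coreVec φ q ζ)(p, r)`. -/
def columnIntegrand (ψ : Cc N ℂ) (ζ : Cc (N × G × G) ℂ) : Cc ((N × G × G) × N) ℂ :=
  ⟨fun a => (ψ : N → ℂ) a.1.1 * coreFun φ ζ a.1.2.2 a.1.2.1 (a.1.1, a.2), by
    obtain ⟨K, hK, h⟩ := Cc.exists_isCompact ζ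
    obtain ⟨L, hL, h'⟩ := Cc.exists_isCompact ψ
    refine mem_Cc_of_isCompact ((ψ.2.1.comp (by fun_prop)).mul ((continuous_coreFun φ ζ).comp
      (f := fun a : (N × G × G) × N => ((a.1.2.2, a.1.2.1), (a.1.1, a.2))) (by fun_prop)))
      ((hL.prod hK).image (f := fun b : N × N × G × G =>
        ((b.1, ((b.1 * b.2.1⁻¹ : N) : G) * b.2.2.2, ((b.1 * b.2.1⁻¹ : N) : G) * b.2.2.1),
          b.1 * b.2.1⁻¹)) (by fun_prop)) fun a ha => ?_
    obtain ⟨⟨q, w, x⟩, r⟩ := a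
    by_cases hq : q ∈ L
    · have h1 : coreFun φ ζ x w (q, r) = 0 :=
        mul_eq_zero_of_right _ (h _ fun hm => ha ⟨(_, _), ⟨hq, hm⟩, by simp⟩)
      rw [h1, mul_zero]
    · rw [h' q hq, zero_mul]⟩

/-- The function `(w, x) ↦ K_ζ(x, w) ψ`. -/
def columnVec (ψ : Cc N ℂ) : Cc (N × G × G) ℂ →ₗ[ℂ] Cc (G × G) (Lp ℂ 2 μN) where
  toFun ζ := Cc.integralFst μN (curryL2 μN (columnIntegrand φ ψ ζ))
  map_add' ζ ζ' := by
    ext1; funext p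
    refine Eq.trans ?_ (integral_add
      (Cc.integrable_fst μN (curryL2 μN (columnIntegrand φ ψ ζ)) p)
      (Cc.integrable_fst μN (curryL2 μN (columnIntegrand φ ψ ζ')) p))
    refine integral_congr_ae (ae_of_all _ fun q => ?_)
    simp only [curryL2_apply]
    rw [← map_add]
    refine toL2_congr μN fun r => ?_
    exact (congrArg _ (mul_add _ _ _)).trans (mul_add _ _ _)
  map_smul' c ζ := by
    ext1; funext p
    refine Eq.trans ?_ (integral_smul c _)
    refine integral_congr_ae (ae_of_all _ fun q => ?_)
    simp only [curryL2_apply]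
    rw [← map_smul]
    refine toL2_congr μN fun r => ?_
    exact (congrArg _ (mul_left_comm _ _ _)).trans (mul_left_comm _ _ _)

theorem columnVec_apply (hN : IsClosed (N : Set G)) (hφ : ∀ r s t : N, φ r s t = 1)
    (ψ : Cc N ℂ) (ζ : Cc (N × G × G) ℂ) (w x : G) :
    (columnVec φ μN ψ ζ : G × G → Lp ℂ 2 μN) (w, x) =
      kernels.fn (coreKernel φ μN hN hφ ζ) x w (toL2 μN ψ) := by
  rw [coreKernel_apply, kernelOperator_toL2]
  refine integral_congr_ae (ae_of_all _ fun q => ?_)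
  refine Eq.trans (toL2_congr (E := ℂ) μN fun r => ?_)
    (map_smul (toL2 (E := ℂ) μN) ((ψ : N → ℂ) q) (Cc.slice (coreCc φ hN ζ x w) q))
  rfl

theorem toL2_slice_columnIntegrand (ψ : Cc N ℂ) (ζ : Cc (N × G × G) ℂ) (q : N) :
    toL2 (μG.prod μG) (Cc.slice (curryL2 μN (columnIntegrand φ ψ ζ)) q) =
      (ψ : N → ℂ) q • toL2L2 (μG.prod μG) μN (coreVec φ q ζ) := by
  rw [toL2L2_apply, ← map_smul]
  refine toL2_congr _ fun p => ?_
  refine Eq.trans (toL2_congr (E := ℂ) μN fun r => ?_)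
    (map_smul (toL2 (E := ℂ) μN) ((ψ : N → ℂ) q) (Cc.slice (coreVec φ q ζ) p))
  rfl

/-- The columns of `K_ζ` are superpositions of the isometric images `coreVec φ q ζ`, with weights `ψ(q)`;
hence they depend boundedly on `ζ` in the norm of `L²(N, HS)`. -/
theorem toL2_columnVec (ψ : Cc N ℂ) (ζ : Cc (N × G × G) ℂ) :
    toL2 (μG.prod μG) (columnVec φ μN ψ ζ) =
      ∫ q, (ψ : N → ℂ) q • toL2L2 (μG.prod μG) μN (coreVec φ q ζ) ∂μN := by
  rw [← integral_toL2 μN (μG.prod μG) (curryL2 μN (columnIntegrand φ ψ ζ)) _ fun _ => rfl]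
  exact integral_congr_ae (ae_of_all _ fun q => toL2_slice_columnIntegrand φ μG μN ψ ζ q)

theorem integrable_smul_coreVec (ψ : Cc N ℂ) (ζ : Cc (N × G × G) ℂ) :
    Integrable (fun q => (ψ : N → ℂ) q • toL2L2 (μG.prod μG) μN (coreVec φ q ζ)) μN := by
  have h := Cc.integrable μN (curryL2 (μG.prod μG) (curryL2 μN (columnIntegrand φ ψ ζ)))
  exact h.congr (ae_of_all _ fun q => toL2_slice_columnIntegrand φ μG μN ψ ζ q)

theorem norm_toL2_columnVec_le (ψ : Cc N ℂ) (ζ : Cc (N × G × G) ℂ) :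
    ‖toL2 (μG.prod μG) (columnVec φ μN ψ ζ)‖ ≤
      (∫ q, ‖(ψ : N → ℂ) q‖ ∂μN) * ‖toL2L2 μN (μG.prod μG) ζ‖ := by
  rw [toL2_columnVec, ← integral_mul_const]
  refine norm_integral_le_of_norm_le ((Cc.integrable μN ψ).norm.mul_const _)
    (ae_of_all _ fun q => ?_)
  rw [norm_smul, norm_toL2L2_coreVec]

/-- The bounded operator `L²(N, HS) → L²(G × G, L²(N))` which takes `ζ` in `C_c(N × G × G)` to
the function `(w, x) ↦ K_ζ(x, w) ψ`. -/
def columnOperator (ψ : Cc N ℂ) : Lp (HS μG) 2 μN →L[ℂ] Lp (Lp ℂ 2 μN) 2 (μG.prod μG) :=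
  (toL2 (μG.prod μG) ∘ₗ columnVec φ μN ψ).extendOfNorm (toL2L2 μN (μG.prod μG))

theorem columnOperator_toL2L2 (ψ : Cc N ℂ) (ζ : Cc (N × G × G) ℂ) :
    columnOperator φ μG μN ψ (toL2L2 μN (μG.prod μG) ζ) =
      toL2 (μG.prod μG) (columnVec φ μN ψ ζ) :=
  LinearMap.extendOfNorm_eq (f := toL2 (μG.prod μG) ∘ₗ columnVec φ μN ψ)
    (denseRange_toL2L2 μN (μG.prod μG)) ⟨_, norm_toL2_columnVec_le φ μG μN ψ⟩ ζ

/-- `columnOperator` intertwines the operators of `ζ` as well, because `kernelRep_coreKernel` holds for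
every `q`. -/
theorem kernelRep_coreKernel_columnOperator (hN : IsClosed (N : Set G))
    (hφ : ∀ r s t : N, φ r s t = 1) (ψ : Cc N ℂ) (ζ : Cc (N × G × G) ℂ) (h : Lp (HS μG) 2 μN) :
    kernelRep μG (coreKernel φ μN hN hφ ζ) (columnOperator φ μG μN ψ h) =
      columnOperator φ μG μN ψ
        (aphiRep φ N μG μN (hsElement φ μG (curryL2 (μG.prod μG) ζ)) h) := by
  refine (denseRange_toL2L2 μN (μG.prod μG)).induction_on (p := fun h =>
    kernelRep μG (coreKernel φ μN hN hφ ζ) (columnOperator φ μG μN ψ h) =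
      columnOperator φ μG μN ψ
        (aphiRep φ N μG μN (hsElement φ μG (curryL2 (μG.prod μG) ζ)) h)) h
    (isClosed_eq ((kernelRep μG (coreKernel φ μN hN hφ ζ)).continuous.comp
      (columnOperator φ μG μN ψ).continuous) ((columnOperator φ μG μN ψ).continuous.comp
      (aphiRep φ N μG μN (hsElement φ μG (curryL2 (μG.prod μG) ζ))).continuous)) fun ζ' => ?_
  rw [aphiRep_hsElement]
  refine (congrArg _ (columnOperator_toL2L2 φ μG μN ψ ζ')).trans (Eq.trans ?_
    (columnOperator_toL2L2 φ μG μN ψ (coreMul φ μG μN ζ ζ')).symm)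
  refine (congrArg _ (toL2_columnVec φ μG μN ψ ζ')).trans (Eq.trans ?_
    (toL2_columnVec φ μG μN ψ (coreMul φ μG μN ζ ζ')).symm)
  refine (ContinuousLinearMap.integral_comp_comm _
    (integrable_smul_coreVec φ μG μN ψ ζ')).symm.trans ?_
  refine integral_congr_ae (ae_of_all _ fun q => ?_)
  exact (map_smul _ _ _).trans (congrArg _ (kernelRep_coreKernel φ μG μN hN hφ ζ ζ' q))

/-- The unitary operator intertwines the operators of `ζ` in the two representations: this is
`kernelRep_coreKernel` for `q = 1`. -/
theorem kernelRep_coreKernel_coreUnitary (hN : IsClosed (N : Set G))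
    (hφ : ∀ r s t : N, φ r s t = 1) (ζ : Cc (N × G × G) ℂ) (h : Lp (HS μG) 2 μN) :
    kernelRep μG (coreKernel φ μN hN hφ ζ) (coreUnitary φ μG μN h) =
      coreUnitary φ μG μN
        (aphiRep φ N μG μN (hsElement φ μG (curryL2 (μG.prod μG) ζ)) h) := by
  refine (denseRange_toL2L2 μN (μG.prod μG)).induction_on (p := fun h =>
    kernelRep μG (coreKernel φ μN hN hφ ζ) (coreUnitary φ μG μN h) =
      coreUnitary φ μG μN
        (aphiRep φ N μG μN (hsElement φ μG (curryL2 (μG.prod μG) ζ)) h)) h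
    (isClosed_eq ((kernelRep μG (coreKernel φ μN hN hφ ζ)).continuous.comp
      (coreUnitary φ μG μN).continuous) ((coreUnitary φ μG μN).continuous.comp
      (aphiRep φ N μG μN (hsElement φ μG (curryL2 (μG.prod μG) ζ))).continuous)) fun ζ' => ?_
  rw [aphiRep_hsElement]
  exact (congrArg _ (coreUnitary_toL2L2 φ μG μN ζ')).trans
    ((kernelRep_coreKernel φ μG μN hN hφ ζ ζ' 1).trans
      (coreUnitary_toL2L2 φ μG μN (coreMul φ μG μN ζ ζ')).symm)

theorem kernelRep_mem_closure (hN : IsClosed (N : Set G)) (hφ : ∀ r s t : N, φ r s t = 1)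
    (k : kernels φ N μN) : kernelRep μG k ∈ closure
      (Set.range fun ζ : Cc (N × G × G) ℂ => kernelRep μG (coreKernel φ μN hN hφ ζ)) := by
  refine Metric.mem_closure_iff.2 fun ε hε => ?_
  obtain ⟨ζ, h⟩ := exists_norm_kernelRep_coreKernel_sub_lt μG hN hφ k hε
  refine ⟨_, ⟨ζ, rfl⟩, ?_⟩
  rw [dist_comm, dist_eq_norm, ← map_sub]
  exact h

/-- The operators `columnOperator` intertwine `kernelRep k` with the operator that corresponds to
it under `coreUnitary`. -/
theorem kernelRep_columnOperator (hN : IsClosed (N : Set G)) (hφ : ∀ r s t : N, φ r s t = 1)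
    (k : kernels φ N μN) (ψ : Cc N ℂ) (h : Lp (HS μG) 2 μN) :
    kernelRep μG k (columnOperator φ μG μN ψ h) = columnOperator φ μG μN ψ
      ((coreUnitary φ μG μN).symm (kernelRep μG k (coreUnitary φ μG μN h))) := by
  refine closure_minimal (t := {R : Lp (Lp ℂ 2 μN) 2 (μG.prod μG) →L[ℂ] _ |
    R (columnOperator φ μG μN ψ h) = columnOperator φ μG μN ψ
      ((coreUnitary φ μG μN).symm (R (coreUnitary φ μG μN h)))}) ?_
    (isClosed_eq (by fun_prop) (by fun_prop)) (kernelRep_mem_closure φ μG μN hN hφ k)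
  rintro _ ⟨ζ, rfl⟩
  change kernelRep μG (coreKernel φ μN hN hφ ζ) _ = _
  rw [kernelRep_coreKernel_columnOperator, kernelRep_coreKernel_coreUnitary,
    LinearIsometryEquiv.symm_apply_apply]

end ColumnOperators

/-! ### Recovering a kernel from its operator -/

section ColumnPairing

open scoped Pointwise ComplexConjugate

/-- A continuous function with compact support in a given neighbourhood of the identity, which is
nonnegative and has integral `1`. -/
theorem exists_approximateUnit {Γ : Type*} [Group Γ] [TopologicalSpace Γ] [IsTopologicalGroup Γ]
    [LocallyCompactSpace Γ] [T2Space Γ] [MeasurableSpace Γ] [BorelSpace Γ] (μ : Measure Γ)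
    [μ.IsHaarMeasure] {U : Set Γ} (hU : U ∈ 𝓝 1) : ∃ δ : Γ → ℝ, Continuous δ ∧
      HasCompactSupport δ ∧ (∀ x, 0 ≤ δ x) ∧ (∀ x ∉ U, δ x = 0) ∧ ∫ x, δ x ∂μ = 1 := by
  obtain ⟨f, hf1, hf0, hfc, hf⟩ := exists_continuous_one_zero_of_isCompact
    (isCompact_singleton (x := (1 : Γ))) (isClosed_compl_iff.2 (isOpen_interior (s := U)))
    (by simpa using mem_interior_iff_mem_nhds.2 hU)
  have hpos : 0 < ∫ x, f x ∂μ := f.continuous.integral_pos_of_hasCompactSupport_nonneg_nonzero hfc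
    (fun x => (hf x).1) (x := 1) (by rw [hf1 (Set.mem_singleton 1)]; exact one_ne_zero)
  refine ⟨fun x => (∫ x, f x ∂μ)⁻¹ * f x, by fun_prop, hfc.mul_left,
    fun x => mul_nonneg (inv_nonneg.2 hpos.le) (hf x).1, fun x hx => ?_, ?_⟩
  · exact mul_eq_zero_of_right _ (hf0 fun h => hx (interior_subset h))
  · rw [integral_const_mul, inv_mul_cancel₀ hpos.ne']

variable {G : Type u} [Group G] [TopologicalSpace G] [IsTopologicalGroup G]
  [MeasurableSpace G] [BorelSpace G] [SecondCountableTopology G] [LocallyCompactSpace G] [T2Space G]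
  (φ : Tricharacter G) {N : Subgroup G} [LocallyCompactSpace N]
  (μG : Measure G) [μG.IsHaarMeasure] [μG.IsMulRightInvariant]
  (μN : Measure N) [μN.IsHaarMeasure] [μN.IsMulRightInvariant]

section Smear

variable {H : Type u} [NormedAddCommGroup H] [InnerProductSpace ℂ H] [CompleteSpace H]

/-- The integrand of `smear`, as a function of `(w, (v, x))`. -/
def smearIntegrand (f : Cc (G × G) ℂ) (η : Cc (G × G) H) : Cc (G × G × G) H :=
  ⟨fun a => conj ((φ a.2.2 a.2.1 a.1 : ℂ) * (f : G × G → ℂ) (a.1, a.2.1)) •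
      (η : G × G → H) (a.1, a.2.2), by
    obtain ⟨K, hK, h⟩ := Cc.exists_isCompact f
    obtain ⟨L, hL, h'⟩ := Cc.exists_isCompact η
    refine mem_Cc_of_isCompact ?_ ((hK.image continuous_fst).prod ((hK.image continuous_snd).prod
      (hL.image continuous_snd))) fun a ha => ?_
    · have h1 : Continuous fun a : G × G × G =>
          ((φ a.2.2 a.2.1 a.1 : ℂ) * (f : G × G → ℂ) (a.1, a.2.1)) :=
        (continuous_circle_coe.comp (φ.continuous_comp (by fun_prop) (by fun_prop)
          (by fun_prop))).mul (f.2.1.comp (by fun_prop))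
      exact (Complex.continuous_conj.comp h1).smul (η.2.1.comp (by fun_prop))
    · by_cases hm : (a.1, a.2.1) ∈ K
      · rw [h' (a.1, a.2.2) fun hm' => ha ⟨⟨_, hm, rfl⟩, ⟨_, hm, rfl⟩, ⟨_, hm', rfl⟩⟩, smul_zero]
      · rw [h _ hm, mul_zero, map_zero, zero_smul]⟩

theorem smearIntegrand_apply (f : Cc (G × G) ℂ) (η : Cc (G × G) H) (w v x : G) :
    (smearIntegrand φ f η : G × G × G → H) (w, v, x) =
      conj ((φ x v w : ℂ) * (f : G × G → ℂ) (w, v)) • (η : G × G → H) (w, x) := rfl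

/-- The function `(v, x) ↦ ∫ conj (φ(x, v, w) f(w, v)) η(w, x) dw`. -/
def smear (f : Cc (G × G) ℂ) (η : Cc (G × G) H) : Cc (G × G) H :=
  Cc.integralFst μG (smearIntegrand φ f η)

theorem smear_apply (f : Cc (G × G) ℂ) (η : Cc (G × G) H) (p : G × G) :
    (smear φ μG f η : G × G → H) p =
      ∫ w, (smearIntegrand φ f η : G × G × G → H) (w, p) ∂μG := rfl

/-- Every continuous compactly supported function is a uniform limit of functions `smear f η`,
with control of the supports: take for `f(w, v)` an approximate unit in `v⁻¹ w`, and use that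
`φ(x, v, v) = 1`. -/
theorem exists_smear_approx (η : Cc (G × G) H) : ∃ L : Set (G × G), IsCompact L ∧ ∀ ε > 0,
    ∃ f : Cc (G × G) ℂ, (∀ p ∉ L, (smear φ μG f η : G × G → H) p = 0) ∧
      ∀ p, ‖(smear φ μG f η : G × G → H) p - (η : G × G → H) p‖ ≤ ε := by
  obtain ⟨K, hK, hK0⟩ := Cc.exists_isCompact η
  obtain ⟨U₀, hU₀, hU₀n⟩ := exists_compact_mem_nhds (1 : G)
  set K₁ : Set G := Prod.fst '' K * U₀⁻¹ with hK₁
  have hK₁c : IsCompact K₁ := (hK.image continuous_fst).mul hU₀.inv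
  have hL : IsCompact (K₁ ×ˢ (Prod.snd '' K)) := hK₁c.prod (hK.image continuous_snd)
  refine ⟨K₁ ×ˢ (Prod.snd '' K), hL, fun ε hε => ?_⟩
  -- the deviation from `η` caused by replacing `v` by `v u`
  let D : G → G × G → H := fun u p =>
    conj (φ p.2 p.1 (p.1 * u) : ℂ) • (η : G × G → H) (p.1 * u, p.2) - (η : G × G → H) p
  have hD : Continuous fun a : G × G × G => D a.1 a.2 := by
    have h1 : Continuous fun a : G × G × G => (φ a.2.2 a.2.1 (a.2.1 * a.1) : ℂ) :=
      continuous_circle_coe.comp (φ.continuous_comp (by fun_prop) (by fun_prop) (by fun_prop))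
    exact ((Complex.continuous_conj.comp h1).smul (η.2.1.comp (by fun_prop))).sub
      (η.2.1.comp continuous_snd)
  have hD1 : ∀ p, D 1 p = 0 := fun p => by
    simp only [D, mul_one, φ.alt₂₃, Circle.coe_one, map_one, one_smul, sub_self]
  have hev : ∀ᶠ u in 𝓝 (1 : G), ∀ p ∈ K₁ ×ˢ (Prod.snd '' K), ‖D u p‖ < ε := by
    refine hL.eventually_forall_of_forall_eventually fun p _ => ?_
    refine hD.norm.continuousAt.eventually (Iio_mem_nhds ?_)
    dsimp only
    rw [hD1, norm_zero]
    exact hε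
  obtain ⟨δ, hδ, hδc, hδ0, hδU, hδ1⟩ := exists_approximateUnit μG (inter_mem hU₀n hev)
  obtain ⟨χ, hχ1, -, hχc, -⟩ := exists_continuous_one_zero_of_isCompact hK₁c
    isClosed_empty (Set.disjoint_empty _)
  let e : G × G ≃ₜ G × G :=
    { toFun := fun p => (p.2⁻¹ * p.1, p.2)
      invFun := fun p => (p.2 * p.1, p.2)
      left_inv := fun p => by simp
      right_inv := fun p => by simp
      continuous_toFun := by fun_prop
      continuous_invFun := by fun_prop }
  let f : Cc (G × G) ℂ := ⟨fun p => ((δ (p.2⁻¹ * p.1) * χ p.2 : ℝ) : ℂ), by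
    have h1 : HasCompactSupport fun p : G × G => ((δ p.1 * χ p.2 : ℝ) : ℂ) := by
      refine HasCompactSupport.intro (hδc.isCompact.prod hχc.isCompact) fun p hp => ?_
      by_cases h : p.1 ∈ tsupport δ
      · rw [image_eq_zero_of_notMem_tsupport (f := χ) fun h' => hp ⟨h, h'⟩, mul_zero,
          Complex.ofReal_zero]
      · rw [image_eq_zero_of_notMem_tsupport h, zero_mul, Complex.ofReal_zero]
    refine ⟨by fun_prop, h1.comp_homeomorph e⟩⟩
  have hval : ∀ p : G × G, (smear φ μG f η : G × G → H) p =
      ∫ u, (δ u * χ p.1) • (D u p + (η : G × G → H) p) ∂μG := fun p => by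
    rw [smear_apply, ← integral_mul_left_eq_self _ p.1]
    refine integral_congr_ae (ae_of_all _ fun u => ?_)
    obtain ⟨v, x⟩ := p
    dsimp only
    rw [smearIntegrand_apply, map_mul, mul_comm, mul_smul]
    have h1 : (f : G × G → ℂ) (v * u, v) = ((δ u * χ v : ℝ) : ℂ) := by
      change ((δ (v⁻¹ * (v * u)) * χ v : ℝ) : ℂ) = _
      rw [inv_mul_cancel_left]
    rw [h1, Complex.conj_ofReal, sub_add_cancel, Complex.coe_smul]
  -- away from `K₁` the integrand vanishes
  have hzero : ∀ p ∉ K₁ ×ˢ (Prod.snd '' K), (smear φ μG f η : G × G → H) p = 0 ∧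
      (η : G × G → H) p = 0 := fun p hp => by
    have hη : ∀ u ∈ U₀, (η : G × G → H) (p.1 * u, p.2) = 0 := fun u hu =>
      hK0 _ fun hm => hp ⟨⟨p.1 * u, ⟨_, hm, rfl⟩, u⁻¹, Set.inv_mem_inv.2 hu, by simp⟩,
        ⟨_, hm, rfl⟩⟩
    refine ⟨?_, by simpa using hη 1 (mem_of_mem_nhds hU₀n)⟩
    rw [hval]
    refine integral_eq_zero_of_ae (ae_of_all _ fun u => ?_)
    dsimp only
    rw [sub_add_cancel]
    by_cases hu : u ∈ U₀
    · rw [hη u hu, smul_zero, smul_zero]; rfl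
    · rw [hδU u fun h => hu h.1, zero_mul, zero_smul]; rfl
  refine ⟨f, fun p hp => (hzero p hp).1, fun p => ?_⟩
  by_cases hp : p ∈ K₁ ×ˢ (Prod.snd '' K)
  · have hχp : χ p.1 = 1 := hχ1 hp.1
    have hi : Integrable δ μG := hδ.integrable_of_hasCompactSupport hδc
    have hDp : Continuous fun u => D u p := hD.comp (f := fun u => (u, p)) (by fun_prop)
    have hi1 : Integrable (fun u => δ u • D u p) μG :=
      (hδ.smul hDp).integrable_of_hasCompactSupport hδc.smul_right
    have h1 : (smear φ μG f η : G × G → H) p - (η : G × G → H) p = ∫ u, δ u • D u p ∂μG := by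
      simp only [hval, hχp, mul_one, smul_add]
      rw [integral_add hi1 (hi.smul_const _), integral_smul_const, hδ1, one_smul,
        add_sub_cancel_right]
    rw [h1]
    refine (norm_integral_le_of_norm_le (hi.const_mul ε) (ae_of_all _ fun u => ?_)).trans
      (le_of_eq (by rw [integral_const_mul, hδ1, mul_one]))
    rw [norm_smul, Real.norm_of_nonneg (hδ0 u), mul_comm]
    by_cases hu : u ∈ U₀ ∩ {u | ∀ p ∈ K₁ ×ˢ (Prod.snd '' K), ‖D u p‖ < ε}
    · exact mul_le_mul_of_nonneg_right (hu.2 p hp).le (hδ0 u)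
    · rw [hδU u hu, mul_zero, mul_zero]
  · rw [(hzero p hp).1, (hzero p hp).2, sub_zero, norm_zero]
    exact hε.le

end Smear

/-- The pairing `∫∫ ⟨η(w, x), k(x, w) v⟩ dx dw` of the function `(w, x) ↦ k(x, w) v`, which need
not be square integrable, with a compactly supported function. -/
def columnPairing (k : kernels φ N μN) (v : Lp ℂ 2 μN) (η : Cc (G × G) (Lp ℂ 2 μN)) : ℂ :=
  ∫ w, ∫ x, inner ℂ ((η : G × G → Lp ℂ 2 μN) (w, x)) (kernels.fn k x w v) ∂μG ∂μG

variable {φ μN}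

/-- For `K_ζ` the pairing is the inner product with `columnOperator`, applied to `ζ`. -/
theorem columnPairing_coreKernel (hN : IsClosed (N : Set G)) (hφ : ∀ r s t : N, φ r s t = 1)
    (ζ : Cc (N × G × G) ℂ) (ψ : Cc N ℂ) (η : Cc (G × G) (Lp ℂ 2 μN)) :
    columnPairing φ μG μN (coreKernel φ μN hN hφ ζ) (toL2 μN ψ) η =
      inner ℂ (toL2 (μG.prod μG) η)
        (columnOperator φ μG μN ψ (toL2L2 μN (μG.prod μG) ζ)) := by
  rw [columnOperator_toL2L2, inner_toL2_prod]
  refine integral_congr_ae (ae_of_all _ fun w => integral_congr_ae (ae_of_all _ fun x => ?_))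
  exact congrArg _ (columnVec_apply φ μN hN hφ ψ ζ w x).symm

/-- The column `(w, x) ↦ k(x, w) v` is locally square integrable, so on functions supported in a given
compact set the pairing is the inner product with a cut-off of it. -/
theorem exists_columnPairing_eq_inner (k : kernels φ N μN) (v : Lp ℂ 2 μN) {L : Set (G × G)}
    (hL : IsCompact L) : ∃ c : Cc (G × G) (Lp ℂ 2 μN), ∀ η : Cc (G × G) (Lp ℂ 2 μN),
      (∀ p ∉ L, (η : G × G → Lp ℂ 2 μN) p = 0) →
      columnPairing φ μG μN k v η = inner ℂ (toL2 (μG.prod μG) η) (toL2 (μG.prod μG) c) := by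
  obtain ⟨χ, hχ1, -, hχc, -⟩ := exists_continuous_one_zero_of_isCompact hL
    isClosed_empty (Set.disjoint_empty _)
  refine ⟨⟨fun p => χ p • kernels.fn k p.2 p.1 v, χ.continuous.smul (((kernels.continuous k).comp
    (f := fun p : G × G => (p.2, p.1)) (by fun_prop)).clm_apply continuous_const),
    hχc.smul_right⟩, fun η hη => ?_⟩
  rw [inner_toL2_prod]
  refine integral_congr_ae (ae_of_all _ fun w => integral_congr_ae (ae_of_all _ fun x => ?_))
  dsimp only
  by_cases h : (w, x) ∈ L
  · rw [hχ1 h, Pi.one_apply, one_smul]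
  · rw [hη _ h, inner_zero_left, inner_zero_left]

/-- An identity for the pairing extends from the functions `smear f η` to all functions. -/
theorem columnPairing_eq_of_smear {k : kernels φ N μN} {v : Lp ℂ 2 μN}
    {y : Lp (Lp ℂ 2 μN) 2 (μG.prod μG)}
    (h : ∀ (f : Cc (G × G) ℂ) (η : Cc (G × G) (Lp ℂ 2 μN)),
      columnPairing φ μG μN k v (smear φ μG f η) =
        inner ℂ (toL2 (μG.prod μG) (smear φ μG f η)) y) (η : Cc (G × G) (Lp ℂ 2 μN)) :
    columnPairing φ μG μN k v η = inner ℂ (toL2 (μG.prod μG) η) y := by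
  obtain ⟨L, hL, hLη⟩ := exists_smear_approx φ μG η
  obtain ⟨K, hK, hK0⟩ := Cc.exists_isCompact η
  -- with supports in a fixed compact set, the pairing is continuous in the norm of `L²`
  obtain ⟨c, hc⟩ := exists_columnPairing_eq_inner μG k v (hK.union hL)
  have hcl : toL2 (μG.prod μG) η ∈ closure {z : Lp (Lp ℂ 2 μN) 2 (μG.prod μG) |
      inner ℂ z (toL2 (μG.prod μG) c) = inner ℂ z y} := by
    refine Metric.mem_closure_iff.2 fun ε hε => ?_
    set r := Real.sqrt ((μG.prod μG).real (K ∪ L)) with hr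
    have hr0 : 0 ≤ r := Real.sqrt_nonneg _
    obtain ⟨f, hf0, hf⟩ := hLη (ε / (r + 1)) (by positivity)
    refine ⟨toL2 (μG.prod μG) (smear φ μG f η), ?_, ?_⟩
    · exact (hc _ fun p hp => hf0 p fun h => hp (Or.inr h)).symm.trans (h f η)
    · rw [dist_comm, dist_eq_norm]
      refine (norm_toL2_sub_le (μG.prod μG) _ _ (hK.union hL)
        (fun p hp => hf0 p fun h => hp (Or.inr h)) (fun p hp => hK0 p fun h => hp (Or.inl h))
        (by positivity) hf).trans_lt ?_
      rw [← hr, div_mul_eq_mul_div, div_lt_iff₀ (by positivity)]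
      nlinarith
  rw [hc η fun p hp => hK0 p fun h => hp (Or.inl h)]
  exact closure_minimal subset_rfl (isClosed_eq (by fun_prop) (by fun_prop)) hcl

/-- The function `p ↦ f(p) v`. -/
def Cc.smulConst {X H : Type*} [TopologicalSpace X] [NormedAddCommGroup H] [NormedSpace ℂ H]
    (f : Cc X ℂ) (v : H) : Cc X H :=
  ⟨fun p => (f : X → ℂ) p • v, f.2.1.smul continuous_const, f.2.2.smul_right⟩

/-- The matrix coefficients of `kernelRep k` determine the pairings of the columns of `k` with all
functions `smear f η`, hence the columns. -/
theorem inner_kernelRep_smulConst (k : kernels φ N μN) (f : Cc (G × G) ℂ) (c : Lp ℂ 2 μN)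
    (η : Cc (G × G) (Lp ℂ 2 μN)) :
    inner ℂ (toL2 (μG.prod μG) η) (kernelRep μG k (toL2 (μG.prod μG) (Cc.smulConst f c))) =
      columnPairing φ μG μN k c (smear φ μG f η) := by
  rw [kernelRep_toL2, inner_toL2_prod]
  let T : Cc (G × G × G) ℂ := ⟨fun a => inner ℂ ((smearIntegrand φ f η : G × G × G → Lp ℂ 2 μN) a)
      (kernels.fn k a.2.2 a.2.1 c), by
    obtain ⟨K, hK, h⟩ := Cc.exists_isCompact (smearIntegrand φ f η)
    refine mem_Cc_of_isCompact ?_ hK fun a ha => by rw [h a ha, inner_zero_left]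
    exact (smearIntegrand φ f η).2.1.inner (((kernels.continuous k).comp
      (f := fun a : G × G × G => (a.2.2, a.2.1)) (by fun_prop)).clm_apply continuous_const)⟩
  have h1 : ∀ w x, inner ℂ ((η : G × G → Lp ℂ 2 μN) (w, x))
      ((kernelConv μG k (Cc.smulConst f c) : G × G → Lp ℂ 2 μN) (w, x)) =
      ∫ v, (T : G × G × G → ℂ) (w, v, x) ∂μG := fun w x => by
    rw [kernelConv_apply]
    refine (integral_inner (𝕜 := ℂ) (Cc.integrable μG
      ⟨_, kernelConv_slice_mem k (Cc.smulConst f c) w x⟩) _).symm.trans ?_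
    refine integral_congr_ae (ae_of_all _ fun v => ?_)
    change inner ℂ ((η : G × G → Lp ℂ 2 μN) (w, x)) ((φ x v w : ℂ) • kernels.fn k x v
      ((f : G × G → ℂ) (w, v) • c)) = inner ℂ (conj ((φ x v w : ℂ) * (f : G × G → ℂ) (w, v)) •
        (η : G × G → Lp ℂ 2 μN) (w, x)) (kernels.fn k x v c)
    rw [map_smul, smul_smul, inner_smul_right, inner_smul_left, Complex.conj_conj]
  have h2 : ∀ v x, inner ℂ ((smear φ μG f η : G × G → Lp ℂ 2 μN) (v, x))
      (kernels.fn k x v c) = ∫ w, (T : G × G × G → ℂ) (w, v, x) ∂μG := fun v x => by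
    rw [smear_apply]
    exact (integral_inner_const (Cc.integrable_fst μG (smearIntegrand φ f η) (v, x)) _).symm
  rw [columnPairing]
  simp only [h1, h2]
  rw [← Cc.integral_swap₂₃ μG μG μG T]
  refine Eq.trans ?_ (Cc.integral_prod μG μG (Cc.integralFst μG T))
  refine Eq.trans ?_ (Cc.integral_swap μG (μG.prod μG) T)
  refine integral_congr_ae (ae_of_all _ fun w => ?_)
  exact (Cc.integral_prod μG μG (Cc.slice T w)).symm

/-- The pairing of the columns of `k * l` is the pairing of those of `l`, with `k` moved to the test
function. -/
theorem columnPairing_kernelMul (k l : kernels φ N μN) (v : Lp ℂ 2 μN)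
    (η : Cc (G × G) (Lp ℂ 2 μN)) : columnPairing φ μG μN (kernelMul μG k l) v η =
      columnPairing φ μG μN l v (kernelConv μG (kernelStar k) η) := by
  refine integral_congr_ae (ae_of_all _ fun w => ?_)
  let T : Cc (G × G) ℂ := ⟨fun q => inner ℂ ((η : G × G → Lp ℂ 2 μN) (w, q.1))
      ((φ q.1 q.2 w : ℂ) • kernels.fn k q.1 q.2 (kernels.fn l q.2 w v)), by
    obtain ⟨K, hK, h⟩ := Cc.exists_isCompact (Cc.slice η w)
    obtain ⟨K', hK', h'⟩ := Cc.exists_isCompact (kernels.column l w v)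
    simp only [Cc.slice_apply] at h
    simp only [kernels.column_apply] at h'
    refine mem_Cc_of_isCompact ?_ (hK.prod hK') fun q hq => ?_
    · have hη : Continuous fun q : G × G => (η : G × G → Lp ℂ 2 μN) (w, q.1) :=
        η.2.1.comp (by fun_prop)
      have hl : Continuous fun q : G × G => (φ q.1 q.2 w : ℂ) • kernels.fn k q.1 q.2
          (kernels.fn l q.2 w v) :=
        (continuous_circle_coe.comp (φ.continuous_comp (by fun_prop) (by fun_prop)
          (by fun_prop))).smul ((kernels.continuous k).clm_apply (((kernels.continuous l).comp
          (f := fun q : G × G => (q.2, w)) (by fun_prop)).clm_apply continuous_const))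
      exact hη.inner hl
    · by_cases h1 : q.1 ∈ K
      · rw [h' q.2 fun h2 => hq ⟨h1, h2⟩, map_zero, smul_zero, inner_zero_right]
      · rw [h q.1 h1, inner_zero_left]⟩
  calc ∫ x, inner ℂ ((η : G × G → Lp ℂ 2 μN) (w, x)) (kernels.fn (kernelMul μG k l) x w v) ∂μG
      = ∫ x, ∫ y, (T : G × G → ℂ) (x, y) ∂μG ∂μG := by
        refine integral_congr_ae (ae_of_all _ fun x => ?_)
        dsimp only
        rw [kernelMul_apply, ContinuousLinearMap.integral_apply (kernels.integrable_mul μG k l x w)]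
        exact (integral_inner (𝕜 := ℂ) ((kernels.integrable_mul μG k l x w).apply_continuousLinearMap v)
          ((η : G × G → Lp ℂ 2 μN) (w, x))).symm
    _ = ∫ y, ∫ x, (T : G × G → ℂ) (x, y) ∂μG ∂μG := Cc.integral_swap μG μG T
    _ = _ := by
        refine integral_congr_ae (ae_of_all _ fun y => ?_)
        dsimp only
        rw [kernelConv_apply]
        refine Eq.trans ?_ (integral_inner_const (Cc.integrable μG
          ⟨_, kernelConv_slice_mem (kernelStar k) η w y⟩) _)
        refine integral_congr_ae (ae_of_all _ fun x => ?_)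
        simp only [T]
        rw [inner_smul_left, inner_smul_right, kernelStar_apply, star_apply_inner,
          ← Circle.coe_inv_eq_conj, φ.swap₁₂ x y w, inv_inv]

end ColumnPairing

/-! ### Approximation in the crossed product and multiplicativity -/

section Multiplicativity

variable {G : Type u} [Group G] [TopologicalSpace G] [IsTopologicalGroup G]
  [MeasurableSpace G] [BorelSpace G] [SecondCountableTopology G] [LocallyCompactSpace G] [T2Space G]
  {φ : Tricharacter G} {N : Subgroup G} [LocallyCompactSpace N]
  (μG : Measure G) [μG.IsHaarMeasure] [μG.IsMulRightInvariant]
  {μN : Measure N} [μN.IsHaarMeasure] [μN.IsMulRightInvariant]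

/-- The norm of the crossed product is dominated by the `L¹` norm. -/
theorem norm_aphiRep_le (a : aphiCore φ N μG) : ‖aphiRep φ N μG μN a‖ ≤
    ∫ s, ‖(a : N → (HS μG →L[ℂ] HS μG)) s‖ ∂μN := by
  refine ContinuousLinearMap.opNorm_le_bound _ (integral_nonneg fun _ => norm_nonneg _) fun h => ?_
  refine (denseRange_toL2 μN).induction_on (p := fun h => ‖aphiRep φ N μG μN a h‖ ≤
    (∫ s, ‖(a : N → (HS μG →L[ℂ] HS μG)) s‖ ∂μN) * ‖h‖) h
    (isClosed_le (by fun_prop) (by fun_prop)) fun g => ?_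
  rw [aphiRep_toL2]
  exact norm_toL2_aphiConv_le φ N μG μN a g

theorem norm_aphiRep_sub_le (a b : aphiCore φ N μG) {K : Set N} (hK : IsCompact K)
    (ha : ∀ s ∉ K, (a : N → (HS μG →L[ℂ] HS μG)) s = 0)
    (hb : ∀ s ∉ K, (b : N → (HS μG →L[ℂ] HS μG)) s = 0) {M : ℝ}
    (h : ∀ s, ‖(a : N → (HS μG →L[ℂ] HS μG)) s - (b : N → (HS μG →L[ℂ] HS μG)) s‖ ≤ M) :
    ‖aphiRep φ N μG μN a - aphiRep φ N μG μN b‖ ≤ M * μN.real K := by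
  rw [← map_sub]
  refine (norm_aphiRep_le μG (a - b)).trans ?_
  have hm := hK.measurableSet
  have h1 : ∫ s, K.indicator (fun _ => M) s ∂μN = M * μN.real K := by
    rw [integral_indicator_const _ hm, smul_eq_mul, mul_comm]
  rw [← h1]
  refine integral_mono_of_nonneg (ae_of_all _ fun s => norm_nonneg _)
    ((integrable_indicator_iff hm).2 (integrableOn_const hK.measure_lt_top.ne))
    (ae_of_all _ fun s => ?_)
  by_cases hs : s ∈ K
  · rw [Set.indicator_of_mem hs]
    exact h s
  · rw [Set.indicator_of_notMem hs]
    change ‖(a : N → (HS μG →L[ℂ] HS μG)) s - (b : N → (HS μG →L[ℂ] HS μG)) s‖ ≤ 0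
    rw [ha s hs, hb s hs, sub_zero, norm_zero]

/-- Elements of `C_c(N, HS)` are approximated by elements of `C_c(N × G × G)`, in the norm of
operators and in `L²` at the same time. -/
theorem mem_closure_range_hsElement (g : Cc N (HS μG)) :
    (aphiRep φ N μG μN (hsElement φ μG g), toL2 μN g) ∈
      closure (Set.range fun ζ : Cc (N × G × G) ℂ =>
        (aphiRep φ N μG μN (hsElement φ μG (curryL2 (μG.prod μG) ζ)),
          toL2L2 μN (μG.prod μG) ζ)) := by
  obtain ⟨L, hL, hap⟩ := curryL2_exists_approx (μG.prod μG) g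
  obtain ⟨K, hK, h0⟩ := Cc.exists_isCompact g
  have hC := hK.union hL
  refine Metric.mem_closure_iff.2 fun ε hε => ?_
  set r := Real.sqrt (μN.real (K ∪ L)) with hr
  set m := μN.real (K ∪ L) with hm
  have hr0 : 0 ≤ r := Real.sqrt_nonneg _
  have hm0 : 0 ≤ m := measureReal_nonneg
  obtain ⟨ζ, h1, h2⟩ := hap (ε / (r + m + 1)) (by positivity)
  have e1 : ε / (r + m + 1) * m < ε := by
    rw [div_mul_eq_mul_div, div_lt_iff₀ (by positivity)]
    nlinarith
  have e2 : ε / (r + m + 1) * r < ε := by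
    rw [div_mul_eq_mul_div, div_lt_iff₀ (by positivity)]
    nlinarith
  have hs1 : ∀ s ∉ K ∪ L, (curryL2 (μG.prod μG) ζ : N → HS μG) s = 0 :=
    fun s hs => h1 s fun h => hs (Or.inr h)
  have hs2 : ∀ s ∉ K ∪ L, (g : N → HS μG) s = 0 := fun s hs => h0 s fun h => hs (Or.inl h)
  refine ⟨_, ⟨ζ, rfl⟩, ?_⟩
  rw [dist_comm, Prod.dist_eq, max_lt_iff, dist_eq_norm, dist_eq_norm]
  refine ⟨(norm_aphiRep_sub_le μG _ _ hC (fun s hs => ?_) (fun s hs => ?_)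
    (M := ε / (r + m + 1)) fun s => ?_).trans_lt e1, ?_⟩
  · rw [hsElement_apply, hs1 s hs]; exact map_zero (hsMulL φ μG)
  · rw [hsElement_apply, hs2 s hs]; exact map_zero (hsMulL φ μG)
  · rw [hsElement_apply, hsElement_apply, ← hsMulL_apply, ← hsMulL_apply, ← map_sub, hsMulL_apply]
    exact (norm_hsMul_le φ μG _).trans (h2 s).le
  · exact (norm_toL2_sub_le μN _ _ hC hs1 hs2 (by positivity) fun s => (h2 s).le).trans_lt e2

/-- The operators of elements of `C_c(N × G × G)` are dense in the crossed product. -/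
theorem aphiRep_mem_closure (a : aphiCore φ N μG) : aphiRep φ N μG μN a ∈
    closure (Set.range fun ζ : Cc (N × G × G) ℂ =>
      aphiRep φ N μG μN (hsElement φ μG (curryL2 (μG.prod μG) ζ))) := by
  -- the functions `t ↦ L_{ζ(t)}` form a module over the functions of `t`, dense in every fibre
  obtain ⟨L, hL, hap⟩ := Cc.exists_approx (⟨a, a.2.2⟩ : Cc N (HS μG →L[ℂ] HS μG))
    (LinearMap.range ((aphiCore φ N μG).subtype ∘ₗ hsElement φ μG ∘ₗ curryL2 (μG.prod μG)))
    (by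
      rintro p hp - _ ⟨ζ, rfl⟩
      refine ⟨Cc.mulFst p hp ζ, funext fun s => ?_⟩
      refine Eq.trans (congrArg (hsMul φ μG) ?_) (hsMul_smul_left φ μG (p s : ℂ) _)
      refine Eq.trans (toL2_congr (E := ℂ) (μG.prod μG) fun q => ?_)
        (map_smul (toL2 (E := ℂ) (μG.prod μG)) (p s : ℂ) (Cc.slice ζ s))
      rfl)
    (by rintro _ ⟨ζ, rfl⟩; exact (hsElement φ μG (curryL2 (μG.prod μG) ζ)).2.2.1)
    (fun s ε hε => by
      obtain ⟨_, ⟨κ, rfl⟩, hκ⟩ := Metric.mem_closure_iff.1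
        (mem_closure_range_hsMul φ μG (a.2.1 s)) (ε / 2) (by positivity)
      obtain ⟨g, hg⟩ := Metric.denseRange_iff.1 (denseRange_toL2 (μG.prod μG)) κ (ε / 2)
        (by positivity)
      obtain ⟨f, hf⟩ := Cc.exists_eq_one s
      refine ⟨_, ⟨Cc.tensor f g, rfl⟩, ?_⟩
      have e : (curryL2 (μG.prod μG) (Cc.tensor f g) : N → HS μG) s = toL2 (μG.prod μG) g := by
        refine toL2_congr _ fun q => ?_
        change (f : N → ℂ) s * (g : G × G → ℂ) q = _
        rw [hf, one_mul]
      change ‖hsMul φ μG ((curryL2 (μG.prod μG) (Cc.tensor f g) : N → HS μG) s) -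
        (a : N → (HS μG →L[ℂ] HS μG)) s‖ < ε
      rw [e]
      have h1 : ‖hsMul φ μG (toL2 (μG.prod μG) g) - hsMul φ μG κ‖ < ε / 2 := by
        rw [← hsMulL_apply, ← hsMulL_apply, ← map_sub, hsMulL_apply]
        refine (norm_hsMul_le φ μG _).trans_lt ?_
        rwa [← dist_eq_norm, dist_comm]
      have h2 : ‖hsMul φ μG κ - (a : N → (HS μG →L[ℂ] HS μG)) s‖ < ε / 2 := by
        rwa [← dist_eq_norm, dist_comm]
      calc _ ≤ ‖hsMul φ μG (toL2 (μG.prod μG) g) - hsMul φ μG κ‖ +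
            ‖hsMul φ μG κ - (a : N → (HS μG →L[ℂ] HS μG)) s‖ := norm_sub_le_norm_sub_add_norm_sub _ _ _
        _ < ε := by linarith)
  have hK := a.2.2.2.isCompact
  have hC := hK.union hL
  refine Metric.mem_closure_iff.2 fun ε hε => ?_
  set m := μN.real (tsupport (a : N → (HS μG →L[ℂ] HS μG)) ∪ L) with hm
  have hm0 : 0 ≤ m := measureReal_nonneg
  obtain ⟨_, ⟨ζ, rfl⟩, h1, h2⟩ := hap (ε / (m + 1)) (by positivity)
  refine ⟨_, ⟨ζ, rfl⟩, ?_⟩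
  rw [dist_comm, dist_eq_norm]
  refine (norm_aphiRep_sub_le μG (hsElement φ μG (curryL2 (μG.prod μG) ζ)) a hC
    (fun s hs => h1 s fun h => hs (Or.inr h))
    (fun s hs => image_eq_zero_of_notMem_tsupport fun h => hs (Or.inl h))
    (M := ε / (m + 1)) fun s => (h2 s).le).trans_lt ?_
  rw [← hm, div_mul_eq_mul_div, div_lt_iff₀ (by positivity)]
  nlinarith

theorem inner_eq_inner_of_mem_closure {H H' : Type*} [NormedAddCommGroup H] [NormedSpace ℂ H]
    [NormedAddCommGroup H'] [InnerProductSpace ℂ H'] {S : Set ((H →L[ℂ] H) × H)} {A : H →L[ℂ] H}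
    {g : H} (hp : (A, g) ∈ closure S) (V : H ≃ₗᵢ[ℂ] H') (C : H →L[ℂ] H') (x : H) (y z : H')
    (h : ∀ q ∈ S, inner ℂ y (V (q.1 x)) = inner ℂ z (C q.2)) :
    inner ℂ y (V (A x)) = inner ℂ z (C g) := by
  refine closure_minimal (t := {q : (H →L[ℂ] H) × H |
    inner ℂ y (V (q.1 x)) = inner ℂ z (C q.2)}) h (isClosed_eq ?_ ?_) hp
  · exact continuous_const.inner (V.continuous.comp (continuous_fst.clm_apply continuous_const))
  · exact continuous_const.inner (C.continuous.comp continuous_snd)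

/-- The matrix coefficients of an element `g` of `C_c(N, HS)`, on `L²(G × G, L²(N))`, expressed by
`columnOperator` at `g`. Both sides are continuous for the convergence in
`mem_closure_range_hsElement`, so `g` may be taken in `C_c(N × G × G)`. -/
theorem inner_coreUnitary_aphiRep_smulConst (hN : IsClosed (N : Set G))
    (hφ : ∀ r s t : N, φ r s t = 1) (g : Cc N (HS μG)) (f : Cc (G × G) ℂ) (ψ : Cc N ℂ)
    (η : Cc (G × G) (Lp ℂ 2 μN)) :
    inner ℂ (toL2 (μG.prod μG) η) (coreUnitary φ μG μN (aphiRep φ N μG μN (hsElement φ μG g)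
      ((coreUnitary φ μG μN).symm (toL2 (μG.prod μG) (Cc.smulConst f (toL2 μN ψ)))))) =
    inner ℂ (toL2 (μG.prod μG) (smear φ μG f η)) (columnOperator φ μG μN ψ (toL2 μN g)) := by
  refine inner_eq_inner_of_mem_closure (mem_closure_range_hsElement (φ := φ) μG g)
    (coreUnitary φ μG μN) (columnOperator φ μG μN ψ) _ _ _ (Set.forall_mem_range.2 fun ζ => ?_)
  have e1 := kernelRep_coreKernel_coreUnitary φ μG μN hN hφ ζ
    ((coreUnitary φ μG μN).symm (toL2 (μG.prod μG) (Cc.smulConst f (toL2 μN ψ))))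
  rw [LinearIsometryEquiv.apply_symm_apply] at e1
  exact (congrArg (inner ℂ (toL2 (μG.prod μG) η)) e1.symm).trans
    ((inner_kernelRep_smulConst μG _ f (toL2 μN ψ) η).trans
      (columnPairing_coreKernel μG hN hφ ζ ψ (smear φ μG f η)))

/-- If a kernel `k` and an element `g` of `C_c(N, HS)` give the same operator, then `columnOperator` at
`g` is the column of `k`. This recovers `k` from its operator without a product of operators. -/
theorem columnPairing_eq_of_kernelRep_eq (hN : IsClosed (N : Set G))
    (hφ : ∀ r s t : N, φ r s t = 1) {k : kernels φ N μN} {g : Cc N (HS μG)}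
    (hk : ∀ h, kernelRep μG k (coreUnitary φ μG μN h) =
      coreUnitary φ μG μN (aphiRep φ N μG μN (hsElement φ μG g) h)) (ψ : Cc N ℂ)
    (η : Cc (G × G) (Lp ℂ 2 μN)) : columnPairing φ μG μN k (toL2 μN ψ) η =
      inner ℂ (toL2 (μG.prod μG) η) (columnOperator φ μG μN ψ (toL2 μN g)) := by
  refine columnPairing_eq_of_smear μG (fun f η => ?_) η
  rw [← inner_kernelRep_smulConst, ← inner_coreUnitary_aphiRep_smulConst μG hN hφ]
  exact congrArg _ ((congrArg _ (LinearIsometryEquiv.apply_symm_apply _ _).symm).trans (hk _))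

/-- Operators on `L²(X, H)` are determined by their values on the functions `f v`. -/
theorem clm_ext_of_smulConst {X H F : Type*} [TopologicalSpace X] [LocallyCompactSpace X]
    [T2Space X] [NormalSpace X] [MeasurableSpace X] [BorelSpace X]
    (μ : Measure X) [IsFiniteMeasureOnCompacts μ] [μ.Regular] [NormedAddCommGroup H]
    [InnerProductSpace ℂ H] [CompleteSpace H] [NormedAddCommGroup F] [NormedSpace ℂ F]
    {A B : Lp H 2 μ →L[ℂ] F} {s : Set H} (hs : Dense s)
    (h : ∀ (f : Cc X ℂ), ∀ v ∈ s, A (toL2 μ (Cc.smulConst f v)) =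
      B (toL2 μ (Cc.smulConst f v))) : A = B := by
  have hv : ∀ (f : Cc X ℂ) (v : H), A (toL2 μ (Cc.smulConst f v)) =
      B (toL2 μ (Cc.smulConst f v)) := fun f => by
    have hc : Continuous fun v : H => toL2 μ (Cc.smulConst f v) := by
      refine continuous_toL2 μ (f := fun v => Cc.smulConst f v)
        ((f.2.1.comp continuous_snd).smul continuous_fst) fun v => ?_
      exact ⟨_, f.2.2.isCompact, Eventually.of_forall fun v y hy => by
        change (f : X → ℂ) y • v = 0
        rw [image_eq_zero_of_notMem_tsupport hy, zero_smul]⟩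
    exact hs.induction (h f) (isClosed_eq (A.continuous.comp hc) (B.continuous.comp hc))
  have hle : elementaryTensors X H ≤ (LinearMap.eqLocus (A.toLinearMap ∘ₗ toL2 μ)
      (B.toLinearMap ∘ₗ toL2 μ)).map (Cc X H).subtype := by
    refine Submodule.span_le.2 ?_
    rintro _ ⟨f, v, rfl⟩
    exact ⟨Cc.smulConst f v, hv f v, rfl⟩
  refine clm_ext_of_denseRange (e := toL2 μ (E := H)) (denseRange_toL2 μ) fun c => ?_
  obtain ⟨L, hL, hap⟩ := Cc.exists_approx c (elementaryTensors X H)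
    (fun p hp _ s hs => mul_mem_elementaryTensors hp hs)
    (fun s hs => (mem_Cc_of_mem_elementaryTensors hs).1) fun x ε hε => by
      obtain ⟨f, hf⟩ := Cc.exists_eq_one x
      exact ⟨_, Submodule.subset_span ⟨f, (c : X → H) x, rfl⟩, by
        rw [hf, one_smul, sub_self, norm_zero]; exact hε⟩
  obtain ⟨K, hK, h0⟩ := Cc.exists_isCompact c
  have hcl : toL2 μ c ∈ closure {z : Lp H 2 μ | A z = B z} := by
    refine Metric.mem_closure_iff.2 fun ε hε => ?_
    set r := Real.sqrt (μ.real (K ∪ L)) with hr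
    have hr0 : 0 ≤ r := Real.sqrt_nonneg _
    obtain ⟨s, hsm, hsL, hsc⟩ := hap (ε / (r + 1)) (by positivity)
    obtain ⟨c', hc', rfl⟩ := hle hsm
    refine ⟨toL2 μ c', hc', ?_⟩
    rw [dist_comm, dist_eq_norm]
    refine (norm_toL2_sub_le μ _ _ (hK.union hL) (fun x hx => hsL x fun h => hx (Or.inr h))
      (fun x hx => h0 x fun h => hx (Or.inl h)) (M := ε / (r + 1)) (by positivity)
      fun x => (hsc x).le).trans_lt ?_
    rw [← hr, div_mul_eq_mul_div, div_lt_iff₀ (by positivity)]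
    nlinarith
  exact closure_minimal subset_rfl (isClosed_eq A.continuous B.continuous) hcl

/-- Multiplicativity. If `k` corresponds to `a` and `l` to `g`, the columns of `l` are given by
`columnOperator` at `g`, those of `k * l` by `kernelRep k` applied to these, hence by
`columnOperator` at `a * g`; and an operator is determined by its columns. -/
theorem kernelRep_kernelMul (hN : IsClosed (N : Set G)) (hφ : ∀ r s t : N, φ r s t = 1)
    {k l : kernels φ N μN} {a : aphiCore φ N μG} {g : Cc N (HS μG)}
    (hk : ∀ h, kernelRep μG k (coreUnitary φ μG μN h) =
      coreUnitary φ μG μN (aphiRep φ N μG μN a h))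
    (hl : ∀ h, kernelRep μG l (coreUnitary φ μG μN h) =
      coreUnitary φ μG μN (aphiRep φ N μG μN (hsElement φ μG g) h)) (h : Lp (HS μG) 2 μN) :
    kernelRep μG (kernelMul μG k l) (coreUnitary φ μG μN h) = coreUnitary φ μG μN
      (aphiRep φ N μG μN (hsElement φ μG (aphiConv φ N μG μN a g)) h) := by
  -- the columns of `k * l` are those of `a * g`
  have hcol : ∀ (ψ : Cc N ℂ) (η : Cc (G × G) (Lp ℂ 2 μN)),
      columnPairing φ μG μN (kernelMul μG k l) (toL2 μN ψ) η =
      inner ℂ (toL2 (μG.prod μG) η)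
        (columnOperator φ μG μN ψ (toL2 μN (aphiConv φ N μG μN a g))) := fun ψ η => by
    have e1 := columnPairing_kernelMul μG k l (toL2 μN ψ) η
    have e2 := columnPairing_eq_of_kernelRep_eq μG hN hφ hl ψ (kernelConv μG (kernelStar k) η)
    have e3 : toL2 (μG.prod μG) (kernelConv μG (kernelStar k) η) =
        star (kernelRep μG k) (toL2 (μG.prod μG) η) :=
      (kernelRep_toL2 μG (kernelStar k) η).symm.trans
        (congrArg (fun R => R (toL2 (μG.prod μG) η)) (kernelRep_star μG k))
    have e4 := star_apply_inner (kernelRep μG k) (toL2 (μG.prod μG) η)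
      (columnOperator φ μG μN ψ (toL2 μN g))
    have e5 := kernelRep_columnOperator φ μG μN hN hφ k ψ (toL2 μN g)
    have e6 : (coreUnitary φ μG μN).symm (kernelRep μG k (coreUnitary φ μG μN (toL2 μN g))) =
        toL2 μN (aphiConv φ N μG μN a g) :=
      (congrArg (coreUnitary φ μG μN).symm (hk (toL2 μN g))).trans
        ((LinearIsometryEquiv.symm_apply_apply _ _).trans (aphiRep_toL2 φ N μG μN a g))
    exact e1.trans (e2.trans ((congrArg (fun z => inner ℂ z (columnOperator φ μG μN ψ (toL2 μN g)))
      e3).trans (e4.trans (congrArg (inner ℂ (toL2 (μG.prod μG) η))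
        (e5.trans (congrArg (columnOperator φ μG μN ψ) e6))))))
  -- equality of columns gives equality of matrix coefficients
  have hop : kernelRep μG (kernelMul μG k l) =
      (coreUnitary φ μG μN).toContinuousLinearEquiv.toContinuousLinearMap ∘L
        aphiRep φ N μG μN (hsElement φ μG (aphiConv φ N μG μN a g)) ∘L
        (coreUnitary φ μG μN).symm.toContinuousLinearEquiv.toContinuousLinearMap := by
    refine clm_ext_of_smulConst (μG.prod μG) (s := Set.range (toL2 μN (E := ℂ)))
      (denseRange_toL2 μN) fun f => Set.forall_mem_range.2 fun ψ => ?_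
    refine (denseRange_toL2 (μG.prod μG)).eq_of_inner_right (𝕜 := ℂ) fun η => ?_
    exact (inner_kernelRep_smulConst μG (kernelMul μG k l) f (toL2 μN ψ) η).trans
      ((hcol ψ (smear φ μG f η)).trans
        (inner_coreUnitary_aphiRep_smulConst μG hN hφ _ f ψ η).symm)
  have e1 := congrArg (fun R => R (coreUnitary φ μG μN h)) hop
  refine e1.trans ?_
  exact congrArg (fun z => coreUnitary φ μG μN
    (aphiRep φ N μG μN (hsElement φ μG (aphiConv φ N μG μN a g)) z))
    (LinearIsometryEquiv.symm_apply_apply (coreUnitary φ μG μN) h)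

end Multiplicativity

/-! ### The isomorphism -/

section Isomorphism

variable {G : Type u} [Group G] [TopologicalSpace G] [IsTopologicalGroup G]
  [MeasurableSpace G] [BorelSpace G] [SecondCountableTopology G] [LocallyCompactSpace G] [T2Space G]
  (φ : Tricharacter G) (N : Subgroup G) [LocallyCompactSpace N]
  (μG : Measure G) [μG.IsHaarMeasure] [μG.IsMulRightInvariant]
  (μN : Measure N) [μN.IsHaarMeasure] [μN.IsMulRightInvariant]

/-- The representation of `C_c(G, B)` on `L²(G × G, L²(N))`. -/
def torusRep : torusCore φ N μN →ₗ[ℂ]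
    (Lp (Lp ℂ 2 μN) 2 (μG.prod μG) →L[ℂ] Lp (Lp ℂ 2 μN) 2 (μG.prod μG)) :=
  kernelRep μG ∘ₗ toKernel φ N μN

theorem torusRep_apply (F : torusCore φ N μN) :
    torusRep φ N μG μN F = kernelRep μG (toKernel φ N μN F) := rfl

theorem torusRep_ofKernel (k : kernels φ N μN) :
    torusRep φ N μG μN (ofKernel φ N μN k) = kernelRep μG k := by
  rw [torusRep_apply, toKernel_ofKernel]

theorem exists_torusRep_star (F : torusCore φ N μN) : ∃ F' : torusCore φ N μN,
    (F' : G → G → Op N μN) = torusStar φ N μN F ∧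
      torusRep φ N μG μN F' = star (torusRep φ N μG μN F) :=
  ⟨ofKernel φ N μN (kernelStar (toKernel φ N μN F)), (torusStar_eq φ N μN F).symm, by
    rw [torusRep_ofKernel, kernelRep_star, torusRep_apply]⟩

theorem exists_aphiRep_star (a : aphiCore φ N μG) : ∃ b : aphiCore φ N μG,
    (b : N → (HS μG →L[ℂ] HS μG)) = aphiStar φ N μG a ∧
      aphiRep φ N μG μN b = star (aphiRep φ N μG μN a) :=
  ⟨⟨_, aphiStar_mem_aphiCore φ N μG a.2⟩, rfl, aphiRep_star φ N μG μN a _ rfl⟩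

/-- The left regular representation of `C_c(N, K_φ)`, carried over to `L²(G × G, L²(N))` by the
unitary operator `coreUnitary`. -/
def transportedRep : aphiCore φ N μG →ₗ[ℂ]
    (Lp (Lp ℂ 2 μN) 2 (μG.prod μG) →L[ℂ] Lp (Lp ℂ 2 μN) 2 (μG.prod μG)) :=
  (coreUnitary φ μG μN).conjStarAlgEquiv.toAlgEquiv.toLinearMap ∘ₗ aphiRep φ N μG μN

theorem norm_transportedRep (a : aphiCore φ N μG) :
    ‖transportedRep φ N μG μN a‖ = aphiNorm φ N μG μN a :=
  (StarAlgEquiv.norm_map (coreUnitary φ μG μN).conjStarAlgEquiv (aphiRep φ N μG μN a)).trans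
    (norm_aphiRep φ N μG μN a)

theorem exists_transportedRep_star (a : aphiCore φ N μG) : ∃ b : aphiCore φ N μG,
    (b : N → (HS μG →L[ℂ] HS μG)) = aphiStar φ N μG a ∧
      transportedRep φ N μG μN b = star (transportedRep φ N μG μN a) := by
  obtain ⟨b, hb, hb'⟩ := exists_aphiRep_star φ N μG μN a
  exact ⟨b, hb, (congrArg (coreUnitary φ μG μN).conjStarAlgEquiv hb').trans
    (map_star (coreUnitary φ μG μN).conjStarAlgEquiv (aphiRep φ N μG μN a))⟩

theorem conjStarAlgEquiv_mem_closure {H H' ι : Type*} [NormedAddCommGroup H]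
    [InnerProductSpace ℂ H] [CompleteSpace H] [NormedAddCommGroup H'] [InnerProductSpace ℂ H']
    [CompleteSpace H'] (V : H ≃ₗᵢ[ℂ] H') {f : ι → H →L[ℂ] H} {A : H →L[ℂ] H}
    (hA : A ∈ closure (Set.range f)) :
    V.conjStarAlgEquiv A ∈ closure (Set.range fun i => V.conjStarAlgEquiv (f i)) :=
  map_mem_closure (StarAlgEquiv.isometry V.conjStarAlgEquiv).continuous hA
    (Set.mapsTo_range_iff.2 fun i => ⟨i, rfl⟩)

theorem transportedRep_mem_closure (a : aphiCore φ N μG) : transportedRep φ N μG μN a ∈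
    closure (Set.range fun ζ : Cc (N × G × G) ℂ =>
      transportedRep φ N μG μN (hsElement φ μG (curryL2 (μG.prod μG) ζ))) :=
  conjStarAlgEquiv_mem_closure (coreUnitary φ μG μN) (aphiRep_mem_closure μG (μN := μN) a)

/-- Equality with `transportedRep a` as an intertwining relation for `coreUnitary`. -/
theorem eq_transportedRep_iff (R : Lp (Lp ℂ 2 μN) 2 (μG.prod μG) →L[ℂ] _) (a : aphiCore φ N μG) :
    R = transportedRep φ N μG μN a ↔ ∀ h, R (coreUnitary φ μG μN h) =
      coreUnitary φ μG μN (aphiRep φ N μG μN a h) := by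
  constructor
  · rintro rfl h
    exact congrArg (fun z => coreUnitary φ μG μN (aphiRep φ N μG μN a z))
      (LinearIsometryEquiv.symm_apply_apply (coreUnitary φ μG μN) h)
  · intro h
    refine ContinuousLinearMap.ext fun y => ?_
    exact (congrArg R (LinearIsometryEquiv.apply_symm_apply (coreUnitary φ μG μN) y).symm).trans
      (h ((coreUnitary φ μG μN).symm y))

theorem torusRep_torusMul (hN : IsClosed (N : Set G)) (hφ : ∀ r s t : N, φ r s t = 1)
    {F₁ F₂ F₃ : torusCore φ N μN} {a : aphiCore φ N μG} {g : Cc N (HS μG)}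
    (h₃ : (F₃ : G → G → Op N μN) = torusMul φ N μG μN F₁ F₂)
    (h₁ : torusRep φ N μG μN F₁ = transportedRep φ N μG μN a)
    (h₂ : torusRep φ N μG μN F₂ = transportedRep φ N μG μN (hsElement φ μG g)) :
    torusRep φ N μG μN F₃ =
      transportedRep φ N μG μN (hsElement φ μG (aphiConv φ N μG μN a g)) := by
  have e : F₃ = ofKernel φ N μN (kernelMul μG (toKernel φ N μN F₁) (toKernel φ N μN F₂)) :=
    Subtype.ext (h₃.trans (torusMul_eq φ N μG μN F₁ F₂))
  have h₁' := (eq_transportedRep_iff φ N μG μN _ _).1 h₁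
  have h₂' := (eq_transportedRep_iff φ N μG μN _ _).1 h₂
  rw [e, torusRep_ofKernel]
  exact (eq_transportedRep_iff φ N μG μN _ _).2 (kernelRep_kernelMul μG hN hφ h₁' h₂')

/-- The two elements given by `ζ` have the same operator. -/
theorem torusRep_coreKernel (hN : IsClosed (N : Set G)) (hφ : ∀ r s t : N, φ r s t = 1)
    (ζ : Cc (N × G × G) ℂ) :
    torusRep φ N μG μN (ofKernel φ N μN (coreKernel φ μN hN hφ ζ)) =
      transportedRep φ N μG μN (hsElement φ μG (curryL2 (μG.prod μG) ζ)) := by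
  rw [torusRep_ofKernel]
  exact (eq_transportedRep_iff φ N μG μN _ _).2
    (kernelRep_coreKernel_coreUnitary φ μG μN hN hφ ζ)

/-- The elements of `C_c(G, B)` with the kernels `K_ζ`. -/
def smoothElements (hN : IsClosed (N : Set G)) (hφ : ∀ r s t : N, φ r s t = 1) :
    Set (torusCore φ N μN) :=
  Set.range fun ζ : Cc (N × G × G) ℂ => ofKernel φ N μN (coreKernel φ μN hN hφ ζ)

theorem torusRep_image_smoothElements (hN : IsClosed (N : Set G))
    (hφ : ∀ r s t : N, φ r s t = 1) :
    torusRep φ N μG μN '' smoothElements φ N μN hN hφ =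
      Set.range fun ζ : Cc (N × G × G) ℂ => kernelRep μG (coreKernel φ μN hN hφ ζ) :=
  (Set.range_comp _ _).symm.trans
    (congrArg Set.range (funext fun _ => torusRep_ofKernel φ N μG μN _))

theorem torusRep_image_smoothElements_eq_transportedRep (hN : IsClosed (N : Set G))
    (hφ : ∀ r s t : N, φ r s t = 1) :
    torusRep φ N μG μN '' smoothElements φ N μN hN hφ =
      Set.range fun ζ : Cc (N × G × G) ℂ =>
        transportedRep φ N μG μN (hsElement φ μG (curryL2 (μG.prod μG) ζ)) :=
  (Set.range_comp _ _).symm.trans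
    (congrArg Set.range (funext (torusRep_coreKernel φ N μG μN hN hφ)))

theorem range_torusRep_subset (hN : IsClosed (N : Set G)) (hφ : ∀ r s t : N, φ r s t = 1) :
    Set.range (torusRep φ N μG μN) ⊆
      closure (torusRep φ N μG μN '' smoothElements φ N μN hN hφ) := by
  rw [torusRep_image_smoothElements]
  exact Set.range_subset_iff.2 fun F =>
    kernelRep_mem_closure φ μG μN hN hφ (toKernel φ N μN F)

theorem range_transportedRep_subset (hN : IsClosed (N : Set G)) (hφ : ∀ r s t : N, φ r s t = 1) :
    Set.range (transportedRep φ N μG μN) ⊆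
      closure (torusRep φ N μG μN '' smoothElements φ N μN hN hφ) := by
  rw [torusRep_image_smoothElements_eq_transportedRep]
  exact Set.range_subset_iff.2 fun a => transportedRep_mem_closure φ N μG μN a

theorem torusRep_image_smoothElements_subset (hN : IsClosed (N : Set G))
    (hφ : ∀ r s t : N, φ r s t = 1) : torusRep φ N μG μN '' smoothElements φ N μN hN hφ ⊆
      Set.range (transportedRep φ N μG μN) := by
  rw [torusRep_image_smoothElements_eq_transportedRep]
  exact Set.range_subset_iff.2 fun _ => Set.mem_range_self _

/-- Any two completions are isomorphic, since both are realised as the closure of the operators of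
`smoothElements`. -/
theorem exists_algebraIso (hN : IsClosed (N : Set G)) (hφ : ∀ r s t : N, φ r s t = 1)
    (T : NonassociativeTorus φ N μG μN) (A : TwistedCompactsCrossedProduct φ N μG μN) :
    ∃ Φ : T.carrier ≃ₗᵢ[ℂ] A.carrier, IsAlgebraIso φ N μG μN Φ := by
  obtain ⟨Φ, hstar, hΦ, hdense⟩ := StarCompletion.exists_equiv T A (torusRep φ N μG μN)
    (norm_kernelRep_toKernel μG hN hφ) (exists_torusRep_star φ N μG μN)
    (transportedRep φ N μG μN) (norm_transportedRep φ N μG μN)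
    (exists_transportedRep_star φ N μG μN) (smoothElements φ N μN hN hφ)
    (range_torusRep_subset φ N μG μN hN hφ) (torusRep_image_smoothElements_subset φ N μG μN hN hφ)
    (range_transportedRep_subset φ N μG μN hN hφ)
  refine ⟨Φ, hstar, hdense.mono ?_, ?_⟩
  · rintro _ ⟨_, ⟨ζ, rfl⟩, rfl⟩
    exact ⟨_, _, rfl, (curryL2 (μG.prod μG) ζ).2, hsElement φ μG (curryL2 (μG.prod μG) ζ), rfl,
      (hΦ _ _).2 (torusRep_coreKernel φ N μG μN hN hφ ζ)⟩
  · rintro F₁ F₂ F₃ a g h₃ h₁ ⟨hg, b, hb, h₂⟩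
    obtain rfl : b = hsElement φ μG ⟨g, hg⟩ := Subtype.ext hb
    exact ⟨aphiMul_mem_hsCore φ N μG μN a.2 hg,
      hsElement φ μG (aphiConv φ N μG μN a ⟨g, hg⟩), rfl, (hΦ _ _).2
        (torusRep_torusMul φ N μG μN hN hφ h₃ ((hΦ _ _).1 h₁) ((hΦ _ _).1 h₂))⟩

end Isomorphism

end NAT

end

theorem theorem8p2 {G : Type u} [Group G] [TopologicalSpace G] [IsTopologicalGroup G]
    [LocallyCompactSpace G] [T2Space G] [SecondCountableTopology G]
    [MeasurableSpace G] [BorelSpace G]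
    (μG : MeasureTheory.Measure G) [μG.IsHaarMeasure] [μG.IsMulRightInvariant]
    (N : Subgroup G) (hN : IsClosed (N : Set G))
    (μN : MeasureTheory.Measure N) [μN.IsHaarMeasure] [μN.IsMulRightInvariant]
    (φ : NAT.Tricharacter G) (hφ : ∀ r s t : N, φ r s t = 1) :
    -- `C_c(G, B)` is closed under the twisted convolution and the involution
    ((∀ F₁ ∈ NAT.torusCore φ N μN, ∀ F₂ ∈ NAT.torusCore φ N μN,
        NAT.torusMul φ N μG μN F₁ F₂ ∈ NAT.torusCore φ N μN) ∧
      (∀ F ∈ NAT.torusCore φ N μN, NAT.torusStar φ N μN F ∈ NAT.torusCore φ N μN)) ∧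
    -- `γ` is an action of `N` on the twisted kernels by `*`-automorphisms, twisted by `u`
    ((∀ K : NAT.HS μG, NAT.hsMul φ μG (NAT.hsStar μG K) = star (NAT.hsMul φ μG K)) ∧
      (∀ s : N, Function.Bijective (NAT.gamma φ μG s)) ∧
      (∀ (s : N) (K₁ K₂ : NAT.HS μG), NAT.gamma φ μG s (NAT.hsMul φ μG K₁ K₂) =
        NAT.hsMul φ μG (NAT.gamma φ μG s K₁) (NAT.gamma φ μG s K₂)) ∧
      (∀ (s : N) (K : NAT.HS μG),
        NAT.gamma φ μG s (NAT.hsStar μG K) = NAT.hsStar μG (NAT.gamma φ μG s K)) ∧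
      (∀ (s t : N) (K : NAT.HS μG), NAT.gamma φ μG s (NAT.gamma φ μG t K) =
        NAT.uLeft φ μG s t (star (NAT.uRight φ μG s t) (NAT.gamma φ μG (s * t) K)))) ∧
    -- `C_c(N, HS)` and `C_c(N, K_φ)` are closed under the operations of the crossed product
    ((∀ g ∈ NAT.hsCore N μG, NAT.hsMul φ μG ∘ g ∈ NAT.aphiCore φ N μG) ∧
      (∀ a ∈ NAT.aphiCore φ N μG, ∀ g ∈ NAT.hsCore N μG,
        NAT.aphiMul φ N μG μN a g ∈ NAT.hsCore N μG) ∧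
      (∀ a ∈ NAT.aphiCore φ N μG, NAT.aphiStar φ N μG a ∈ NAT.aphiCore φ N μG) ∧
      (∀ g ∈ NAT.hsCore N μG, ∃ g' ∈ NAT.hsCore N μG,
        NAT.hsMul φ μG ∘ g' = NAT.aphiStar φ N μG (NAT.hsMul φ μG ∘ g))) ∧
    -- both completions exist, and they are isomorphic
    Nonempty (NAT.NonassociativeTorus φ N μG μN) ∧
    Nonempty (NAT.TwistedCompactsCrossedProduct φ N μG μN) ∧
    ∀ (T : NAT.NonassociativeTorus φ N μG μN)
      (A : NAT.TwistedCompactsCrossedProduct φ N μG μN),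
      ∃ Φ : T.carrier ≃ₗᵢ[ℂ] A.carrier, NAT.IsAlgebraIso φ N μG μN Φ := by
  have : LocallyCompactSpace N := hN.isClosedEmbedding_subtypeVal.locallyCompactSpace
  refine ⟨⟨fun F₁ h₁ F₂ h₂ => NAT.torusMul_mem φ N μG μN h₁ h₂,
    fun F hF => NAT.torusStar_mem φ N μN hF⟩,
    ⟨NAT.hsMul_hsStar φ μG, fun s => NAT.bijective_gamma φ μG s, fun s => NAT.gamma_hsMul φ μG s,
      fun s => NAT.gamma_hsStar φ μG s, fun s t => NAT.gamma_gamma φ μG s t⟩,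
    ⟨fun g hg => NAT.hsMul_comp_mem_aphiCore φ N μG hg,
      fun a ha g hg => NAT.aphiMul_mem_hsCore φ N μG μN ha hg,
      fun a ha => NAT.aphiStar_mem_aphiCore φ N μG ha,
      fun g hg => NAT.exists_hsMul_comp_eq_aphiStar φ N μG hg⟩,
    NAT.StarCompletion.nonempty_of_rep (NAT.torusRep φ N μG μN)
      (NAT.norm_kernelRep_toKernel μG hN hφ) (NAT.exists_torusRep_star φ N μG μN),
    NAT.StarCompletion.nonempty_of_rep (NAT.aphiRep φ N μG μN) (NAT.norm_aphiRep φ N μG μN)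
      (NAT.exists_aphiRep_star φ N μG μN),
    NAT.exists_algebraIso φ N μG μN hN hφ⟩
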